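/- Let $n\ge 1$. There is a constant $C_n>0$, depending only on $n$, with the following property. Let $\nu>0$ and $0<T\le\infty$, and let $U:\mathbb R^n\times(0,T)\to\mathbb R^n$ and $V:\mathbb R^n\times(0,T)\to\mathbb R$ be continuous functions such that $\operatorname{div}U(\cdot,t)=0$ in the sense of distributions for all $t\in(0,T)$ and $$\sup_{0<t<T}\Bigl(\frac t\nu\Bigr)^{1/2}\|U(\cdot,t)\|_{L^\infty(\mathbb R^n)}=K_1<\infty,\qquad \int_0^T\|V(\cdot,t)\|_{L^\infty(\mathbb R^n)}\,dt=K_2<\infty .$$ Consider the advection-diffusion equation $$\partial_t f+U\cdot\nabla f-Vf=\nu\Delta f. \tag{1}$$ A regular solution of (1) on $\mathbb R^n\times J$, with $J\subset(0,T)$ an open interval, is a continuous function $f:\mathbb R^n\times J\to\mathbb R$ that satisfies (1) in the sense of distributions (with $U\cdot\nabla f=\operatorname{div}(fU)$) and such that, for every compact interval $I\subset J$, there are constants $A,B$ with $|f(x,t)|\le Ae^{B|x|}$ for all $x\in\mathbb R^n$, $t\in I$. A fundamental solution of (1) is a real-valued function $\Phi(x,t;y,s)$, defined and jointly continuous for $x,y\in\mathbb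 R^n$ and $0<s<t<T$, such that (i) for all $y\in\mathbb R^n$ and $s\in(0,T)$, the function $(x,t)\mapsto\Phi(x,t;y,s)$ is a regular solution of (1) on $\mathbb R^n\times(s,T)$; (ii) for every $s\in(0,T)$ and every continuous compactly supported $\varphi:\mathbb R^n\to\mathbb R$, the function $u(x,t)=\int_{\mathbb R^n}\Phi(x,t;y,s)\varphi(y)\,dy$ is bounded on $\mathbb R^n\times(s,b]$ for each $b\in(s,T)$, and $u(x,t)\to\varphi(x_0)$ as $(x,t)\to(x_0,s)$ with $t>s$, for all $x_0\in\mathbb R^n$. Then (1) has exactly one fundamental solution $\Phi=\Phi_{U,V,\nu}$. Every regular solution $f$ of (1) on $\mathbb R^n\times(0,T)$ is represented as $$f(x,t)=\int_{\mathbb R^n}\Phi_{U,V,\nu}(x,t;y,s)\,f(y,s)\,dy,\qquad x\in\mathbb R^n,\quad 0<s<t<T,$$ where the integral converges absolutely. Moreover, for all $x,y\in\mathbb R^n$ and $0<s<t<T$, $$0<\Phi_{U,V,\nu}(x,t;y,s)\le\frac{C_n}{(\nu(t-s))^{n/2}}\exp\Bigl(-\frac{|x-y|^2}{4\nu(t-s)}+K_1\frac{|x-y|}{\sqrt{\nu(t-s)}}+K_2\Bigr).$$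 -/

import Mathlib

open MeasureTheory Set Filter Topology
open scoped ENNReal NNReal ContDiff

namespace AdvectionDiffusion

/-- The open time interval `(a, T)`, where `T` may be `+∞`. -/
def timeInterval (a : ℝ) (T : EReal) : Set ℝ := {t | a < t ∧ (t : EReal) < T}

/-- A continuous vector field `u` on `ℝⁿ` is divergence free (in the sense of distributions). -/
def DivFree {n : ℕ} (u : EuclideanSpace ℝ (Fin n) → EuclideanSpace ℝ (Fin n)) : Prop :=
  ∀ φ : EuclideanSpace ℝ (Fin n) → ℝ, ContDiff ℝ ∞ φ → HasCompactSupport φ →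
    ∫ x, inner ℝ (u x) (gradient φ x) = 0

/-- `∂ₜφ + U·∇φ + Vφ + νΔφ` at the point `p = (x, t)`: up to sign, the formal adjoint of
`∂ₜ + U·∇ - V - νΔ` applied to `φ`, for a field `U` with `div U = 0`. -/
noncomputable def adjointOp {n : ℕ} (ν : ℝ)
    (U : EuclideanSpace ℝ (Fin n) → ℝ → EuclideanSpace ℝ (Fin n))
    (V : EuclideanSpace ℝ (Fin n) → ℝ → ℝ)
    (φ : EuclideanSpace ℝ (Fin n) × ℝ → ℝ) (p : EuclideanSpace ℝ (Fin n) × ℝ) : ℝ :=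
  deriv (fun τ => φ (p.1, τ)) p.2
    + inner ℝ (U p.1 p.2) (gradient (fun z => φ (z, p.2)) p.1)
    + V p.1 p.2 * φ p
    + ν * Laplacian.laplacian (fun z => φ (z, p.2)) p.1

/-- `f` is a regular solution of `∂ₜf + U·∇f - Vf = νΔf` on `ℝⁿ × J` (with `div U = 0`): it is
continuous, it grows at most exponentially in space, uniformly on compact time intervals, and it
satisfies the equation in the sense of distributions. As `div U = 0`, we have
`U·∇f = div(fU)`, so that all derivatives can be moved to the test function; in particular
classical solutions of that growth are included. -/
structure IsRegularSolution {n : ℕ} (ν : ℝ)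
    (U : EuclideanSpace ℝ (Fin n) → ℝ → EuclideanSpace ℝ (Fin n))
    (V : EuclideanSpace ℝ (Fin n) → ℝ → ℝ) (J : Set ℝ)
    (f : EuclideanSpace ℝ (Fin n) → ℝ → ℝ) : Prop where
  continuousOn : ContinuousOn (fun p : EuclideanSpace ℝ (Fin n) × ℝ => f p.1 p.2) (univ ×ˢ J)
  growth : ∀ a b : ℝ, Icc a b ⊆ J →
    ∃ A B : ℝ, ∀ t ∈ Icc a b, ∀ x, |f x t| ≤ A * Real.exp (B * ‖x‖)
  weak_eq : ∀ φ : EuclideanSpace ℝ (Fin n) × ℝ → ℝ, ContDiff ℝ ∞ φ → HasCompactSupport φ →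
    tsupport φ ⊆ univ ×ˢ J →
    ∫ p : EuclideanSpace ℝ (Fin n) × ℝ, f p.1 p.2 * adjointOp ν U V φ p = 0

/-- `Φ x t y s`, for `x, y ∈ ℝⁿ` and `0 < s < t < T`, is a (continuous) fundamental solution of
`∂ₜf + U·∇f - Vf = νΔf` on `ℝⁿ × (0, T)`: it solves the equation in `(x, t)`, and for every
`φ ∈ C_c(ℝⁿ)` the function `u(x, t) = ∫ Φ(x, t; y, s) φ(y) dy` takes the value `φ` at time `s`
and is bounded on `ℝⁿ × (s, b]` for all `b < T`. -/
structure IsFundamentalSolution {n : ℕ} (ν : ℝ) (T : EReal)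
    (U : EuclideanSpace ℝ (Fin n) → ℝ → EuclideanSpace ℝ (Fin n))
    (V : EuclideanSpace ℝ (Fin n) → ℝ → ℝ)
    (Φ : EuclideanSpace ℝ (Fin n) → ℝ → EuclideanSpace ℝ (Fin n) → ℝ → ℝ) : Prop where
  continuousOn : ContinuousOn
    (fun p : (EuclideanSpace ℝ (Fin n) × ℝ) × (EuclideanSpace ℝ (Fin n) × ℝ) =>
      Φ p.1.1 p.1.2 p.2.1 p.2.2)
    {p | 0 < p.2.2 ∧ p.2.2 < p.1.2 ∧ (p.1.2 : EReal) < T}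
  solution : ∀ s ∈ timeInterval 0 T, ∀ y,
    IsRegularSolution ν U V (timeInterval s T) (fun x t => Φ x t y s)
  bounded : ∀ s ∈ timeInterval 0 T, ∀ φ : EuclideanSpace ℝ (Fin n) → ℝ, Continuous φ →
    HasCompactSupport φ → ∀ b ∈ timeInterval s T,
    ∃ M : ℝ, ∀ t ∈ Ioc s b, ∀ x, |∫ y, Φ x t y s * φ y| ≤ M
  initial : ∀ s ∈ timeInterval 0 T, ∀ φ : EuclideanSpace ℝ (Fin n) → ℝ, Continuous φ →
    HasCompactSupport φ → ∀ x₀,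
    Tendsto (fun p : EuclideanSpace ℝ (Fin n) × ℝ => ∫ y, Φ p.1 p.2 y s * φ y)
      (𝓝[univ ×ˢ Ioi s] (x₀, s)) (𝓝 (φ x₀))

end AdvectionDiffusion

set_option linter.unusedSectionVars false

/-! On times `t > a > 0` the drift is bounded, and the potential is dominated in space by an
integrable function `v` of time. The equation is then a perturbation of the heat equation. Since
`U·∇f = div(fU)`, Duhamel's formula can be written with the derivative on the heat kernel `G`, and
its kernel `G · (V + (x - z)·U / (2ν(t - τ)))` is bounded by a Gaussian of doubled variance times
the integrable density `C (M/√(ν(t - τ)) + v(τ))`. An exponential weight in time makes the integral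
of this density small, uniformly in the time interval. Hence the Picard series converges with a
Gaussian bound (`Coeff.fundSol_spec`), and the integral equation has at most one solution of
exponential growth (`Coeff.eq_zero_of_mild`).

Distributional solutions satisfy the integral equation, by testing with heat kernels that are cut
off in space and localized in time (`Coeff.mild_of_weak`). Conversely the series is a distributional
solution, by Fubini and the representation of test functions as heat potentials
(`Coeff.weak_fundSol`). This yields existence and the representation formula. Uniqueness of the
fundamental solution follows by letting the starting time in the representation formula decrease to
`s` (`Admissible.integral_eq_of_isFundamentalSolution`).

The sharp upper bound needs constants that do not see `M`, and comes from the methods of Nash and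
Davies instead of the series. As the coefficients are merely continuous, the differential inequality
of Nash is replaced by a discrete one along a time-stepping scheme. A step applies an explicit
kernel `K` and then the heat semigroup `Γ` for half of the step. For small steps `K ≥ 0`. Because
`div U = 0`, both the row and the column integrals of `K`, conjugated with a weight `exp ⟨α, ·⟩`,
are at most an explicit factor; after division by it `K` contracts `L¹` and `L²`
(`Coeff.isContractive_weightedKernel`). Nash's inequality for `Γ` follows from log-convexity of `j ↦
‖Γ^j f‖²` (`nash_gaussK`). Applied to the iteration and to its dual, it bounds the iteration from
`L¹` to `L^∞` in the weak sense, independently of the number of steps (`lintegral_mul_fwd_le`). The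
scheme converges to the Duhamel solution by an asymptotic Gronwall argument
(`Coeff.tendsto_schemeSeq`), so the bound passes to the fundamental solution for every `α`
(`Coeff.fundSol_le`). The choice `α = (x - y)/(2ν(t - s))` and `∫_s^t K₁√(ν/τ) dτ ≤ 2K₁√(ν(t - s))`
give the stated exponent.

Strict positivity holds near the diagonal for short times, where the heat kernel beats the Duhamel
correction, and spreads by chaining with the Chapman-Kolmogorov relation (`Coeff.fundSol_pos`). -/

namespace AdvectionDiffusion

/-! ### Gaussian heat kernels: semigroup property, moments, weighted bounds -/

section HeatKernel

variable {E : Type*} [NormedAddCommGroup E] [InnerProductSpace ℝ E] [FiniteDimensional ℝ E]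
  [MeasurableSpace E] [BorelSpace E]

/-- The Gaussian heat kernel `(4πa)^(-d/2) exp(-|x|²/(4a))` on a `d`-dimensional space. -/
noncomputable def heatKernel (a : ℝ) (x : E) : ℝ :=
  (4 * Real.pi * a) ^ (-((Module.finrank ℝ E : ℝ) / 2)) * Real.exp (-(‖x‖ ^ 2 / (4 * a)))

/-- The factor `2^(d/2)` lost when a Gaussian is compared with one of twice the variance. -/
noncomputable def gaussFactor (E : Type*) [NormedAddCommGroup E] [InnerProductSpace ℝ E] : ℝ :=
  (2 : ℝ) ^ ((Module.finrank ℝ E : ℝ) / 2)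

lemma one_le_gaussFactor : 1 ≤ gaussFactor E :=
  Real.one_le_rpow (by norm_num) (by positivity)

lemma gaussFactor_pos : 0 < gaussFactor E := by
  unfold gaussFactor; positivity

lemma heatKernel_pos {a : ℝ} (ha : 0 < a) (x : E) : 0 < heatKernel a x := by
  have := Real.pi_pos
  unfold heatKernel; positivity

lemma heatKernel_neg (a : ℝ) (x : E) : heatKernel a (-x) = heatKernel a x := by
  simp [heatKernel]

lemma heatKernel_sub_comm (a : ℝ) (x y : E) : heatKernel a (x - y) = heatKernel a (y - x) := by
  rw [← heatKernel_neg, neg_sub]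

lemma heatKernel_zero (a : ℝ) :
    heatKernel a (0 : E) = (4 * Real.pi * a) ^ (-((Module.finrank ℝ E : ℝ) / 2)) := by
  simp [heatKernel]

lemma heatKernel_le_zero {a : ℝ} (ha : 0 < a) (x : E) : heatKernel a x ≤ heatKernel a (0 : E) := by
  have := Real.pi_pos
  rw [heatKernel_zero, heatKernel]
  refine mul_le_of_le_one_right (by positivity) ?_
  rw [Real.exp_le_one_iff]
  have : 0 ≤ ‖x‖ ^ 2 / (4 * a) := by positivity
  linarith

lemma continuous_heatKernel (a : ℝ) : Continuous (fun x : E => heatKernel a x) := by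
  unfold heatKernel; fun_prop

lemma continuousOn_heatKernel :
    ContinuousOn (fun p : ℝ × E => heatKernel p.1 p.2) {p | 0 < p.1} := by
  unfold heatKernel
  intro p hp
  have hp : 0 < p.1 := hp
  have h4 : 4 * Real.pi * p.1 ≠ 0 := by have := Real.pi_pos; positivity
  refine ContinuousAt.continuousWithinAt (ContinuousAt.mul ?_ ?_)
  · exact ContinuousAt.rpow (by fun_prop) (by fun_prop) (Or.inl h4)
  · refine Real.continuous_exp.continuousAt.comp (ContinuousAt.neg ?_)
    exact ContinuousAt.div (by fun_prop) (by fun_prop) (by positivity)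

lemma measurable_heatKernel : Measurable (fun p : ℝ × E => heatKernel p.1 p.2) := by
  unfold heatKernel; fun_prop

lemma Measurable.heatKernel {α : Type*} [MeasurableSpace α] {f : α → ℝ} {g : α → E}
    (hf : Measurable f) (hg : Measurable g) : Measurable (fun x => heatKernel (f x) (g x)) :=
  measurable_heatKernel.comp (hf.prodMk hg)

lemma integral_heatKernel {a : ℝ} (ha : 0 < a) : ∫ x : E, heatKernel a x = 1 := by
  have hpi := Real.pi_pos
  unfold heatKernel
  rw [integral_const_mul]
  have h := GaussianFourier.integral_rexp_neg_mul_sq_norm (V := E) (b := 1 / (4 * a))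
    (by positivity)
  have e : ∀ v : E, Real.exp (-(‖v‖ ^ 2 / (4 * a))) = Real.exp (-(1 / (4 * a)) * ‖v‖ ^ 2) := by
    intro v; congr 1; ring
  simp_rw [e]
  rw [h, show Real.pi / (1 / (4 * a)) = 4 * Real.pi * a by field_simp, ← Real.rpow_add (by positivity)]
  simp

lemma integrable_heatKernel {a : ℝ} (ha : 0 < a) : Integrable (fun x : E => heatKernel a x) := by
  -- A non-integrable function has integral zero by convention, while this integral is one.
  by_contra h
  have := integral_heatKernel (E := E) ha
  rw [integral_undef h] at this
  norm_num at this

lemma integrable_heatKernel_sub {a : ℝ} (ha : 0 < a) (x : E) :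
    Integrable (fun y : E => heatKernel a (x - y)) :=
  (integrable_heatKernel ha).comp_sub_left x

lemma integral_heatKernel_sub {a : ℝ} (ha : 0 < a) (x : E) :
    ∫ y : E, heatKernel a (x - y) = 1 := by
  rw [integral_sub_left_eq_self (fun y => heatKernel a y) volume x, integral_heatKernel ha]

/-- Completing the square: in `z` the product is a Gaussian centred at the point that divides the
segment from `y` to `x` in the ratio `a : c`. Both the semigroup property and its gradient version
are read off from this factorisation. -/
lemma heatKernel_mul_heatKernel {a c : ℝ} (ha : 0 < a) (hc : 0 < c) (x y z : E) :
    heatKernel c (x - z) * heatKernel a (z - y) =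
      heatKernel (a + c) (x - y) *
        heatKernel (a * c / (a + c)) (z - (y + (a / (a + c)) • (x - y))) := by
  have hpi := Real.pi_pos
  have hac : 0 < a + c := by positivity
  unfold heatKernel
  rw [mul_mul_mul_comm, mul_mul_mul_comm ((4 * Real.pi * (a + c)) ^ _),
    ← Real.mul_rpow (by positivity) (by positivity), ← Real.exp_add, ← Real.exp_add]
  congr 2
  · rw [← Real.mul_rpow (by positivity) (by positivity)]
    congr 1; field_simp
  · generalize hu : x - y = u
    generalize hw : z - y = w
    have h1 : x - z = u - w := by rw [← hu, ← hw]; abel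
    have h2 : z - (y + (a / (a + c)) • u) = w - (a / (a + c)) • u := by rw [← hw]; abel
    rw [h1, h2, norm_sub_sq_real, norm_sub_sq_real, norm_smul, real_inner_smul_right,
      real_inner_comm w u, mul_pow, Real.norm_eq_abs, sq_abs]
    field_simp
    ring

lemma integrable_heatKernel_conv {a c : ℝ} (ha : 0 < a) (hc : 0 < c) (x y : E) :
    Integrable (fun z => heatKernel c (x - z) * heatKernel a (z - y)) := by
  simp_rw [heatKernel_mul_heatKernel ha hc]
  exact ((integrable_heatKernel (by positivity)).comp_sub_right _).const_mul _

lemma integral_heatKernel_conv {a c : ℝ} (ha : 0 < a) (hc : 0 < c) (x y : E) :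
    ∫ z, heatKernel c (x - z) * heatKernel a (z - y) = heatKernel (a + c) (x - y) := by
  simp_rw [heatKernel_mul_heatKernel ha hc]
  rw [integral_const_mul, integral_sub_right_eq_self (fun z => heatKernel (a * c / (a + c)) z),
    integral_heatKernel (by positivity), mul_one]

/-- Doubling the variance leaves a spare factor `exp(-|x|²/(8a))`. It absorbs exponential weights
and the factor `‖x‖` of the gradient in the bounds below. -/
lemma heatKernel_eq_two_mul {a : ℝ} (ha : 0 < a) (x : E) :
    heatKernel a x = gaussFactor E * Real.exp (-(‖x‖ ^ 2 / (8 * a))) * heatKernel (2 * a) x := by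
  have hpi := Real.pi_pos
  unfold heatKernel gaussFactor
  have : (4 * Real.pi * (2 * a)) ^ (-((Module.finrank ℝ E : ℝ) / 2)) =
      (4 * Real.pi * a) ^ (-((Module.finrank ℝ E : ℝ) / 2)) *
        ((2 : ℝ) ^ ((Module.finrank ℝ E : ℝ) / 2))⁻¹ := by
    rw [← Real.rpow_neg (by norm_num), ← Real.mul_rpow (by positivity) (by norm_num)]
    congr 1; ring
  rw [this, show -(‖x‖ ^ 2 / (4 * a)) = -(‖x‖ ^ 2 / (8 * a)) + -(‖x‖ ^ 2 / (4 * (2 * a))) by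
    field_simp; ring, Real.exp_add]
  have h2 : ((2 : ℝ) ^ ((Module.finrank ℝ E : ℝ) / 2)) ≠ 0 := by positivity
  field_simp

lemma heatKernel_le_two_mul {a : ℝ} (ha : 0 < a) (x : E) :
    heatKernel a x ≤ gaussFactor E * heatKernel (2 * a) x := by
  rw [heatKernel_eq_two_mul ha]
  have h1 := heatKernel_pos (show 0 < 2 * a by positivity) x
  have h2 := gaussFactor_pos (E := E)
  have h3 : Real.exp (-(‖x‖ ^ 2 / (8 * a))) ≤ 1 := by
    rw [Real.exp_le_one_iff]
    have : 0 ≤ ‖x‖ ^ 2 / (8 * a) := by positivity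
    linarith
  nlinarith [mul_pos h2 h1, mul_le_mul_of_nonneg_left h3 (mul_pos h2 h1).le]

lemma heatKernel_mul_exp_le {a : ℝ} (ha : 0 < a) (B : ℝ) (x : E) :
    heatKernel a x * Real.exp (B * ‖x‖) ≤
      gaussFactor E * Real.exp (2 * a * B ^ 2) * heatKernel (2 * a) x := by
  rw [heatKernel_eq_two_mul ha]
  have h1 := heatKernel_pos (show 0 < 2 * a by positivity) x
  have h2 := gaussFactor_pos (E := E)
  have h3 : Real.exp (-(‖x‖ ^ 2 / (8 * a))) * Real.exp (B * ‖x‖) ≤ Real.exp (2 * a * B ^ 2) := by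
    rw [← Real.exp_add, Real.exp_le_exp]
    have : 2 * a * B ^ 2 - B * ‖x‖ + ‖x‖ ^ 2 / (8 * a) = (‖x‖ - 4 * a * B) ^ 2 / (8 * a) := by
      field_simp; ring
    have h : 0 ≤ (‖x‖ - 4 * a * B) ^ 2 / (8 * a) := by positivity
    linarith
  have := mul_le_mul_of_nonneg_left h3 (mul_pos h2 h1).le
  nlinarith [this]

/-- The estimate `|∇G_a| ≤ C a^(-1/2) G_{2a}`. In the variable `q = ‖x‖/√a` it reduces to `(q/2)
exp(-q²/8) ≤ 1`. The power `a^(-1/2)` is integrable in time, which makes the drift a tame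
perturbation. -/
lemma norm_mul_heatKernel_le {a : ℝ} (ha : 0 < a) (x : E) :
    ‖x‖ / (2 * a) * heatKernel a x ≤ gaussFactor E * (1 / Real.sqrt a) * heatKernel (2 * a) x := by
  rw [heatKernel_eq_two_mul ha]
  have h1 := heatKernel_pos (show 0 < 2 * a by positivity) x
  have h2 := gaussFactor_pos (E := E)
  have hs : 0 < Real.sqrt a := Real.sqrt_pos.2 ha
  have hsq : Real.sqrt a ^ 2 = a := Real.sq_sqrt ha.le
  have h3 : ‖x‖ / (2 * a) * Real.exp (-(‖x‖ ^ 2 / (8 * a))) ≤ 1 / Real.sqrt a := by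
    set q := ‖x‖ / Real.sqrt a with hq
    have e1 : ‖x‖ / (2 * a) = (q / 2) * (1 / Real.sqrt a) := by
      rw [hq]; conv_lhs => rw [← hsq]
      field_simp
    have e2 : ‖x‖ ^ 2 / (8 * a) = q ^ 2 / 8 := by
      rw [hq, div_pow, hsq]; field_simp
    rw [e1, e2]
    have h4 : q / 2 * Real.exp (-(q ^ 2 / 8)) ≤ 1 := by
      rw [Real.exp_neg, ← div_eq_mul_inv, div_le_one (Real.exp_pos _)]
      have := Real.add_one_le_exp (q ^ 2 / 8)
      nlinarith [sq_nonneg (q - 2)]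
    have h5 : 0 < 1 / Real.sqrt a := by positivity
    nlinarith [mul_le_mul_of_nonneg_right h4 h5.le]
  have := mul_le_mul_of_nonneg_left h3 (mul_pos h2 h1).le
  nlinarith [this]

lemma integrable_heatKernel_mul_exp {a : ℝ} (ha : 0 < a) (B : ℝ) :
    Integrable (fun x : E => heatKernel a x * Real.exp (B * ‖x‖)) := by
  refine ((integrable_heatKernel (E := E) (a := 2 * a) (by positivity)).const_mul
    (gaussFactor E * Real.exp (2 * a * B ^ 2))).mono' ?_ ?_
  · exact ((continuous_heatKernel a).mul (by fun_prop)).aestronglyMeasurable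
  · refine ae_of_all _ fun x => ?_
    rw [Real.norm_of_nonneg (mul_nonneg (heatKernel_pos ha x).le (Real.exp_pos _).le)]
    exact heatKernel_mul_exp_le ha B x

lemma integral_heatKernel_mul_exp_le {a : ℝ} (ha : 0 < a) (B : ℝ) :
    ∫ x : E, heatKernel a x * Real.exp (B * ‖x‖) ≤ gaussFactor E * Real.exp (2 * a * B ^ 2) := by
  calc _ ≤ ∫ x : E, gaussFactor E * Real.exp (2 * a * B ^ 2) * heatKernel (2 * a) x :=
        integral_mono (integrable_heatKernel_mul_exp ha B)
          ((integrable_heatKernel (by positivity)).const_mul _) (heatKernel_mul_exp_le ha B)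
    _ = _ := by rw [integral_const_mul, integral_heatKernel (by positivity), mul_one]

lemma heatKernel_sub_mul_exp_le {a : ℝ} (ha : 0 < a) (B : ℝ) (x y : E) :
    heatKernel a (x - y) * Real.exp (B * ‖y‖) ≤
      Real.exp (B * ‖x‖) * (heatKernel a (x - y) * Real.exp (|B| * ‖x - y‖)) := by
  have h1 := heatKernel_pos ha (x - y)
  have h2 : Real.exp (B * ‖y‖) ≤ Real.exp (B * ‖x‖) * Real.exp (|B| * ‖x - y‖) := by
    rw [← Real.exp_add, Real.exp_le_exp]
    have := abs_norm_sub_norm_le y x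
    have h3 : B * (‖y‖ - ‖x‖) ≤ |B| * ‖x - y‖ := by
      calc B * (‖y‖ - ‖x‖) ≤ |B * (‖y‖ - ‖x‖)| := le_abs_self _
        _ = |B| * |‖y‖ - ‖x‖| := abs_mul _ _
        _ ≤ |B| * ‖x - y‖ := by
          rw [norm_sub_rev]; exact mul_le_mul_of_nonneg_left this (abs_nonneg _)
    linarith
  nlinarith [mul_le_mul_of_nonneg_left h2 h1.le]

lemma integrable_heatKernel_sub_mul_exp {a : ℝ} (ha : 0 < a) (B : ℝ) (x : E) :
    Integrable (fun y : E => heatKernel a (x - y) * Real.exp (B * ‖y‖)) := by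
  refine (((integrable_heatKernel_mul_exp (E := E) ha |B|).comp_sub_left x).const_mul
    (Real.exp (B * ‖x‖))).mono' ?_ ?_
  · exact (((continuous_heatKernel a).comp (continuous_const.sub continuous_id)).mul
      (by fun_prop)).aestronglyMeasurable
  · refine ae_of_all _ fun y => ?_
    rw [Real.norm_of_nonneg (mul_nonneg (heatKernel_pos ha _).le (Real.exp_pos _).le)]
    exact heatKernel_sub_mul_exp_le ha B x y

lemma integral_heatKernel_sub_mul_exp_le {a : ℝ} (ha : 0 < a) (B : ℝ) (x : E) :
    ∫ y : E, heatKernel a (x - y) * Real.exp (B * ‖y‖) ≤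
      gaussFactor E * Real.exp (2 * a * B ^ 2) * Real.exp (B * ‖x‖) := by
  calc _ ≤ ∫ y : E, Real.exp (B * ‖x‖) * (heatKernel a (x - y) * Real.exp (|B| * ‖x - y‖)) :=
        integral_mono (integrable_heatKernel_sub_mul_exp ha B x)
          (((integrable_heatKernel_mul_exp ha |B|).comp_sub_left x).const_mul _)
          (heatKernel_sub_mul_exp_le ha B x)
    _ = Real.exp (B * ‖x‖) * ∫ w : E, heatKernel a w * Real.exp (|B| * ‖w‖) := by
        rw [integral_const_mul,
          integral_sub_left_eq_self (fun w : E => heatKernel a w * Real.exp (|B| * ‖w‖)) volume x]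
    _ ≤ Real.exp (B * ‖x‖) * (gaussFactor E * Real.exp (2 * a * |B| ^ 2)) := by
        gcongr; exact integral_heatKernel_mul_exp_le ha _
    _ = _ := by rw [sq_abs]; ring

/-- An exponential tilt of a Gaussian is a translate of it, up to the factor `exp(a|α|²)`. This
identity carries Davies' method: weights cost only a constant and a shift. -/
lemma heatKernel_mul_exp_inner {a : ℝ} (ha : 0 < a) (α w : E) :
    heatKernel a w * Real.exp (inner ℝ α w) =
      Real.exp (a * ‖α‖ ^ 2) * heatKernel a (w - (2 * a) • α) := by
  unfold heatKernel
  rw [mul_assoc, mul_left_comm (Real.exp (a * ‖α‖ ^ 2)), ← Real.exp_add, ← Real.exp_add]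
  congr 2
  rw [norm_sub_sq_real, norm_smul, real_inner_smul_right, Real.norm_eq_abs, mul_pow, sq_abs,
    real_inner_comm]
  field_simp
  ring

lemma integrable_heatKernel_mul_inner {a : ℝ} (ha : 0 < a) (ξ : E) :
    Integrable (fun w : E => heatKernel a w * inner ℝ w ξ) := by
  refine ((integrable_heatKernel_mul_exp (E := E) ha 1).const_mul ‖ξ‖).mono' ?_ ?_
  · exact ((continuous_heatKernel a).mul (by fun_prop)).aestronglyMeasurable
  · refine ae_of_all _ fun w => ?_
    rw [norm_mul, Real.norm_of_nonneg (heatKernel_pos ha w).le]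
    have h1 := heatKernel_pos ha w
    have h2 : ‖(inner ℝ w ξ : ℝ)‖ ≤ ‖ξ‖ * Real.exp (1 * ‖w‖) := by
      refine (norm_inner_le_norm w ξ).trans ?_
      rw [mul_comm]
      gcongr
      have := Real.add_one_le_exp (1 * ‖w‖)
      linarith
    calc _ ≤ heatKernel a w * (‖ξ‖ * Real.exp (1 * ‖w‖)) := by gcongr
      _ = _ := by ring

lemma integral_heatKernel_mul_inner (a : ℝ) (ξ : E) :
    ∫ w : E, heatKernel a w * inner ℝ w ξ = 0 := by
  have h := integral_neg_eq_self (fun w : E => heatKernel a w * inner ℝ w ξ) volume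
  simp only [heatKernel_neg, inner_neg_left, mul_neg, integral_neg] at h
  linarith

lemma integrable_heatKernel_sub_mul_inner {a : ℝ} (ha : 0 < a) (m y ξ : E) :
    Integrable (fun z : E => heatKernel a (z - m) * inner ℝ (z - y) ξ) := by
  have h := (((integrable_heatKernel_mul_inner (E := E) ha ξ).add
    ((integrable_heatKernel ha).mul_const (inner ℝ (m - y) ξ)))).comp_sub_right m
  refine h.congr (ae_of_all _ fun z => ?_)
  simp only [Pi.add_apply]
  rw [← mul_add, ← inner_add_left]; congr 2; abel

lemma integral_heatKernel_sub_mul_inner {a : ℝ} (ha : 0 < a) (m y ξ : E) :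
    ∫ z : E, heatKernel a (z - m) * inner ℝ (z - y) ξ = inner ℝ (m - y) ξ := by
  have e : ∀ z : E, heatKernel a (z - m) * inner ℝ (z - y) ξ =
      heatKernel a (z - m) * inner ℝ (z - m) ξ + heatKernel a (z - m) * inner ℝ (m - y) ξ := by
    intro z
    rw [← mul_add, ← inner_add_left]; congr 2; abel
  simp_rw [e]
  rw [integral_add ((integrable_heatKernel_mul_inner ha ξ).comp_sub_right m)
    (((integrable_heatKernel ha).comp_sub_right m).mul_const _),
    integral_sub_right_eq_self (fun w => heatKernel a w * inner ℝ w ξ), integral_mul_const,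
    integral_sub_right_eq_self (fun w => heatKernel a w), integral_heatKernel ha,
    integral_heatKernel_mul_inner]
  ring

lemma integrable_heatKernel_conv_grad {a c : ℝ} (ha : 0 < a) (hc : 0 < c) (x y ξ : E) :
    Integrable (fun z => heatKernel c (x - z) * (heatKernel a (z - y) *
      (inner ℝ (z - y) ξ / (2 * a)))) := by
  simp_rw [← mul_assoc, heatKernel_mul_heatKernel ha hc, ← mul_div_assoc, mul_assoc]
  exact ((integrable_heatKernel_sub_mul_inner (by positivity) _ y ξ).const_mul _).div_const _

/-- The semigroup property differentiated in `y`; by the factorisation of the product it amounts to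
computing the mean of a Gaussian. -/
lemma integral_heatKernel_conv_grad {a c : ℝ} (ha : 0 < a) (hc : 0 < c) (x y ξ : E) :
    ∫ z, heatKernel c (x - z) * (heatKernel a (z - y) * (inner ℝ (z - y) ξ / (2 * a))) =
      heatKernel (a + c) (x - y) * (inner ℝ (x - y) ξ / (2 * (a + c))) := by
  simp_rw [← mul_assoc, heatKernel_mul_heatKernel ha hc, ← mul_div_assoc, mul_assoc]
  rw [integral_div, integral_const_mul, integral_heatKernel_sub_mul_inner (by positivity)]
  rw [add_sub_cancel_left, real_inner_smul_left]
  field_simp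

lemma integral_heatKernel_scale {a : ℝ} (ha : 0 < a) (F : E → ℝ) :
    ∫ w, heatKernel a w * F w = ∫ z, heatKernel 1 z * F (Real.sqrt a • z) := by
  have hpi := Real.pi_pos
  have hs : 0 < Real.sqrt a := Real.sqrt_pos.2 ha
  have hsq : Real.sqrt a ^ 2 = a := Real.sq_sqrt ha.le
  have h := Measure.integral_comp_smul (volume : Measure E) (fun w => heatKernel a w * F w)
    (Real.sqrt a)
  have e : ∀ z : E, heatKernel a (Real.sqrt a • z) =
      (Real.sqrt a ^ Module.finrank ℝ E)⁻¹ * heatKernel 1 z := by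
    intro z
    unfold heatKernel
    rw [norm_smul, Real.norm_of_nonneg hs.le, mul_pow, hsq, ← mul_assoc]
    congr 1
    · rw [Real.mul_rpow (by positivity) ha.le, mul_one, mul_comm]
      congr 1
      rw [Real.rpow_neg ha.le, Real.sqrt_eq_rpow, ← Real.rpow_mul_natCast ha.le]
      congr 2; ring
    · congr 2; field_simp
  simp_rw [e] at h
  have hne : (Real.sqrt a ^ Module.finrank ℝ E)⁻¹ ≠ 0 := by positivity
  rw [abs_of_pos (by positivity), smul_eq_mul] at h
  simp_rw [mul_assoc] at h
  rw [integral_const_mul] at h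
  exact (mul_left_cancel₀ hne h).symm

/-- Gaussians are an approximate identity, also along varying functions of exponential growth. -/
lemma tendsto_integral_heatKernel_mul {ι : Type*} {l : Filter ι} [l.IsCountablyGenerated]
    {a : ι → ℝ} {F : ι → E → ℝ} {A B L : ℝ} (ha : Tendsto a l (𝓝 0)) (hpos : ∀ᶠ i in l, 0 < a i)
    (hF : ∀ᶠ i in l, ∀ w, |F i w| ≤ A * Real.exp (B * ‖w‖))
    (hm : ∀ᶠ i in l, AEStronglyMeasurable (F i) volume)
    (hL : Tendsto (fun p : ι × E => F p.1 p.2) (l ×ˢ 𝓝 0) (𝓝 L)) :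
    Tendsto (fun i => ∫ w, heatKernel (a i) w * F i w) l (𝓝 L) := by
  -- Rescaling to variance one gives a majorant that does not depend on `i`: eventually `a i < 1`,
  -- so the growth in the rescaled variable is at most `exp(|B|‖z‖)`.
  have key : Tendsto (fun i => ∫ z : E, heatKernel 1 z * F i (Real.sqrt (a i) • z)) l
      (𝓝 (∫ z : E, heatKernel 1 z * L)) := by
    refine tendsto_integral_filter_of_dominated_convergence
      (fun z => |A| * (heatKernel 1 z * Real.exp (|B| * ‖z‖))) ?_ ?_ ?_ ?_
    · filter_upwards [hpos, hm] with i hi hmi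
      refine (continuous_heatKernel 1).aestronglyMeasurable.mul ?_
      have hq : Measure.QuasiMeasurePreserving (fun z : E => Real.sqrt (a i) • z) := by
        refine ⟨by fun_prop, ?_⟩
        rw [Measure.map_addHaar_smul volume (Real.sqrt_pos.2 hi).ne']
        exact Measure.smul_absolutelyContinuous
      exact hmi.comp_quasiMeasurePreserving hq
    · filter_upwards [hpos, hF, ha.eventually (gt_mem_nhds (show (0 : ℝ) < 1 by norm_num))]
        with i hi hFi hi1
      refine ae_of_all _ fun z => ?_
      rw [norm_mul, Real.norm_of_nonneg (heatKernel_pos one_pos z).le, mul_left_comm]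
      refine mul_le_mul_of_nonneg_left ?_ (heatKernel_pos one_pos z).le
      refine (hFi _).trans (mul_le_mul (le_abs_self A) (Real.exp_le_exp.2 ?_) (Real.exp_pos _).le
        (abs_nonneg _))
      rw [norm_smul, Real.norm_of_nonneg (Real.sqrt_nonneg _)]
      have h1 : Real.sqrt (a i) ≤ 1 := by
        exact Real.sqrt_le_one.2 hi1.le
      calc B * (Real.sqrt (a i) * ‖z‖) ≤ |B| * (1 * ‖z‖) := by
            gcongr
            exact le_abs_self B
        _ = _ := by ring
    · exact (integrable_heatKernel_mul_exp one_pos _).const_mul _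
    · refine ae_of_all _ fun z => Tendsto.const_mul _ ?_
      have : Tendsto (fun i => (i, Real.sqrt (a i) • z)) l (l ×ˢ 𝓝 0) := by
        refine tendsto_id.prodMk ?_
        have h0 : Tendsto (fun i => Real.sqrt (a i)) l (𝓝 0) := by
          have := (Real.continuous_sqrt.tendsto 0).comp ha
          simpa [Function.comp_def] using this
        simpa using h0.smul_const z
      exact hL.comp this
  rw [integral_mul_const, integral_heatKernel one_pos, one_mul] at key
  refine key.congr' ?_
  filter_upwards [hpos] with i hi
  rw [integral_heatKernel_scale hi]

end HeatKernel

end AdvectionDiffusion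

/-! ### Dominated convergence with varying majorants -/

namespace AdvectionDiffusion

/-- Dominated convergence with varying majorants whose integrals converge. -/
lemma tendsto_integral_of_varying_dominated {α : Type*} [MeasurableSpace α] {μ : Measure α}
    {f g : ℕ → α → ℝ} {f' g' : α → ℝ}
    (hf : ∀ j, AEStronglyMeasurable (f j) μ) (hg : ∀ j, Integrable (g j) μ) (hg' : Integrable g' μ)
    (hfg : ∀ j, ∀ᵐ x ∂μ, |f j x| ≤ g j x)
    (hlimf : ∀ᵐ x ∂μ, Tendsto (fun j => f j x) atTop (𝓝 (f' x)))
    (hlimg : ∀ᵐ x ∂μ, Tendsto (fun j => g j x) atTop (𝓝 (g' x)))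
    (hint : Tendsto (fun j => ∫ x, g j x ∂μ) atTop (𝓝 (∫ x, g' x ∂μ))) :
    Tendsto (fun j => ∫ x, f j x ∂μ) atTop (𝓝 (∫ x, f' x ∂μ)) := by
  have hg0 : ∀ᵐ x ∂μ, 0 ≤ g' x := by
    filter_upwards [hlimg, ae_all_iff.2 hfg] with x hx h
    exact ge_of_tendsto' hx fun j => (abs_nonneg _).trans (h j)
  have hff' : AEStronglyMeasurable f' μ := aestronglyMeasurable_of_tendsto_ae atTop hf hlimf
  -- clamp `f j` by the limiting majorant
  have h1 : Tendsto (fun j => ∫ x, max (-(g' x)) (min (f j x) (g' x)) ∂μ) atTop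
      (𝓝 (∫ x, f' x ∂μ)) := by
    refine tendsto_integral_of_dominated_convergence g' ?_ hg' ?_ ?_
    · intro j
      exact hg'.1.neg.sup ((hf j).inf hg'.1)
    · intro j
      filter_upwards [hg0] with x hx
      rw [Real.norm_eq_abs, abs_le]
      exact ⟨le_max_left _ _, max_le (by linarith) (min_le_right _ _)⟩
    · filter_upwards [hlimf, hlimg, ae_all_iff.2 hfg] with x hx hgx h
      have hb : |f' x| ≤ g' x := le_of_tendsto_of_tendsto' hx.abs hgx h
      have h2 : Tendsto (fun j => max (-(g' x)) (min (f j x) (g' x))) atTop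
          (𝓝 (max (-(g' x)) (min (f' x) (g' x)))) :=
        tendsto_const_nhds.max (hx.min tendsto_const_nhds)
      rwa [min_eq_left (abs_le.1 hb).2, max_eq_right (abs_le.1 hb).1] at h2
  -- Scheffé's argument: `(g' - g j)⁺` is dominated by `g'` and tends to zero, and the integrals of
  -- `g j - g'` tend to zero, so the same is true of `(g j - g')⁺`. This bounds the error made by
  -- the clamping.
  have h2 : Tendsto (fun j => ∫ x, max (g j x - g' x) 0 ∂μ) atTop (𝓝 0) := by
    have h3 : Tendsto (fun j => ∫ x, max (g' x - g j x) 0 ∂μ) atTop (𝓝 (∫ _, (0 : ℝ) ∂μ)) := by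
      refine tendsto_integral_of_dominated_convergence g' ?_ hg' ?_ ?_
      · intro j
        exact (hg'.1.sub (hg j).1).sup aestronglyMeasurable_const
      · intro j
        filter_upwards [hg0, hfg j] with x hx hj
        rw [Real.norm_eq_abs, abs_of_nonneg (le_max_right _ _)]
        exact max_le (by linarith [abs_nonneg (f j x)]) hx
      · filter_upwards [hlimg] with x hx
        have := (tendsto_const_nhds (x := g' x) |>.sub hx).max (tendsto_const_nhds (x := (0 : ℝ)))
        simpa using this
    have e : ∀ j, ∫ x, max (g j x - g' x) 0 ∂μ =
        (∫ x, g j x ∂μ - ∫ x, g' x ∂μ) + ∫ x, max (g' x - g j x) 0 ∂μ := by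
      intro j
      rw [← integral_sub (hg j) hg', ← integral_add (f := fun x => g j x - g' x)
        (g := fun x => max (g' x - g j x) 0) ((hg j).sub hg') ((hg'.sub (hg j)).pos_part)]
      refine integral_congr_ae (ae_of_all _ fun x => ?_)
      simp only
      rcases le_total (g j x) (g' x) with h | h
      · rw [max_eq_right (by linarith), max_eq_left (by linarith)]; ring
      · rw [max_eq_left (by linarith), max_eq_right (by linarith)]; ring
    simp_rw [e]
    simpa using (hint.sub_const (∫ x, g' x ∂μ)).add h3
  have hfi : ∀ j, Integrable (f j) μ := fun j => (hg j).mono' (hf j) (hfg j)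
  have hci : ∀ j, Integrable (fun x => max (-(g' x)) (min (f j x) (g' x))) μ := fun j =>
    (hg'.neg).sup ((hfi j).inf hg')
  have h3 : Tendsto (fun j => ∫ x, f j x ∂μ - ∫ x, max (-(g' x)) (min (f j x) (g' x)) ∂μ) atTop
      (𝓝 0) := by
    refine squeeze_zero_norm (fun j => ?_) h2
    rw [← integral_sub (hfi j) (hci j)]
    refine norm_integral_le_of_norm_le (((hg j).sub hg').pos_part) ?_
    filter_upwards [hfg j, hg0] with x hx hx0
    have := abs_le.1 hx
    rw [Real.norm_eq_abs, abs_le]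
    rcases le_total (f j x) (g' x) with h | h
    · rw [min_eq_left h]
      rcases le_total (-(g' x)) (f j x) with h' | h'
      · rw [max_eq_right h']
        exact ⟨by linarith [le_max_right (g j x - g' x) 0], by linarith [le_max_right (g j x - g' x) 0]⟩
      · rw [max_eq_left h']
        exact ⟨by linarith [le_max_left (g j x - g' x) 0], by linarith [le_max_right (g j x - g' x) 0]⟩
    · rw [min_eq_right h, max_eq_right (show -(g' x) ≤ g' x by linarith)]
      exact ⟨by linarith [le_max_right (g j x - g' x) 0], by linarith [le_max_left (g j x - g' x) 0]⟩
  have := h1.add h3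
  simpa using this

/-! ### Integrals of the singular time density -/

section TimeIntegrals

/-- After `τ ↦ t - τ` the integrand is a restriction of the Gamma integrand to a bounded interval.
The bound therefore depends neither on `s` nor on `t`. -/
lemma integrableOn_rpow_mul_exp {a lam : ℝ} (ha : 0 < a) (hl : 0 < lam) (s t : ℝ) :
    IntegrableOn (fun τ => (t - τ) ^ (a - 1) * Real.exp (-(lam * (t - τ)))) (Ioo s t) ∧
    ∫ τ in Ioo s t, (t - τ) ^ (a - 1) * Real.exp (-(lam * (t - τ))) ≤
      (1 / lam) ^ a * Real.Gamma a := by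
  set g : ℝ → ℝ := fun x => x ^ (a - 1) * Real.exp (-(lam * x)) with hg
  have hi : IntegrableOn g (Ioi 0) := by
    by_contra h
    have h1 := Real.integral_rpow_mul_exp_neg_mul_Ioi ha hl
    rw [integral_undef h] at h1
    have : 0 < (1 / lam) ^ a * Real.Gamma a := by
      have := Real.Gamma_pos_of_pos ha
      positivity
    linarith
  have h2 : IntegrableOn g (Ioo 0 (t - s)) := hi.mono_set Ioo_subset_Ioi_self
  have e : ∀ τ, (Ioo s t).indicator (fun τ => g (t - τ)) τ = (Ioo 0 (t - s)).indicator g (t - τ) := by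
    intro τ
    by_cases h : τ ∈ Ioo s t
    · rw [indicator_of_mem h, indicator_of_mem]
      exact ⟨by linarith [h.2], by linarith [h.1]⟩
    · rw [indicator_of_notMem h, indicator_of_notMem]
      intro h'
      exact h ⟨by linarith [h'.2], by linarith [h'.1]⟩
  refine ⟨?_, ?_⟩
  · rw [← integrable_indicator_iff measurableSet_Ioo]
    have := ((integrable_indicator_iff measurableSet_Ioo).2 h2).comp_sub_left t
    exact this.congr (ae_of_all _ fun τ => (e τ).symm)
  · rw [← Real.integral_rpow_mul_exp_neg_mul_Ioi ha hl, ← integral_indicator measurableSet_Ioo]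
    have h3 : ∫ τ, (Ioo s t).indicator (fun τ => g (t - τ)) τ = ∫ τ in Ioo 0 (t - s), g τ := by
      simp_rw [e]
      rw [integral_sub_left_eq_self ((Ioo 0 (t - s)).indicator g) volume t,
        integral_indicator measurableSet_Ioo]
    refine h3.le.trans (setIntegral_mono_set hi ?_ Ioo_subset_Ioi_self.eventuallyLE)
    refine (ae_restrict_iff' measurableSet_Ioi).2 (ae_of_all _ fun x hx => ?_)
    have : (0 : ℝ) < x := hx
    simp only [hg, Pi.zero_apply]
    positivity

/-- The time density bounding the Duhamel kernel. -/
noncomputable def rate (c ν M : ℝ) (v : ℝ → ℝ) (t τ : ℝ) : ℝ :=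
  c * (M / Real.sqrt (ν * (t - τ)) + v τ)

variable {c ν M : ℝ} {v : ℝ → ℝ}

lemma rate_nonneg (hc : 0 ≤ c) (hM : 0 ≤ M) (hv : ∀ τ, 0 ≤ v τ) (t τ : ℝ) :
    0 ≤ rate c ν M v t τ := by
  have := hv τ
  unfold rate; positivity

lemma one_div_sqrt_eq (hν : 0 < ν) {t τ : ℝ} (h : τ < t) :
    M / Real.sqrt (ν * (t - τ)) = M / Real.sqrt ν * (t - τ) ^ ((1 / 2 : ℝ) - 1) := by
  have : 0 < t - τ := by linarith
  rw [Real.sqrt_mul hν.le, show (1 / 2 : ℝ) - 1 = -(1 / 2) by norm_num, Real.rpow_neg this.le,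
    ← Real.sqrt_eq_rpow]
  field_simp

lemma integrableOn_div_sqrt (hν : 0 < ν) (s t : ℝ) :
    IntegrableOn (fun τ => M / Real.sqrt (ν * (t - τ))) (Ioo s t) := by
  have h := (integrableOn_rpow_mul_exp (a := 1 / 2) (lam := 1) (by norm_num) one_pos s t).1
  have h2 : IntegrableOn (fun τ => (M / Real.sqrt ν * Real.exp (t - τ)) *
      ((t - τ) ^ ((1 / 2 : ℝ) - 1) * Real.exp (-(1 * (t - τ))))) (Ioo s t) := by
    refine Integrable.bdd_mul (c := |M / Real.sqrt ν| * Real.exp (t - s)) h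
      (by fun_prop) ?_
    refine (ae_restrict_iff' measurableSet_Ioo).2 (ae_of_all _ fun τ hτ => ?_)
    rw [norm_mul, Real.norm_eq_abs, Real.norm_of_nonneg (Real.exp_pos _).le]
    gcongr
    exact hτ.1.le
  refine h2.congr_fun (fun τ hτ => ?_) measurableSet_Ioo
  beta_reduce
  rw [one_div_sqrt_eq hν hτ.2, one_mul, Real.exp_neg]
  field_simp

lemma integrableOn_rate (hν : 0 < ν) (hv : Integrable v) (s t : ℝ) :
    IntegrableOn (rate c ν M v t) (Ioo s t) :=
  ((integrableOn_div_sqrt hν s t).add hv.integrableOn).const_mul c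

lemma integrableOn_rate_mul {g : ℝ → ℝ} (hν : 0 < ν) (hv : Integrable v) (s t : ℝ) {C : ℝ}
    (hg : Measurable g) (hC : ∀ τ ∈ Ioo s t, |g τ| ≤ C) :
    IntegrableOn (fun τ => rate c ν M v t τ * g τ) (Ioo s t) := by
  have := Integrable.bdd_mul (c := C) (integrableOn_rate (c := c) (M := M) hν hv s t)
    (f := g) hg.aestronglyMeasurable
    ((ae_restrict_iff' measurableSet_Ioo).2 (ae_of_all _ fun τ hτ => hC τ hτ))
  exact this.congr (ae_of_all _ fun τ => mul_comm _ _)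

lemma integrableOn_rate_mul_exp (hν : 0 < ν) (hv : Integrable v) (lam s t : ℝ) :
    IntegrableOn (fun τ => rate c ν M v t τ * Real.exp (-(lam * (t - τ)))) (Ioo s t) := by
  refine integrableOn_rate_mul (C := Real.exp (|lam| * (t - s))) hν hv s t (by fun_prop) fun τ hτ => ?_
  rw [abs_of_pos (Real.exp_pos _), Real.exp_le_exp]
  have h1 : 0 ≤ t - τ := by linarith [hτ.2]
  have h2 : t - τ ≤ t - s := by linarith [hτ.1]
  calc -(lam * (t - τ)) = (-lam) * (t - τ) := by ring
    _ ≤ |lam| * (t - τ) := by gcongr; exact neg_le_abs lam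
    _ ≤ |lam| * (t - s) := by gcongr

lemma exists_integral_sub_min_le (hv : Integrable v) (hv0 : ∀ τ, 0 ≤ v τ) {ε : ℝ} (hε : 0 < ε) :
    ∃ K : ℕ, ∫ τ, (v τ - min (v τ) K) ≤ ε := by
  have h : Tendsto (fun K : ℕ => ∫ τ, (v τ - min (v τ) K)) atTop (𝓝 (∫ _ : ℝ, (0 : ℝ))) := by
    refine tendsto_integral_of_dominated_convergence v (fun K => ?_) hv (fun K => ?_) ?_
    · exact hv.1.sub (hv.1.inf aestronglyMeasurable_const)
    · refine ae_of_all _ fun τ => ?_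
      have := hv0 τ
      have hK : (0 : ℝ) ≤ K := Nat.cast_nonneg K
      rw [Real.norm_of_nonneg (by linarith [min_le_left (v τ) (K : ℝ)])]
      linarith [le_min this hK]
    · refine ae_of_all _ fun τ => ?_
      refine tendsto_const_nhds.congr' ?_
      obtain ⟨N, hN⟩ := exists_nat_ge (v τ)
      filter_upwards [eventually_ge_atTop N] with K hK
      rw [min_eq_left (hN.trans (by exact_mod_cast hK)), sub_self]
  rw [integral_zero] at h
  obtain ⟨K, hK⟩ := (h.eventually (gt_mem_nhds hε)).exists
  exact ⟨K, hK.le⟩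

/-- With a sufficiently strong exponential weight, the Duhamel rate has small integral. -/
lemma exists_integral_rate_mul_exp_le (hc : 0 ≤ c) (hν : 0 < ν) (hM : 0 ≤ M) (hv : Integrable v)
    (hv0 : ∀ τ, 0 ≤ v τ) {ε : ℝ} (hε : 0 < ε) :
    ∃ lam : ℝ, 0 < lam ∧ ∀ s t : ℝ,
      ∫ τ in Ioo s t, rate c ν M v t τ * Real.exp (-(lam * (t - τ))) ≤ ε := by
  -- `v` is split into its truncation at height `K` and a remainder with small integral. `K` is
  -- fixed first. The truncated part contributes `O(K/lam)` and the singular part `O(lam^(-1/2))`,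
  -- so `lam` is chosen afterwards. The `c + 1` avoids division by zero.
  obtain ⟨K, hK⟩ := exists_integral_sub_min_le hv hv0 (ε := ε / (3 * (c + 1))) (by positivity)
  have hlim : Tendsto (fun lam : ℝ => c * (M / Real.sqrt ν) * ((1 / lam) ^ (1 / 2 : ℝ) *
      Real.Gamma (1 / 2)) + c * K * ((1 / lam) ^ (1 : ℝ) * Real.Gamma 1)) atTop (𝓝 0) := by
    have h0 : Tendsto (fun lam : ℝ => 1 / lam) atTop (𝓝 0) := by
      simpa using tendsto_inv_atTop_zero (𝕜 := ℝ)
    have h1 : ∀ a : ℝ, 0 < a → Tendsto (fun lam : ℝ => (1 / lam) ^ a) atTop (𝓝 0) := by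
      intro a ha
      have := h0.rpow_const (p := a) (Or.inr ha.le)
      rwa [Real.zero_rpow ha.ne'] at this
    have := (((h1 (1 / 2) (by norm_num)).mul_const (Real.Gamma (1 / 2))).const_mul
      (c * (M / Real.sqrt ν))).add (((h1 1 one_pos).mul_const (Real.Gamma 1)).const_mul (c * K))
    simpa using this
  obtain ⟨lam, hlam, hl0⟩ :=
    ((hlim.eventually (gt_mem_nhds (show 0 < ε / 3 by positivity))).and (eventually_gt_atTop 0)).exists
  refine ⟨lam, hl0, fun s t => ?_⟩
  obtain ⟨i1, b1⟩ := integrableOn_rpow_mul_exp (a := 1 / 2) (by norm_num) hl0 s t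
  obtain ⟨i2, b2⟩ := integrableOn_rpow_mul_exp (a := 1) (by norm_num) hl0 s t
  have i3 : Integrable (fun τ => v τ - min (v τ) K) := by
    refine hv.mono' (hv.1.sub (hv.1.inf aestronglyMeasurable_const)) (ae_of_all _ fun τ => ?_)
    have := hv0 τ
    have hK : (0 : ℝ) ≤ K := Nat.cast_nonneg K
    rw [Real.norm_of_nonneg (by linarith [min_le_left (v τ) (K : ℝ)])]
    linarith [le_min this hK]
  have hb : ∫ τ in Ioo s t, rate c ν M v t τ * Real.exp (-(lam * (t - τ))) ≤
      ∫ τ in Ioo s t, (c * (M / Real.sqrt ν) *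
        ((t - τ) ^ ((1 / 2 : ℝ) - 1) * Real.exp (-(lam * (t - τ)))) +
        c * K * ((t - τ) ^ ((1 : ℝ) - 1) * Real.exp (-(lam * (t - τ)))) +
        c * (v τ - min (v τ) K)) := by
    refine setIntegral_mono_on (integrableOn_rate_mul_exp hν hv _ _ _)
      (((i1.const_mul _).add (i2.const_mul _)).add (i3.integrableOn.const_mul _)) measurableSet_Ioo
      fun τ hτ => ?_
    have hp : 0 < t - τ := by linarith [hτ.2]
    have he : Real.exp (-(lam * (t - τ))) ≤ 1 := by
      rw [Real.exp_le_one_iff]; nlinarith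
    have he0 := Real.exp_pos (-(lam * (t - τ)))
    have h3 : 0 ≤ v τ - min (v τ) K := by linarith [min_le_left (v τ) (K : ℝ)]
    unfold rate
    rw [one_div_sqrt_eq hν hτ.2, sub_self, Real.rpow_zero, one_mul]
    have h4 : v τ * Real.exp (-(lam * (t - τ))) ≤ K * Real.exp (-(lam * (t - τ))) +
        (v τ - min (v τ) K) := by
      have := min_le_right (v τ) (K : ℝ)
      nlinarith
    nlinarith [mul_le_mul_of_nonneg_left h4 hc]
  refine hb.trans ?_
  rw [integral_add (f := fun τ => c * (M / Real.sqrt ν) *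
        ((t - τ) ^ ((1 / 2 : ℝ) - 1) * Real.exp (-(lam * (t - τ)))) +
        c * K * ((t - τ) ^ ((1 : ℝ) - 1) * Real.exp (-(lam * (t - τ)))))
      ((i1.const_mul _).add (i2.const_mul _)) (i3.integrableOn.const_mul _),
    integral_add (i1.const_mul _) (i2.const_mul _), integral_const_mul, integral_const_mul,
    integral_const_mul]
  have b3 : ∫ τ in Ioo s t, (v τ - min (v τ) K) ≤ ε / (3 * (c + 1)) := by
    refine (setIntegral_le_integral i3 (ae_of_all _ fun τ => ?_)).trans hK
    simp only [Pi.zero_apply]; linarith [min_le_left (v τ) (K : ℝ)]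
  have b4 : c * (ε / (3 * (c + 1))) ≤ ε / 3 := by
    rw [mul_div_assoc', div_le_div_iff₀ (by positivity) (by norm_num)]
    nlinarith
  have b1' := mul_le_mul_of_nonneg_left b1 (show 0 ≤ c * (M / Real.sqrt ν) by positivity)
  have b2' := mul_le_mul_of_nonneg_left b2 (show 0 ≤ c * K by positivity)
  have b3' := mul_le_mul_of_nonneg_left b3 hc
  linarith

/-- On an interval of length at most `1/lam` the exponential weight is at least `exp(-1)`, so it can
be removed at the cost of a factor `e`. -/
lemma exists_integral_rate_le (hc : 0 ≤ c) (hν : 0 < ν) (hM : 0 ≤ M) (hv : Integrable v)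
    (hv0 : ∀ τ, 0 ≤ v τ) {ε : ℝ} (hε : 0 < ε) :
    ∃ δ : ℝ, 0 < δ ∧ ∀ s t : ℝ, t - s ≤ δ → ∫ τ in Ioo s t, rate c ν M v t τ ≤ ε := by
  obtain ⟨lam, hl, h⟩ := exists_integral_rate_mul_exp_le hc hν hM hv hv0
    (ε := ε / Real.exp 1) (by positivity)
  refine ⟨1 / lam, by positivity, fun s t hst => ?_⟩
  calc ∫ τ in Ioo s t, rate c ν M v t τ
      ≤ ∫ τ in Ioo s t, Real.exp 1 * (rate c ν M v t τ * Real.exp (-(lam * (t - τ)))) := by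
        refine setIntegral_mono_on (integrableOn_rate hν hv _ _)
          ((integrableOn_rate_mul_exp hν hv _ _ _).const_mul _) measurableSet_Ioo fun τ hτ => ?_
        have h0 := rate_nonneg (ν := ν) hc hM hv0 t τ
        have h1 : 1 ≤ Real.exp 1 * Real.exp (-(lam * (t - τ))) := by
          rw [← Real.exp_add, Real.one_le_exp_iff]
          have : lam * (t - τ) ≤ 1 := by
            calc lam * (t - τ) ≤ lam * (1 / lam) := by gcongr; linarith [hτ.1]
              _ = 1 := by field_simp
          linarith
        nlinarith
    _ ≤ Real.exp 1 * (ε / Real.exp 1) := by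
        rw [integral_const_mul]; gcongr; exact h s t
    _ = ε := by field_simp

/-- The closed form shows that the integral depends continuously on both endpoints. This is the
convergence of the integrals of the majorants that the varying dominated convergence requires. -/
lemma integral_rate (hν : 0 < ν) (hv : Integrable v) {s t : ℝ} (hst : s ≤ t) :
    ∫ τ in Ioo s t, rate c ν M v t τ =
      c * (M / Real.sqrt ν * (2 * Real.sqrt (t - s)) + ∫ τ in s..t, v τ) := by
  unfold rate
  rw [integral_const_mul, integral_add (integrableOn_div_sqrt hν s t) hv.integrableOn,
    intervalIntegral.integral_of_le hst, integral_Ioc_eq_integral_Ioo]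
  congr 2
  rw [setIntegral_congr_fun measurableSet_Ioo (fun τ hτ => one_div_sqrt_eq hν hτ.2),
    integral_const_mul, ← integral_Ioc_eq_integral_Ioo, ← intervalIntegral.integral_of_le hst,
    intervalIntegral.integral_comp_sub_left (fun x => x ^ ((1 / 2 : ℝ) - 1)) t, sub_self,
    integral_rpow (Or.inl (by norm_num)), show (1 / 2 : ℝ) - 1 + 1 = 1 / 2 by norm_num,
    Real.zero_rpow (by norm_num), ← Real.sqrt_eq_rpow]
  ring

end TimeIntegrals

/-! ### Integration over space-time strips -/

section Strip

variable {E : Type*} [NormedAddCommGroup E] [InnerProductSpace ℝ E] [FiniteDimensional ℝ E]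
  [MeasurableSpace E] [BorelSpace E]

lemma restrict_strip (s t : ℝ) :
    (volume : Measure (E × ℝ)).restrict (univ ×ˢ Ioo s t) =
      (volume : Measure E).prod (volume.restrict (Ioo s t)) := by
  rw [Measure.volume_eq_prod, ← Measure.prod_restrict, Measure.restrict_univ]

lemma ae_strip {s t : ℝ} {p : E × ℝ → Prop} (h : ∀ z, ∀ τ ∈ Ioo s t, p (z, τ)) :
    ∀ᵐ q ∂((volume : Measure (E × ℝ)).restrict (univ ×ˢ Ioo s t)), p q :=
  (ae_restrict_iff' (MeasurableSet.univ.prod measurableSet_Ioo)).2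
    (ae_of_all _ fun q hq => h q.1 q.2 hq.2)

/-- Integrability and size on a strip, from a majorant with known space integrals. -/
lemma strip_bound {s t R : ℝ} {f : E × ℝ → ℝ} {g : ℝ → ℝ} {k : E → ℝ → ℝ}
    (hf : AEStronglyMeasurable f (volume.restrict (univ ×ˢ Ioo s t)))
    (hg : IntegrableOn g (Ioo s t)) (hg0 : ∀ τ ∈ Ioo s t, 0 ≤ g τ)
    (hk : ∀ τ ∈ Ioo s t, Integrable (fun z => k z τ) ∧ ∫ z, k z τ ≤ R)
    (hfk : ∀ z, ∀ τ ∈ Ioo s t, |f (z, τ)| ≤ g τ * k z τ) :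
    IntegrableOn f (univ ×ˢ Ioo s t) ∧
      ∫ p in univ ×ˢ Ioo s t, |f p| ≤ (∫ τ in Ioo s t, g τ) * R := by
  have hI : ∀ τ ∈ Ioo s t, AEStronglyMeasurable (fun z => f (z, τ)) volume →
      Integrable (fun z => f (z, τ)) ∧ ∫ z, |f (z, τ)| ≤ g τ * R := by
    intro τ hτ hm
    have h1 : Integrable (fun z => f (z, τ)) :=
      ((hk τ hτ).1.const_mul (g τ)).mono' hm (ae_of_all _ fun z => hfk z τ hτ)
    refine ⟨h1, (integral_mono h1.abs ((hk τ hτ).1.const_mul (g τ)) fun z => hfk z τ hτ).trans ?_⟩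
    rw [integral_const_mul]
    exact mul_le_mul_of_nonneg_left (hk τ hτ).2 (hg0 τ hτ)
  rw [restrict_strip] at hf
  have hm := hf.prodMk_right
  have hae : ∀ᵐ τ ∂(volume.restrict (Ioo s t)), Integrable (fun z => f (z, τ)) ∧
      ∫ z, |f (z, τ)| ≤ g τ * R := by
    filter_upwards [hm, ae_restrict_mem measurableSet_Ioo] with τ h1 h2
    exact hI τ h2 h1
  have hint : Integrable f (volume.prod (volume.restrict (Ioo s t))) := by
    rw [integrable_prod_iff' hf]
    refine ⟨hae.mono fun τ h => h.1, (hg.mul_const R).mono' ?_ ?_⟩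
    · exact (hf.norm.prod_swap).integral_prod_right'
    · filter_upwards [hae] with τ h
      rw [Real.norm_of_nonneg (integral_nonneg fun z => norm_nonneg _)]
      exact h.2
  refine ⟨by rw [IntegrableOn, restrict_strip]; exact hint, ?_⟩
  rw [restrict_strip, integral_prod_symm _ hint.abs, ← integral_mul_const]
  exact integral_mono_ae hint.abs.integral_prod_right (hg.mul_const R) (hae.mono fun τ h => h.2)

lemma integral_strip_mul {s t R : ℝ} {g : ℝ → ℝ} {k : E → ℝ → ℝ}
    (hint : IntegrableOn (fun p : E × ℝ => g p.2 * k p.1 p.2) (univ ×ˢ Ioo s t))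
    (hk : ∀ τ ∈ Ioo s t, ∫ z, k z τ = R) :
    ∫ p in univ ×ˢ Ioo s t, g p.2 * k p.1 p.2 = (∫ τ in Ioo s t, g τ) * R := by
  rw [IntegrableOn, restrict_strip] at hint
  rw [restrict_strip, integral_prod_symm _ hint, ← integral_mul_const]
  refine setIntegral_congr_fun measurableSet_Ioo fun τ hτ => ?_
  simp only
  rw [integral_const_mul, hk τ hτ]

end Strip

/-- Bounds on measurable coefficients, defined for all times. -/
structure Coeff {E : Type*} [NormedAddCommGroup E] [InnerProductSpace ℝ E] [FiniteDimensional ℝ E]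
    [MeasurableSpace E] [BorelSpace E] (ν M : ℝ) (m v : ℝ → ℝ) (U : E → ℝ → E) (V : E → ℝ → ℝ) :
    Prop where
  ν_pos : 0 < ν
  measU : Measurable (fun p : E × ℝ => U p.1 p.2)
  measV : Measurable (fun p : E × ℝ => V p.1 p.2)
  measm : Measurable m
  U_le : ∀ x τ, ‖U x τ‖ ≤ m τ
  m_le : ∀ τ, m τ ≤ M
  V_le : ∀ x τ, |V x τ| ≤ v τ
  v_int : Integrable v

/-! ### The Duhamel kernel and its Gaussian majorant -/

section Duhamel

variable {E : Type*} [NormedAddCommGroup E] [InnerProductSpace ℝ E] [FiniteDimensional ℝ E]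
  [MeasurableSpace E] [BorelSpace E]

/-- The kernel of Duhamel's formula: first order terms moved to the heat kernel. -/
noncomputable def duhamelKernel (ν : ℝ) (U : E → ℝ → E) (V : E → ℝ → ℝ) (x : E) (t : ℝ) (z : E)
    (τ : ℝ) : ℝ :=
  heatKernel (ν * (t - τ)) (x - z) * (V z τ + inner ℝ (x - z) (U z τ) / (2 * (ν * (t - τ))))

/-- The Duhamel integral over the time interval `(s, t)`. -/
noncomputable def duhamel (ν : ℝ) (U : E → ℝ → E) (V : E → ℝ → ℝ) (F : E → ℝ → ℝ) (s : ℝ) (x : E)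
    (t : ℝ) : ℝ :=
  ∫ p : E × ℝ in univ ×ˢ Ioo s t, duhamelKernel ν U V x t p.1 p.2 * F p.1 p.2

variable {ν M : ℝ} {m v : ℝ → ℝ} {U : E → ℝ → E} {V : E → ℝ → ℝ}

lemma Coeff.v_nonneg (h : Coeff ν M m v U V) (τ : ℝ) : 0 ≤ v τ :=
  (abs_nonneg _).trans (h.V_le 0 τ)

lemma Coeff.m_nonneg (h : Coeff ν M m v U V) (τ : ℝ) : 0 ≤ m τ :=
  (norm_nonneg _).trans (h.U_le 0 τ)

lemma Coeff.M_nonneg (h : Coeff ν M m v U V) : 0 ≤ M := (h.m_nonneg 0).trans (h.m_le 0)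

lemma Coeff.U_le' (h : Coeff ν M m v U V) (x : E) (τ : ℝ) : ‖U x τ‖ ≤ M :=
  (h.U_le x τ).trans (h.m_le τ)

lemma Coeff.rate_nonneg (h : Coeff ν M m v U V) (t τ : ℝ) :
    0 ≤ rate (gaussFactor E) ν M v t τ :=
  AdvectionDiffusion.rate_nonneg gaussFactor_pos.le h.M_nonneg h.v_nonneg t τ

/-- A single Gaussian of doubled variance dominates the kernel and its gradient. The case `V₀ = v₀ =
0` is the pure gradient bound, used again for the approximation scheme. -/
lemma abs_drift_kernel_le {a : ℝ} (ha : 0 < a) {V₀ v₀ : ℝ} {ξ : E} (hM : ‖ξ‖ ≤ M)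
    (hV : |V₀| ≤ v₀) (w : E) :
    |heatKernel a w * (V₀ + inner ℝ w ξ / (2 * a))| ≤
      gaussFactor E * (M / Real.sqrt a + v₀) * heatKernel (2 * a) w := by
  have hG := heatKernel_pos ha w
  have h1 := heatKernel_le_two_mul ha w
  have h2 := norm_mul_heatKernel_le ha w
  have hM0 : 0 ≤ M := (norm_nonneg _).trans hM
  have hv0 : 0 ≤ v₀ := (abs_nonneg _).trans hV
  have h3 : |V₀ + inner ℝ w ξ / (2 * a)| ≤ v₀ + ‖w‖ / (2 * a) * M := by
    refine (abs_add_le _ _).trans (add_le_add hV ?_)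
    rw [abs_div, abs_of_pos (show 0 < 2 * a by positivity), div_mul_eq_mul_div]
    gcongr
    exact (abs_real_inner_le_norm w ξ).trans (by gcongr)
  rw [abs_mul, abs_of_pos hG]
  calc heatKernel a w * |V₀ + inner ℝ w ξ / (2 * a)|
      ≤ heatKernel a w * (v₀ + ‖w‖ / (2 * a) * M) := by gcongr
    _ = v₀ * heatKernel a w + M * (‖w‖ / (2 * a) * heatKernel a w) := by ring
    _ ≤ v₀ * (gaussFactor E * heatKernel (2 * a) w) +
        M * (gaussFactor E * (1 / Real.sqrt a) * heatKernel (2 * a) w) := by gcongr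
    _ = _ := by ring

lemma Coeff.abs_duhamelKernel_le (h : Coeff ν M m v U V) (x z : E) {t τ : ℝ} (hτ : τ < t) :
    |duhamelKernel ν U V x t z τ| ≤
      rate (gaussFactor E) ν M v t τ * heatKernel (2 * (ν * (t - τ))) (x - z) :=
  abs_drift_kernel_le (mul_pos h.ν_pos (by linarith)) (h.U_le' z τ) (h.V_le z τ) _

lemma Coeff.measurable_duhamelKernel (h : Coeff ν M m v U V) {α : Type*} [MeasurableSpace α]
    {x z : α → E} {t τ : α → ℝ} (hx : Measurable x) (hz : Measurable z) (ht : Measurable t)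
    (hτ : Measurable τ) :
    Measurable (fun i => duhamelKernel ν U V (x i) (t i) (z i) (τ i)) := by
  unfold duhamelKernel
  have h1 : Measurable (fun i => V (z i) (τ i)) := h.measV.comp (hz.prodMk hτ)
  have h2 : Measurable (fun i => U (z i) (τ i)) := h.measU.comp (hz.prodMk hτ)
  exact (Measurable.heatKernel (by fun_prop) (by fun_prop)).mul
    (h1.add (((hx.sub hz).inner h2).div (by fun_prop)))

/-- Size of the Duhamel integral of a function with a weighted bound. -/
lemma Coeff.duhamel_bound (h : Coeff ν M m v U V) {s t R : ℝ} {x : E} {F : E → ℝ → ℝ}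
    {g : ℝ → ℝ} {ρ : E → ℝ → ℝ}
    (hF : AEStronglyMeasurable (fun p : E × ℝ => F p.1 p.2) (volume.restrict (univ ×ˢ Ioo s t)))
    (hg : IntegrableOn (fun τ => rate (gaussFactor E) ν M v t τ * g τ) (Ioo s t))
    (hg0 : ∀ τ ∈ Ioo s t, 0 ≤ g τ)
    (hρ : ∀ τ ∈ Ioo s t, Integrable (fun z => heatKernel (2 * (ν * (t - τ))) (x - z) * ρ z τ) ∧
      ∫ z, heatKernel (2 * (ν * (t - τ))) (x - z) * ρ z τ ≤ R)
    (hFb : ∀ z, ∀ τ ∈ Ioo s t, |F z τ| ≤ g τ * ρ z τ) :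
    IntegrableOn (fun p : E × ℝ => duhamelKernel ν U V x t p.1 p.2 * F p.1 p.2)
        (univ ×ˢ Ioo s t) ∧
      ∫ p : E × ℝ in univ ×ˢ Ioo s t, |duhamelKernel ν U V x t p.1 p.2 * F p.1 p.2| ≤
        (∫ τ in Ioo s t, rate (gaussFactor E) ν M v t τ * g τ) * R ∧
      |duhamel ν U V F s x t| ≤
        (∫ τ in Ioo s t, rate (gaussFactor E) ν M v t τ * g τ) * R := by
  have := strip_bound (f := fun p : E × ℝ => duhamelKernel ν U V x t p.1 p.2 * F p.1 p.2)
    (k := fun z τ => heatKernel (2 * (ν * (t - τ))) (x - z) * ρ z τ) (R := R) (s := s) (t := t)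
    (g := fun τ => rate (gaussFactor E) ν M v t τ * g τ) ?_ hg ?_ hρ ?_
  · exact ⟨this.1, this.2, abs_integral_le_integral_abs.trans this.2⟩
  · exact (h.measurable_duhamelKernel measurable_const measurable_fst measurable_const
      measurable_snd).aestronglyMeasurable.mul hF
  · exact fun τ hτ => mul_nonneg (h.rate_nonneg t τ) (hg0 τ hτ)
  · intro z τ hτ
    simp only
    rw [abs_mul]
    have h1 := h.abs_duhamelKernel_le x z hτ.2
    calc _ ≤ (rate (gaussFactor E) ν M v t τ * heatKernel (2 * (ν * (t - τ))) (x - z)) *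
          (g τ * ρ z τ) := mul_le_mul h1 (hFb z τ hτ) (abs_nonneg _) ((abs_nonneg _).trans h1)
      _ = _ := by ring

end Duhamel

end AdvectionDiffusion

namespace AdvectionDiffusion

/-! ### The Picard series of the fundamental solution -/

section Picard

variable {E : Type*} [NormedAddCommGroup E] [InnerProductSpace ℝ E] [FiniteDimensional ℝ E]
  [MeasurableSpace E] [BorelSpace E]

/-- The terms of the Picard (Dyson) series of the fundamental solution. -/
noncomputable def picard (ν : ℝ) (U : E → ℝ → E) (V : E → ℝ → ℝ) : ℕ → E → ℝ → E → ℝ → ℝ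
  | 0 => fun x t y s => heatKernel (ν * (t - s)) (x - y)
  | k + 1 => fun x t y s => duhamel ν U V (fun z τ => picard ν U V k z τ y s) s x t

/-- The fundamental solution. -/
noncomputable def fundSol (ν : ℝ) (U : E → ℝ → E) (V : E → ℝ → ℝ) (x : E) (t : ℝ) (y : E)
    (s : ℝ) : ℝ :=
  ∑' k, picard ν U V k x t y s

variable {ν M : ℝ} {m v : ℝ → ℝ} {U : E → ℝ → E} {V : E → ℝ → ℝ}

/-- Both the Duhamel kernel and the iterates are bounded by Gaussians of doubled variance.
Convolution reproduces exactly the doubled variance of the whole interval, so nothing is lost from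
one iteration to the next. -/
lemma heatKernel_conv_time (hν : 0 < ν) {s τ t : ℝ} (h1 : s < τ) (h2 : τ < t) (x y : E) :
    Integrable (fun z => heatKernel (2 * (ν * (t - τ))) (x - z) *
      heatKernel (2 * (ν * (τ - s))) (z - y)) ∧
    ∫ z, heatKernel (2 * (ν * (t - τ))) (x - z) * heatKernel (2 * (ν * (τ - s))) (z - y) =
      heatKernel (2 * (ν * (t - s))) (x - y) := by
  have ha : 0 < 2 * (ν * (τ - s)) := by have : 0 < τ - s := by linarith
                                        positivity
  have hc : 0 < 2 * (ν * (t - τ)) := by have : 0 < t - τ := by linarith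
                                        positivity
  refine ⟨integrable_heatKernel_conv ha hc x y, ?_⟩
  rw [integral_heatKernel_conv ha hc]
  congr 1; ring

lemma ae_snd_ne (s : ℝ) : ∀ᵐ p : E × ℝ, p.2 ≠ s := by
  have h : ∀ᵐ τ : ℝ, τ ≠ s := by
    simp [ae_iff]
  rw [Measure.volume_eq_prod]
  exact Measure.quasiMeasurePreserving_snd.ae h

lemma measurableSet_strip (s t : ℝ) : MeasurableSet ((univ : Set E) ×ˢ Ioo s t) :=
  MeasurableSet.univ.prod measurableSet_Ioo

/-- The time-ordered pairs of space-time points. -/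
def orderedPairs (E : Type*) : Set ((E × ℝ) × (E × ℝ)) := {p | p.2.2 < p.1.2}

lemma isOpen_orderedPairs : IsOpen (orderedPairs E) :=
  isOpen_lt (by fun_prop) (by fun_prop)

lemma aestronglyMeasurable_strip {F : E → ℝ → E → ℝ → ℝ}
    (hF : ContinuousOn (fun p : (E × ℝ) × (E × ℝ) => F p.1.1 p.1.2 p.2.1 p.2.2) (orderedPairs E))
    (y : E) (s t : ℝ) :
    AEStronglyMeasurable (fun p : E × ℝ => F p.1 p.2 y s) (volume.restrict (univ ×ˢ Ioo s t)) := by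
  refine ContinuousOn.aestronglyMeasurable ?_ (measurableSet_strip s t)
  refine hF.comp (f := fun p : E × ℝ => (p, (y, s))) (by fun_prop) fun p hp => ?_
  exact hp.2.1

/-- The singularities at `τ = s` and `τ = t` move with the point, so there is no common majorant
along a sequence. The Gaussian majorants vary, but their integrals are explicit and continuous, so
dominated convergence with varying majorants applies. -/
lemma Coeff.continuousOn_duhamel (h : Coeff ν M m v U V) {F : E → ℝ → E → ℝ → ℝ} {A lam : ℝ}
    (hA : 0 ≤ A) (hlam : 0 ≤ lam)
    (hF : ContinuousOn (fun p : (E × ℝ) × (E × ℝ) => F p.1.1 p.1.2 p.2.1 p.2.2) (orderedPairs E))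
    (hFb : ∀ z τ y s, s < τ →
      |F z τ y s| ≤ A * Real.exp (lam * (τ - s)) * heatKernel (2 * (ν * (τ - s))) (z - y)) :
    ContinuousOn (fun p : (E × ℝ) × (E × ℝ) =>
      duhamel ν U V (fun z τ => F z τ p.2.1 p.2.2) p.2.2 p.1.1 p.1.2) (orderedPairs E) := by
  have hν := h.ν_pos
  intro p₀ hp₀
  refine ContinuousAt.continuousWithinAt ?_
  rw [← continuousWithinAt_iff_continuousAt (isOpen_orderedPairs.mem_nhds hp₀)]
  refine tendsto_of_seq_tendsto fun q hq => ?_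
  rw [tendsto_nhdsWithin_iff] at hq
  obtain ⟨hq, hqD⟩ := hq
  obtain ⟨N, hN⟩ := eventually_atTop.1 hqD
  rw [← tendsto_add_atTop_iff_nat N] at hq ⊢
  set u : ℕ → (E × ℝ) × (E × ℝ) := fun j => q (j + N) with hu
  have huD : ∀ j, (u j).2.2 < (u j).1.2 := fun j => hN (j + N) (by omega)
  have hp0 : p₀.2.2 < p₀.1.2 := hp₀
  obtain ⟨⟨x₀, t₀⟩, ⟨y₀, s₀⟩⟩ := p₀
  simp only at hp0
  have hx : Tendsto (fun j => (u j).1.1) atTop (𝓝 x₀) :=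
    (continuous_fst.comp continuous_fst).tendsto _ |>.comp hq
  have ht : Tendsto (fun j => (u j).1.2) atTop (𝓝 t₀) :=
    (continuous_snd.comp continuous_fst).tendsto _ |>.comp hq
  have hy : Tendsto (fun j => (u j).2.1) atTop (𝓝 y₀) :=
    (continuous_fst.comp continuous_snd).tendsto _ |>.comp hq
  have hs : Tendsto (fun j => (u j).2.2) atTop (𝓝 s₀) :=
    (continuous_snd.comp continuous_snd).tendsto _ |>.comp hq
  -- A bound on the time differences along the sequence, which turns the weight `exp(lam(τ - s))`
  -- into a constant.
  obtain ⟨L, hL⟩ := (ht.sub hs).bddAbove_range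
  have hL' : ∀ j, (u j).1.2 - (u j).2.2 ≤ L := fun j => hL ⟨j, rfl⟩
  have hL0 : t₀ - s₀ ≤ L := le_of_tendsto' (ht.sub hs) hL'
  set C := A * Real.exp (lam * L) with hC
  have hC0 : 0 ≤ C := by positivity
  let maj : (E × ℝ) × (E × ℝ) → E × ℝ → ℝ := fun P p =>
    (rate (gaussFactor E) ν M v P.1.2 p.2 * C) *
      (heatKernel (2 * (ν * (P.1.2 - p.2))) (P.1.1 - p.1) *
        heatKernel (2 * (ν * (p.2 - P.2.2))) (p.1 - P.2.1))
  have hmaj : ∀ P : (E × ℝ) × (E × ℝ), P.2.2 < P.1.2 →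
      IntegrableOn (maj P) (univ ×ˢ Ioo P.2.2 P.1.2) ∧
      ∫ p in univ ×ˢ Ioo P.2.2 P.1.2, maj P p =
        (∫ τ in Ioo P.2.2 P.1.2, rate (gaussFactor E) ν M v P.1.2 τ * C) *
          heatKernel (2 * (ν * (P.1.2 - P.2.2))) (P.1.1 - P.2.1) := by
    intro P hP
    have hg : IntegrableOn (fun τ => rate (gaussFactor E) ν M v P.1.2 τ * C) (Ioo P.2.2 P.1.2) :=
      (integrableOn_rate hν h.v_int _ _).mul_const C
    have i1 := (strip_bound (s := P.2.2) (t := P.1.2) (f := maj P)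
      (R := heatKernel (2 * (ν * (P.1.2 - P.2.2))) (P.1.1 - P.2.1))
      (g := fun τ => rate (gaussFactor E) ν M v P.1.2 τ * C)
      (k := fun z τ => heatKernel (2 * (ν * (P.1.2 - τ))) (P.1.1 - z) *
        heatKernel (2 * (ν * (τ - P.2.2))) (z - P.2.1)) ?_ hg ?_ ?_ ?_).1
    · exact ⟨i1, integral_strip_mul (E := E)
        (g := fun τ => rate (gaussFactor E) ν M v P.1.2 τ * C)
        (k := fun z τ => heatKernel (2 * (ν * (P.1.2 - τ))) (P.1.1 - z) *
          heatKernel (2 * (ν * (τ - P.2.2))) (z - P.2.1)) i1 fun τ hτ =>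
        (heatKernel_conv_time hν hτ.1 hτ.2 P.1.1 P.2.1).2⟩
    · refine AEStronglyMeasurable.mul ?_ (Measurable.aestronglyMeasurable ?_)
      · rw [restrict_strip]
        exact hg.1.comp_snd
      · exact (Measurable.heatKernel (by fun_prop) (by fun_prop)).mul
          (Measurable.heatKernel (by fun_prop) (by fun_prop))
    · exact fun τ hτ => mul_nonneg (h.rate_nonneg _ _) hC0
    · exact fun τ hτ => ⟨(heatKernel_conv_time hν hτ.1 hτ.2 _ _).1,
        (heatKernel_conv_time hν hτ.1 hτ.2 _ _).2.le⟩
    · intro z τ hτ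
      refine (abs_of_nonneg ?_).le
      have h1 := heatKernel_pos (show 0 < 2 * (ν * (P.1.2 - τ)) by
        have : 0 < P.1.2 - τ := by linarith [hτ.2]
        positivity) (P.1.1 - z)
      have h2 := heatKernel_pos (show 0 < 2 * (ν * (τ - P.2.2)) by
        have : 0 < τ - P.2.2 := by linarith [hτ.1]
        positivity) (z - P.2.1)
      exact mul_nonneg (mul_nonneg (h.rate_nonneg _ _) hC0) (mul_pos h1 h2).le
  have hval : ∀ P : (E × ℝ) × (E × ℝ), P.2.2 < P.1.2 →
      ∫ p, (univ ×ˢ Ioo P.2.2 P.1.2).indicator (maj P) p =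
        (gaussFactor E * (M / Real.sqrt ν * (2 * Real.sqrt (P.1.2 - P.2.2)) +
          ∫ τ in P.2.2..P.1.2, v τ)) * C *
          heatKernel (2 * (ν * (P.1.2 - P.2.2))) (P.1.1 - P.2.1) := by
    intro P hP
    rw [integral_indicator (measurableSet_strip _ _), (hmaj P hP).2, integral_mul_const,
      integral_rate hν h.v_int hP.le]
  simp only [duhamel]
  simp_rw [← integral_indicator (measurableSet_strip _ _)]
  refine tendsto_integral_of_varying_dominated
    (g := fun j => (univ ×ˢ Ioo (u j).2.2 (u j).1.2).indicator (maj (u j)))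
    (g' := (univ ×ˢ Ioo s₀ t₀).indicator (maj ((x₀, t₀), (y₀, s₀)))) ?_ ?_ ?_ ?_ ?_ ?_ ?_
  · intro j
    rw [aestronglyMeasurable_indicator_iff (measurableSet_strip _ _)]
    exact (h.measurable_duhamelKernel measurable_const measurable_fst measurable_const
      measurable_snd).aestronglyMeasurable.mul (aestronglyMeasurable_strip hF _ _ _)
  · intro j
    exact (integrable_indicator_iff (measurableSet_strip _ _)).2 (hmaj _ (huD j)).1
  · exact (integrable_indicator_iff (measurableSet_strip _ _)).2
      (hmaj ((x₀, t₀), (y₀, s₀)) hp0).1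
  · intro j
    refine ae_of_all _ fun p => ?_
    by_cases hp : p ∈ (univ : Set E) ×ˢ Ioo (u j).2.2 (u j).1.2
    · rw [indicator_of_mem hp, indicator_of_mem hp, abs_mul]
      have h1 := h.abs_duhamelKernel_le (u j).1.1 p.1 hp.2.2
      have h2 := hFb p.1 p.2 (u j).2.1 (u j).2.2 hp.2.1
      have h3 : A * Real.exp (lam * (p.2 - (u j).2.2)) ≤ C := by
        rw [hC]; gcongr
        linarith [hL' j, hp.2.2]
      have h4 := heatKernel_pos (show 0 < 2 * (ν * (p.2 - (u j).2.2)) by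
        have : 0 < p.2 - (u j).2.2 := by linarith [hp.2.1]
        positivity) (p.1 - (u j).2.1)
      have h5 := h2.trans (mul_le_mul_of_nonneg_right h3 h4.le)
      calc _ ≤ (rate (gaussFactor E) ν M v (u j).1.2 p.2 *
            heatKernel (2 * (ν * ((u j).1.2 - p.2))) ((u j).1.1 - p.1)) *
            (C * heatKernel (2 * (ν * (p.2 - (u j).2.2))) (p.1 - (u j).2.1)) :=
            mul_le_mul h1 h5 (abs_nonneg _) ((abs_nonneg _).trans h1)
        _ = _ := by simp only [maj]; ring
    · rw [indicator_of_notMem hp, indicator_of_notMem hp, abs_zero]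
  -- The indicators of the strips converge except on the two null slices `τ = s₀` and `τ = t₀`.
  · filter_upwards [ae_snd_ne (E := E) s₀, ae_snd_ne (E := E) t₀] with p hps hpt
    by_cases hp : p ∈ (univ : Set E) ×ˢ Ioo s₀ t₀
    · rw [indicator_of_mem hp]
      have hev : ∀ᶠ j in atTop, p ∈ (univ : Set E) ×ˢ Ioo (u j).2.2 (u j).1.2 := by
        filter_upwards [hs.eventually (gt_mem_nhds hp.2.1), ht.eventually (lt_mem_nhds hp.2.2)]
          with j h1 h2 using ⟨trivial, h1, h2⟩
      have htp : 0 < t₀ - p.2 := by linarith [hp.2.2]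
      have hk : Tendsto (fun j => duhamelKernel ν U V (u j).1.1 (u j).1.2 p.1 p.2) atTop
          (𝓝 (duhamelKernel ν U V x₀ t₀ p.1 p.2)) := by
        unfold duhamelKernel
        have c1 : Tendsto (fun j => (ν * ((u j).1.2 - p.2), (u j).1.1 - p.1)) atTop
            (𝓝 (ν * (t₀ - p.2), x₀ - p.1)) :=
          ((ht.sub_const _).const_mul ν).prodMk_nhds (hx.sub_const _)
        have c2 := ((continuousOn_heatKernel (E := E)).continuousAt
          (IsOpen.mem_nhds (isOpen_lt continuous_const continuous_fst)
            (show (0 : ℝ) < (ν * (t₀ - p.2), x₀ - p.1).1 by positivity))).tendsto.comp c1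
        refine c2.mul (tendsto_const_nhds.add (Tendsto.div ?_ ?_ (by positivity)))
        · exact (hx.sub_const _).inner tendsto_const_nhds
        · exact ((ht.sub_const _).const_mul ν).const_mul 2
      have hFt : Tendsto (fun j => F p.1 p.2 (u j).2.1 (u j).2.2) atTop
          (𝓝 (F p.1 p.2 y₀ s₀)) := by
        have c1 : Tendsto (fun j => ((p.1, p.2), ((u j).2.1, (u j).2.2))) atTop
            (𝓝 ((p.1, p.2), (y₀, s₀))) := tendsto_const_nhds.prodMk_nhds (hy.prodMk_nhds hs)
        exact ((hF.continuousAt (isOpen_orderedPairs.mem_nhds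
          (show ((p.1, p.2), (y₀, s₀)) ∈ orderedPairs E from hp.2.1))).tendsto.comp c1)
      refine (hk.mul hFt).congr' ?_
      filter_upwards [hev] with j hj
      rw [indicator_of_mem hj]
    · rw [indicator_of_notMem hp]
      refine tendsto_const_nhds.congr' ?_
      have : p.2 < s₀ ∨ t₀ < p.2 := by
        by_contra hcon
        push Not at hcon
        exact hp ⟨trivial, lt_of_le_of_ne hcon.1 hps.symm, lt_of_le_of_ne hcon.2 hpt⟩
      rcases this with h' | h'
      · filter_upwards [hs.eventually (lt_mem_nhds h')] with j hj
        rw [indicator_of_notMem]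
        exact fun hh => absurd hh.2.1 (not_lt.2 hj.le)
      · filter_upwards [ht.eventually (gt_mem_nhds h')] with j hj
        rw [indicator_of_notMem]
        exact fun hh => absurd hh.2.2 (not_lt.2 hj.le)
  · filter_upwards [ae_snd_ne (E := E) s₀, ae_snd_ne (E := E) t₀] with p hps hpt
    by_cases hp : p ∈ (univ : Set E) ×ˢ Ioo s₀ t₀
    · rw [indicator_of_mem hp]
      have hev : ∀ᶠ j in atTop, p ∈ (univ : Set E) ×ˢ Ioo (u j).2.2 (u j).1.2 := by
        filter_upwards [hs.eventually (gt_mem_nhds hp.2.1), ht.eventually (lt_mem_nhds hp.2.2)]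
          with j h1 h2 using ⟨trivial, h1, h2⟩
      have htp : 0 < t₀ - p.2 := by linarith [hp.2.2]
      have hsp : 0 < p.2 - s₀ := by linarith [hp.2.1]
      have hk : Tendsto (fun j => maj (u j) p) atTop (𝓝 (maj ((x₀, t₀), (y₀, s₀)) p)) := by
        simp only [maj, rate]
        have c1 : Tendsto (fun j => (2 * (ν * ((u j).1.2 - p.2)), (u j).1.1 - p.1)) atTop
            (𝓝 (2 * (ν * (t₀ - p.2)), x₀ - p.1)) :=
          (((ht.sub_const _).const_mul ν).const_mul 2).prodMk_nhds (hx.sub_const _)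
        have c2 := ((continuousOn_heatKernel (E := E)).continuousAt
          (IsOpen.mem_nhds (isOpen_lt continuous_const continuous_fst)
            (show (0 : ℝ) < (2 * (ν * (t₀ - p.2)), x₀ - p.1).1 by positivity))).tendsto.comp c1
        have c3 : Tendsto (fun j => (2 * (ν * (p.2 - (u j).2.2)), p.1 - (u j).2.1)) atTop
            (𝓝 (2 * (ν * (p.2 - s₀)), p.1 - y₀)) :=
          (((hs.const_sub _).const_mul ν).const_mul 2).prodMk_nhds (hy.const_sub _)
        have c4 := ((continuousOn_heatKernel (E := E)).continuousAt
          (IsOpen.mem_nhds (isOpen_lt continuous_const continuous_fst)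
            (show (0 : ℝ) < (2 * (ν * (p.2 - s₀)), p.1 - y₀).1 by positivity))).tendsto.comp c3
        refine Tendsto.mul (Tendsto.mul_const _ (Tendsto.const_mul _ (Tendsto.add_const _ ?_)))
          (c2.mul c4)
        refine tendsto_const_nhds.div ?_ (by positivity)
        exact (Real.continuous_sqrt.tendsto _).comp ((ht.sub_const _).const_mul ν)
      refine hk.congr' ?_
      filter_upwards [hev] with j hj
      rw [indicator_of_mem hj]
    · rw [indicator_of_notMem hp]
      refine tendsto_const_nhds.congr' ?_
      have : p.2 < s₀ ∨ t₀ < p.2 := by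
        by_contra hcon
        push Not at hcon
        exact hp ⟨trivial, lt_of_le_of_ne hcon.1 hps.symm, lt_of_le_of_ne hcon.2 hpt⟩
      rcases this with h' | h'
      · filter_upwards [hs.eventually (lt_mem_nhds h')] with j hj
        rw [indicator_of_notMem]
        exact fun hh => absurd hh.2.1 (not_lt.2 hj.le)
      · filter_upwards [ht.eventually (gt_mem_nhds h')] with j hj
        rw [indicator_of_notMem]
        exact fun hh => absurd hh.2.2 (not_lt.2 hj.le)
  · rw [hval ((x₀, t₀), (y₀, s₀)) hp0]
    have e : ∀ j, _ := fun j => hval (u j) (huD j)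
    simp_rw [e]
    have hts : 0 < t₀ - s₀ := by linarith
    have c1 : Tendsto (fun j => (2 * (ν * ((u j).1.2 - (u j).2.2)), (u j).1.1 - (u j).2.1)) atTop
        (𝓝 (2 * (ν * (t₀ - s₀)), x₀ - y₀)) :=
      (((ht.sub hs).const_mul ν).const_mul 2).prodMk_nhds (hx.sub hy)
    have c2 := ((continuousOn_heatKernel (E := E)).continuousAt
      (IsOpen.mem_nhds (isOpen_lt continuous_const continuous_fst)
        (show (0 : ℝ) < (2 * (ν * (t₀ - s₀)), x₀ - y₀).1 by positivity))).tendsto.comp c1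
    refine Tendsto.mul (Tendsto.mul_const _ (Tendsto.const_mul _ (Tendsto.add ?_ ?_))) c2
    · exact ((Real.continuous_sqrt.tendsto _).comp (ht.sub hs)).const_mul 2 |>.const_mul _
    · have hc := intervalIntegral.continuous_primitive
        (fun a b => h.v_int.intervalIntegrable (a := a) (b := b)) 0
      have e2 : ∀ a b : ℝ, ∫ τ in a..b, v τ = (∫ τ in (0 : ℝ)..b, v τ) - ∫ τ in (0 : ℝ)..a, v τ :=
        fun a b => (intervalIntegral.integral_interval_sub_left h.v_int.intervalIntegrable
          h.v_int.intervalIntegrable).symm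
      refine Tendsto.congr (fun j => (e2 _ _).symm) ?_
      rw [e2 s₀ t₀]
      exact ((hc.tendsto _).comp ht).sub ((hc.tendsto _).comp hs)

/-- The Duhamel integral of a function with a weighted Gaussian bound. -/
lemma Coeff.duhamel_gauss_bound (h : Coeff ν M m v U V) {F : E → ℝ → ℝ} {A lam q s t : ℝ} {y x : E}
    (hA : 0 ≤ A)
    (hq : ∫ τ in Ioo s t, rate (gaussFactor E) ν M v t τ * Real.exp (-(lam * (t - τ))) ≤ q)
    (hst : s < t)
    (hF : AEStronglyMeasurable (fun p : E × ℝ => F p.1 p.2) (volume.restrict (univ ×ˢ Ioo s t)))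
    (hFb : ∀ z, ∀ τ ∈ Ioo s t,
      |F z τ| ≤ A * Real.exp (lam * (τ - s)) * heatKernel (2 * (ν * (τ - s))) (z - y)) :
    IntegrableOn (fun p : E × ℝ => duhamelKernel ν U V x t p.1 p.2 * F p.1 p.2)
        (univ ×ˢ Ioo s t) ∧
      ∫ p : E × ℝ in univ ×ˢ Ioo s t, |duhamelKernel ν U V x t p.1 p.2 * F p.1 p.2| ≤
        q * A * Real.exp (lam * (t - s)) * heatKernel (2 * (ν * (t - s))) (x - y) ∧
      |duhamel ν U V F s x t| ≤
        q * A * Real.exp (lam * (t - s)) * heatKernel (2 * (ν * (t - s))) (x - y) := by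
  have hν := h.ν_pos
  have e : ∀ τ, rate (gaussFactor E) ν M v t τ * (A * Real.exp (lam * (τ - s))) =
      (A * Real.exp (lam * (t - s))) *
        (rate (gaussFactor E) ν M v t τ * Real.exp (-(lam * (t - τ)))) := by
    intro τ
    have : Real.exp (lam * (τ - s)) = Real.exp (lam * (t - s)) * Real.exp (-(lam * (t - τ))) := by
      rw [← Real.exp_add]; congr 1; ring
    rw [this]; ring
  have hb := h.duhamel_bound (x := x) (R := heatKernel (2 * (ν * (t - s))) (x - y))
    (g := fun τ => A * Real.exp (lam * (τ - s)))
    (ρ := fun z τ => heatKernel (2 * (ν * (τ - s))) (z - y)) hF ?_ ?_ ?_ hFb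
  · have hR := heatKernel_pos (show 0 < 2 * (ν * (t - s)) by
      have : 0 < t - s := by linarith
      positivity) (x - y)
    have hle : (∫ τ in Ioo s t, rate (gaussFactor E) ν M v t τ * (A * Real.exp (lam * (τ - s)))) *
        heatKernel (2 * (ν * (t - s))) (x - y) ≤
        q * A * Real.exp (lam * (t - s)) * heatKernel (2 * (ν * (t - s))) (x - y) := by
      simp_rw [e]
      rw [integral_const_mul]
      refine mul_le_mul_of_nonneg_right ?_ hR.le
      have := mul_le_mul_of_nonneg_left hq (show 0 ≤ A * Real.exp (lam * (t - s)) by positivity)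
      linarith
    exact ⟨hb.1, hb.2.1.trans hle, hb.2.2.trans hle⟩
  · simp_rw [e]
    exact (integrableOn_rate_mul_exp hν h.v_int lam s t).const_mul _
  · intro τ _; positivity
  · intro τ hτ
    obtain ⟨h1, h2⟩ := heatKernel_conv_time hν hτ.1 hτ.2 x y
    exact ⟨h1, h2.le⟩

/-- The weight `exp(lam(t - s))` passes through Duhamel's integral and leaves `exp(-lam(t - τ))` on
the time density, whose weighted integral is at most `1/2`. So every iteration halves the constant.
The factor `gaussFactor E` is paid once, for doubling the variance in the zeroth term. -/
lemma Coeff.picard_spec (h : Coeff ν M m v U V) {lam : ℝ} (hlam : 0 < lam)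
    (hq : ∀ s t : ℝ,
      ∫ τ in Ioo s t, rate (gaussFactor E) ν M v t τ * Real.exp (-(lam * (t - τ))) ≤ 1 / 2) (k : ℕ) :
    ContinuousOn (fun p : (E × ℝ) × (E × ℝ) => picard ν U V k p.1.1 p.1.2 p.2.1 p.2.2)
        (orderedPairs E) ∧
      ∀ x t y s, s < t → |picard ν U V k x t y s| ≤
        gaussFactor E * (1 / 2) ^ k * Real.exp (lam * (t - s)) *
          heatKernel (2 * (ν * (t - s))) (x - y) := by
  have hν := h.ν_pos
  have hgf := gaussFactor_pos (E := E)
  induction k with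
  | zero =>
    refine ⟨?_, fun x t y s hst => ?_⟩
    · simp only [picard]
      refine continuousOn_heatKernel.comp (f := fun p : (E × ℝ) × (E × ℝ) =>
        (ν * (p.1.2 - p.2.2), p.1.1 - p.2.1)) (by fun_prop) fun p hp => ?_
      exact mul_pos hν (sub_pos.2 hp)
    · have h0 : 0 < ν * (t - s) := mul_pos hν (sub_pos.2 hst)
      simp only [picard, pow_zero, mul_one]
      rw [abs_of_pos (heatKernel_pos h0 _)]
      refine (heatKernel_le_two_mul h0 _).trans ?_
      have h1 : 1 ≤ Real.exp (lam * (t - s)) :=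
        Real.one_le_exp (mul_nonneg hlam.le (by linarith))
      have h2 := heatKernel_pos (show 0 < 2 * (ν * (t - s)) by positivity) (x - y)
      nlinarith [mul_pos hgf h2]
  | succ k ih =>
    obtain ⟨ihc, ihb⟩ := ih
    refine ⟨?_, fun x t y s hst => ?_⟩
    · exact h.continuousOn_duhamel (by positivity) hlam.le ihc fun z τ y s hs => ihb z τ y s hs
    · have := (h.duhamel_gauss_bound (x := x) (A := gaussFactor E * (1 / 2) ^ k) (by positivity)
        (hq s t) hst (aestronglyMeasurable_strip ihc y s t)
        fun z τ hτ => ihb z τ y s hτ.1).2.2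
      simp only [picard]
      refine this.trans (le_of_eq ?_)
      rw [pow_succ]; ring

/-- Gaussian bound, continuity, and Duhamel's formula for the fundamental solution. -/
lemma Coeff.fundSol_spec (h : Coeff ν M m v U V) : ∃ A lam : ℝ, 0 ≤ A ∧ 0 < lam ∧
    ContinuousOn (fun p : (E × ℝ) × (E × ℝ) => fundSol ν U V p.1.1 p.1.2 p.2.1 p.2.2)
      (orderedPairs E) ∧
    (∀ x t y s, s < t → |fundSol ν U V x t y s| ≤
      A * Real.exp (lam * (t - s)) * heatKernel (2 * (ν * (t - s))) (x - y)) ∧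
    (∀ x t y s, s < t → fundSol ν U V x t y s = heatKernel (ν * (t - s)) (x - y) +
      duhamel ν U V (fun z τ => fundSol ν U V z τ y s) s x t) := by
  have hν := h.ν_pos
  have hgf := gaussFactor_pos (E := E)
  obtain ⟨lam, hlam, hq⟩ := exists_integral_rate_mul_exp_le (c := gaussFactor E) hgf.le hν
    h.M_nonneg h.v_int h.v_nonneg (ε := 1 / 2) (by norm_num)
  have hspec := fun k => h.picard_spec hlam hq k
  have hsum2 : Summable (fun k : ℕ => ((1 : ℝ) / 2) ^ k) :=
    summable_geometric_of_lt_one (by norm_num) (by norm_num)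
  have htsum : ∑' k : ℕ, ((1 : ℝ) / 2) ^ k = 2 := tsum_geometric_two
  have hmaj : ∀ (x : E) (t : ℝ) (y : E) (s : ℝ), Summable (fun k : ℕ => gaussFactor E * (1 / 2) ^ k *
      Real.exp (lam * (t - s)) * heatKernel (2 * (ν * (t - s))) (x - y)) := fun x t y s =>
    ((hsum2.mul_left _).mul_right _).mul_right _
  have hsummable : ∀ x t y s, s < t → Summable (fun k => picard ν U V k x t y s) :=
    fun x t y s hst => Summable.of_norm_bounded (hmaj x t y s) fun k => (hspec k).2 x t y s hst
  refine ⟨gaussFactor E * 2, lam, by positivity, hlam, ?_, ?_, ?_⟩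
  · intro p₀ hp₀
    have hp0 : p₀.2.2 < p₀.1.2 := hp₀
    let w : (E × ℝ) × (E × ℝ) → ℝ := fun p => Real.exp (lam * (p.1.2 - p.2.2)) *
      heatKernel (2 * (ν * (p.1.2 - p.2.2))) (p.1.1 - p.2.1)
    have hw : ContinuousOn w (orderedPairs E) := by
      refine ContinuousOn.mul (by fun_prop) ?_
      refine continuousOn_heatKernel.comp (f := fun p : (E × ℝ) × (E × ℝ) =>
        (2 * (ν * (p.1.2 - p.2.2)), p.1.1 - p.2.1)) (by fun_prop) fun p hp => ?_
      have : 0 < ν * (p.1.2 - p.2.2) := mul_pos hν (sub_pos.2 hp)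
      exact mul_pos two_pos this
    -- The common Gaussian factor of the majorants is bounded on this neighbourhood, which gives
    -- locally uniform convergence of the series.
    set N := orderedPairs E ∩ w ⁻¹' (Iio (w p₀ + 1)) with hN
    have hNo : IsOpen N := hw.isOpen_inter_preimage isOpen_orderedPairs isOpen_Iio
    have hpN : p₀ ∈ N := ⟨hp₀, by simp [mem_Iio]⟩
    have hc : ContinuousOn (fun p : (E × ℝ) × (E × ℝ) =>
        ∑' k, picard ν U V k p.1.1 p.1.2 p.2.1 p.2.2) N := by
      refine continuousOn_tsum (u := fun k : ℕ => gaussFactor E * (1 / 2) ^ k * (w p₀ + 1))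
        (fun k => (hspec k).1.mono inter_subset_left) ((hsum2.mul_left _).mul_right _) ?_
      intro k p hp
      refine ((hspec k).2 _ _ _ _ hp.1).trans ?_
      rw [mul_assoc]
      refine mul_le_mul_of_nonneg_left (le_of_lt hp.2) (by positivity)
    exact (hc.continuousAt (hNo.mem_nhds hpN)).continuousWithinAt
  · intro x t y s hst
    have h1 := norm_tsum_le_tsum_norm (hsummable x t y s hst).norm
    refine h1.trans ((Summable.tsum_le_tsum (fun k => (hspec k).2 x t y s hst)
      (hsummable x t y s hst).norm (hmaj x t y s)).trans (le_of_eq ?_))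
    rw [tsum_mul_right, tsum_mul_right, tsum_mul_left, htsum]
  · intro x t y s hst
    unfold fundSol
    rw [(hsummable x t y s hst).tsum_eq_zero_add]
    congr 1
    have hb := fun k => h.duhamel_gauss_bound (x := x) (A := gaussFactor E * (1 / 2) ^ k)
      (by positivity) (hq s t) hst (aestronglyMeasurable_strip (hspec k).1 y s t)
      fun z τ hτ => (hspec k).2 z τ y s hτ.1
    -- The integrals of the absolute values are summable like a geometric series, so the sum may be
    -- taken inside Duhamel's integral.
    have hs := hasSum_integral_of_summable_integral_norm
      (μ := (volume : Measure (E × ℝ)).restrict (univ ×ˢ Ioo s t))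
      (F := fun k (p : E × ℝ) => duhamelKernel ν U V x t p.1 p.2 * picard ν U V k p.1 p.2 y s)
      (fun k => (hb k).1) ?_
    · simp only [picard]
      unfold duhamel
      rw [hs.tsum_eq]
      simp_rw [tsum_mul_left]
    · refine Summable.of_nonneg_of_le (fun k => integral_nonneg fun _ => norm_nonneg _)
        (fun k => (hb k).2.1) ?_
      refine Summable.mul_right _ (Summable.mul_right _ (Summable.mul_left _ (hsum2.mul_left _)))

end Picard

end AdvectionDiffusion

namespace AdvectionDiffusion

/-! ### The integral equation: uniqueness, representation, initial values -/

section Mild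

variable {E : Type*} [NormedAddCommGroup E] [InnerProductSpace ℝ E] [FiniteDimensional ℝ E]
  [MeasurableSpace E] [BorelSpace E]
  {ν M : ℝ} {m v : ℝ → ℝ} {U : E → ℝ → E} {V : E → ℝ → ℝ}

/-- The Duhamel integral of a function of exponential growth. -/
lemma Coeff.duhamel_exp_bound (h : Coeff ν M m v U V) {F : E → ℝ → ℝ} {A B lam q s t : ℝ}
    (x : E) (hA : 0 ≤ A)
    (hq : ∫ τ in Ioo s t, rate (gaussFactor E) ν M v t τ * Real.exp (-(lam * (t - τ))) ≤ q)
    (_hst : s < t)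
    (hF : AEStronglyMeasurable (fun p : E × ℝ => F p.1 p.2) (volume.restrict (univ ×ˢ Ioo s t)))
    (hFb : ∀ z, ∀ τ ∈ Ioo s t, |F z τ| ≤ A * Real.exp (lam * (τ - s)) * Real.exp (B * ‖z‖)) :
    IntegrableOn (fun p : E × ℝ => duhamelKernel ν U V x t p.1 p.2 * F p.1 p.2)
        (univ ×ˢ Ioo s t) ∧
      |duhamel ν U V F s x t| ≤ q * A * Real.exp (lam * (t - s)) *
        (gaussFactor E * Real.exp (4 * ν * (t - s) * B ^ 2) * Real.exp (B * ‖x‖)) := by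
  have hν := h.ν_pos
  have hgf := gaussFactor_pos (E := E)
  have e : ∀ τ, rate (gaussFactor E) ν M v t τ * (A * Real.exp (lam * (τ - s))) =
      (A * Real.exp (lam * (t - s))) *
        (rate (gaussFactor E) ν M v t τ * Real.exp (-(lam * (t - τ)))) := by
    intro τ
    have : Real.exp (lam * (τ - s)) = Real.exp (lam * (t - s)) * Real.exp (-(lam * (t - τ))) := by
      rw [← Real.exp_add]; congr 1; ring
    rw [this]; ring
  have hb := h.duhamel_bound (x := x)
    (R := gaussFactor E * Real.exp (4 * ν * (t - s) * B ^ 2) * Real.exp (B * ‖x‖))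
    (g := fun τ => A * Real.exp (lam * (τ - s)))
    (ρ := fun z _ => Real.exp (B * ‖z‖)) hF ?_ ?_ ?_ hFb
  · refine ⟨hb.1, hb.2.2.trans ?_⟩
    simp_rw [e]
    rw [integral_const_mul]
    refine mul_le_mul_of_nonneg_right ?_ (by positivity)
    have := mul_le_mul_of_nonneg_left hq (show 0 ≤ A * Real.exp (lam * (t - s)) by positivity)
    linarith
  · simp_rw [e]
    exact (integrableOn_rate_mul_exp hν h.v_int lam s t).const_mul _
  · intro τ _; positivity
  · intro τ hτ
    have h0 : 0 < 2 * (ν * (t - τ)) := by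
      have : 0 < t - τ := by linarith [hτ.2]
      positivity
    refine ⟨integrable_heatKernel_sub_mul_exp h0 B x,
      (integral_heatKernel_sub_mul_exp_le h0 B x).trans ?_⟩
    have : 2 * (2 * (ν * (t - τ))) * B ^ 2 ≤ 4 * ν * (t - s) * B ^ 2 := by
      have : ν * (t - τ) ≤ ν * (t - s) := by gcongr; exact hτ.1.le
      nlinarith [sq_nonneg B, mul_le_mul_of_nonneg_right this (sq_nonneg B)]
    gcongr

/-- Uniqueness for the integral equation in the class of exponential growth. -/
lemma Coeff.eq_zero_of_mild (h : Coeff ν M m v U V) {w : E → ℝ → ℝ} {A B s b : ℝ}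
    (hm : ∀ t ∈ Ioc s b, AEStronglyMeasurable (fun p : E × ℝ => w p.1 p.2)
      (volume.restrict (univ ×ˢ Ioo s t)))
    (hw : ∀ t ∈ Ioc s b, ∀ x, |w x t| ≤ A * Real.exp (B * ‖x‖))
    (hmild : ∀ t ∈ Ioc s b, ∀ x, w x t = duhamel ν U V w s x t) :
    ∀ t ∈ Ioc s b, ∀ x, w x t = 0 := by
  have hν := h.ν_pos
  have hgf := gaussFactor_pos (E := E)
  intro t₀ ht₀
  have hA : 0 ≤ A := by
    have h1 := (abs_nonneg _).trans (hw t₀ ht₀ 0)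
    exact nonneg_of_mul_nonneg_left h1 (Real.exp_pos _)
  set C := gaussFactor E * Real.exp (4 * ν * (b - s) * B ^ 2) with hC
  have hC0 : 0 < C := by positivity
  -- `C` is the loss from averaging `exp(B‖z‖)` against a Gaussian up to time `b`. With the weighted
  -- integral at most `1/(2C)`, each use of the equation halves the bound on `w`.
  obtain ⟨lam, hlam, hq⟩ := exists_integral_rate_mul_exp_le (c := gaussFactor E) hgf.le hν
    h.M_nonneg h.v_int h.v_nonneg (ε := 1 / (2 * C)) (by positivity)
  have key : ∀ k : ℕ, ∀ t ∈ Ioc s b, ∀ x,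
      |w x t| ≤ A * (1 / 2) ^ k * Real.exp (lam * (t - s)) * Real.exp (B * ‖x‖) := by
    intro k
    induction k with
    | zero =>
      intro t ht x
      have h1 : 1 ≤ Real.exp (lam * (t - s)) :=
        Real.one_le_exp (mul_nonneg hlam.le (by linarith [ht.1]))
      have h2 : 0 ≤ A * Real.exp (B * ‖x‖) := by positivity
      rw [pow_zero, mul_one]
      nlinarith [hw t ht x]
    | succ k ih =>
      intro t ht x
      rw [hmild t ht x]
      have := (h.duhamel_exp_bound x (A := A * (1 / 2) ^ k) (by positivity) (hq s t) ht.1 (hm t ht)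
        (fun z τ hτ => ih τ ⟨hτ.1, hτ.2.le.trans ht.2⟩ z)).2
      refine this.trans ?_
      have h3 : gaussFactor E * Real.exp (4 * ν * (t - s) * B ^ 2) ≤ C := by
        rw [hC]
        have : 4 * ν * (t - s) * B ^ 2 ≤ 4 * ν * (b - s) * B ^ 2 := by
          have := ht.2
          gcongr
        gcongr
      calc _ ≤ 1 / (2 * C) * (A * (1 / 2) ^ k) * Real.exp (lam * (t - s)) *
            (C * Real.exp (B * ‖x‖)) := by gcongr
        _ = _ := by rw [pow_succ]; field_simp
  intro x
  have hlim : Tendsto (fun k : ℕ => A * (1 / 2) ^ k * Real.exp (lam * (t₀ - s)) *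
      Real.exp (B * ‖x‖)) atTop (𝓝 0) := by
    have := (((tendsto_pow_atTop_nhds_zero_of_lt_one (r := (1 : ℝ) / 2) (by norm_num)
      (by norm_num)).const_mul A).mul_const (Real.exp (lam * (t₀ - s)))).mul_const
        (Real.exp (B * ‖x‖))
    simpa using this
  have h0 : |w x t₀| ≤ 0 := ge_of_tendsto' hlim fun k => key k t₀ ht₀ x
  exact abs_eq_zero.1 (le_antisymm h0 (abs_nonneg _))

/-- The solution with initial value `f` at time `s`. -/
noncomputable def evolve (ν : ℝ) (U : E → ℝ → E) (V : E → ℝ → ℝ) (f : E → ℝ) (s : ℝ) (x : E)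
    (t : ℝ) : ℝ :=
  ∫ y, fundSol ν U V x t y s * f y

lemma aestronglyMeasurable_fundSol_strip {F : E → ℝ → E → ℝ → ℝ}
    (hF : ContinuousOn (fun p : (E × ℝ) × (E × ℝ) => F p.1.1 p.1.2 p.2.1 p.2.2) (orderedPairs E))
    (s t : ℝ) :
    AEStronglyMeasurable (fun q : E × (E × ℝ) => F q.2.1 q.2.2 q.1 s)
      ((volume : Measure E).prod (volume.restrict (univ ×ˢ Ioo s t))) := by
  have : (volume : Measure E).prod ((volume : Measure (E × ℝ)).restrict (univ ×ˢ Ioo s t)) =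
      ((volume : Measure E).prod volume).restrict (univ ×ˢ (univ ×ˢ Ioo s t)) := by
    rw [← Measure.prod_restrict, Measure.restrict_univ]
  rw [this]
  refine ContinuousOn.aestronglyMeasurable ?_ (MeasurableSet.univ.prod (measurableSet_strip s t))
  refine hF.comp (f := fun q : E × (E × ℝ) => (q.2, (q.1, s))) (by fun_prop) fun q hq => ?_
  exact hq.2.2.1

/-- Integrability, growth, measurability and Duhamel's formula for `evolve`. -/
lemma Coeff.evolve_spec (h : Coeff ν M m v U V) : ∃ A lam : ℝ, 0 ≤ A ∧ 0 < lam ∧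
    ∀ (f : E → ℝ) (A' B s : ℝ), AEStronglyMeasurable f volume → 0 ≤ A' →
      (∀ y, |f y| ≤ A' * Real.exp (B * ‖y‖)) →
      (∀ x t, s < t → Integrable (fun y => fundSol ν U V x t y s * f y)) ∧
      (∀ x t, s < t → |evolve ν U V f s x t| ≤ A * A' * Real.exp (lam * (t - s)) *
        Real.exp (4 * ν * (t - s) * B ^ 2) * Real.exp (B * ‖x‖)) ∧
      (∀ t, AEStronglyMeasurable (fun p : E × ℝ => evolve ν U V f s p.1 p.2)
        (volume.restrict (univ ×ˢ Ioo s t))) ∧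
      (∀ x t, s < t → evolve ν U V f s x t = (∫ y, heatKernel (ν * (t - s)) (x - y) * f y) +
        duhamel ν U V (evolve ν U V f s) s x t) := by
  have hν := h.ν_pos
  have hgf := gaussFactor_pos (E := E)
  obtain ⟨A, lam, hA, hlam, hc, hb, hd⟩ := h.fundSol_spec
  refine ⟨A * gaussFactor E, lam, by positivity, hlam, fun f A' B s hf hA' hfb => ?_⟩
  have hpos : ∀ t, s < t → 0 < 2 * (ν * (t - s)) := fun t hst => by
    have : 0 < t - s := by linarith
    positivity
  have hfc : ∀ x t, s < t → AEStronglyMeasurable (fun y => fundSol ν U V x t y s) volume := by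
    intro x t hst
    rw [← Measure.restrict_univ (μ := volume)]
    refine ContinuousOn.aestronglyMeasurable ?_ MeasurableSet.univ
    refine hc.comp (f := fun y => ((x, t), (y, s))) (by fun_prop) fun y _ => hst
  have hmajor : ∀ x t, s < t → ∀ y, |fundSol ν U V x t y s * f y| ≤
      (A * A' * Real.exp (lam * (t - s))) *
        (heatKernel (2 * (ν * (t - s))) (x - y) * Real.exp (B * ‖y‖)) := by
    intro x t hst y
    rw [abs_mul]
    calc _ ≤ (A * Real.exp (lam * (t - s)) * heatKernel (2 * (ν * (t - s))) (x - y)) *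
          (A' * Real.exp (B * ‖y‖)) :=
          mul_le_mul (hb x t y s hst) (hfb y) (abs_nonneg _) ((abs_nonneg _).trans (hb x t y s hst))
      _ = _ := by ring
  have hint : ∀ x t, s < t → Integrable (fun y => fundSol ν U V x t y s * f y) :=
    fun x t hst => ((integrable_heatKernel_sub_mul_exp (hpos t hst) B x).const_mul _).mono'
      ((hfc x t hst).mul hf) (ae_of_all _ (hmajor x t hst))
  refine ⟨hint, ?_, ?_, ?_⟩
  · intro x t hst
    unfold evolve
    refine (abs_integral_le_integral_abs).trans ((integral_mono (hint x t hst).abs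
      ((integrable_heatKernel_sub_mul_exp (hpos t hst) B x).const_mul _)
      (hmajor x t hst)).trans ?_)
    rw [integral_const_mul]
    refine (mul_le_mul_of_nonneg_left (integral_heatKernel_sub_mul_exp_le (hpos t hst) B x)
      (by positivity)).trans (le_of_eq ?_)
    rw [show 2 * (2 * (ν * (t - s))) * B ^ 2 = 4 * ν * (t - s) * B ^ 2 by ring]
    ring
  · intro t
    have h1 := (aestronglyMeasurable_fundSol_strip hc s t).mul
      (hf.comp_fst (ν := (volume : Measure (E × ℝ)).restrict (univ ×ˢ Ioo s t)))
    have h2 := h1.prod_swap.integral_prod_right'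
    exact h2
  · intro x t hst
    -- No smallness is needed here: any finite `q` justifies Fubini's theorem.
    obtain ⟨q, hq⟩ : ∃ q, ∫ τ in Ioo s t, rate (gaussFactor E) ν M v t τ *
        Real.exp (-(lam * (t - τ))) ≤ q := ⟨_, le_rfl⟩
    have hgb := fun y : E => h.duhamel_gauss_bound (x := x) (y := y) hA hq hst
      (aestronglyMeasurable_strip hc y s t) (fun z τ hτ => hb z τ y s hτ.1)
    have hI : Integrable (fun r : E × (E × ℝ) => duhamelKernel ν U V x t r.2.1 r.2.2 *
        (fundSol ν U V r.2.1 r.2.2 r.1 s * f r.1))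
        ((volume : Measure E).prod (volume.restrict (univ ×ˢ Ioo s t))) := by
      have hmeas : AEStronglyMeasurable (fun r : E × (E × ℝ) =>
          duhamelKernel ν U V x t r.2.1 r.2.2 * (fundSol ν U V r.2.1 r.2.2 r.1 s * f r.1))
          ((volume : Measure E).prod (volume.restrict (univ ×ˢ Ioo s t))) :=
        ((h.measurable_duhamelKernel measurable_const (by fun_prop) measurable_const
          (by fun_prop)).aestronglyMeasurable).mul
          ((aestronglyMeasurable_fundSol_strip hc s t).mul hf.comp_fst)
      rw [integrable_prod_iff hmeas]
      refine ⟨ae_of_all _ fun y => ?_, ?_⟩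
      · simp_rw [← mul_assoc]
        exact (hgb y).1.mul_const (f y)
      · refine ((integrable_heatKernel_sub_mul_exp (hpos t hst) B x).const_mul
          (q * A * Real.exp (lam * (t - s)) * A')).mono'
          (hmeas.norm.integral_prod_right') (ae_of_all _ fun y => ?_)
        rw [Real.norm_of_nonneg (integral_nonneg fun _ => norm_nonneg _)]
        simp_rw [← mul_assoc, norm_mul _ (f y)]
        rw [integral_mul_const]
        calc _ ≤ (q * A * Real.exp (lam * (t - s)) * heatKernel (2 * (ν * (t - s))) (x - y)) *
              (A' * Real.exp (B * ‖y‖)) :=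
              mul_le_mul (hgb y).2.1 (hfb y) (abs_nonneg _)
                ((integral_nonneg fun _ => abs_nonneg _).trans (hgb y).2.1)
          _ = _ := by ring_nf
    have hswap := integral_integral_swap
      (f := fun (y : E) (p : E × ℝ) => duhamelKernel ν U V x t p.1 p.2 *
        (fundSol ν U V p.1 p.2 y s * f y)) hI
    have e1 : duhamel ν U V (evolve ν U V f s) s x t =
        ∫ y, duhamel ν U V (fun z τ => fundSol ν U V z τ y s) s x t * f y := by
      unfold duhamel evolve
      simp_rw [← integral_const_mul, ← integral_mul_const]
      rw [← hswap]
      simp_rw [mul_assoc]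
    have e2 : Integrable (fun y => heatKernel (ν * (t - s)) (x - y) * f y) := by
      have h0 : 0 < ν * (t - s) := mul_pos hν (by linarith)
      refine ((integrable_heatKernel_sub_mul_exp h0 B x).const_mul A').mono'
        (((continuous_heatKernel _).comp (continuous_const.sub continuous_id)).aestronglyMeasurable.mul
          hf) (ae_of_all _ fun y => ?_)
      rw [norm_mul, Real.norm_of_nonneg (heatKernel_pos h0 _).le]
      have := mul_le_mul_of_nonneg_left (hfb y) (heatKernel_pos h0 (x - y)).le
      calc _ ≤ _ := this
        _ = _ := by ring
    have e3 : Integrable (fun y =>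
        duhamel ν U V (fun z τ => fundSol ν U V z τ y s) s x t * f y) := by
      refine ((hint x t hst).sub e2).congr (ae_of_all _ fun y => ?_)
      simp only [Pi.sub_apply]
      rw [hd x t y s hst]; ring
    rw [e1, ← integral_add e2 e3]
    unfold evolve
    congr 1; ext y
    rw [hd x t y s hst]; ring

/-- A solution of the integral equation is given by the fundamental solution. -/
lemma Coeff.eq_evolve_of_mild (h : Coeff ν M m v U V) {f : E → ℝ → ℝ} {f₀ : E → ℝ}
    {A A₀ B s b : ℝ} (hA₀ : 0 ≤ A₀)
    (hf₀ : AEStronglyMeasurable f₀ volume) (hf₀b : ∀ y, |f₀ y| ≤ A₀ * Real.exp (B * ‖y‖))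
    (hm : ∀ t ∈ Ioc s b, AEStronglyMeasurable (fun p : E × ℝ => f p.1 p.2)
      (volume.restrict (univ ×ˢ Ioo s t)))
    (hfb : ∀ t ∈ Ioc s b, ∀ x, |f x t| ≤ A * Real.exp (B * ‖x‖))
    (hmild : ∀ t ∈ Ioc s b, ∀ x, f x t = (∫ y, heatKernel (ν * (t - s)) (x - y) * f₀ y) +
      duhamel ν U V f s x t) :
    ∀ t ∈ Ioc s b, ∀ x, f x t = evolve ν U V f₀ s x t := by
  have hν := h.ν_pos
  have hgf := gaussFactor_pos (E := E)
  obtain ⟨A₁, lam, hA₁, hlam, hspec⟩ := h.evolve_spec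
  obtain ⟨-, hg, hgm, hgd⟩ := hspec f₀ A₀ B s hf₀ hA₀ hf₀b
  intro t₀ ht₀
  have hA : 0 ≤ A := by
    have h1 := (abs_nonneg _).trans (hfb t₀ ht₀ 0)
    exact nonneg_of_mul_nonneg_left h1 (Real.exp_pos _)
  set A₂ := A₁ * A₀ * Real.exp (lam * (b - s)) * Real.exp (4 * ν * (b - s) * B ^ 2) with hA₂
  have hg' : ∀ t ∈ Ioc s b, ∀ x, |evolve ν U V f₀ s x t| ≤ A₂ * Real.exp (B * ‖x‖) := by
    intro t ht x
    refine (hg x t ht.1).trans ?_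
    have := ht.2
    rw [hA₂]; gcongr
  have hA₂0 : 0 ≤ A₂ := by positivity
  have hdi : ∀ (F : E → ℝ → ℝ) (A' : ℝ), 0 ≤ A' →
      (∀ t ∈ Ioc s b, AEStronglyMeasurable (fun p : E × ℝ => F p.1 p.2)
        (volume.restrict (univ ×ˢ Ioo s t))) →
      (∀ t ∈ Ioc s b, ∀ x, |F x t| ≤ A' * Real.exp (B * ‖x‖)) → ∀ t ∈ Ioc s b, ∀ x,
      IntegrableOn (fun p : E × ℝ => duhamelKernel ν U V x t p.1 p.2 * F p.1 p.2)
        (univ ×ˢ Ioo s t) := by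
    intro F A' hA' hm hF t ht x
    refine (h.duhamel_exp_bound x (lam := 0) (B := B) hA' le_rfl ht.1 (hm t ht) (fun z τ hτ => ?_)).1
    simpa using hF τ ⟨hτ.1, hτ.2.le.trans ht.2⟩ z
  have hz := h.eq_zero_of_mild (w := fun x t => f x t - evolve ν U V f₀ s x t) (s := s) (b := b)
    (A := A + A₂) (B := B) (fun t ht => (hm t ht).sub (hgm t)) ?_ ?_
  · intro x
    exact sub_eq_zero.1 (hz t₀ ht₀ x)
  · intro t ht x
    refine (abs_sub _ _).trans ?_
    have := hfb t ht x
    have := hg' t ht x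
    linarith
  · intro t ht x
    rw [hmild t ht x, hgd x t ht.1]
    have i1 := hdi f A hA hm hfb t ht x
    have i2 := hdi (evolve ν U V f₀ s) A₂ hA₂0 (fun t _ => hgm t) hg' t ht x
    unfold duhamel at *
    simp_rw [mul_sub]
    rw [integral_sub i1 i2]
    ring

/-- The initial value is attained locally uniformly. -/
lemma Coeff.tendsto_evolve (h : Coeff ν M m v U V) {f : E → ℝ} {A' : ℝ} (s : ℝ) (x₀ : E)
    (hf : Continuous f) (hfb : ∀ y, |f y| ≤ A') :
    Tendsto (fun p : E × ℝ => evolve ν U V f s p.1 p.2) (𝓝[univ ×ˢ Ioi s] (x₀, s))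
      (𝓝 (f x₀)) := by
  have hν := h.ν_pos
  have hgf := gaussFactor_pos (E := E)
  have hA' : 0 ≤ A' := (abs_nonneg _).trans (hfb 0)
  have hfb' : ∀ y, |f y| ≤ A' * Real.exp (0 * ‖y‖) := by simpa using hfb
  obtain ⟨A, lam, hA, hlam, hspec⟩ := h.evolve_spec
  obtain ⟨-, hg, hgm, hgd⟩ := hspec f A' 0 s hf.aestronglyMeasurable hA' hfb'
  have hev : ∀ᶠ p : E × ℝ in 𝓝[univ ×ˢ Ioi s] (x₀, s), s < p.2 :=
    eventually_nhdsWithin_of_forall fun p hp => hp.2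
  have hfst : Tendsto (fun p : E × ℝ => p.1) (𝓝[univ ×ˢ Ioi s] (x₀, s)) (𝓝 x₀) :=
    (continuous_fst.tendsto (x₀, s)).mono_left nhdsWithin_le_nhds
  have hsnd : Tendsto (fun p : E × ℝ => p.2) (𝓝[univ ×ˢ Ioi s] (x₀, s)) (𝓝 s) :=
    (continuous_snd.tendsto (x₀, s)).mono_left nhdsWithin_le_nhds
  have h1 : Tendsto (fun p : E × ℝ => ∫ y, heatKernel (ν * (p.2 - s)) (p.1 - y) * f y)
      (𝓝[univ ×ˢ Ioi s] (x₀, s)) (𝓝 (f x₀)) := by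
    have e : ∀ p : E × ℝ, ∫ y, heatKernel (ν * (p.2 - s)) (p.1 - y) * f y =
        ∫ w, heatKernel (ν * (p.2 - s)) w * f (p.1 - w) := by
      intro p
      rw [← integral_sub_left_eq_self (fun y => heatKernel (ν * (p.2 - s)) (p.1 - y) * f y)
        volume p.1]
      simp
    simp_rw [e]
    refine tendsto_integral_heatKernel_mul (A := A') (B := 0) ?_ ?_ ?_ ?_ ?_
    · have := (hsnd.sub_const s).const_mul ν
      simpa using this
    · filter_upwards [hev] with p hp
      exact mul_pos hν (sub_pos.2 hp)
    · exact Eventually.of_forall fun p w => by simpa using hfb _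
    · exact Eventually.of_forall fun p => (hf.comp (by fun_prop)).aestronglyMeasurable
    · have : Tendsto (fun q : (E × ℝ) × E => q.1.1 - q.2)
          (𝓝[univ ×ˢ Ioi s] (x₀, s) ×ˢ 𝓝 0) (𝓝 (x₀ - 0)) :=
        (hfst.comp tendsto_fst).sub tendsto_snd
      rw [sub_zero] at this
      exact (hf.tendsto x₀).comp this
  have h2 : Tendsto (fun p : E × ℝ => duhamel ν U V (evolve ν U V f s) s p.1 p.2)
      (𝓝[univ ×ˢ Ioi s] (x₀, s)) (𝓝 0) := by
    set C := A * A' * Real.exp (lam * 1) with hC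
    have hC0 : 0 ≤ C := by positivity
    rw [Metric.tendsto_nhds]
    intro ε hε
    -- Over a short interval the Duhamel term is at most `C · gaussFactor E` times the integral of
    -- the time density. The tolerance is chosen so that the product stays below `ε/2`; restricting
    -- to `t - s ≤ 1` lets the constant `C` bound the solution.
    obtain ⟨δ, hδ, hr⟩ := exists_integral_rate_le (c := gaussFactor E) hgf.le hν
      h.M_nonneg h.v_int h.v_nonneg (ε := ε / (2 * (C * gaussFactor E + 1))) (by positivity)
    filter_upwards [hev, hsnd.eventually (gt_mem_nhds (show s < s + min δ 1 by
      have : 0 < min δ 1 := by positivity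
      linarith))] with p hp hp2
    have hp1 : p.2 - s ≤ 1 := by linarith [min_le_right δ 1]
    have hpδ : p.2 - s ≤ δ := by linarith [min_le_left δ 1]
    have hb := (h.duhamel_exp_bound (F := evolve ν U V f s) (A := C) (B := 0) (lam := 0)
      (q := ε / (2 * (C * gaussFactor E + 1))) p.1 hC0 ?_ hp (hgm p.2) ?_).2
    · rw [dist_zero_right, Real.norm_eq_abs]
      refine hb.trans_lt ?_
      simp only [zero_mul, Real.exp_zero, mul_one]
      norm_num
      have : ε / (2 * (C * gaussFactor E + 1)) * C * gaussFactor E =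
        (ε / 2) * (C * gaussFactor E / (C * gaussFactor E + 1)) := by
        field_simp
      rw [this]
      have h5 : C * gaussFactor E / (C * gaussFactor E + 1) ≤ 1 := by
        rw [div_le_one (by positivity)]; linarith
      nlinarith
    · simpa using hr s p.2 hpδ
    · intro z τ hτ
      refine (hg z τ hτ.1).trans ?_
      have : τ - s ≤ 1 := by linarith [hτ.2]
      simp only [zero_mul, Real.exp_zero, mul_one, hC]
      norm_num
      gcongr
      nlinarith
  have h3 := h1.add h2
  rw [add_zero] at h3
  refine h3.congr' ?_
  filter_upwards [hev] with p hp
  rw [hgd p.1 p.2 hp]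

end Mild

end AdvectionDiffusion

namespace AdvectionDiffusion

/-! ### Gradients and Laplacians; the heat equation; cutoffs -/

section Calculus

variable {E : Type*} [NormedAddCommGroup E] [InnerProductSpace ℝ E] [FiniteDimensional ℝ E]

lemma gradient_eq_of_hasFDerivAt {f : E → ℝ} {g x : E} (h : HasFDerivAt f (innerSL ℝ g) x) :
    gradient f x = g := by
  have : HasGradientAt f g x := h
  exact this.gradient

lemma hasFDerivAt_innerSL_gradient {f : E → ℝ} {x : E} (h : DifferentiableAt ℝ f x) :
    HasFDerivAt f (innerSL ℝ (gradient f x)) x := h.hasGradientAt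

/-- The Laplacian as the trace of the derivative of the gradient field. Explicit gradients can thus
be differentiated as vector fields, without second order multilinear derivatives. -/
lemma laplacian_eq_sum_of_hasFDerivAt {f : E → ℝ} {g : E → E} {g' : E →L[ℝ] E} {x : E}
    (h1 : ∀ᶠ y in 𝓝 x, HasFDerivAt f (innerSL ℝ (g y)) y) (h2 : HasFDerivAt g g' x) :
    Laplacian.laplacian f x =
      ∑ i, inner ℝ (g' (stdOrthonormalBasis ℝ E i)) (stdOrthonormalBasis ℝ E i) := by
  rw [InnerProductSpace.laplacian_eq_iteratedFDeriv_stdOrthonormalBasis]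
  refine Finset.sum_congr rfl fun i _ => ?_
  rw [iteratedFDeriv_two_apply]
  have e : fderiv ℝ f =ᶠ[𝓝 x] fun y => innerSL ℝ (g y) := h1.mono fun y hy => hy.fderiv
  rw [e.fderiv_eq]
  have h3 : HasFDerivAt (fun y => innerSL ℝ (g y)) ((innerSL ℝ).comp g') x :=
    (innerSL ℝ).hasFDerivAt.comp x h2
  rw [h3.fderiv]
  simp

lemma hasFDerivAt_gradient {f : E → ℝ} {x : E} (h : ContDiffAt ℝ 2 f x) :
    HasFDerivAt (gradient f) (fderiv ℝ (gradient f) x) x := by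
  refine DifferentiableAt.hasFDerivAt ?_
  have h1 : DifferentiableAt ℝ (fderiv ℝ f) x :=
    (h.fderiv_right (m := 1) (by norm_num)).differentiableAt (by norm_num)
  exact ((InnerProductSpace.toDual ℝ E).symm.toContinuousLinearEquiv.differentiableAt).comp x h1

lemma laplacian_eq_sum_gradient {f : E → ℝ} {x : E} (h : ContDiffAt ℝ 2 f x) :
    Laplacian.laplacian f x =
      ∑ i, inner ℝ (fderiv ℝ (gradient f) x (stdOrthonormalBasis ℝ E i))
        (stdOrthonormalBasis ℝ E i) := by
  refine laplacian_eq_sum_of_hasFDerivAt ?_ (hasFDerivAt_gradient h)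
  filter_upwards [h.eventually (by simp)] with y hy
  exact hasFDerivAt_innerSL_gradient (hy.differentiableAt (by norm_num))

lemma gradient_mul {f g : E → ℝ} {x : E} (hf : DifferentiableAt ℝ f x)
    (hg : DifferentiableAt ℝ g x) :
    gradient (fun y => f y * g y) x = f x • gradient g x + g x • gradient f x := by
  refine gradient_eq_of_hasFDerivAt ?_
  refine ((hasFDerivAt_innerSL_gradient hf).mul (hasFDerivAt_innerSL_gradient hg)).congr_fderiv ?_
  ext w; simp

lemma laplacian_mul {f g : E → ℝ} {x : E} (hf : ContDiffAt ℝ 2 f x) (hg : ContDiffAt ℝ 2 g x) :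
    Laplacian.laplacian (fun y => f y * g y) x =
      f x * Laplacian.laplacian g x + 2 * inner ℝ (gradient f x) (gradient g x) +
        g x * Laplacian.laplacian f x := by
  have hfd := hasFDerivAt_innerSL_gradient (hf.differentiableAt (by norm_num))
  have hgd := hasFDerivAt_innerSL_gradient (hg.differentiableAt (by norm_num))
  have h1 : ∀ᶠ y in 𝓝 x, HasFDerivAt (fun y => f y * g y)
      (innerSL ℝ (f y • gradient g y + g y • gradient f y)) y := by
    filter_upwards [hf.eventually (by simp), hg.eventually (by simp)] with y hfy hgy
    refine ((hasFDerivAt_innerSL_gradient (hfy.differentiableAt (by norm_num))).mul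
      (hasFDerivAt_innerSL_gradient (hgy.differentiableAt (by norm_num)))).congr_fderiv ?_
    ext w; simp
  have h2 := (hfd.smul (hasFDerivAt_gradient hg)).add (hgd.smul (hasFDerivAt_gradient hf))
  rw [laplacian_eq_sum_of_hasFDerivAt h1 h2, laplacian_eq_sum_gradient hf,
    laplacian_eq_sum_gradient hg, Finset.mul_sum, Finset.mul_sum,
    ← (stdOrthonormalBasis ℝ E).sum_inner_mul_inner (gradient f x) (gradient g x),
    Finset.mul_sum, ← Finset.sum_add_distrib, ← Finset.sum_add_distrib]
  refine Finset.sum_congr rfl fun i _ => ?_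
  simp only [_root_.add_apply, _root_.smul_apply,
    ContinuousLinearMap.smulRight_apply, innerSL_apply_apply, inner_add_left,
    real_inner_smul_left]
  rw [real_inner_comm (gradient g x)]
  ring

lemma contDiffAt_heatKernel {a : ℝ} (ha : 0 < a) (x : E) :
    ContDiffAt ℝ ∞ (fun p : ℝ × E => heatKernel p.1 p.2) (a, x) := by
  unfold heatKernel
  have hpi := Real.pi_pos
  refine ContDiffAt.mul ?_ ?_
  · exact ContDiffAt.rpow_const_of_ne (by fun_prop) (by positivity)
  · refine ContDiffAt.exp (ContDiffAt.neg (ContDiffAt.div ?_ ?_ (by positivity)))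
    · exact (contDiff_norm_sq ℝ).contDiffAt.comp (a, x) contDiffAt_snd
    · fun_prop

lemma hasFDerivAt_heatKernel (a : ℝ) (x : E) :
    HasFDerivAt (fun y : E => heatKernel a y)
      (innerSL ℝ ((-(1 / (2 * a)) * heatKernel a x) • x)) x := by
  unfold heatKernel
  have h1 : HasFDerivAt (fun y : E => ‖y‖ ^ 2) (2 • innerSL ℝ x) x :=
    (hasStrictFDerivAt_norm_sq x).hasFDerivAt
  have h2 := (((h1.mul_const (4 * a)⁻¹).neg).exp).const_mul
    ((4 * Real.pi * a) ^ (-((Module.finrank ℝ E : ℝ) / 2)))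
  refine h2.congr_fderiv ?_
  ext w
  simp [div_eq_mul_inv]
  ring

lemma laplacian_heatKernel (a : ℝ) (x : E) :
    Laplacian.laplacian (fun y : E => heatKernel a y) x =
      (‖x‖ ^ 2 / (4 * a ^ 2) - Module.finrank ℝ E / (2 * a)) * heatKernel a x := by
  have h2 := ((hasFDerivAt_heatKernel a x).const_mul (-(1 / (2 * a)))).smul (hasFDerivAt_id x)
  rw [laplacian_eq_sum_of_hasFDerivAt (g := fun y => (-(1 / (2 * a)) * heatKernel a y) • y)
    (Eventually.of_forall fun y => hasFDerivAt_heatKernel a y) h2]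
  have e : ‖x‖ ^ 2 = ∑ i, inner ℝ x (stdOrthonormalBasis ℝ E i) *
      inner ℝ (stdOrthonormalBasis ℝ E i) x := by
    rw [(stdOrthonormalBasis ℝ E).sum_inner_mul_inner x x, real_inner_self_eq_norm_sq]
  have hc : (Module.finrank ℝ E : ℝ) = ∑ _i : Fin (Module.finrank ℝ E), (1 : ℝ) := by simp
  rw [e, hc, Finset.sum_div, Finset.sum_div, ← Finset.sum_sub_distrib, Finset.sum_mul]
  refine Finset.sum_congr rfl fun i _ => ?_
  have hi : inner ℝ (stdOrthonormalBasis ℝ E i) (stdOrthonormalBasis ℝ E i) = (1 : ℝ) := by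
    rw [real_inner_self_eq_norm_sq, (stdOrthonormalBasis ℝ E).orthonormal.1 i]; norm_num
  simp only [_root_.add_apply, _root_.smul_apply, innerSL_apply_apply,
    ContinuousLinearMap.smulRight_apply, inner_add_left, real_inner_smul_left, id_eq, hi,
    ContinuousLinearMap.id_apply, smul_eq_mul]
  rw [real_inner_comm x]
  ring

lemma hasDerivAt_heatKernel {a : ℝ} (ha : 0 < a) (x : E) :
    HasDerivAt (fun b : ℝ => heatKernel b x)
      ((‖x‖ ^ 2 / (4 * a ^ 2) - Module.finrank ℝ E / (2 * a)) * heatKernel a x) a := by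
  have hpi := Real.pi_pos
  unfold heatKernel
  have h1 : HasDerivAt (fun b : ℝ => 4 * Real.pi * b) (4 * Real.pi) a := by
    simpa using (hasDerivAt_id a).const_mul (4 * Real.pi)
  have h2 := h1.rpow_const (p := -((Module.finrank ℝ E : ℝ) / 2)) (Or.inl (by positivity))
  have h3 : HasDerivAt (fun b : ℝ => -(‖x‖ ^ 2 / (4 * b))) (‖x‖ ^ 2 / (4 * a ^ 2)) a := by
    have h4 : HasDerivAt (fun b : ℝ => 4 * b) 4 a := by
      simpa using (hasDerivAt_id a).const_mul (4 : ℝ)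
    have h5 := ((hasDerivAt_const a (‖x‖ ^ 2)).div h4 (by positivity)).neg
    refine h5.congr_deriv ?_
    field_simp
    ring
  refine (h2.mul h3.exp).congr_deriv ?_
  rw [Real.rpow_sub_one (by positivity)]
  field_simp
  ring

/-- The minus sign is that of the backward variable: as a function of the starting time the kernel
solves the backward heat equation. -/
lemma hasDerivAt_heatKernel_time {ν t τ : ℝ} (hν : 0 < ν) (h : τ < t) (x : E) :
    HasDerivAt (fun r : ℝ => heatKernel (ν * (t - r)) x)
      (-(ν * Laplacian.laplacian (fun y : E => heatKernel (ν * (t - τ)) y) x)) τ := by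
  have h1 : HasDerivAt (fun r : ℝ => ν * (t - r)) (ν * (-1)) τ := by
    simpa using ((hasDerivAt_id τ).const_sub t).const_mul ν
  have h2 := (hasDerivAt_heatKernel (E := E) (mul_pos hν (sub_pos.2 h)) x).comp τ h1
  rw [laplacian_heatKernel]
  refine h2.congr_deriv ?_
  ring

lemma hasFDerivAt_heatKernel_sub (a : ℝ) (x z : E) :
    HasFDerivAt (fun y : E => heatKernel a (x - y))
      (innerSL ℝ ((1 / (2 * a) * heatKernel a (x - z)) • (x - z))) z := by
  have h1 : HasFDerivAt (fun y : E => x - y) (-ContinuousLinearMap.id ℝ E) z :=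
    (hasFDerivAt_id z).const_sub x
  refine ((hasFDerivAt_heatKernel a (x - z)).comp z h1).congr_fderiv ?_
  ext w
  simp

lemma laplacian_heatKernel_sub (a : ℝ) (x z : E) :
    Laplacian.laplacian (fun y : E => heatKernel a (x - y)) z =
      Laplacian.laplacian (fun y : E => heatKernel a y) (x - z) := by
  have e : (fun y : E => heatKernel a (x - y)) = fun y => heatKernel a (y - x) := by
    ext y; simp only [heatKernel, norm_sub_rev]
  have e2 : heatKernel a (x - z) = heatKernel a (z - x) := congrFun e z
  rw [e, laplacian_heatKernel, norm_sub_rev, e2]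
  have h1 : ∀ y : E, HasFDerivAt (fun y : E => y - x) (ContinuousLinearMap.id ℝ E) y :=
    fun y => (hasFDerivAt_id y).sub_const x
  have hg : ∀ y : E, HasFDerivAt (fun y : E => heatKernel a (y - x))
      (innerSL ℝ ((-(1 / (2 * a)) * heatKernel a (y - x)) • (y - x))) y := by
    intro y
    refine ((hasFDerivAt_heatKernel a (y - x)).comp y (h1 y)).congr_fderiv ?_
    ext w; simp
  have h2 := ((hg z).const_mul (-(1 / (2 * a)))).smul (h1 z)
  have h3 := ((hasFDerivAt_heatKernel a (z - x)).const_mul (-(1 / (2 * a)))).smul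
    (hasFDerivAt_id (z - x))
  rw [← laplacian_heatKernel,
    laplacian_eq_sum_of_hasFDerivAt (g := fun y => (-(1 / (2 * a)) * heatKernel a (y - x)) • (y - x))
      (Eventually.of_forall hg) h2,
    laplacian_eq_sum_of_hasFDerivAt (g := fun y => (-(1 / (2 * a)) * heatKernel a y) • y)
      (Eventually.of_forall fun y => hasFDerivAt_heatKernel a y) h3]
  rfl

/-- Cutoff functions exhausting the space, with bounded derivatives. -/
lemma exists_cutoffs (E : Type*) [NormedAddCommGroup E] [InnerProductSpace ℝ E]
    [FiniteDimensional ℝ E] : ∃ (χ : ℕ → E → ℝ) (C : ℝ), 0 ≤ C ∧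
    (∀ k, ContDiff ℝ ∞ (χ k)) ∧ (∀ k, HasCompactSupport (χ k)) ∧
    (∀ k x, |χ k x| ≤ 1) ∧ (∀ k x, ‖gradient (χ k) x‖ ≤ C) ∧
    (∀ k x, |Laplacian.laplacian (χ k) x| ≤ C) ∧
    ∀ x, ∀ᶠ k in atTop, χ k x = 1 ∧ gradient (χ k) x = 0 ∧ Laplacian.laplacian (χ k) x = 0 := by
  let θ : ContDiffBump (0 : E) := ⟨1, 2, by norm_num, by norm_num⟩
  -- The cutoffs are dilations `θ(c_k x)` of one bump function with `c_k ≤ 1`, so all derivatives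
  -- are bounded by those of `θ`. Dominated convergence uses only this and that each point
  -- eventually sees a constant.
  let c : ℕ → ℝ := fun k => ((k : ℝ) + 1)⁻¹
  have hc0 : ∀ k, 0 < c k := fun k => by simp only [c]; positivity
  have hc1 : ∀ k, c k ≤ 1 := fun k => by
    simp only [c]; exact inv_le_one_of_one_le₀ (by linarith [Nat.cast_nonneg (α := ℝ) k])
  have hθ : ContDiff ℝ ∞ (θ : E → ℝ) := θ.contDiff
  have hgc : Continuous (gradient (θ : E → ℝ)) :=
    (InnerProductSpace.toDual ℝ E).symm.continuous.comp (hθ.continuous_fderiv (by simp))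
  have hgs : HasCompactSupport (gradient (θ : E → ℝ)) :=
    (θ.hasCompactSupport.fderiv ℝ).comp_left (g := (InnerProductSpace.toDual ℝ E).symm) (by simp)
  have hgd : ContDiff ℝ 1 (gradient (θ : E → ℝ)) :=
    (InnerProductSpace.toDual ℝ E).symm.toContinuousLinearEquiv.contDiff.comp
      ((contDiff_infty.1 hθ 2).fderiv_right (m := 1) (by norm_num))
  have hlc : Continuous (fderiv ℝ (gradient (θ : E → ℝ))) := hgd.continuous_fderiv (by norm_num)
  obtain ⟨C₁, hC₁⟩ := hgc.bounded_above_of_compact_support hgs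
  obtain ⟨C₂, hC₂⟩ := hlc.bounded_above_of_compact_support (hgs.fderiv ℝ)
  have hC₁0 : 0 ≤ C₁ := (norm_nonneg _).trans (hC₁ 0)
  have hC₂0 : 0 ≤ C₂ := (norm_nonneg _).trans (hC₂ 0)
  have hs : ∀ k (x : E), HasFDerivAt (fun y : E => c k • y) (c k • ContinuousLinearMap.id ℝ E) x :=
    fun k x => (hasFDerivAt_id x).const_smul (c k)
  have hgr : ∀ k (x : E), HasFDerivAt (fun y => θ (c k • y))
      (innerSL ℝ (c k • gradient (θ : E → ℝ) (c k • x))) x := by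
    intro k x
    refine ((hasFDerivAt_innerSL_gradient (hθ.differentiable (by simp) (c k • x))).comp x
      (hs k x)).congr_fderiv ?_
    ext w
    simp
  have hlap : ∀ k (x : E), Laplacian.laplacian (fun y => θ (c k • y)) x =
      ∑ i, inner ℝ ((c k • (fderiv ℝ (gradient (θ : E → ℝ)) (c k • x)).comp
        (c k • ContinuousLinearMap.id ℝ E)) (stdOrthonormalBasis ℝ E i))
        (stdOrthonormalBasis ℝ E i) := by
    intro k x
    have h2 := ((hgd.differentiable (by norm_num) (c k • x)).hasFDerivAt.comp x
      (hs k x)).const_smul (c k)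
    exact laplacian_eq_sum_of_hasFDerivAt
      (g := fun y => c k • gradient (θ : E → ℝ) (c k • y))
      (Eventually.of_forall fun y => hgr k y) h2
  refine ⟨fun k x => θ (c k • x), max C₁ (Module.finrank ℝ E * C₂), by positivity, ?_, ?_, ?_, ?_,
    ?_, ?_⟩
  · exact fun k => hθ.comp (contDiff_const_smul _)
  · intro k
    exact θ.hasCompactSupport.comp_smul (hc0 k).ne'
  · intro k x
    rw [abs_of_nonneg θ.nonneg]; exact θ.le_one
  · intro k x
    rw [gradient_eq_of_hasFDerivAt (hgr k x), norm_smul, Real.norm_of_nonneg (hc0 k).le]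
    refine le_trans ?_ (le_max_left _ _)
    calc c k * ‖gradient (θ : E → ℝ) (c k • x)‖ ≤ 1 * C₁ := by
          gcongr
          · exact hc1 k
          · exact hC₁ _
      _ = C₁ := one_mul _
  · intro k x
    rw [hlap]
    refine le_trans ?_ (le_max_right _ _)
    refine (Finset.abs_sum_le_sum_abs _ _).trans ?_
    have hb : ∀ i ∈ (Finset.univ : Finset (Fin (Module.finrank ℝ E))),
        |inner ℝ ((c k • (fderiv ℝ (gradient (θ : E → ℝ)) (c k • x)).comp
          (c k • ContinuousLinearMap.id ℝ E)) (stdOrthonormalBasis ℝ E i))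
          (stdOrthonormalBasis ℝ E i)| ≤ C₂ := by
      intro i _
      refine (abs_real_inner_le_norm _ _).trans ?_
      rw [(stdOrthonormalBasis ℝ E).orthonormal.1 i, mul_one]
      refine (ContinuousLinearMap.le_opNorm _ _).trans ?_
      rw [(stdOrthonormalBasis ℝ E).orthonormal.1 i, mul_one, norm_smul,
        Real.norm_of_nonneg (hc0 k).le]
      calc c k * ‖(fderiv ℝ (gradient (θ : E → ℝ)) (c k • x)).comp
            (c k • ContinuousLinearMap.id ℝ E)‖ ≤ 1 * (C₂ * 1) := by
            refine mul_le_mul (hc1 k) ?_ (norm_nonneg _) zero_le_one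
            refine (ContinuousLinearMap.opNorm_comp_le _ _).trans ?_
            refine mul_le_mul (hC₂ _) ?_ (norm_nonneg _) hC₂0
            rw [norm_smul, Real.norm_of_nonneg (hc0 k).le]
            calc c k * ‖ContinuousLinearMap.id ℝ E‖ ≤ 1 * 1 :=
                  mul_le_mul (hc1 k) ContinuousLinearMap.norm_id_le (norm_nonneg _) zero_le_one
              _ = 1 := one_mul _
        _ = C₂ := by ring
    refine (Finset.sum_le_sum hb).trans ?_
    simp
  · intro x
    obtain ⟨N, hN⟩ := exists_nat_gt ‖x‖
    filter_upwards [eventually_ge_atTop N] with k hk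
    have hk' : ‖x‖ < (k : ℝ) + 1 := by
      have : (N : ℝ) ≤ k := by exact_mod_cast hk
      linarith
    have hev : (fun y => θ (c k • y)) =ᶠ[𝓝 x] fun _ => (1 : ℝ) := by
      have : ∀ᶠ y in 𝓝 x, ‖y‖ < (k : ℝ) + 1 := continuous_norm.continuousAt.eventually_lt
        continuousAt_const hk'
      filter_upwards [this] with y hy
      apply θ.one_of_mem_closedBall
      rw [mem_closedBall_zero_iff, norm_smul, Real.norm_of_nonneg (hc0 k).le]
      simp only [c]
      rw [inv_mul_le_iff₀ (by positivity)]
      simp only [θ]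
      linarith
    refine ⟨hev.eq_of_nhds, ?_, ?_⟩
    · refine gradient_eq_of_hasFDerivAt ?_
      simpa using (hasFDerivAt_const (1 : ℝ) x).congr_of_eventuallyEq hev
    · rw [InnerProductSpace.laplacian_congr_nhds hev |>.eq_of_nhds]
      simp

end Calculus

end AdvectionDiffusion

namespace AdvectionDiffusion

/-! ### From distributional to integral solutions: testing with the heat kernel -/

section WeakToMild

variable {E : Type*} [NormedAddCommGroup E] [InnerProductSpace ℝ E] [FiniteDimensional ℝ E]
  [MeasurableSpace E] [BorelSpace E]
  {ν M : ℝ} {m v : ℝ → ℝ} {U : E → ℝ → E} {V : E → ℝ → ℝ}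

/-- The formal adjoint operator, on a general Euclidean space. -/
noncomputable def adjOp (ν : ℝ) (U : E → ℝ → E) (V : E → ℝ → ℝ) (φ : E × ℝ → ℝ) (p : E × ℝ) : ℝ :=
  deriv (fun τ => φ (p.1, τ)) p.2
    + inner ℝ (U p.1 p.2) (gradient (fun z => φ (z, p.2)) p.1)
    + V p.1 p.2 * φ p
    + ν * Laplacian.laplacian (fun z => φ (z, p.2)) p.1

/-- The heat kernel ending at `(x, t)`, localized in time. -/
noncomputable def backKernel (ν : ℝ) (η : ℝ → ℝ) (x : E) (t : ℝ) (p : E × ℝ) : ℝ :=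
  η p.2 * heatKernel (ν * (t - p.2)) (x - p.1)

lemma contDiff_backKernel (hν : 0 < ν) {η : ℝ → ℝ} (hη : ContDiff ℝ ∞ η) {t : ℝ}
    (hsupp : tsupport η ⊆ Iio t) (x : E) : ContDiff ℝ ∞ (backKernel ν η x t) := by
  rw [contDiff_iff_contDiffAt]
  intro p
  by_cases hp : p.2 < t
  · have h1 : ContDiffAt ℝ ∞ (fun q : E × ℝ => ((ν * (t - q.2)), x - q.1)) p := by fun_prop
    have h2 := (contDiffAt_heatKernel (mul_pos hν (sub_pos.2 hp)) (x - p.1)).comp p h1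
    exact (hη.contDiffAt.comp p contDiffAt_snd).mul h2
  · have hn : p.2 ∉ tsupport η := fun h => hp (hsupp h)
    have hev : ∀ᶠ q : E × ℝ in 𝓝 p, η q.2 = 0 := by
      have := (notMem_tsupport_iff_eventuallyEq.1 hn)
      exact continuous_snd.continuousAt.eventually this
    refine (contDiffAt_const (c := (0 : ℝ))).congr_of_eventuallyEq ?_
    filter_upwards [hev] with q hq
    simp [backKernel, hq]

/-- The backward heat equation cancels the time derivative of the kernel against `ν` times its
Laplacian. There remain `η'G`, the Duhamel kernel (which is `VG + U·∇G`), and terms carrying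
derivatives of the cutoff, which disappear in the limit. -/
lemma adjOp_cutoff (hν : 0 < ν) {χ : E → ℝ} (hχ : ContDiff ℝ ∞ χ) {η : ℝ → ℝ}
    (hη : ContDiff ℝ ∞ η) (x : E) {t : ℝ} {p : E × ℝ} (hp : p.2 < t) :
    adjOp ν U V (fun q => χ q.1 * backKernel ν η x t q) p =
      χ p.1 * (deriv η p.2 * heatKernel (ν * (t - p.2)) (x - p.1) +
        η p.2 * duhamelKernel ν U V x t p.1 p.2) +
      inner ℝ (gradient χ p.1) (η p.2 • (heatKernel (ν * (t - p.2)) (x - p.1) • U p.1 p.2 +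
        (2 * ν * (1 / (2 * (ν * (t - p.2))) * heatKernel (ν * (t - p.2)) (x - p.1))) •
          (x - p.1))) +
      Laplacian.laplacian χ p.1 * (ν * η p.2 * heatKernel (ν * (t - p.2)) (x - p.1)) := by
  obtain ⟨z, τ⟩ := p
  simp only at hp
  have ha : 0 < ν * (t - τ) := mul_pos hν (sub_pos.2 hp)
  have hχd : DifferentiableAt ℝ χ z := hχ.differentiable (by simp) z
  have hχ2 : ContDiffAt ℝ 2 χ z := (contDiff_infty.1 hχ 2).contDiffAt
  have hGd := hasFDerivAt_heatKernel_sub (ν * (t - τ)) x z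
  have hG2 : ContDiffAt ℝ 2 (fun y : E => heatKernel (ν * (t - τ)) (x - y)) z := by
    have h1 : ContDiffAt ℝ 2 (fun y : E => ((ν * (t - τ)), x - y)) z := by fun_prop
    have h2 : ContDiffAt ℝ 2 (fun p : ℝ × E => heatKernel p.1 p.2) (ν * (t - τ), x - z) :=
      contDiffAt_infty.1 (contDiffAt_heatKernel ha (x - z)) 2
    exact ContDiffAt.comp (g := fun p : ℝ × E => heatKernel p.1 p.2) z h2 h1
  -- time derivative
  have d1 : deriv (fun r => χ z * backKernel ν η x t (z, r)) τ =
      χ z * (deriv η τ * heatKernel (ν * (t - τ)) (x - z) + η τ *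
        -(ν * Laplacian.laplacian (fun y : E => heatKernel (ν * (t - τ)) y) (x - z))) := by
    have := (((hη.differentiable (by simp) τ).hasDerivAt.mul
      (hasDerivAt_heatKernel_time hν hp (x - z))).const_mul (χ z))
    exact this.deriv
  -- space derivatives
  have e : (fun y => χ y * backKernel ν η x t (y, τ)) =
      η τ • fun y => χ y * heatKernel (ν * (t - τ)) (x - y) := by
    ext y; simp [backKernel]; ring
  have d2 : gradient (fun y => χ y * backKernel ν η x t (y, τ)) z =
      η τ • (χ z • ((1 / (2 * (ν * (t - τ))) * heatKernel (ν * (t - τ)) (x - z)) • (x - z)) +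
        heatKernel (ν * (t - τ)) (x - z) • gradient χ z) := by
    refine gradient_eq_of_hasFDerivAt ?_
    rw [e]
    have h1 := hasFDerivAt_innerSL_gradient (hχd.mul hGd.differentiableAt)
    have h2 := gradient_mul hχd hGd.differentiableAt
    rw [gradient_eq_of_hasFDerivAt hGd] at h2
    change HasFDerivAt (fun y => χ y * heatKernel (ν * (t - τ)) (x - y))
      (innerSL ℝ (gradient (fun y => χ y * heatKernel (ν * (t - τ)) (x - y)) z)) z at h1
    rw [h2] at h1
    refine (h1.const_smul (η τ)).congr_fderiv ?_
    rw [map_smul]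
  have d3 : Laplacian.laplacian (fun y => χ y * backKernel ν η x t (y, τ)) z =
      η τ * (χ z * Laplacian.laplacian (fun y : E => heatKernel (ν * (t - τ)) y) (x - z) +
        2 * inner ℝ (gradient χ z)
          ((1 / (2 * (ν * (t - τ))) * heatKernel (ν * (t - τ)) (x - z)) • (x - z)) +
        heatKernel (ν * (t - τ)) (x - z) * Laplacian.laplacian χ z) := by
    rw [e, InnerProductSpace.laplacian_smul (η τ) (hχ2.mul hG2), laplacian_mul hχ2 hG2,
      gradient_eq_of_hasFDerivAt hGd, laplacian_heatKernel_sub, smul_eq_mul]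
  simp only [adjOp]
  rw [d1, d2, d3]
  simp only [backKernel, duhamelKernel, inner_add_right, real_inner_smul_right]
  rw [real_inner_comm (x - z) (U z τ), real_inner_comm (gradient χ z) (U z τ)]
  ring

lemma adjOp_eq_zero {φ : E × ℝ → ℝ} {p : E × ℝ} (h : ∀ᶠ q in 𝓝 p, φ q = 0) :
    adjOp ν U V φ p = 0 := by
  have h1 : (fun τ => φ (p.1, τ)) =ᶠ[𝓝 p.2] fun _ => (0 : ℝ) :=
    ((Continuous.prodMk_right p.1).tendsto p.2).eventually (p := fun q => φ q = 0) h
  have h2 : (fun z => φ (z, p.2)) =ᶠ[𝓝 p.1] fun _ => (0 : ℝ) :=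
    ((Continuous.prodMk_left p.2).tendsto p.1).eventually (p := fun q => φ q = 0) h
  have h3 : gradient (fun z => φ (z, p.2)) p.1 = 0 := by
    refine gradient_eq_of_hasFDerivAt ?_
    simpa using (hasFDerivAt_const (0 : ℝ) p.1).congr_of_eventuallyEq h2
  unfold adjOp
  rw [h1.deriv_eq, (InnerProductSpace.laplacian_congr_nhds h2).eq_of_nhds, h3, h.self_of_nhds]
  simp

/-- Testing a distributional solution with a time-localized heat kernel. -/
lemma Coeff.weak_backKernel (h : Coeff ν M m v U V) {J : Set ℝ} {f : E → ℝ → ℝ}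
    (hf : ContinuousOn (fun p : E × ℝ => f p.1 p.2) (univ ×ˢ J))
    (hweak : ∀ φ : E × ℝ → ℝ, ContDiff ℝ ∞ φ → HasCompactSupport φ → tsupport φ ⊆ univ ×ˢ J →
      ∫ p : E × ℝ, f p.1 p.2 * adjOp ν U V φ p = 0)
    {a b t A B : ℝ} (hab : Icc a b ⊆ J) (hbt : b < t)
    (hgrow : ∀ τ ∈ Icc a b, ∀ x, |f x τ| ≤ A * Real.exp (B * ‖x‖))
    {η : ℝ → ℝ} (hη : ContDiff ℝ ∞ η) (hsupp : tsupport η ⊆ Ioo a b) (x : E) :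
    ∫ p : E × ℝ in univ ×ˢ Ioo a b, f p.1 p.2 * (deriv η p.2 *
      heatKernel (ν * (t - p.2)) (x - p.1) + η p.2 * duhamelKernel ν U V x t p.1 p.2) = 0 := by
  have hν := h.ν_pos
  have hgf := gaussFactor_pos (E := E)
  have hM := h.M_nonneg
  obtain ⟨χ, C, hC, hχ, hχs, hχ1, hχg, hχl, hχe⟩ := exists_cutoffs E
  have hηc : HasCompactSupport η :=
    HasCompactSupport.of_support_subset_isCompact isCompact_Icc
      ((subset_tsupport η).trans (hsupp.trans Ioo_subset_Icc_self))
  obtain ⟨C₁, hC₁⟩ := hη.continuous.bounded_above_of_compact_support hηc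
  obtain ⟨C₂, hC₂⟩ := (hη.continuous_deriv (by simp)).bounded_above_of_compact_support hηc.deriv
  have hC₁0 : 0 ≤ C₁ := (norm_nonneg _).trans (hC₁ 0)
  have hC₂0 : 0 ≤ C₂ := (norm_nonneg _).trans (hC₂ 0)
  have hsuppt : tsupport η ⊆ Iio t := fun τ hτ => (hsupp hτ).2.trans hbt
  set S : Set (E × ℝ) := univ ×ˢ Ioo a b with hS
  set Φ : ℕ → E × ℝ → ℝ := fun k q => χ k q.1 * backKernel ν η x t q with hΦ
  have hΦsub : ∀ k, tsupport (Φ k) ⊆ (tsupport (χ k)) ×ˢ (tsupport η) := by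
    intro k
    refine closure_minimal (fun q hq => ?_) ((isClosed_tsupport _).prod (isClosed_tsupport _))
    rw [Function.mem_support] at hq
    refine ⟨subset_tsupport _ ?_, subset_tsupport _ ?_⟩
    · rw [Function.mem_support]; exact left_ne_zero_of_mul hq
    · rw [Function.mem_support]
      exact left_ne_zero_of_mul (right_ne_zero_of_mul hq)
  have hΦ0 : ∀ k, ∫ p in S, f p.1 p.2 * adjOp ν U V (Φ k) p = 0 := by
    intro k
    rw [← hweak (Φ k) ((hχ k).comp contDiff_fst |>.mul (contDiff_backKernel hν hη hsuppt x)) ?_ ?_]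
    · refine setIntegral_eq_integral_of_forall_compl_eq_zero fun p hp => ?_
      rw [adjOp_eq_zero, mul_zero]
      have : p ∉ tsupport (Φ k) := fun hh => hp ⟨trivial, hsupp (hΦsub k hh).2⟩
      exact notMem_tsupport_iff_eventuallyEq.1 this
    · exact HasCompactSupport.of_support_subset_isCompact ((hχs k).isCompact.prod hηc.isCompact)
        ((subset_tsupport _).trans (hΦsub k))
    · exact (hΦsub k).trans fun q hq => ⟨trivial, hab (Ioo_subset_Icc_self (hsupp hq.2))⟩
  -- Since `b < t`, the kernel stays at distance `α` from its singularity; this controls the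
  -- gradient that is paired with `∇χ`. The constant `D` collects all the other contributions to the
  -- majorant.
  set α := ν * (t - b) with hα
  have hα0 : 0 < α := mul_pos hν (sub_pos.2 hbt)
  set D := C₂ * gaussFactor E + C₁ + C * (C₁ * (gaussFactor E * M +
    2 * ν * (gaussFactor E * (1 / Real.sqrt α)))) + C * (ν * C₁ * gaussFactor E) with hD
  have hD0 : 0 ≤ D := by positivity
  have hA0 : ∀ τ ∈ Ioo a b, 0 ≤ A := fun τ hτ => nonneg_of_mul_nonneg_left
    ((abs_nonneg _).trans (hgrow τ (Ioo_subset_Icc_self hτ) 0)) (Real.exp_pos _)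
  let maj : E × ℝ → ℝ := fun p => (|A| * D * (1 + rate (gaussFactor E) ν M v t p.2)) *
    (heatKernel (2 * (ν * (t - p.2))) (x - p.1) * Real.exp (B * ‖p.1‖))
  have hrate : IntegrableOn (rate (gaussFactor E) ν M v t) (Ioo a b) :=
    (integrableOn_rate hν h.v_int a t).mono_set (Ioo_subset_Ioo_right hbt.le)
  have hg : IntegrableOn (fun τ => |A| * D * (1 + rate (gaussFactor E) ν M v t τ)) (Ioo a b) :=
    ((integrableOn_const (by simp)).add hrate).const_mul _
  have hGpos : ∀ τ ∈ Ioo a b, 0 < ν * (t - τ) := fun τ hτ => by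
    have : 0 < t - τ := by linarith [hτ.2]
    positivity
  have hmaj : IntegrableOn maj S := by
    refine (strip_bound (f := maj) (k := fun z τ => heatKernel (2 * (ν * (t - τ))) (x - z) *
      Real.exp (B * ‖z‖)) (R := gaussFactor E * Real.exp (4 * ν * (t - a) * B ^ 2) *
        Real.exp (B * ‖x‖)) ?_ hg ?_ ?_ ?_).1
    · refine AEStronglyMeasurable.mul ?_ (Measurable.aestronglyMeasurable ?_)
      · rw [restrict_strip]; exact hg.1.comp_snd
      · exact (Measurable.heatKernel (by fun_prop) (by fun_prop)).mul (by fun_prop)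
    · intro τ hτ
      have := h.rate_nonneg t τ
      positivity
    · intro τ hτ
      have h0 : 0 < 2 * (ν * (t - τ)) := by have := hGpos τ hτ; positivity
      refine ⟨integrable_heatKernel_sub_mul_exp h0 B x,
        (integral_heatKernel_sub_mul_exp_le h0 B x).trans ?_⟩
      have : 2 * (2 * (ν * (t - τ))) * B ^ 2 ≤ 4 * ν * (t - a) * B ^ 2 := by
        have : ν * (t - τ) ≤ ν * (t - a) := by gcongr; exact hτ.1.le
        nlinarith [mul_le_mul_of_nonneg_right this (sq_nonneg B)]
      gcongr
    · intro z τ hτ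
      have h0 : 0 < 2 * (ν * (t - τ)) := by have := hGpos τ hτ; positivity
      have := h.rate_nonneg t τ
      have h2 := heatKernel_pos h0 (x - z)
      refine (abs_of_nonneg ?_).le
      simp only [maj]
      positivity
  have hfm : AEStronglyMeasurable (fun p : E × ℝ => f p.1 p.2) (volume.restrict S) :=
    (hf.mono (prod_mono le_rfl (Ioo_subset_Icc_self.trans hab))).aestronglyMeasurable
      (measurableSet_strip a b)
  have hmt : ∀ k, Measurable (gradient (χ k)) := fun k =>
    ((InnerProductSpace.toDual ℝ E).symm.continuous.comp
      ((hχ k).continuous_fderiv (by simp))).measurable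
  have hml : ∀ k, Measurable (Laplacian.laplacian (χ k)) := by
    intro k
    have : Laplacian.laplacian (χ k) = fun z => ∑ i, iteratedFDeriv ℝ 2 (χ k) z
        ![stdOrthonormalBasis ℝ E i, stdOrthonormalBasis ℝ E i] := by
      rw [InnerProductSpace.laplacian_eq_iteratedFDeriv_stdOrthonormalBasis]
    rw [this]
    have hc := (contDiff_infty.1 (hχ k) 2).continuous_iteratedFDeriv (m := 2) le_rfl
    have : Continuous fun z => ∑ i, iteratedFDeriv ℝ 2 (χ k) z
        ![stdOrthonormalBasis ℝ E i, stdOrthonormalBasis ℝ E i] := by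
      refine continuous_finsetSum _ fun i _ => ?_
      exact (ContinuousMultilinearMap.apply ℝ (fun _ : Fin 2 => E) ℝ
        ![stdOrthonormalBasis ℝ E i, stdOrthonormalBasis ℝ E i]).continuous.comp hc
    exact this.measurable
  have hlim : Tendsto (fun k => ∫ p in S, f p.1 p.2 * adjOp ν U V (Φ k) p) atTop
      (𝓝 (∫ p in S, f p.1 p.2 * (deriv η p.2 *
        heatKernel (ν * (t - p.2)) (x - p.1) + η p.2 * duhamelKernel ν U V x t p.1 p.2))) := by
    refine tendsto_integral_of_dominated_convergence maj ?_ hmaj ?_ ?_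
    · intro k
      refine hfm.mul ?_
      have hmeas : Measurable fun p : E × ℝ => χ k p.1 * (deriv η p.2 *
          heatKernel (ν * (t - p.2)) (x - p.1) + η p.2 * duhamelKernel ν U V x t p.1 p.2) +
          inner ℝ (gradient (χ k) p.1) (η p.2 • (heatKernel (ν * (t - p.2)) (x - p.1) • U p.1 p.2 +
          (2 * ν * (1 / (2 * (ν * (t - p.2))) * heatKernel (ν * (t - p.2)) (x - p.1))) •
            (x - p.1))) +
          Laplacian.laplacian (χ k) p.1 * (ν * η p.2 * heatKernel (ν * (t - p.2)) (x - p.1)) := by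
        have m1 : Measurable fun p : E × ℝ => heatKernel (ν * (t - p.2)) (x - p.1) :=
          Measurable.heatKernel (by fun_prop) (by fun_prop)
        have m2 : Measurable fun p : E × ℝ => η p.2 := hη.continuous.measurable.comp measurable_snd
        have m3 : Measurable fun p : E × ℝ => deriv η p.2 :=
          (measurable_deriv η).comp measurable_snd
        have m4 : Measurable fun p : E × ℝ => χ k p.1 :=
          (hχ k).continuous.measurable.comp measurable_fst
        have m5 : Measurable fun p : E × ℝ => gradient (χ k) p.1 := (hmt k).comp measurable_fst
        have m6 : Measurable fun p : E × ℝ => Laplacian.laplacian (χ k) p.1 :=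
          (hml k).comp measurable_fst
        have m7 : Measurable fun p : E × ℝ => duhamelKernel ν U V x t p.1 p.2 :=
          h.measurable_duhamelKernel measurable_const measurable_fst measurable_const measurable_snd
        have m8 := h.measU
        refine ((m4.mul ((m3.mul m1).add (m2.mul m7))).add (m5.inner (m2.smul
          ((m1.smul m8).add (Measurable.smul ?_ (by fun_prop)))))).add
          (m6.mul ((m2.const_mul ν).mul m1))
        exact (Measurable.mul (by fun_prop) m1).const_mul _
      refine hmeas.aestronglyMeasurable.congr ?_
      filter_upwards [ae_restrict_mem (measurableSet_strip (E := E) a b)] with p hp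
      exact (adjOp_cutoff hν (hχ k) hη x (hp.2.2.trans hbt)).symm
    · intro k
      filter_upwards [ae_restrict_mem (measurableSet_strip (E := E) a b)] with p hp
      obtain ⟨z, τ⟩ := p
      have hτ : τ ∈ Ioo a b := hp.2
      have hτt : τ < t := hτ.2.trans hbt
      have h0 := hGpos τ hτ
      simp only [maj]
      rw [hΦ, adjOp_cutoff hν (hχ k) hη x hτt]
      simp only
      set G := heatKernel (ν * (t - τ)) (x - z) with hG
      set G₂ := heatKernel (2 * (ν * (t - τ))) (x - z) with hG₂
      have hGp : 0 < G := heatKernel_pos h0 _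
      have hG₂p : 0 < G₂ := heatKernel_pos (by positivity) _
      have hr := h.rate_nonneg t τ
      have b1 : |χ k z * (deriv η τ * G + η τ * duhamelKernel ν U V x t z τ)| ≤
          (C₂ * gaussFactor E + C₁ * rate (gaussFactor E) ν M v t τ) * G₂ := by
        rw [abs_mul]
        refine (mul_le_mul_of_nonneg_right (hχ1 k z) (abs_nonneg _)).trans ?_
        rw [one_mul]
        refine (abs_add_le _ _).trans ?_
        rw [abs_mul, abs_mul, abs_of_pos hGp, add_mul, mul_assoc, mul_assoc]
        refine add_le_add (mul_le_mul (hC₂ τ) (heatKernel_le_two_mul h0 _) hGp.le hC₂0)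
          (mul_le_mul (hC₁ τ) (h.abs_duhamelKernel_le x z hτt) (abs_nonneg _) hC₁0)
      have b2 : |inner ℝ (gradient (χ k) z) (η τ • (G • U z τ +
          (2 * ν * (1 / (2 * (ν * (t - τ))) * G)) • (x - z)))| ≤
          C * (C₁ * (gaussFactor E * M + 2 * ν * (gaussFactor E * (1 / Real.sqrt α)))) * G₂ := by
        refine (abs_real_inner_le_norm _ _).trans ?_
        rw [mul_assoc C]
        refine mul_le_mul (hχg k z) ?_ (norm_nonneg _) hC
        rw [norm_smul, mul_assoc C₁]
        refine mul_le_mul (hC₁ τ) ?_ (norm_nonneg _) hC₁0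
        refine (norm_add_le _ _).trans ?_
        rw [norm_smul, norm_smul, Real.norm_of_nonneg hGp.le, add_mul]
        refine add_le_add ?_ ?_
        · calc G * ‖U z τ‖ ≤ (gaussFactor E * G₂) * M :=
                mul_le_mul (heatKernel_le_two_mul h0 _) (h.U_le' z τ) (norm_nonneg _)
                  (by positivity)
            _ = _ := by ring
        · rw [Real.norm_of_nonneg (by positivity)]
          have h3 := norm_mul_heatKernel_le h0 (x - z)
          have h4 : 1 / Real.sqrt (ν * (t - τ)) ≤ 1 / Real.sqrt α := by
            have : α ≤ ν * (t - τ) := by rw [hα]; gcongr; exact hτ.2.le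
            have := Real.sqrt_pos.2 hα0
            gcongr
          calc 2 * ν * (1 / (2 * (ν * (t - τ))) * G) * ‖x - z‖
              = 2 * ν * (‖x - z‖ / (2 * (ν * (t - τ))) * G) := by ring
            _ ≤ 2 * ν * (gaussFactor E * (1 / Real.sqrt (ν * (t - τ))) * G₂) := by gcongr
            _ ≤ 2 * ν * (gaussFactor E * (1 / Real.sqrt α) * G₂) := by gcongr
            _ = _ := by ring
      have b3 : |Laplacian.laplacian (χ k) z * (ν * η τ * G)| ≤
          C * (ν * C₁ * gaussFactor E) * G₂ := by
        rw [abs_mul, mul_assoc C]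
        refine mul_le_mul (hχl k z) ?_ (abs_nonneg _) hC
        rw [abs_mul, abs_mul, abs_of_pos hν, abs_of_pos hGp]
        calc ν * |η τ| * G ≤ ν * C₁ * (gaussFactor E * G₂) := by
              have := hC₁ τ
              rw [Real.norm_eq_abs] at this
              gcongr
              exact heatKernel_le_two_mul h0 _
          _ = _ := by ring
      rw [norm_mul, Real.norm_eq_abs, Real.norm_eq_abs]
      have hA0' := hA0 τ hτ
      have b4 := hgrow τ (Ioo_subset_Icc_self hτ) z
      have b5 := (abs_add_le _ _).trans (add_le_add ((abs_add_le _ _).trans (add_le_add b1 b2)) b3)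
      refine (mul_le_mul b4 b5 (abs_nonneg _) (by positivity)).trans ?_
      rw [abs_of_nonneg hA0']
      have b6 : (C₂ * gaussFactor E + C₁ * rate (gaussFactor E) ν M v t τ) * G₂ +
          C * (C₁ * (gaussFactor E * M + 2 * ν * (gaussFactor E * (1 / Real.sqrt α)))) * G₂ +
          C * (ν * C₁ * gaussFactor E) * G₂ ≤
          D * (1 + rate (gaussFactor E) ν M v t τ) * G₂ := by
        rw [← add_mul, ← add_mul]
        refine mul_le_mul_of_nonneg_right ?_ hG₂p.le
        have i1 : C₁ ≤ D := by
          rw [hD]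
          have : 0 ≤ C₂ * gaussFactor E + C * (C₁ * (gaussFactor E * M +
            2 * ν * (gaussFactor E * (1 / Real.sqrt α)))) + C * (ν * C₁ * gaussFactor E) := by
            positivity
          linarith
        have i2 := mul_le_mul_of_nonneg_right i1 hr
        have i4 : D * (1 + rate (gaussFactor E) ν M v t τ) = D + D * rate (gaussFactor E) ν M v t τ := by
          ring
        have i3 : C₂ * gaussFactor E + C * (C₁ * (gaussFactor E * M +
            2 * ν * (gaussFactor E * (1 / Real.sqrt α)))) + C * (ν * C₁ * gaussFactor E) ≤ D := by
          rw [hD]; linarith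
        linarith
      calc _ ≤ A * Real.exp (B * ‖z‖) * (D * (1 + rate (gaussFactor E) ν M v t τ) * G₂) := by
            gcongr
        _ = _ := by ring
    -- At a fixed point the sequence is eventually constant, because the cutoff has value one and
    -- vanishing derivatives there.
    · filter_upwards [ae_restrict_mem (measurableSet_strip (E := E) a b)] with p hp
      refine tendsto_const_nhds.congr' ?_
      filter_upwards [hχe p.1] with k hk
      rw [hΦ, adjOp_cutoff hν (hχ k) hη x (hp.2.2.trans hbt), hk.1, hk.2.1, hk.2.2]
      simp
  simp_rw [hΦ0] at hlim
  exact (tendsto_nhds_unique hlim tendsto_const_nhds)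

end WeakToMild

end AdvectionDiffusion

namespace AdvectionDiffusion

/-! ### Distributional derivatives in time -/

section SmoothStep

/-- A smooth approximation of the Heaviside function at `s`, of width `δ`. -/
noncomputable def smoothStep (s δ τ : ℝ) : ℝ := Real.smoothTransition ((τ - s) / δ)

lemma contDiff_smoothStep (s δ : ℝ) : ContDiff ℝ ∞ (smoothStep s δ) :=
  Real.smoothTransition.contDiff.comp (by fun_prop)

lemma smoothStep_of_le {s δ τ : ℝ} (hδ : 0 < δ) (h : τ ≤ s) : smoothStep s δ τ = 0 :=
  Real.smoothTransition.zero_of_nonpos (div_nonpos_of_nonpos_of_nonneg (by linarith) hδ.le)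

lemma smoothStep_of_ge {s δ τ : ℝ} (hδ : 0 < δ) (h : s + δ ≤ τ) : smoothStep s δ τ = 1 :=
  Real.smoothTransition.one_of_one_le ((one_le_div hδ).2 (by linarith))

lemma abs_smoothStep_le (s δ τ : ℝ) : |smoothStep s δ τ| ≤ 1 := by
  rw [smoothStep, abs_of_nonneg (Real.smoothTransition.nonneg _)]
  exact Real.smoothTransition.le_one _

lemma monotone_smoothStep {s δ : ℝ} (hδ : 0 < δ) : Monotone (smoothStep s δ) := fun a b hab =>
  Real.smoothTransition.monotone (div_le_div_of_nonneg_right (by linarith) hδ.le)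

lemma deriv_smoothStep_eq_zero {s δ τ : ℝ} (hδ : 0 < δ) (h : τ ∉ Icc s (s + δ)) :
    deriv (smoothStep s δ) τ = 0 := by
  have : ∃ c : ℝ, smoothStep s δ =ᶠ[𝓝 τ] fun _ => c := by
    by_cases h1 : τ < s
    · refine ⟨0, ?_⟩
      filter_upwards [Iio_mem_nhds h1] with r hr using smoothStep_of_le hδ (le_of_lt hr)
    · have h2 : s + δ < τ := by
        by_contra h3
        exact h ⟨not_lt.1 h1, not_lt.1 h3⟩
      refine ⟨1, ?_⟩
      filter_upwards [Ioi_mem_nhds h2] with r hr using smoothStep_of_ge hδ (le_of_lt hr)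
  obtain ⟨c, hc⟩ := this
  rw [hc.deriv_eq, deriv_const]

/-- The derivative of the smooth step is a non-negative approximate identity of mass one, carried by
`[s, s + δ]`. -/
lemma tendsto_integral_deriv_smoothStep {F : ℝ → ℝ} {p q s : ℝ} (hs : s ∈ Ioo p q)
    (hF : ContinuousOn F (Icc p q)) :
    Tendsto (fun δ => ∫ τ in Ioo p q, deriv (smoothStep s δ) τ * F τ) (𝓝[>] 0) (𝓝 (F s)) := by
  have hpq : p ≤ q := (hs.1.trans hs.2).le
  have hFs : ContinuousAt F s := hF.continuousAt (Icc_mem_nhds hs.1 hs.2)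
  rw [Metric.tendsto_nhds]
  intro ε hε
  obtain ⟨r, hr, hball⟩ := Metric.continuousAt_iff.1 hFs (ε / 2) (by positivity)
  have e1 : ∀ᶠ δ : ℝ in 𝓝[>] 0, δ < min r (q - s) :=
    nhdsWithin_le_nhds (Iio_mem_nhds (lt_min hr (by linarith [hs.2])))
  filter_upwards [e1, self_mem_nhdsWithin] with δ hδ hδ0
  have hδ0 : 0 < δ := hδ0
  have hδr := hδ.trans_le (min_le_left _ _)
  have hδq := hδ.trans_le (min_le_right _ _)
  have hcd : Continuous (deriv (smoothStep s δ)) :=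
    (contDiff_smoothStep s δ).continuous_deriv (by simp)
  have hint : ∫ τ in p..q, deriv (smoothStep s δ) τ = 1 := by
    rw [intervalIntegral.integral_deriv_eq_sub
      (fun x _ => (contDiff_smoothStep s δ).differentiable (by simp) x)
      (hcd.intervalIntegrable _ _),
      smoothStep_of_ge hδ0 (by linarith), smoothStep_of_le hδ0 hs.1.le, sub_zero]
  have hI1 : IntervalIntegrable (fun τ => deriv (smoothStep s δ) τ * F τ) volume p q :=
    ContinuousOn.intervalIntegrable (by rw [uIcc_of_le hpq]; exact hcd.continuousOn.mul hF)
  rw [← integral_Ioc_eq_integral_Ioo, ← intervalIntegral.integral_of_le hpq, dist_eq_norm]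
  have e2 : F s = ∫ τ in p..q, deriv (smoothStep s δ) τ * F s := by
    rw [intervalIntegral.integral_mul_const, hint, one_mul]
  have hI2 : IntervalIntegrable (fun τ => deriv (smoothStep s δ) τ * F s) volume p q :=
    (hcd.mul continuous_const).intervalIntegrable _ _
  rw [e2, ← intervalIntegral.integral_sub hI1 hI2]
  have hb : ‖∫ τ in p..q, (deriv (smoothStep s δ) τ * F τ - deriv (smoothStep s δ) τ * F s)‖ ≤
      ∫ τ in p..q, deriv (smoothStep s δ) τ * (ε / 2) := by
    refine intervalIntegral.norm_integral_le_of_norm_le hpq (Eventually.of_forall fun τ hτ => ?_)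
      ((hcd.mul continuous_const).intervalIntegrable _ _)
    have h0 : 0 ≤ deriv (smoothStep s δ) τ := (monotone_smoothStep hδ0).deriv_nonneg
    rw [← mul_sub, norm_mul, Real.norm_of_nonneg h0]
    by_cases hτs : τ ∈ Icc s (s + δ)
    · refine mul_le_mul_of_nonneg_left ?_ h0
      have := hball (x := τ) (by
        rw [Real.dist_eq, abs_of_nonneg (by linarith [hτs.1])]; linarith [hτs.2])
      rw [dist_eq_norm] at this
      exact this.le
    · rw [deriv_smoothStep_eq_zero hδ0 hτs]; simp
  rw [intervalIntegral.integral_mul_const, hint] at hb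
  linarith

lemma tendsto_integral_smoothStep_mul {g : ℝ → ℝ} {p q s : ℝ} (hg : IntegrableOn g (Ioo p q)) :
    Tendsto (fun δ => ∫ τ in Ioo p q, smoothStep s δ τ * g τ) (𝓝[>] 0)
      (𝓝 (∫ τ in Ioo p q, (Ioi s).indicator g τ)) := by
  refine tendsto_integral_filter_of_dominated_convergence (fun τ => |g τ|) ?_ ?_ hg.abs ?_
  · exact Eventually.of_forall fun δ =>
      (contDiff_smoothStep s δ).continuous.aestronglyMeasurable.mul hg.1
  · refine Eventually.of_forall fun δ => Eventually.of_forall fun τ => ?_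
    rw [norm_mul, Real.norm_eq_abs, Real.norm_eq_abs]
    exact mul_le_of_le_one_left (abs_nonneg _) (abs_smoothStep_le _ _ _)
  · refine Eventually.of_forall fun τ => tendsto_const_nhds.congr' ?_
    by_cases h : s < τ
    · have e1 : ∀ᶠ δ : ℝ in 𝓝[>] 0, δ < τ - s :=
        nhdsWithin_le_nhds (Iio_mem_nhds (by linarith))
      filter_upwards [e1, self_mem_nhdsWithin] with δ hδ hδ0
      rw [smoothStep_of_ge hδ0 (by linarith), indicator_of_mem (by exact h), one_mul]
    · filter_upwards [self_mem_nhdsWithin] with δ hδ0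
      rw [smoothStep_of_le hδ0 (not_lt.1 h), indicator_of_notMem (by exact h), zero_mul]

/-- If `F' = g` in the sense of distributions, then `F` is a primitive of `g`. -/
lemma sub_eq_integral_of_weak {F g : ℝ → ℝ} {p s t : ℝ} (hs : s ∈ Ioo p t)
    (hF : ContinuousOn F (Icc p t)) (hg : IntegrableOn g (Ioo p t))
    (h : ∀ q < t, ∀ η : ℝ → ℝ, ContDiff ℝ ∞ η → tsupport η ⊆ Ioo p q →
      ∫ τ in Ioo p q, (deriv η τ * F τ + η τ * g τ) = 0) :
    F t - F s = ∫ τ in Ioo s t, g τ := by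
  have key : ∀ b ∈ Ioo s t, F b - F s = ∫ τ in s..b, g τ := by
    intro b hb
    set q := (b + t) / 2 with hq
    have hbq : b < q := by rw [hq]; linarith [hb.2]
    have hqt : q < t := by rw [hq]; linarith [hb.2]
    have hFq : ContinuousOn F (Icc p q) := hF.mono (Icc_subset_Icc_right hqt.le)
    have hgq : IntegrableOn g (Ioo p q) := hg.mono_set (Ioo_subset_Ioo_right hqt.le)
    have hsq : s ∈ Ioo p q := ⟨hs.1, hb.1.trans hbq⟩
    have hbq' : b ∈ Ioo p q := ⟨hs.1.trans hb.1, hbq⟩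
    have lim := ((tendsto_integral_deriv_smoothStep hsq hFq).sub
      (tendsto_integral_deriv_smoothStep hbq' hFq)).add
      ((tendsto_integral_smoothStep_mul (s := s) hgq).sub
        (tendsto_integral_smoothStep_mul (s := b) hgq))
    -- The test function is the difference of the steps at `s` and at `b`, a smoothed indicator of
    -- `(s, b)`. Both steps equal one beyond `b + δ`, so its support lies in `[s, b + δ]`, inside
    -- `(p, q)` for small `δ`.
    have hev : ∀ᶠ δ : ℝ in 𝓝[>] 0, (∫ τ in Ioo p q, deriv (smoothStep s δ) τ * F τ) -
        (∫ τ in Ioo p q, deriv (smoothStep b δ) τ * F τ) +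
        ((∫ τ in Ioo p q, smoothStep s δ τ * g τ) -
        ∫ τ in Ioo p q, smoothStep b δ τ * g τ) = 0 := by
      have e1 : ∀ᶠ δ : ℝ in 𝓝[>] 0, δ < q - b :=
        nhdsWithin_le_nhds (Iio_mem_nhds (by linarith))
      filter_upwards [e1, self_mem_nhdsWithin] with δ hδ hδ0
      have hδ0 : 0 < δ := hδ0
      have i1 : ∀ c, IntegrableOn (fun τ => deriv (smoothStep c δ) τ * F τ) (Ioo p q) := fun c =>
        ((((contDiff_smoothStep c δ).continuous_deriv (by simp)).continuousOn.mul
          hFq).integrableOn_Icc).mono_set Ioo_subset_Icc_self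
      have i2 : ∀ c, IntegrableOn (fun τ => smoothStep c δ τ * g τ) (Ioo p q) := fun c =>
        Integrable.bdd_mul (c := 1) hgq
          (contDiff_smoothStep c δ).continuous.aestronglyMeasurable
          (Eventually.of_forall fun τ => abs_smoothStep_le _ _ _)
      rw [← integral_sub (i1 s) (i1 b), ← integral_sub (i2 s) (i2 b),
        ← integral_add (f := fun a => deriv (smoothStep s δ) a * F a -
            deriv (smoothStep b δ) a * F a) (g := fun a => smoothStep s δ a * g a -
            smoothStep b δ a * g a) ((i1 s).sub (i1 b)) ((i2 s).sub (i2 b)),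
        ← h q hqt (fun τ => smoothStep s δ τ - smoothStep b δ τ)
          ((contDiff_smoothStep s δ).sub (contDiff_smoothStep b δ)) ?_]
      · refine integral_congr_ae (Eventually.of_forall fun τ => ?_)
        have hd : deriv (fun τ => smoothStep s δ τ - smoothStep b δ τ) τ =
            deriv (smoothStep s δ) τ - deriv (smoothStep b δ) τ :=
          deriv_fun_sub ((contDiff_smoothStep s δ).differentiable (by simp) τ)
            ((contDiff_smoothStep b δ).differentiable (by simp) τ)
        simp only [hd]
        ring
      · refine (closure_minimal (t := Icc s (b + δ)) (fun τ hτ => ?_) isClosed_Icc).trans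
          fun τ hτ => ⟨hs.1.trans_le hτ.1, hτ.2.trans_lt (by linarith)⟩
        by_contra hn
        refine hτ ?_
        by_cases h1 : τ < s
        · simp only
          rw [smoothStep_of_le hδ0 h1.le, smoothStep_of_le hδ0 (h1.le.trans hb.1.le), sub_zero]
        · have h2 : b + δ < τ := by
            by_contra h3
            exact hn ⟨not_lt.1 h1, not_lt.1 h3⟩
          simp only
          rw [smoothStep_of_ge hδ0 (by linarith [hb.1]), smoothStep_of_ge hδ0 h2.le, sub_self]
    have h0 := tendsto_nhds_unique (lim.congr' hev) tendsto_const_nhds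
    have hind : ∀ c ∈ Ioo p q, ∫ τ in Ioo p q, (Ioi c).indicator g τ = ∫ τ in c..q, g τ := by
      intro c hc
      rw [setIntegral_indicator measurableSet_Ioi, Ioo_inter_Ioi, max_eq_right hc.1.le,
        ← integral_Ioc_eq_integral_Ioo, intervalIntegral.integral_of_le hc.2.le]
    have hii : ∀ c ∈ Ioo p q, IntervalIntegrable g volume c q := fun c hc => by
      rw [intervalIntegrable_iff_integrableOn_Ioo_of_le hc.2.le]
      exact hgq.mono_set (Ioo_subset_Ioo_left hc.1.le)
    rw [hind s hsq, hind b hbq', intervalIntegral.integral_interval_sub_interval_comm' (hii s hsq)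
      (hii b hbq') ((hii s hsq).trans (hii b hbq').symm), intervalIntegral.integral_same,
      intervalIntegral.integral_symm] at h0
    linarith
  -- Test functions have to stay away from `t`. The identity at `t` is the limit `b → t` of the
  -- previous one, both sides being continuous up to `t`.
  have hgi : IntegrableOn g (Icc s t) := by
    rw [integrableOn_Icc_iff_integrableOn_Ioo]
    exact hg.mono_set (Ioo_subset_Ioo_left hs.1.le)
  have c1 := intervalIntegral.continuousOn_primitive_interval (a := s) (b := t) (f := g)
    (μ := volume) (by rwa [uIcc_of_le hs.2.le])
  rw [uIcc_of_le hs.2.le] at c1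
  have ht : t ∈ Icc s t := right_mem_Icc.2 hs.2.le
  have hne : (𝓝[Ioo s t] t).NeBot := by
    rw [← mem_closure_iff_nhdsWithin_neBot, closure_Ioo hs.2.ne]; exact ht
  have l1 := (c1 t ht).mono_left (nhdsWithin_mono t (Ioo_subset_Icc_self (a := s) (b := t)))
  have l2 := ((hF t (right_mem_Icc.2 (hs.1.trans hs.2).le)).mono_left (nhdsWithin_mono t
    (Ioo_subset_Icc_self.trans (Icc_subset_Icc_left hs.1.le)))).sub
    (tendsto_const_nhds (x := F s))
  have l3 := l2.congr' (by filter_upwards [self_mem_nhdsWithin] with b hb using key b hb)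
  refine (tendsto_nhds_unique l3 l1).trans ?_
  simp only
  rw [intervalIntegral.integral_of_le hs.2.le,
    integral_Ioc_eq_integral_Ioo]

end SmoothStep

/-! ### Duhamel's formula for distributional solutions -/

section WeakToMild

variable {E : Type*} [NormedAddCommGroup E] [InnerProductSpace ℝ E] [FiniteDimensional ℝ E]
  [MeasurableSpace E] [BorelSpace E]
  {ν M : ℝ} {m v : ℝ → ℝ} {U : E → ℝ → E} {V : E → ℝ → ℝ}

lemma integral_heatKernel_sub_scale {a : ℝ} (ha : 0 < a) (x : E) (F : E → ℝ) :
    ∫ z, heatKernel a (x - z) * F z = ∫ ζ, heatKernel 1 ζ * F (x - Real.sqrt a • ζ) := by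
  rw [← integral_sub_left_eq_self (fun z => heatKernel a (x - z) * F z) volume x]
  simp only [sub_sub_cancel]
  exact integral_heatKernel_scale ha fun w => F (x - w)

/-- In the rescaled variable the heat average makes sense at `τ = t`, where it is the value of `f`
itself. Continuity up to that endpoint is what produces the left side of Duhamel's formula. -/
lemma continuousOn_heatAverage (hν : 0 < ν) {f : E → ℝ → ℝ} {a t A B : ℝ}
    (hf : ContinuousOn (fun p : E × ℝ => f p.1 p.2) (univ ×ˢ Icc a t))
    (hg : ∀ τ ∈ Icc a t, ∀ x, |f x τ| ≤ A * Real.exp (B * ‖x‖)) (x : E) :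
    ContinuousOn (fun τ => ∫ ζ, heatKernel 1 ζ * f (x - Real.sqrt (ν * (t - τ)) • ζ) τ)
      (Icc a t) := by
  intro τ₀ hτ₀
  have hA : 0 ≤ A := nonneg_of_mul_nonneg_left ((abs_nonneg _).trans (hg τ₀ hτ₀ 0))
    (Real.exp_pos _)
  have hcomp : ∀ ζ : E, ContinuousOn
      (fun τ => f (x - Real.sqrt (ν * (t - τ)) • ζ) τ) (Icc a t) := by
    intro ζ
    exact hf.comp (f := fun τ : ℝ => (x - Real.sqrt (ν * (t - τ)) • ζ, τ))
      (by fun_prop) fun τ hτ => ⟨trivial, hτ⟩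
  refine continuousWithinAt_of_dominated (bound := fun ζ => A * Real.exp (|B| * ‖x‖) *
    (heatKernel 1 ζ * Real.exp ((|B| * Real.sqrt (ν * (t - a))) * ‖ζ‖))) ?_ ?_ ?_ ?_
  · filter_upwards [self_mem_nhdsWithin] with τ hτ
    refine ((continuous_heatKernel 1).mul ?_).aestronglyMeasurable
    exact hf.comp_continuous (f := fun ζ : E => (x - Real.sqrt (ν * (t - τ)) • ζ, τ))
      (by fun_prop) fun ζ => ⟨trivial, hτ⟩
  · filter_upwards [self_mem_nhdsWithin] with τ hτ
    refine Eventually.of_forall fun ζ => ?_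
    have h1 := heatKernel_pos one_pos ζ
    rw [norm_mul, Real.norm_of_nonneg h1.le, Real.norm_eq_abs]
    have h2 := hg τ hτ (x - Real.sqrt (ν * (t - τ)) • ζ)
    have h3 : B * ‖x - Real.sqrt (ν * (t - τ)) • ζ‖ ≤
        |B| * ‖x‖ + (|B| * Real.sqrt (ν * (t - a))) * ‖ζ‖ := by
      have h4 : ‖x - Real.sqrt (ν * (t - τ)) • ζ‖ ≤ ‖x‖ + Real.sqrt (ν * (t - a)) * ‖ζ‖ := by
        refine (norm_sub_le _ _).trans ?_
        rw [norm_smul, Real.norm_of_nonneg (Real.sqrt_nonneg _)]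
        have := hτ.1
        gcongr
      calc _ ≤ |B| * ‖x - Real.sqrt (ν * (t - τ)) • ζ‖ := by gcongr; exact le_abs_self B
        _ ≤ |B| * (‖x‖ + Real.sqrt (ν * (t - a)) * ‖ζ‖) := by gcongr
        _ = _ := by ring
    calc _ ≤ heatKernel 1 ζ * (A * Real.exp (|B| * ‖x‖ +
          (|B| * Real.sqrt (ν * (t - a))) * ‖ζ‖)) := by
          refine mul_le_mul_of_nonneg_left (h2.trans ?_) h1.le
          gcongr
      _ = _ := by rw [Real.exp_add]; ring
  · exact (integrable_heatKernel_mul_exp one_pos _).const_mul _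
  · exact Eventually.of_forall fun ζ => (hcomp ζ τ₀ hτ₀).const_mul _

/-- Distributional solutions of exponential growth satisfy Duhamel's formula. -/
theorem Coeff.mild_of_weak (h : Coeff ν M m v U V) {J : Set ℝ} (hJ : IsOpen J) {f : E → ℝ → ℝ}
    (hf : ContinuousOn (fun p : E × ℝ => f p.1 p.2) (univ ×ˢ J))
    (hgrow : ∀ a b : ℝ, Icc a b ⊆ J →
      ∃ A B : ℝ, ∀ t ∈ Icc a b, ∀ x, |f x t| ≤ A * Real.exp (B * ‖x‖))
    (hweak : ∀ φ : E × ℝ → ℝ, ContDiff ℝ ∞ φ → HasCompactSupport φ → tsupport φ ⊆ univ ×ˢ J →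
      ∫ p : E × ℝ, f p.1 p.2 * adjOp ν U V φ p = 0)
    {s t : ℝ} (hst : s < t) (hsub : Icc s t ⊆ J) (x : E) :
    f x t = (∫ y, heatKernel (ν * (t - s)) (x - y) * f y s) + duhamel ν U V f s x t := by
  have hν := h.ν_pos
  have hgf := gaussFactor_pos (E := E)
  -- Room to the left of `s` is needed, because the test functions in time are supported in an open
  -- interval containing `s`.
  obtain ⟨a, has, haJ⟩ : ∃ a < s, Icc a t ⊆ J := by
    obtain ⟨a, ha, hsubJ⟩ := exists_Ioc_subset_of_mem_nhds
      (hJ.mem_nhds (hsub (left_mem_Icc.2 hst.le))) (exists_lt s)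
    refine ⟨(a + s) / 2, by linarith, fun τ hτ => ?_⟩
    by_cases h1 : τ ≤ s
    · exact hsubJ ⟨by linarith [hτ.1], h1⟩
    · exact hsub ⟨(not_le.1 h1).le, hτ.2⟩
  have hat := has.trans hst
  obtain ⟨A, B, hAB⟩ := hgrow a t haJ
  have hA : 0 ≤ A := nonneg_of_mul_nonneg_left
    ((abs_nonneg _).trans (hAB a (left_mem_Icc.2 hat.le) 0)) (Real.exp_pos _)
  have hfc : ContinuousOn (fun p : E × ℝ => f p.1 p.2) (univ ×ˢ Icc a t) :=
    hf.mono (prod_mono le_rfl haJ)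
  have hfm : AEStronglyMeasurable (fun p : E × ℝ => f p.1 p.2)
      (volume.restrict (univ ×ˢ Ioo a t)) :=
    (hfc.mono (prod_mono le_rfl Ioo_subset_Icc_self)).aestronglyMeasurable
      (measurableSet_strip a t)
  have hD := (h.duhamel_exp_bound (F := f) (A := A) (B := B) (lam := 0) (s := a) (t := t) x hA le_rfl
    hat hfm (fun z τ hτ => by simpa using hAB τ (Ioo_subset_Icc_self hτ) z)).1
  have hG : IntegrableOn (fun p : E × ℝ => heatKernel (ν * (t - p.2)) (x - p.1) * f p.1 p.2)
      (univ ×ˢ Ioo a t) := by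
    refine (strip_bound (k := fun z τ => heatKernel (ν * (t - τ)) (x - z) *
      Real.exp (B * ‖z‖)) (g := fun _ => A) (R := gaussFactor E *
        Real.exp (2 * (ν * (t - a)) * B ^ 2) * Real.exp (B * ‖x‖))
      ((Measurable.heatKernel (by fun_prop) (by fun_prop)).aestronglyMeasurable.mul hfm)
      (integrableOn_const (by simp)) (fun _ _ => hA) ?_ ?_).1
    · intro τ hτ
      have h0 : 0 < ν * (t - τ) := mul_pos hν (by linarith [hτ.2])
      refine ⟨integrable_heatKernel_sub_mul_exp h0 B x,
        (integral_heatKernel_sub_mul_exp_le h0 B x).trans ?_⟩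
      have := hτ.1
      gcongr
    · intro z τ hτ
      have h0 : 0 < ν * (t - τ) := mul_pos hν (by linarith [hτ.2])
      have h1 := heatKernel_pos h0 (x - z)
      simp only [Pi.mul_apply]
      rw [abs_mul, abs_of_pos h1]
      calc _ ≤ heatKernel (ν * (t - τ)) (x - z) * (A * Real.exp (B * ‖z‖)) := by
            gcongr; exact hAB τ (Ioo_subset_Icc_self hτ) z
        _ = _ := by ring
  set F : ℝ → ℝ := fun τ => ∫ ζ, heatKernel 1 ζ * f (x - Real.sqrt (ν * (t - τ)) • ζ) τ with hF
  set g : ℝ → ℝ := fun τ => ∫ z, duhamelKernel ν U V x t z τ * f z τ with hg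
  have hFeq : ∀ τ < t, ∫ z, heatKernel (ν * (t - τ)) (x - z) * f z τ = F τ := fun τ hτ =>
    integral_heatKernel_sub_scale (mul_pos hν (sub_pos.2 hτ)) x fun z => f z τ
  have hgi : IntegrableOn g (Ioo a t) := by
    rw [IntegrableOn, restrict_strip] at hD
    exact hD.integral_prod_right
  -- The tested equation says that the heat average of `f(·, τ)` has distributional derivative `g`,
  -- the space integral of the Duhamel kernel against `f`. Integrating from `s` to `t` is Duhamel's
  -- formula.
  have key := sub_eq_integral_of_weak (F := F) (g := g) ⟨has, hst⟩
    (continuousOn_heatAverage hν hfc hAB x) hgi ?_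
  · have e1 : F t = f x t := by simp [hF, integral_mul_const, integral_heatKernel one_pos]
    have e2 : ∫ τ in Ioo s t, g τ = duhamel ν U V f s x t := by
      have hD' : IntegrableOn (fun p : E × ℝ => duhamelKernel ν U V x t p.1 p.2 * f p.1 p.2)
          (univ ×ˢ Ioo s t) := hD.mono_set (prod_mono le_rfl (Ioo_subset_Ioo_left has.le))
      rw [IntegrableOn, restrict_strip] at hD'
      rw [duhamel, restrict_strip, integral_prod_symm _ hD']
    rw [hFeq s hst, ← e2, ← key, e1]
    ring
  · intro q hq η hη hsupp
    by_cases hpq : q ≤ a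
    · simp [Ioo_eq_empty (not_lt.2 hpq)]
    have hsubS : (univ : Set E) ×ˢ Ioo a q ⊆ univ ×ˢ Ioo a t :=
      prod_mono le_rfl (Ioo_subset_Ioo_right hq.le)
    have hw := h.weak_backKernel hf hweak (a := a) (b := q) (t := t)
      ((Icc_subset_Icc_right hq.le).trans haJ) hq
      (fun τ hτ => hAB τ ⟨hτ.1, hτ.2.trans hq.le⟩) hη hsupp x
    have hηc : HasCompactSupport η := HasCompactSupport.of_support_subset_isCompact isCompact_Icc
      ((subset_tsupport η).trans (hsupp.trans Ioo_subset_Icc_self))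
    obtain ⟨C₁, hC₁⟩ := hη.continuous.bounded_above_of_compact_support hηc
    obtain ⟨C₂, hC₂⟩ := (hη.continuous_deriv (by simp)).bounded_above_of_compact_support hηc.deriv
    have i1 : IntegrableOn (fun p : E × ℝ => deriv η p.2 *
        (heatKernel (ν * (t - p.2)) (x - p.1) * f p.1 p.2)) (univ ×ˢ Ioo a q) :=
      Integrable.bdd_mul (c := C₂) (hG.mono_set hsubS)
        ((measurable_deriv η).comp measurable_snd).aestronglyMeasurable
        (Eventually.of_forall fun p => hC₂ p.2)
    have i2 : IntegrableOn (fun p : E × ℝ => η p.2 *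
        (duhamelKernel ν U V x t p.1 p.2 * f p.1 p.2)) (univ ×ˢ Ioo a q) :=
      Integrable.bdd_mul (c := C₁) (hD.mono_set hsubS)
        (hη.continuous.measurable.comp measurable_snd).aestronglyMeasurable
        (Eventually.of_forall fun p => hC₁ p.2)
    have i12 := i1.add i2
    rw [IntegrableOn, restrict_strip] at i12
    have e : (fun p : E × ℝ => f p.1 p.2 * (deriv η p.2 *
        heatKernel (ν * (t - p.2)) (x - p.1) + η p.2 * duhamelKernel ν U V x t p.1 p.2)) =
        (fun p : E × ℝ => deriv η p.2 *
          (heatKernel (ν * (t - p.2)) (x - p.1) * f p.1 p.2)) + fun p : E × ℝ => η p.2 *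
          (duhamelKernel ν U V x t p.1 p.2 * f p.1 p.2) := by
      ext p; simp only [Pi.add_apply]; ring
    rw [e, restrict_strip, integral_prod_symm _ i12] at hw
    rw [← hw]
    rw [IntegrableOn, restrict_strip] at i1 i2
    refine integral_congr_ae ?_
    filter_upwards [i1.prod_left_ae, i2.prod_left_ae, ae_restrict_mem measurableSet_Ioo]
      with τ h1 h2 hτ
    simp only [Pi.add_apply]
    rw [integral_add h1 h2, integral_const_mul, integral_const_mul, hFeq τ (hτ.2.trans hq)]

end WeakToMild

end AdvectionDiffusion

namespace AdvectionDiffusion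

/-! ### Directional derivatives of test functions -/

section DirDeriv

variable {F : Type*} [NormedAddCommGroup F] [NormedSpace ℝ F]

/-- The derivative in the direction `v`. -/
noncomputable def dirDeriv (v : F) (f : F → ℝ) (x : F) : ℝ := fderiv ℝ f x v

lemma contDiff_dirDeriv {f : F → ℝ} (hf : ContDiff ℝ ∞ f) (v : F) :
    ContDiff ℝ ∞ (dirDeriv v f) :=
  (hf.fderiv_right (m := ∞) (by simp)).clm_apply contDiff_const

lemma tsupport_dirDeriv_subset (v : F) (f : F → ℝ) : tsupport (dirDeriv v f) ⊆ tsupport f :=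
  tsupport_fderiv_apply_subset ℝ v

lemma hasCompactSupport_dirDeriv {f : F → ℝ} (hf : HasCompactSupport f) (v : F) :
    HasCompactSupport (dirDeriv v f) :=
  hf.mono' ((subset_tsupport _).trans (tsupport_dirDeriv_subset v f))

lemma dirDeriv_comm {f : F → ℝ} (hf : ContDiff ℝ ∞ f) (v w : F) :
    dirDeriv v (dirDeriv w f) = dirDeriv w (dirDeriv v f) := by
  ext x
  have hd : DifferentiableAt ℝ (fderiv ℝ f) x :=
    (hf.fderiv_right (m := ∞) (by simp)).differentiable (by simp) x
  have h : ∀ a b, dirDeriv a (dirDeriv b f) x = fderiv ℝ (fderiv ℝ f) x a b := by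
    intro a b
    change fderiv ℝ (fun y => fderiv ℝ f y b) x a = _
    rw [fderiv_clm_apply hd (differentiableAt_const b)]
    simp
  rw [h, h]
  exact ((contDiff_infty.1 hf 2).contDiffAt.isSymmSndFDerivAt (by simp)) v w

lemma dirDeriv_add {f g : F → ℝ} (hf : ContDiff ℝ ∞ f) (hg : ContDiff ℝ ∞ g) (v : F) :
    dirDeriv v (fun x => f x + g x) = fun x => dirDeriv v f x + dirDeriv v g x := by
  ext x
  simp only [dirDeriv]
  rw [fderiv_fun_add (hf.differentiable (by simp) x) (hg.differentiable (by simp) x)]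
  rfl

lemma dirDeriv_const_mul {f : F → ℝ} (hf : ContDiff ℝ ∞ f) (c : ℝ) (v : F) :
    dirDeriv v (fun x => c * f x) = fun x => c * dirDeriv v f x := by
  ext x
  simp only [dirDeriv]
  rw [fderiv_const_mul (hf.differentiable (by simp) x)]
  rfl

lemma dirDeriv_sum {ι : Type*} (s : Finset ι) {f : ι → F → ℝ} (hf : ∀ i, ContDiff ℝ ∞ (f i))
    (v : F) : dirDeriv v (fun x => ∑ i ∈ s, f i x) = fun x => ∑ i ∈ s, dirDeriv v (f i) x := by
  ext x
  simp only [dirDeriv]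
  rw [fderiv_fun_sum fun i _ => (hf i).differentiable (by simp) x]
  simp

end DirDeriv

/-! ### The backward heat operator and integration by parts -/

section HeatOp

variable {E : Type*} [NormedAddCommGroup E] [InnerProductSpace ℝ E] [FiniteDimensional ℝ E]

lemma dirDeriv_slice {φ : E × ℝ → ℝ} (hφ : ContDiff ℝ ∞ φ) (ξ z : E) (t : ℝ) :
    dirDeriv ξ (fun y => φ (y, t)) z = dirDeriv (ξ, 0) φ (z, t) := by
  have h1 : HasFDerivAt (fun y : E => (y, t)) (ContinuousLinearMap.inl ℝ E ℝ) z := by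
    exact (hasFDerivAt_id z).prodMk (hasFDerivAt_const t z)
  have h2 := (hφ.differentiable (by simp) (z, t)).hasFDerivAt.comp z h1
  change fderiv ℝ (φ ∘ fun y => (y, t)) z ξ = _
  rw [h2.fderiv]
  simp [dirDeriv]

lemma hasDerivAt_slice {φ : E × ℝ → ℝ} (hφ : ContDiff ℝ ∞ φ) (z : E) (t : ℝ) :
    HasDerivAt (fun τ => φ (z, τ)) (dirDeriv (0, 1) φ (z, t)) t := by
  have h1 : HasDerivAt (fun τ : ℝ => (z, τ)) ((0 : E), (1 : ℝ)) t :=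
    (hasDerivAt_const t z).prodMk (hasDerivAt_id t)
  exact (hφ.differentiable (by simp) (z, t)).hasFDerivAt.comp_hasDerivAt t h1

lemma contDiff_slice {φ : E × ℝ → ℝ} (hφ : ContDiff ℝ ∞ φ) (t : ℝ) :
    ContDiff ℝ ∞ fun y => φ (y, t) := hφ.comp (by fun_prop)

lemma hasCompactSupport_slice {φ : E × ℝ → ℝ} (hφ : HasCompactSupport φ) (t : ℝ) :
    HasCompactSupport fun y => φ (y, t) := by
  refine HasCompactSupport.of_support_subset_isCompact (hφ.isCompact.image continuous_fst)
    fun y hy => ⟨(y, t), subset_tsupport _ hy, rfl⟩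

lemma laplacian_eq_sum_dirDeriv {u : E → ℝ} {z : E} (hu : ContDiffAt ℝ 2 u z) :
    Laplacian.laplacian u z = ∑ i, dirDeriv (stdOrthonormalBasis ℝ E i)
      (dirDeriv (stdOrthonormalBasis ℝ E i) u) z := by
  rw [InnerProductSpace.laplacian_eq_iteratedFDeriv_stdOrthonormalBasis]
  refine Finset.sum_congr rfl fun i _ => ?_
  have hd : DifferentiableAt ℝ (fderiv ℝ u) z :=
    (hu.fderiv_right (m := 1) (by norm_num)).differentiableAt (by simp)
  rw [iteratedFDeriv_two_apply]
  change _ = fderiv ℝ (fun y => fderiv ℝ u y _) z _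
  rw [fderiv_clm_apply hd (differentiableAt_const _)]
  simp

/-- The backward heat operator `∂ₜ + νΔ`. -/
noncomputable def heatOp (ν : ℝ) (φ : E × ℝ → ℝ) (p : E × ℝ) : ℝ :=
  dirDeriv (0, 1) φ p + ν * ∑ i, dirDeriv (stdOrthonormalBasis ℝ E i, 0)
    (dirDeriv (stdOrthonormalBasis ℝ E i, 0) φ) p

lemma laplacian_slice {φ : E × ℝ → ℝ} (hφ : ContDiff ℝ ∞ φ) (z : E) (t : ℝ) :
    Laplacian.laplacian (fun y => φ (y, t)) z = ∑ i, dirDeriv (stdOrthonormalBasis ℝ E i, 0)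
      (dirDeriv (stdOrthonormalBasis ℝ E i, 0) φ) (z, t) := by
  rw [laplacian_eq_sum_dirDeriv (contDiff_infty.1 (contDiff_slice hφ t) 2).contDiffAt]
  refine Finset.sum_congr rfl fun i _ => ?_
  rw [show dirDeriv (stdOrthonormalBasis ℝ E i) (fun y => φ (y, t)) = fun y =>
    dirDeriv (stdOrthonormalBasis ℝ E i, 0) φ (y, t) from funext fun y => dirDeriv_slice hφ _ y t,
    dirDeriv_slice (contDiff_dirDeriv hφ _)]

lemma contDiff_heatOp {φ : E × ℝ → ℝ} (hφ : ContDiff ℝ ∞ φ) (ν : ℝ) :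
    ContDiff ℝ ∞ (heatOp ν φ) :=
  (contDiff_dirDeriv hφ _).add (contDiff_const.mul (ContDiff.sum fun _ _ =>
    contDiff_dirDeriv (contDiff_dirDeriv hφ _) _))

lemma tsupport_heatOp_subset (φ : E × ℝ → ℝ) (ν : ℝ) : tsupport (heatOp ν φ) ⊆ tsupport φ := by
  refine closure_minimal (fun p hp => ?_) (isClosed_tsupport _)
  by_contra hn
  refine hp ?_
  have h1 : ∀ v, dirDeriv v φ p = 0 := fun v =>
    image_eq_zero_of_notMem_tsupport fun h => hn (tsupport_dirDeriv_subset v φ h)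
  have h2 : ∀ v w, dirDeriv v (dirDeriv w φ) p = 0 := fun v w =>
    image_eq_zero_of_notMem_tsupport fun h =>
      hn (tsupport_dirDeriv_subset w φ (tsupport_dirDeriv_subset v _ h))
  simp [heatOp, h1, h2]

lemma hasCompactSupport_heatOp {φ : E × ℝ → ℝ} (hφ : HasCompactSupport φ) (ν : ℝ) :
    HasCompactSupport (heatOp ν φ) :=
  hφ.mono' ((subset_tsupport _).trans (tsupport_heatOp_subset φ ν))

/-- Constant coefficient operators commute. This is used to trade a gradient of the heat kernel for
a derivative of the test function. -/
lemma heatOp_dirDeriv {φ : E × ℝ → ℝ} (hφ : ContDiff ℝ ∞ φ) (ν : ℝ) (w : E × ℝ) :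
    heatOp ν (dirDeriv w φ) = dirDeriv w (heatOp ν φ) := by
  have hs : ContDiff ℝ ∞ fun p => ∑ i, dirDeriv (stdOrthonormalBasis ℝ E i, (0 : ℝ))
      (dirDeriv (stdOrthonormalBasis ℝ E i, 0) φ) p :=
    ContDiff.sum fun _ _ => contDiff_dirDeriv (contDiff_dirDeriv hφ _) _
  have e : heatOp ν φ = fun p => dirDeriv (0, 1) φ p +
      ν * ∑ i, dirDeriv (stdOrthonormalBasis ℝ E i, 0)
        (dirDeriv (stdOrthonormalBasis ℝ E i, 0) φ) p := rfl
  rw [e, dirDeriv_add (contDiff_dirDeriv hφ _) (contDiff_const.mul hs), dirDeriv_const_mul hs,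
    dirDeriv_sum _ fun i => contDiff_dirDeriv (contDiff_dirDeriv hφ _) _]
  ext p
  simp only [heatOp]
  rw [dirDeriv_comm hφ (0, 1) w]
  congr 2
  refine Finset.sum_congr rfl fun i _ => ?_
  rw [dirDeriv_comm hφ _ w, dirDeriv_comm (contDiff_dirDeriv hφ _) _ w]

variable [MeasurableSpace E] [BorelSpace E]

lemma adjOp_eq_heatOp {φ : E × ℝ → ℝ} (hφ : ContDiff ℝ ∞ φ) (ν : ℝ) (U : E → ℝ → E)
    (V : E → ℝ → ℝ) (p : E × ℝ) :
    adjOp ν U V φ p = heatOp ν φ p + dirDeriv (U p.1 p.2, 0) φ p + V p.1 p.2 * φ p := by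
  obtain ⟨z, t⟩ := p
  have h3 : inner ℝ (U z t) (gradient (fun y => φ (y, t)) z) = dirDeriv (U z t, 0) φ (z, t) := by
    rw [← dirDeriv_slice hφ, dirDeriv, (hasFDerivAt_innerSL_gradient
      ((contDiff_slice hφ t).differentiable (by simp) z)).fderiv]
    simp
  simp only [adjOp, heatOp]
  rw [(hasDerivAt_slice hφ z t).deriv, laplacian_slice hφ, h3]
  ring

lemma integral_mul_dirDeriv {u w : E → ℝ} (hu : ContDiff ℝ 1 u) (hw : ContDiff ℝ 1 w)
    (hc : HasCompactSupport w) (ξ : E) :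
    ∫ x, u x * dirDeriv ξ w x = -∫ x, dirDeriv ξ u x * w x := by
  have c1 : Continuous fun x => fderiv ℝ u x ξ :=
    (hu.continuous_fderiv (by simp)).clm_apply continuous_const
  have c2 : Continuous fun x => fderiv ℝ w x ξ :=
    (hw.continuous_fderiv (by simp)).clm_apply continuous_const
  refine integral_mul_fderiv_eq_neg_fderiv_mul_of_integrable ?_ ?_ ?_
    (fun x _ => hu.differentiable (by simp) x)
    (fun x _ => hw.differentiable (by simp) x)
  · exact (c1.mul hw.continuous).integrable_of_hasCompactSupport hc.mul_left
  · exact (hu.continuous.mul c2).integrable_of_hasCompactSupport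
      (hasCompactSupport_dirDeriv hc ξ).mul_left
  · exact (hu.continuous.mul hw.continuous).integrable_of_hasCompactSupport hc.mul_left

lemma integral_mul_laplacian {u w : E → ℝ} (hu : ContDiff ℝ ∞ u) (hw : ContDiff ℝ ∞ w)
    (hc : HasCompactSupport w) :
    ∫ x, u x * Laplacian.laplacian w x = ∫ x, Laplacian.laplacian u x * w x := by
  have h2 : ∀ {g : E → ℝ}, ContDiff ℝ ∞ g → ∀ x, Laplacian.laplacian g x =
      ∑ i, dirDeriv (stdOrthonormalBasis ℝ E i) (dirDeriv (stdOrthonormalBasis ℝ E i) g) x :=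
    fun hg x => laplacian_eq_sum_dirDeriv (contDiff_infty.1 hg 2).contDiffAt
  have h1 : ∀ {g : E → ℝ}, ContDiff ℝ ∞ g → ContDiff ℝ 1 g := fun hg => contDiff_infty.1 hg 1
  simp_rw [h2 hu, h2 hw, Finset.mul_sum, Finset.sum_mul]
  rw [integral_finsetSum, integral_finsetSum]
  · refine Finset.sum_congr rfl fun i _ => ?_
    set e := stdOrthonormalBasis ℝ E i
    rw [integral_mul_dirDeriv (h1 hu) (h1 (contDiff_dirDeriv hw e))
      (hasCompactSupport_dirDeriv hc e),
      integral_mul_dirDeriv (h1 (contDiff_dirDeriv hu e)) (h1 hw) hc, neg_neg]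
  · intro i _
    exact ((contDiff_dirDeriv (contDiff_dirDeriv hu _) _).continuous.mul
      hw.continuous).integrable_of_hasCompactSupport hc.mul_left
  · intro i _
    exact (hu.continuous.mul (contDiff_dirDeriv (contDiff_dirDeriv hw _) _).continuous
      ).integrable_of_hasCompactSupport
      (hasCompactSupport_dirDeriv (hasCompactSupport_dirDeriv hc _) _).mul_left

end HeatOp

end AdvectionDiffusion

namespace AdvectionDiffusion

/-! ### Test functions as heat potentials -/

section HeatRepresentation

variable {E : Type*} [NormedAddCommGroup E] [InnerProductSpace ℝ E] [FiniteDimensional ℝ E]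
  [MeasurableSpace E] [BorelSpace E] {ν : ℝ}

lemma hasDerivAt_heatKernel_forward (hν : 0 < ν) {t τ : ℝ} (h : τ < t) (x : E) :
    HasDerivAt (fun r : ℝ => heatKernel (ν * (r - τ)) x)
      (ν * Laplacian.laplacian (fun y : E => heatKernel (ν * (t - τ)) y) x) t := by
  have h1 : HasDerivAt (fun r : ℝ => ν * (r - τ)) ν t := by
    simpa using ((hasDerivAt_id t).sub_const τ).const_mul ν
  have h2 := (hasDerivAt_heatKernel (mul_pos hν (sub_pos.2 h)) x).comp t h1
  rw [laplacian_heatKernel]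
  exact h2.congr_deriv (by ring)

lemma contDiff_heatKernel_sub {a : ℝ} (ha : 0 < a) (z : E) :
    ContDiff ℝ ∞ fun x : E => heatKernel a (x - z) := by
  rw [contDiff_iff_contDiffAt]
  intro x
  have h1 : ContDiffAt ℝ ∞ (fun y : E => (a, y - z)) x := by fun_prop
  exact ContDiffAt.comp (g := fun p : ℝ × E => heatKernel p.1 p.2) x
    (contDiffAt_heatKernel ha (x - z)) h1

lemma laplacian_heatKernel_sub_left (a : ℝ) (x z : E) :
    Laplacian.laplacian (fun y : E => heatKernel a (y - z)) x =
      Laplacian.laplacian (fun y : E => heatKernel a y) (x - z) := by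
  simp_rw [heatKernel_sub_comm a _ z]
  rw [laplacian_heatKernel_sub, laplacian_heatKernel, laplacian_heatKernel, norm_sub_rev,
    heatKernel_sub_comm a z x]

lemma integrableOn_of_compact_support {f : E × ℝ → ℝ} {K : Set (E × ℝ)} {a b : ℝ}
    (hK : IsCompact K) (hf : ContinuousOn f (univ ×ˢ Icc a b)) (h0 : ∀ p ∉ K, f p = 0) :
    IntegrableOn f (univ ×ˢ Ioo a b) := by
  have hc : IsCompact (K ∩ univ ×ˢ Icc a b) := hK.inter_right (isClosed_univ.prod isClosed_Icc)
  refine IntegrableOn.of_forall_sdiff_eq_zero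
    ((hf.mono inter_subset_right).integrableOn_compact hc) (measurableSet_strip a b)
    fun p hp => h0 p fun hpK => hp.2 ⟨hpK, trivial, Ioo_subset_Icc_self hp.1.2⟩

/-- Testing the forward heat kernel started at `(z, τ)` after time `a > τ`. -/
lemma integral_heatKernel_mul_heatOp_of_lt (hν : 0 < ν) {φ : E × ℝ → ℝ} (hφ : ContDiff ℝ ∞ φ)
    (hc : HasCompactSupport φ) {a b τ : ℝ} (hτ : τ < a) (hab : a ≤ b) (hb : ∀ x, φ (x, b) = 0)
    (z : E) :
    ∫ p in univ ×ˢ Ioo a b, heatKernel (ν * (p.2 - τ)) (p.1 - z) * heatOp ν φ p =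
      -∫ x, heatKernel (ν * (a - τ)) (x - z) * φ (x, a) := by
  set G : E × ℝ → ℝ := fun p => heatKernel (ν * (p.2 - τ)) (p.1 - z) with hG
  set L : E × ℝ → ℝ := fun p => Laplacian.laplacian
    (fun y : E => heatKernel (ν * (p.2 - τ)) y) (p.1 - z) with hL
  have hpos : ∀ t ∈ Icc a b, 0 < ν * (t - τ) := fun t ht =>
    mul_pos hν (sub_pos.2 (hτ.trans_le ht.1))
  have hGc : ContinuousOn G (univ ×ˢ Icc a b) :=
    continuousOn_heatKernel.comp (f := fun p : E × ℝ => (ν * (p.2 - τ), p.1 - z)) (by fun_prop)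
      fun p hp => hpos p.2 hp.2
  have hLc : ContinuousOn L (univ ×ˢ Icc a b) := by
    simp only [hL, laplacian_heatKernel]
    refine ContinuousOn.mul (ContinuousOn.sub (ContinuousOn.div (by fun_prop) (by fun_prop) ?_)
      (ContinuousOn.div (by fun_prop) (by fun_prop) ?_)) hGc
    · intro p hp; have := hpos p.2 hp.2; positivity
    · intro p hp; have := hpos p.2 hp.2; positivity
  set φt : E × ℝ → ℝ := dirDeriv (0, 1) φ with hφt
  set Δφ : E × ℝ → ℝ := fun p => ∑ i, dirDeriv (stdOrthonormalBasis ℝ E i, 0)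
    (dirDeriv (stdOrthonormalBasis ℝ E i, 0) φ) p with hΔφ
  have hΔc : Continuous Δφ := continuous_finsetSum _ fun i _ =>
    (contDiff_dirDeriv (contDiff_dirDeriv hφ _) _).continuous
  have hz : ∀ p ∉ tsupport φ, φ p = 0 ∧ φt p = 0 ∧ Δφ p = 0 := by
    intro p hp
    refine ⟨image_eq_zero_of_notMem_tsupport hp, image_eq_zero_of_notMem_tsupport fun h =>
      hp (tsupport_dirDeriv_subset _ φ h), Finset.sum_eq_zero fun i _ =>
      image_eq_zero_of_notMem_tsupport fun h =>
      hp (tsupport_dirDeriv_subset _ φ (tsupport_dirDeriv_subset _ _ h))⟩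
  have i1 : IntegrableOn (fun p => G p * φt p) (univ ×ˢ Ioo a b) :=
    integrableOn_of_compact_support hc.isCompact
      (hGc.mul (contDiff_dirDeriv hφ _).continuous.continuousOn) fun p hp => by simp [(hz p hp).2.1]
  have i2 : IntegrableOn (fun p => ν * (G p * Δφ p)) (univ ×ˢ Ioo a b) :=
    (integrableOn_of_compact_support hc.isCompact (hGc.mul hΔc.continuousOn)
      fun p hp => by simp [(hz p hp).2.2]).const_mul ν
  have i3 : IntegrableOn (fun p => ν * (L p * φ p)) (univ ×ˢ Ioo a b) :=
    (integrableOn_of_compact_support hc.isCompact (hLc.mul hφ.continuous.continuousOn)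
      fun p hp => by simp [(hz p hp).1]).const_mul ν
  -- At each fixed time the Laplacian is moved from the test function to the kernel.
  have e1 : ∫ p in univ ×ˢ Ioo a b, ν * (G p * Δφ p) =
      ∫ p in univ ×ˢ Ioo a b, ν * (L p * φ p) := by
    rw [IntegrableOn, restrict_strip] at i2 i3
    rw [restrict_strip, integral_prod_symm _ i2, integral_prod_symm _ i3]
    refine setIntegral_congr_fun measurableSet_Ioo fun t ht => ?_
    have ht' := hpos t (Ioo_subset_Icc_self ht)
    rw [integral_const_mul, integral_const_mul]
    congr 1
    have := integral_mul_laplacian (contDiff_heatKernel_sub ht' z) (contDiff_slice hφ t)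
      (hasCompactSupport_slice hc t)
    simp_rw [laplacian_heatKernel_sub_left] at this
    rw [← this]
    simp_rw [laplacian_slice hφ]
    rfl
  have e2 : ∫ p in univ ×ˢ Ioo a b, G p * heatOp ν φ p =
      ∫ p in univ ×ˢ Ioo a b, (G p * φt p + ν * (L p * φ p)) := by
    rw [integral_add i1 i3, ← e1, ← integral_add i1 i2]
    refine integral_congr_ae (Eventually.of_forall fun p => ?_)
    simp only [heatOp, hφt, hΔφ]
    ring
  have i13 : Integrable (fun p => G p * φt p + ν * (L p * φ p))
      (volume.restrict ((univ : Set E) ×ˢ Ioo a b)) := i1.add i3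
  rw [e2]
  rw [restrict_strip] at i13 ⊢
  rw [integral_prod _ i13, ← integral_neg]
  refine integral_congr_ae (Eventually.of_forall fun x => ?_)
  -- By the heat equation the remaining integrand is `d/dt (Gφ)`. Only the boundary term at `a`
  -- survives, since `φ` vanishes at time `b`.
  have hd : ∀ t ∈ uIcc a b, HasDerivAt (fun t => G (x, t) * φ (x, t))
      (G (x, t) * φt (x, t) + ν * (L (x, t) * φ (x, t))) t := by
    intro t ht
    rw [uIcc_of_le hab] at ht
    have := (hasDerivAt_heatKernel_forward hν (hτ.trans_le ht.1) (x - z)).mul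
      (hasDerivAt_slice hφ x t)
    exact this.congr_deriv (by simp only [hG, hL, hφt]; ring)
  have hcx : ContinuousOn (fun t => G (x, t) * φt (x, t) + ν * (L (x, t) * φ (x, t))) (Icc a b) := by
    have hm : MapsTo (fun t : ℝ => (x, t)) (Icc a b) (univ ×ˢ Icc a b) := fun t ht => ⟨trivial, ht⟩
    have hx : ContinuousOn (fun t : ℝ => (x, t)) (Icc a b) := by fun_prop
    exact ((hGc.comp hx hm).mul ((contDiff_dirDeriv hφ _).continuous.comp_continuousOn hx)).add
      (((hLc.comp hx hm).mul (hφ.continuous.comp_continuousOn hx)).const_mul ν)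
  beta_reduce
  rw [← integral_Ioc_eq_integral_Ioo, ← intervalIntegral.integral_of_le hab,
    intervalIntegral.integral_eq_sub_of_hasDerivAt hd
    (ContinuousOn.intervalIntegrable (by rwa [uIcc_of_le hab]))]
  simp [hb, hG]

lemma integrableOn_heatKernel_mul (hν : 0 < ν) {ψ : E × ℝ → ℝ} (hψ : Continuous ψ)
    (hc : HasCompactSupport ψ) (b τ : ℝ) (z : E) :
    IntegrableOn (fun p : E × ℝ => heatKernel (ν * (p.2 - τ)) (p.1 - z) * ψ p)
      (univ ×ˢ Ioo τ b) := by
  obtain ⟨C, hC⟩ := hψ.bounded_above_of_compact_support hc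
  refine (strip_bound (g := fun _ => C) (R := 1)
    (k := fun x t => heatKernel (ν * (t - τ)) (x - z))
    ((Measurable.heatKernel (by fun_prop) (by fun_prop)).mul hψ.measurable).aestronglyMeasurable
    (integrableOn_const (by simp)) (fun _ _ => (norm_nonneg _).trans (hC 0)) ?_ ?_).1
  · intro t ht
    have h0 : 0 < ν * (t - τ) := mul_pos hν (by linarith [ht.1])
    simp_rw [heatKernel_sub_comm _ _ z]
    exact ⟨integrable_heatKernel_sub h0 z, (integral_heatKernel_sub h0 z).le⟩
  · intro x t ht
    have h0 : 0 < ν * (t - τ) := mul_pos hν (by linarith [ht.1])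
    simp only [Pi.mul_apply]
    rw [abs_mul, abs_of_pos (heatKernel_pos h0 _), mul_comm]
    exact mul_le_mul_of_nonneg_right (hC _) (heatKernel_pos h0 _).le

/-- Representation of test functions by the heat kernel. -/
lemma integral_heatKernel_mul_heatOp (hν : 0 < ν) {φ : E × ℝ → ℝ} (hφ : ContDiff ℝ ∞ φ)
    (hc : HasCompactSupport φ) {b τ : ℝ} (hτb : τ < b) (hb : ∀ x, φ (x, b) = 0) (z : E) :
    ∫ p in univ ×ˢ Ioo τ b, heatKernel (ν * (p.2 - τ)) (p.1 - z) * heatOp ν φ p = -φ (z, τ) := by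
  -- The singular starting time is approached from above: the strips exhaust the full one, and the
  -- boundary terms converge to `φ(z, τ)` as averages against an approximate identity.
  set a : ℕ → ℝ := fun k => τ + (b - τ) / (k + 1) with ha
  have hbτ : 0 < b - τ := sub_pos.2 hτb
  have haτ : ∀ k, τ < a k := fun k => by
    have : 0 < (b - τ) / ((k : ℝ) + 1) := by positivity
    simp only [ha]; linarith
  have hab : ∀ k, a k ≤ b := fun k => by
    have : (b - τ) / ((k : ℝ) + 1) ≤ b - τ := div_le_self hbτ.le (by simp)
    simp only [ha]; linarith
  have halim : Tendsto a atTop (𝓝 τ) := by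
    have : Tendsto (fun k : ℕ => (b - τ) * (1 / ((k : ℝ) + 1))) atTop (𝓝 ((b - τ) * 0)) :=
      tendsto_one_div_add_atTop_nhds_zero_nat.const_mul _
    have := this.const_add τ
    simpa [ha, div_eq_mul_inv] using this
  have hanti : Antitone a := fun j k hjk => by
    simp only [ha]
    gcongr
  set S : ℕ → Set (E × ℝ) := fun k => univ ×ˢ Ioo (a k) b with hS
  have hSm : Monotone S := fun j k hjk => prod_mono le_rfl (Ioo_subset_Ioo_left (hanti hjk))
  have hU : ⋃ k, S k = univ ×ˢ Ioo τ b := by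
    ext p
    simp only [hS, mem_iUnion, mem_prod, mem_univ, true_and, mem_Ioo]
    refine ⟨fun ⟨k, h1, h2⟩ => ⟨(haτ k).trans h1, h2⟩, fun ⟨h1, h2⟩ => ?_⟩
    obtain ⟨k, hk⟩ := (halim.eventually (gt_mem_nhds h1)).exists
    exact ⟨k, hk, h2⟩
  have hint := integrableOn_heatKernel_mul hν (contDiff_heatOp hφ ν).continuous
    (hasCompactSupport_heatOp hc ν) b τ z
  have l1 := tendsto_setIntegral_of_monotone (μ := volume) (s := S)
    (fun k => measurableSet_strip _ _) hSm (by rwa [hU])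
  rw [hU] at l1
  obtain ⟨C, hC⟩ := hφ.continuous.bounded_above_of_compact_support hc
  have l2 : Tendsto (fun k => ∫ w, heatKernel (ν * (a k - τ)) w * φ (w + z, a k)) atTop
      (𝓝 (φ (z, τ))) := by
    refine tendsto_integral_heatKernel_mul (A := C) (B := 0) ?_ ?_ ?_ ?_ ?_
    · simpa using (halim.sub_const τ).const_mul ν
    · exact Eventually.of_forall fun k => mul_pos hν (sub_pos.2 (haτ k))
    · exact Eventually.of_forall fun k w => by simpa using hC (w + z, a k)
    · exact Eventually.of_forall fun k =>
        (hφ.continuous.comp (by fun_prop)).aestronglyMeasurable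
    · have h1 : Tendsto (fun p : ℕ × E => (p.2 + z, a p.1)) (atTop ×ˢ 𝓝 0) (𝓝 (0 + z, τ)) :=
        Tendsto.prodMk_nhds (tendsto_snd.add_const z) (halim.comp tendsto_fst)
      have := (hφ.continuous.tendsto (0 + z, τ)).comp h1
      simpa [Function.comp_def] using this
  refine tendsto_nhds_unique l1 (l2.neg.congr fun k => ?_)
  rw [integral_heatKernel_mul_heatOp_of_lt hν hφ hc (haτ k) (hab k) hb z,
    ← integral_add_right_eq_self (fun x => heatKernel (ν * (a k - τ)) (x - z) * φ (x, a k)) z]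
  simp

/-- Integrating by parts in space moves the derivative from the kernel to `heatOp ν φ`, where it
commutes with the heat operator. The claim is then the representation of the derivative of `φ` in
direction `ξ`. -/
lemma integral_heatKernel_grad_mul_heatOp (hν : 0 < ν) {φ : E × ℝ → ℝ} (hφ : ContDiff ℝ ∞ φ)
    (hc : HasCompactSupport φ) {b τ : ℝ} (hτb : τ < b) (hb : tsupport φ ⊆ univ ×ˢ Iio b)
    (z ξ : E) :
    IntegrableOn (fun p : E × ℝ => heatKernel (ν * (p.2 - τ)) (p.1 - z) *
      (inner ℝ (p.1 - z) ξ / (2 * (ν * (p.2 - τ)))) * heatOp ν φ p) (univ ×ˢ Ioo τ b) ∧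
    ∫ p in univ ×ˢ Ioo τ b, heatKernel (ν * (p.2 - τ)) (p.1 - z) *
      (inner ℝ (p.1 - z) ξ / (2 * (ν * (p.2 - τ)))) * heatOp ν φ p = -dirDeriv (ξ, 0) φ (z, τ) := by
  have hgf := gaussFactor_pos (E := E)
  have hψ := contDiff_heatOp hφ ν
  have hψc := hasCompactSupport_heatOp hc ν
  obtain ⟨C, hC⟩ := hψ.continuous.bounded_above_of_compact_support hψc
  have hC0 : 0 ≤ C := (norm_nonneg _).trans (hC 0)
  have hint : IntegrableOn (fun p : E × ℝ => heatKernel (ν * (p.2 - τ)) (p.1 - z) *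
      (inner ℝ (p.1 - z) ξ / (2 * (ν * (p.2 - τ)))) * heatOp ν φ p) (univ ×ˢ Ioo τ b) := by
    have hg : IntegrableOn (fun t => C * gaussFactor E * (‖ξ‖ / Real.sqrt (ν * (t - τ))))
        (Ioo τ b) := by
      -- The singularity now sits at the left endpoint; the earlier integrability statement is
      -- reflected in time.
      have h1 := (integrableOn_div_sqrt (M := ‖ξ‖) hν (-b) (-τ)).comp_neg
      have e : (fun t => ‖ξ‖ / Real.sqrt (ν * (-τ - -t))) =
          fun t => ‖ξ‖ / Real.sqrt (ν * (t - τ)) := by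
        ext t; congr 3; ring
      rw [e] at h1
      simp only [neg_Ioo, neg_neg] at h1
      exact h1.const_mul _
    refine (strip_bound (R := 1) (k := fun x t => heatKernel (2 * (ν * (t - τ))) (x - z)) ?_ hg
      ?_ ?_ ?_).1
    · exact (((Measurable.heatKernel (by fun_prop) (by fun_prop)).mul (by fun_prop)).mul
        hψ.continuous.measurable).aestronglyMeasurable
    · intro t ht; positivity
    · intro t ht
      have h0 : 0 < 2 * (ν * (t - τ)) := mul_pos two_pos (mul_pos hν (by linarith [ht.1]))
      simp_rw [heatKernel_sub_comm _ _ z]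
      exact ⟨integrable_heatKernel_sub h0 z, (integral_heatKernel_sub h0 z).le⟩
    · intro x t ht
      have h0 : 0 < ν * (t - τ) := mul_pos hν (by linarith [ht.1])
      have h1 := abs_drift_kernel_le (M := ‖ξ‖) (V₀ := 0) (v₀ := 0) (ξ := ξ) h0 le_rfl (by simp)
        (x - z)
      simp only [zero_add, add_zero] at h1
      rw [abs_mul]
      calc _ ≤ gaussFactor E * (‖ξ‖ / Real.sqrt (ν * (t - τ))) *
            heatKernel (2 * (ν * (t - τ))) (x - z) * C :=
            mul_le_mul h1 (hC _) (abs_nonneg _) ((abs_nonneg _).trans h1)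
        _ = _ := by ring
  refine ⟨hint, ?_⟩
  have h1 := integral_heatKernel_mul_heatOp hν (contDiff_dirDeriv hφ (ξ, 0))
    (hasCompactSupport_dirDeriv hc (ξ, 0)) hτb (fun x => image_eq_zero_of_notMem_tsupport fun h =>
      lt_irrefl b (hb (tsupport_dirDeriv_subset _ _ h)).2) z
  rw [← h1, heatOp_dirDeriv hφ]
  have hint2 := integrableOn_heatKernel_mul hν (contDiff_dirDeriv hψ (ξ, 0)).continuous
    (hasCompactSupport_dirDeriv hψc (ξ, 0)) b τ z
  rw [IntegrableOn, restrict_strip] at hint hint2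
  rw [restrict_strip, integral_prod_symm _ hint, integral_prod_symm _ hint2]
  refine setIntegral_congr_fun measurableSet_Ioo fun t ht => ?_
  have h0 : 0 < ν * (t - τ) := mul_pos hν (by linarith [ht.1])
  simp only
  simp_rw [← dirDeriv_slice hψ]
  rw [integral_mul_dirDeriv (contDiff_infty.1 (contDiff_heatKernel_sub h0 z) 1)
    (contDiff_infty.1 (contDiff_slice hψ t) 1) (hasCompactSupport_slice hψc t), ← integral_neg]
  refine integral_congr_ae (Eventually.of_forall fun x => ?_)
  have hd : dirDeriv ξ (fun y => heatKernel (ν * (t - τ)) (y - z)) x =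
      -(heatKernel (ν * (t - τ)) (x - z) * (inner ℝ (x - z) ξ / (2 * (ν * (t - τ))))) := by
    have := (hasFDerivAt_heatKernel (ν * (t - τ)) (x - z)).comp x ((hasFDerivAt_id x).sub_const z)
    change fderiv ℝ ((fun y => heatKernel (ν * (t - τ)) y) ∘ fun y => id y - z) x ξ = _
    rw [this.fderiv]
    change inner ℝ ((-(1 / (2 * (ν * (t - τ)))) * heatKernel (ν * (t - τ)) (x - z)) • (x - z)) ξ = _
    rw [real_inner_smul_left]
    ring
  simp only [hd]
  ring

end HeatRepresentation

end AdvectionDiffusion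

namespace AdvectionDiffusion

/-! ### The fundamental solution as a distributional solution -/

section MildToWeak

variable {E : Type*} [NormedAddCommGroup E] [InnerProductSpace ℝ E] [FiniteDimensional ℝ E]
  [MeasurableSpace E] [BorelSpace E]
  {ν M : ℝ} {m v : ℝ → ℝ} {U : E → ℝ → E} {V : E → ℝ → ℝ}

lemma setOf_lt_inter_strip {s t b : ℝ} (h : t ≤ b) :
    {q : E × ℝ | q.2 < t} ∩ univ ×ˢ Ioo s b = univ ×ˢ Ioo s t := by
  ext q
  simp only [mem_inter_iff, mem_ofPred_eq, mem_prod, mem_univ, true_and, mem_Ioo]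
  exact ⟨fun ⟨h1, h2, _⟩ => ⟨h2, h1⟩, fun ⟨h1, h2⟩ => ⟨h2, h1, h2.trans_le h⟩⟩

lemma setOf_gt_inter_strip {s τ b : ℝ} (h : s ≤ τ) :
    {p : E × ℝ | τ < p.2} ∩ univ ×ˢ Ioo s b = univ ×ˢ Ioo τ b := by
  ext q
  simp only [mem_inter_iff, mem_ofPred_eq, mem_prod, mem_univ, true_and, mem_Ioo]
  exact ⟨fun ⟨h1, _, h2⟩ => ⟨h1, h2⟩, fun ⟨h1, h2⟩ => ⟨h1, h.trans_lt h1, h2⟩⟩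

lemma setIntegral_indicator_lt {s t b : ℝ} (h : t ≤ b) (f : E × ℝ → ℝ) :
    ∫ q in univ ×ˢ Ioo s b, {q : E × ℝ | q.2 < t}.indicator f q = ∫ q in univ ×ˢ Ioo s t, f q := by
  have hm : MeasurableSet {q : E × ℝ | q.2 < t} := measurableSet_lt (by fun_prop) (by fun_prop)
  rw [integral_indicator hm, Measure.restrict_restrict hm, setOf_lt_inter_strip h]

lemma integrable_indicator_lt {s t b : ℝ} (h : t ≤ b) {f : E × ℝ → ℝ}
    (hf : IntegrableOn f (univ ×ˢ Ioo s t)) :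
    IntegrableOn ({q : E × ℝ | q.2 < t}.indicator f) (univ ×ˢ Ioo s b) := by
  have hm : MeasurableSet {q : E × ℝ | q.2 < t} := measurableSet_lt (by fun_prop) (by fun_prop)
  rw [IntegrableOn, integrable_indicator_iff hm, IntegrableOn, Measure.restrict_restrict hm,
    setOf_lt_inter_strip h]
  exact hf

lemma setIntegral_indicator_gt {s τ b : ℝ} (h : s ≤ τ) (f : E × ℝ → ℝ) :
    ∫ q in univ ×ˢ Ioo s b, {q : E × ℝ | τ < q.2}.indicator f q = ∫ q in univ ×ˢ Ioo τ b, f q := by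
  have hm : MeasurableSet {q : E × ℝ | τ < q.2} := measurableSet_lt (by fun_prop) (by fun_prop)
  rw [integral_indicator hm, Measure.restrict_restrict hm, setOf_gt_inter_strip h]

/-- The functions given by Duhamel's kernel are reproduced in the weak formulation. -/
lemma integral_duhamelKernel_mul_heatOp (hν : 0 < ν) {φ : E × ℝ → ℝ} (hφ : ContDiff ℝ ∞ φ)
    (hc : HasCompactSupport φ) {b τ : ℝ} (hτb : τ < b) (hb : tsupport φ ⊆ univ ×ˢ Iio b) (z : E) :
    ∫ p in univ ×ˢ Ioo τ b, duhamelKernel ν U V p.1 p.2 z τ * heatOp ν φ p =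
      -(dirDeriv (U z τ, 0) φ (z, τ) + V z τ * φ (z, τ)) := by
  obtain ⟨i1, e1⟩ := integral_heatKernel_grad_mul_heatOp hν hφ hc hτb hb z (U z τ)
  have i2 := integrableOn_heatKernel_mul hν (contDiff_heatOp hφ ν).continuous
    (hasCompactSupport_heatOp hc ν) b τ z
  have e2 := integral_heatKernel_mul_heatOp hν hφ hc hτb (fun x =>
    image_eq_zero_of_notMem_tsupport fun h => lt_irrefl b (hb h).2) z
  have : ∀ p : E × ℝ, duhamelKernel ν U V p.1 p.2 z τ * heatOp ν φ p =
      heatKernel (ν * (p.2 - τ)) (p.1 - z) *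
      (inner ℝ (p.1 - z) (U z τ) / (2 * (ν * (p.2 - τ)))) * heatOp ν φ p +
      V z τ * (heatKernel (ν * (p.2 - τ)) (p.1 - z) * heatOp ν φ p) := by
    intro p
    simp only [duhamelKernel]
    ring
  simp_rw [this]
  rw [integral_add i1 (i2.const_mul _), e1, integral_const_mul, e2]
  ring

/-- The fundamental solution solves the equation in the sense of distributions. -/
theorem Coeff.weak_fundSol (h : Coeff ν M m v U V) (y : E) (s : ℝ) {φ : E × ℝ → ℝ}
    (hφ : ContDiff ℝ ∞ φ) (hc : HasCompactSupport φ) (hsupp : tsupport φ ⊆ univ ×ˢ Ioi s) :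
    ∫ p : E × ℝ, fundSol ν U V p.1 p.2 y s * adjOp ν U V φ p = 0 := by
  have hν := h.ν_pos
  have hgf := gaussFactor_pos (E := E)
  obtain ⟨A, lam, hA, hlam, hcont, hbound, hduh⟩ := h.fundSol_spec
  obtain ⟨b, hsb, hb⟩ : ∃ b, s < b ∧ tsupport φ ⊆ univ ×ˢ Iio b := by
    obtain ⟨b, hb⟩ := (hc.isCompact.image continuous_snd).bddAbove
    refine ⟨max b s + 1, by linarith [le_max_right b s], fun p hp => ⟨trivial, ?_⟩⟩
    have := hb (mem_image_of_mem _ hp)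
    change p.2 < _
    linarith [le_max_left b s]
  set S : Set (E × ℝ) := univ ×ˢ Ioo s b with hS
  set Φ : E → ℝ → ℝ := fun z τ => fundSol ν U V z τ y s with hΦ
  set ψ := heatOp ν φ with hψ
  have hψs := contDiff_heatOp hφ ν
  have hψc := hasCompactSupport_heatOp hc ν
  obtain ⟨C, hC⟩ := hψs.continuous.bounded_above_of_compact_support hψc
  have hC0 : 0 ≤ C := (norm_nonneg _).trans (hC 0)
  have hSm : MeasurableSet S := measurableSet_strip s b
  have hΦm : ∀ t, AEStronglyMeasurable (fun q : E × ℝ => Φ q.1 q.2)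
      (volume.restrict (univ ×ˢ Ioo s t)) := fun t => aestronglyMeasurable_strip hcont y s t
  have hrest : ∫ p : E × ℝ, Φ p.1 p.2 * adjOp ν U V φ p =
      ∫ p in S, Φ p.1 p.2 * adjOp ν U V φ p := by
    refine (setIntegral_eq_integral_of_forall_compl_eq_zero fun p hp => ?_).symm
    rw [adjOp_eq_zero, mul_zero]
    exact notMem_tsupport_iff_eventuallyEq.1 fun hh => hp ⟨trivial, (hsupp hh).2, (hb hh).2⟩
  -- the integrand of Duhamel's formula tested against `ψ`
  set K : E × ℝ → E × ℝ → ℝ := fun p q => duhamelKernel ν U V p.1 p.2 q.1 q.2 * Φ q.1 q.2 with hK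
  set H : (E × ℝ) × (E × ℝ) → ℝ := fun r =>
    ψ r.1 * {q : E × ℝ | q.2 < r.1.2}.indicator (K r.1) r.2 with hH
  -- The Gaussian bound comes with its own weight `lam`, which is frozen into the constant `A'` on
  -- `(s, b)`. The second weight `lam'` only serves to bound the Duhamel integrals uniformly in `t <
  -- b`.
  obtain ⟨lam', hlam', hq⟩ := exists_integral_rate_mul_exp_le (c := gaussFactor E) (M := M)
    hgf.le hν h.M_nonneg h.v_int h.v_nonneg one_pos
  set A' := A * Real.exp (lam * (b - s)) with hA'
  have hA'0 : 0 ≤ A' := by positivity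
  set N := C * (1 * A' * Real.exp (lam' * (b - s))) with hN
  have hN0 : 0 ≤ N := by positivity
  have hpos : ∀ t ∈ Ioo s b, 0 < 2 * (ν * (t - s)) := fun t ht =>
    mul_pos two_pos (mul_pos hν (sub_pos.2 ht.1))
  have hKint : ∀ x : E, ∀ t ∈ Ioo s b, IntegrableOn (K (x, t)) (univ ×ˢ Ioo s t) ∧
      ∫ q in univ ×ˢ Ioo s t, |K (x, t) q| ≤
        1 * A' * Real.exp (lam' * (t - s)) * heatKernel (2 * (ν * (t - s))) (x - y) := by
    intro x t ht
    obtain ⟨h1, h2, -⟩ := h.duhamel_gauss_bound (F := Φ) (lam := lam') (y := y) (x := x) hA'0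
      (hq s t) ht.1 (hΦm t) fun z τ hτ => by
        refine (hbound z τ y s hτ.1).trans (mul_le_mul_of_nonneg_right ?_
          (heatKernel_pos (hpos τ ⟨hτ.1, hτ.2.trans ht.2⟩) _).le)
        have e1 : Real.exp (lam * (τ - s)) ≤ Real.exp (lam * (b - s)) := by
          have := hτ.2.trans ht.2
          gcongr
        have e2 : 1 ≤ Real.exp (lam' * (τ - s)) :=
          Real.one_le_exp (mul_nonneg hlam'.le (by linarith [hτ.1]))
        calc A * Real.exp (lam * (τ - s)) ≤ A' := mul_le_mul_of_nonneg_left e1 hA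
          _ ≤ A' * Real.exp (lam' * (τ - s)) := le_mul_of_one_le_right hA'0 e2
    exact ⟨h1, h2⟩
  have hψm : Measurable ψ := hψs.continuous.measurable
  have hHm : AEStronglyMeasurable H ((volume.restrict S).prod (volume.restrict S)) := by
    have m1 : Measurable fun r : (E × ℝ) × (E × ℝ) =>
        duhamelKernel ν U V r.1.1 r.1.2 r.2.1 r.2.2 :=
      h.measurable_duhamelKernel (by fun_prop) (by fun_prop) (by fun_prop) (by fun_prop)
    have m2 : AEStronglyMeasurable (fun r : (E × ℝ) × (E × ℝ) => Φ r.2.1 r.2.2)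
        ((volume.restrict S).prod (volume.restrict S)) := (hΦm b).comp_snd
    have m3 : MeasurableSet {r : (E × ℝ) × (E × ℝ) | r.2.2 < r.1.2} :=
      measurableSet_lt (by fun_prop) (by fun_prop)
    have e : H = fun r => ψ r.1 * {r : (E × ℝ) × (E × ℝ) | r.2.2 < r.1.2}.indicator
        (fun r => duhamelKernel ν U V r.1.1 r.1.2 r.2.1 r.2.2 * Φ r.2.1 r.2.2) r := by
      ext r
      simp only [hH, hK, indicator, mem_ofPred_eq]
    rw [e]
    exact (hψm.comp measurable_fst).aestronglyMeasurable.mul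
      ((m1.aestronglyMeasurable.mul m2).indicator m3)
  have hg1 : IntegrableOn (fun p : E × ℝ => N * heatKernel (2 * (ν * (p.2 - s))) (p.1 - y)) S := by
    refine (strip_bound (g := fun _ => N) (R := 1)
      (k := fun x t => heatKernel (2 * (ν * (t - s))) (x - y))
      ((Measurable.heatKernel (by fun_prop) (by fun_prop)).const_mul N).aestronglyMeasurable
      (integrableOn_const (by simp)) (fun _ _ => hN0) ?_ ?_).1
    · intro t ht
      simp_rw [heatKernel_sub_comm _ _ y]
      exact ⟨integrable_heatKernel_sub (hpos t ht) y, (integral_heatKernel_sub (hpos t ht) y).le⟩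
    · intro x t ht
      exact (abs_of_nonneg (mul_nonneg hN0 (heatKernel_pos (hpos t ht) _).le)).le
  have hHi : Integrable H ((volume.restrict S).prod (volume.restrict S)) := by
    rw [integrable_prod_iff hHm]
    constructor
    · filter_upwards [ae_restrict_mem hSm] with p hp
      exact (integrable_indicator_lt hp.2.2.le (hKint p.1 p.2 hp.2).1).const_mul (ψ p)
    · refine hg1.mono' hHm.norm.integral_prod_right' ?_
      filter_upwards [ae_restrict_mem hSm] with p hp
      obtain ⟨h1, h2⟩ := hKint p.1 p.2 hp.2
      have e : ∫ q, ‖H (p, q)‖ ∂(volume.restrict S) =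
          |ψ p| * ∫ q in univ ×ˢ Ioo s p.2, |K p q| := by
        rw [← setIntegral_indicator_lt hp.2.2.le, ← integral_const_mul]
        refine integral_congr_ae (Eventually.of_forall fun q => ?_)
        simp only [hH, norm_mul, Real.norm_eq_abs, indicator]
        split_ifs <;> simp
      rw [e, Real.norm_of_nonneg (mul_nonneg (abs_nonneg _)
        (integral_nonneg fun _ => abs_nonneg _))]
      have hG := heatKernel_pos (hpos p.2 hp.2) (p.1 - y)
      calc |ψ p| * ∫ q in univ ×ˢ Ioo s p.2, |K p q|
          ≤ C * (1 * A' * Real.exp (lam' * (p.2 - s)) *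
              heatKernel (2 * (ν * (p.2 - s))) (p.1 - y)) :=
            mul_le_mul (hC p) h2 (integral_nonneg fun _ => abs_nonneg _) hC0
        _ ≤ C * (1 * A' * Real.exp (lam' * (b - s)) *
              heatKernel (2 * (ν * (p.2 - s))) (p.1 - y)) := by
            have := hp.2.2.le
            gcongr
        _ = _ := by rw [hN]; ring
  have hin1 : ∀ p ∈ S, ∫ q, H (p, q) ∂(volume.restrict S) = duhamel ν U V Φ s p.1 p.2 * ψ p := by
    intro p hp
    simp only [hH]
    rw [integral_const_mul, setIntegral_indicator_lt hp.2.2.le, mul_comm]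
    rfl
  have hin2 : ∀ q ∈ S, ∫ p, H (p, q) ∂(volume.restrict S) =
      -(Φ q.1 q.2 * (dirDeriv (U q.1 q.2, 0) φ q + V q.1 q.2 * φ q)) := by
    intro q hq
    have e : ∀ p, H (p, q) = Φ q.1 q.2 * {p : E × ℝ | q.2 < p.2}.indicator
        (fun p => duhamelKernel ν U V p.1 p.2 q.1 q.2 * ψ p) p := by
      intro p
      simp only [hH, hK, indicator, mem_ofPred_eq]
      split_ifs
      · ring
      · simp
    simp_rw [e]
    rw [integral_const_mul, setIntegral_indicator_gt hq.2.1.le,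
      integral_duhamelKernel_mul_heatOp hν hφ hc hq.2.2 hb q.1]
    ring
  have j1 : IntegrableOn (fun p => duhamel ν U V Φ s p.1 p.2 * ψ p) S :=
    hHi.integral_prod_left.congr (by
      filter_upwards [ae_restrict_mem hSm] with p hp using hin1 p hp)
  have j2 : IntegrableOn (fun q => -(Φ q.1 q.2 * (dirDeriv (U q.1 q.2, 0) φ q +
      V q.1 q.2 * φ q))) S :=
    hHi.integral_prod_right.congr (by
      filter_upwards [ae_restrict_mem hSm] with q hq using hin2 q hq)
  have j3 : IntegrableOn (fun p => heatKernel (ν * (p.2 - s)) (p.1 - y) * ψ p) S :=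
    integrableOn_heatKernel_mul hν hψs.continuous hψc b s y
  -- The potential of the free kernel returns `-φ(y, s)`, which is zero because `φ` is supported
  -- after time `s`.
  have e3 : ∫ p in S, heatKernel (ν * (p.2 - s)) (p.1 - y) * ψ p = 0 := by
    rw [integral_heatKernel_mul_heatOp hν hφ hc hsb (fun x =>
      image_eq_zero_of_notMem_tsupport fun h => lt_irrefl b (hb h).2) y,
      image_eq_zero_of_notMem_tsupport (x := (y, s)) fun h => lt_irrefl s (hsupp h).2,
      neg_zero]
  -- Fubini on time-ordered pairs. Integrating first in the earlier point gives the Duhamel term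
  -- tested against `heatOp ν φ`; integrating first in the later point gives the lower order terms
  -- of the adjoint, by the potential representation.
  have e12 : ∫ p in S, duhamel ν U V Φ s p.1 p.2 * ψ p = ∫ q in S, -(Φ q.1 q.2 *
      (dirDeriv (U q.1 q.2, 0) φ q + V q.1 q.2 * φ q)) := by
    rw [← setIntegral_congr_fun hSm hin1, ← setIntegral_congr_fun hSm hin2]
    exact integral_integral_swap hHi
  rw [hrest, setIntegral_congr_fun hSm (g := fun p => (heatKernel (ν * (p.2 - s)) (p.1 - y) * ψ p +
    duhamel ν U V Φ s p.1 p.2 * ψ p) - -(Φ p.1 p.2 * (dirDeriv (U p.1 p.2, 0) φ p +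
      V p.1 p.2 * φ p))) fun p hp => ?_]
  · rw [integral_sub (f := fun p => heatKernel (ν * (p.2 - s)) (p.1 - y) * ψ p +
      duhamel ν U V Φ s p.1 p.2 * ψ p) (j3.add j1) j2, integral_add j3 j1, e3, e12]
    ring
  · simp only
    rw [adjOp_eq_heatOp hφ, ← add_mul, ← hduh p.1 p.2 y s hp.2.1]
    ring

end MildToWeak

end AdvectionDiffusion

namespace AdvectionDiffusion

/-! ### The Cauchy-Schwarz inequality for extended non-negative functions -/

section Kernels

variable {E : Type*} [MeasurableSpace E] {μ : Measure E} [SFinite μ]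

lemma sq_lintegral_mul_le {f g : E → ℝ≥0∞} (hf : AEMeasurable f μ) (hg : AEMeasurable g μ) :
    (∫⁻ x, f x * g x ∂μ) ^ 2 ≤ (∫⁻ x, f x ^ 2 ∂μ) * ∫⁻ x, g x ^ 2 ∂μ := by
  have h := ENNReal.lintegral_mul_le_Lp_mul_Lq μ Real.HolderConjugate.two_two hf hg
  simp only [Pi.mul_apply, ENNReal.rpow_two] at h
  refine (pow_le_pow_left₀ zero_le h 2).trans_eq ?_
  rw [mul_pow, ← ENNReal.rpow_natCast, ← ENNReal.rpow_natCast, ← ENNReal.rpow_mul,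
    ← ENNReal.rpow_mul]
  norm_num

end Kernels

/-! ### Contractive kernels -/

section Kernels

/-- The integral operator with kernel `K`. -/
noncomputable def kop {E : Type*} [MeasureSpace E] (K : E → E → ℝ≥0∞) (f : E → ℝ≥0∞) (x : E) :
    ℝ≥0∞ :=
  ∫⁻ y, K x y * f y

/-- A measurable kernel all of whose row and column sums are at most one. -/
structure IsContractive {E : Type*} [MeasureSpace E] (K : E → E → ℝ≥0∞) : Prop where
  meas : Measurable (fun p : E × E => K p.1 p.2)
  row : ∀ x, ∫⁻ y, K x y ≤ 1
  col : ∀ y, ∫⁻ x, K x y ≤ 1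

variable {E : Type*} [MeasureSpace E] [SFinite (volume : Measure E)] {K : E → E → ℝ≥0∞}
  {f g : E → ℝ≥0∞}

lemma IsContractive.flip (hK : IsContractive K) : IsContractive (fun x y => K y x) :=
  ⟨hK.meas.comp measurable_swap, hK.col, hK.row⟩

lemma IsContractive.measurable_kop (hK : IsContractive K) (hf : Measurable f) :
    Measurable (kop K f) :=
  Measurable.lintegral_prod_right' (f := fun p : E × E => K p.1 p.2 * f p.2)
    (hK.meas.mul (hf.comp measurable_snd))

lemma IsContractive.lintegral_mul_kop (hK : IsContractive K) (hf : Measurable f)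
    (hg : Measurable g) :
    ∫⁻ x, g x * kop K f x = ∫⁻ y, kop (fun y x => K x y) g y * f y := by
  have h1 : ∀ x, g x * kop K f x = ∫⁻ y, g x * (K x y * f y) := fun x => by
    rw [kop, lintegral_const_mul]
    exact (hK.meas.comp measurable_prodMk_left).mul hf
  have h2 : ∀ y, kop (fun y x => K x y) g y * f y = ∫⁻ x, g x * (K x y * f y) := fun y => by
    rw [kop, ← lintegral_mul_const]
    · refine lintegral_congr fun x => ?_
      ring
    · exact (hK.meas.comp measurable_prodMk_right).mul hg
  simp_rw [h1, h2]
  refine lintegral_lintegral_swap (Measurable.aemeasurable ?_)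
  exact (hg.comp measurable_fst).mul (hK.meas.mul (hf.comp measurable_snd))

lemma IsContractive.lintegral_kop_le (hK : IsContractive K) (hf : Measurable f) :
    ∫⁻ x, kop K f x ≤ ∫⁻ x, f x := by
  have := hK.lintegral_mul_kop hf (measurable_const (a := (1 : ℝ≥0∞)))
  simp only [one_mul] at this
  rw [this]
  refine lintegral_mono fun y => ?_
  simp only [kop, mul_one]
  exact mul_le_of_le_one_left zero_le (hK.col y)

/-- Schur's test: the measure `K x y dy` has mass at most one, so `(Kf)² ≤ K(f²)` pointwise by
Cauchy-Schwarz, and the contraction in `L¹` finishes. -/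
lemma IsContractive.lintegral_kop_sq_le (hK : IsContractive K) (hf : Measurable f) :
    ∫⁻ x, kop K f x ^ 2 ≤ ∫⁻ x, f x ^ 2 := by
  refine (lintegral_mono fun x => ?_).trans (hK.lintegral_kop_le (hf.pow_const 2))
  have hKx : Measurable (K x) := hK.meas.comp measurable_prodMk_left
  have h := sq_lintegral_mul_le (μ := volume.withDensity (K x)) (f := fun _ => 1) (g := f)
    aemeasurable_const hf.aemeasurable
  have e : ∀ φ : E → ℝ≥0∞, Measurable φ → ∫⁻ y, φ y ∂volume.withDensity (K x) = kop K φ x :=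
    fun φ hφ => by rw [lintegral_withDensity_eq_lintegral_mul _ hKx hφ]; rfl
  simp only [one_mul, one_pow] at h
  rw [e f hf, e _ (hf.pow_const 2), e _ measurable_const] at h
  refine h.trans (mul_le_of_le_one_left zero_le ?_)
  simpa [kop] using hK.row x

end Kernels

/-! ### Discrete Nash estimates -/

section Nash

lemma one_add_inv_pow_le {N : ℕ} (hN : 1 ≤ N) : ((N + 1 : ℝ) / N) ^ N ≤ 4 := by
  have hN0 : (0 : ℝ) < N := by exact_mod_cast hN
  have h1 : (N + 1 : ℝ) / N ≤ Real.exp (1 / N) := by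
    have := Real.add_one_le_exp (1 / (N : ℝ))
    rwa [add_div, div_self hN0.ne', add_comm]
  calc ((N + 1 : ℝ) / N) ^ N ≤ Real.exp (1 / N) ^ N := by gcongr
    _ = Real.exp 1 := by rw [← Real.exp_nat_mul]; congr 1; field_simp
    _ ≤ 4 := by linarith [Real.exp_one_lt_d9]

/-- Discrete form of Nash's differential inequality. -/
lemma le_of_nash_recursion {y : ℕ → ℝ≥0∞} {b : ℝ≥0∞} {r : ℝ} (hr : 0 ≤ r)
    (h : ∀ N m : ℕ, 1 ≤ m →
      y (N + 1) ^ m ≤ y N ^ (m - 1) * (ENNReal.ofReal ((1 / m : ℝ) ^ r) * b)) :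
    ∀ N : ℕ, 1 ≤ N → y N ≤ ENNReal.ofReal ((4 / N : ℝ) ^ r) * b := by
  intro N hN
  induction N, hN using Nat.le_induction with
  | base =>
    have := h 0 1 le_rfl
    simp only [pow_one, Nat.sub_self, pow_zero, one_mul, zero_add, Nat.cast_one] at this ⊢
    refine this.trans (mul_le_mul_left (ENNReal.ofReal_le_ofReal ?_) _)
    exact Real.rpow_le_rpow (by norm_num) (by norm_num) hr
  | succ N hN ih =>
    have hN0 : (0 : ℝ) < N := by exact_mod_cast hN
    -- The free exponent is taken to be `m = N + 1`. With the induction hypothesis the powers of `b`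
    -- match, and the quotient of the time factors is `((N + 1)/N)^N ≤ 4`; hence the constant 4.
    have h1 := h N (N + 1) (by omega)
    rw [Nat.add_sub_cancel] at h1
    have h2 : y (N + 1) ^ (N + 1) ≤ (ENNReal.ofReal ((4 / ((N + 1 : ℕ) : ℝ)) ^ r) * b) ^ (N + 1) := by
      refine h1.trans ((mul_le_mul_left (pow_le_pow_left₀ zero_le ih N) _).trans ?_)
      rw [mul_pow, mul_pow, mul_mul_mul_comm, ← pow_succ, ← ENNReal.ofReal_pow (by positivity),
        ← ENNReal.ofReal_pow (by positivity), ← ENNReal.ofReal_mul (by positivity)]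
      refine mul_le_mul_left (ENNReal.ofReal_le_ofReal ?_) _
      rw [Real.rpow_pow_comm (by positivity), Real.rpow_pow_comm (by positivity),
        ← Real.mul_rpow (by positivity) (by positivity)]
      refine Real.rpow_le_rpow (by positivity) ?_ hr
      have h3 := one_add_inv_pow_le hN
      push_cast
      calc (4 / (N : ℝ)) ^ N * (1 / (N + 1))
          = (4 / (N + 1 : ℝ)) ^ N * ((N + 1 : ℝ) / N) ^ N * (1 / (N + 1)) := by
            rw [← mul_pow]; congr 2; field_simp
        _ ≤ (4 / (N + 1 : ℝ)) ^ N * 4 * (1 / (N + 1)) := by gcongr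
        _ = (4 / (N + 1 : ℝ)) ^ (N + 1) := by rw [pow_succ]; ring
    exact (ENNReal.pow_le_pow_left_iff (by omega)).1 h2

variable {E : Type*} [NormedAddCommGroup E] [InnerProductSpace ℝ E] [FiniteDimensional ℝ E]
  [MeasurableSpace E] [BorelSpace E]

/-- The heat kernel as a kernel with values in `[0, ∞]`. -/
noncomputable def gaussK (a : ℝ) (x z : E) : ℝ≥0∞ := ENNReal.ofReal (heatKernel a (x - z))

lemma gaussK_comm (a : ℝ) (x z : E) : gaussK a x z = gaussK a z x := by
  rw [gaussK, gaussK, heatKernel_sub_comm]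

lemma lintegral_gaussK {a : ℝ} (ha : 0 < a) (x : E) : ∫⁻ z, gaussK a x z = 1 := by
  simp only [gaussK]
  rw [← ofReal_integral_eq_lintegral_ofReal (integrable_heatKernel_sub ha x)
    (Eventually.of_forall fun z => (heatKernel_pos ha _).le), integral_heatKernel_sub ha,
    ENNReal.ofReal_one]

lemma isContractive_gaussK {a : ℝ} (ha : 0 < a) : IsContractive (gaussK (E := E) a) where
  meas := (Measurable.heatKernel measurable_const (by fun_prop)).ennreal_ofReal
  row x := (lintegral_gaussK ha x).le
  col y := by simp_rw [gaussK_comm a _ y]; exact (lintegral_gaussK ha y).le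

lemma lintegral_gaussK_mul_gaussK {a c : ℝ} (ha : 0 < a) (hc : 0 < c) (x y : E) :
    ∫⁻ z, gaussK a z y * gaussK c x z = gaussK (a + c) x y := by
  have h1 : ∀ z : E, gaussK a z y * gaussK c x z =
      ENNReal.ofReal (heatKernel c (x - z) * heatKernel a (z - y)) := fun z => by
    rw [gaussK, gaussK, mul_comm, ENNReal.ofReal_mul (heatKernel_pos hc _).le]
  simp_rw [h1]
  rw [← ofReal_integral_eq_lintegral_ofReal (integrable_heatKernel_conv ha hc x y)
    (Eventually.of_forall fun z => mul_nonneg (heatKernel_pos hc _).le (heatKernel_pos ha _).le),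
    integral_heatKernel_conv ha hc, gaussK]

lemma kop_gaussK_kop_gaussK {a c : ℝ} (ha : 0 < a) (hc : 0 < c) {f : E → ℝ≥0∞}
    (hf : Measurable f) : kop (gaussK c) (kop (gaussK a) f) = kop (gaussK (a + c)) f := by
  ext x
  have hm : Measurable (gaussK c x) :=
    (Measurable.heatKernel measurable_const (by fun_prop)).ennreal_ofReal
  have h1 : kop (gaussK c) (kop (gaussK a) f) x = ∫⁻ z, gaussK c x z * kop (gaussK a) f z := rfl
  rw [h1, (isContractive_gaussK ha).lintegral_mul_kop hf hm]
  exact lintegral_congr fun y => by rw [← lintegral_gaussK_mul_gaussK ha hc x y]; rfl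

lemma kop_gaussK_iterate {a : ℝ} (ha : 0 < a) {f : E → ℝ≥0∞} (hf : Measurable f) (m : ℕ) :
    (kop (gaussK a))^[m + 1] f = kop (gaussK ((m + 1) * a)) f := by
  induction m with
  | zero => simp
  | succ m ih =>
    rw [Function.iterate_succ_apply', ih, kop_gaussK_kop_gaussK (by positivity) ha hf]
    congr 2
    push_cast
    ring

lemma measurable_kop_gaussK_iterate {a : ℝ} (ha : 0 < a) {f : E → ℝ≥0∞} (hf : Measurable f)
    (m : ℕ) : Measurable ((kop (gaussK a))^[m] f) := by
  induction m with
  | zero => exact hf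
  | succ m ih =>
    rw [Function.iterate_succ_apply']
    exact (isContractive_gaussK ha).measurable_kop ih

lemma kop_gaussK_le {a : ℝ} (ha : 0 < a) (f : E → ℝ≥0∞) (hf : Measurable f) (x : E) :
    kop (gaussK a) f x ≤ ENNReal.ofReal (heatKernel a (0 : E)) * ∫⁻ y, f y := by
  rw [← lintegral_const_mul _ hf]
  exact lintegral_mono fun y =>
    mul_le_mul_left (ENNReal.ofReal_le_ofReal (heatKernel_le_zero ha _)) _

/-- By the semigroup property the iterate is a single heat kernel at time `m a`. One factor is
bounded by its supremum, the other one by the contraction in `L¹`. -/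
lemma lintegral_kop_gaussK_iterate_sq_le {a : ℝ} (ha : 0 < a) {f : E → ℝ≥0∞} (hf : Measurable f)
    {m : ℕ} (hm : 1 ≤ m) : ∫⁻ x, (kop (gaussK a))^[m] f x ^ 2 ≤
      ENNReal.ofReal ((1 / m : ℝ) ^ ((Module.finrank ℝ E : ℝ) / 2)) *
        (ENNReal.ofReal (heatKernel a (0 : E)) * (∫⁻ y, f y) ^ 2) := by
  obtain ⟨m, rfl⟩ := Nat.exists_eq_add_of_le' hm
  have hma : 0 < (m + 1) * a := by positivity
  rw [kop_gaussK_iterate ha hf]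
  have hK := isContractive_gaussK (E := E) hma
  have e : heatKernel ((m + 1) * a) (0 : E) = (1 / ((m + 1 : ℕ) : ℝ)) ^ ((Module.finrank ℝ E : ℝ) / 2)
      * heatKernel a (0 : E) := by
    rw [heatKernel_zero, heatKernel_zero, one_div, Real.inv_rpow (by positivity),
      ← Real.rpow_neg (by positivity), ← Real.mul_rpow (by positivity) (by positivity)]
    congr 1
    push_cast
    ring
  calc ∫⁻ x, kop (gaussK ((m + 1) * a)) f x ^ 2
      ≤ ∫⁻ x, ENNReal.ofReal (heatKernel ((m + 1) * a) (0 : E)) * (∫⁻ y, f y) *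
          kop (gaussK ((m + 1) * a)) f x := lintegral_mono fun x => by
        rw [sq]
        exact mul_le_mul_left (kop_gaussK_le hma f hf x) _
    _ = ENNReal.ofReal (heatKernel ((m + 1) * a) (0 : E)) * (∫⁻ y, f y) *
          ∫⁻ x, kop (gaussK ((m + 1) * a)) f x := lintegral_const_mul _ (hK.measurable_kop hf)
    _ ≤ ENNReal.ofReal (heatKernel ((m + 1) * a) (0 : E)) * (∫⁻ y, f y) * ∫⁻ y, f y :=
        mul_le_mul_right (hK.lintegral_kop_le hf) _
    _ = _ := by rw [e, ENNReal.ofReal_mul (by positivity)]; ring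

/-- Nash's inequality for one step of the heat semigroup. -/
lemma nash_gaussK {a : ℝ} (ha : 0 < a) {f : E → ℝ≥0∞} (hf : Measurable f) {m : ℕ} (hm : 1 ≤ m) :
    (∫⁻ x, kop (gaussK a) f x ^ 2) ^ m ≤ (∫⁻ x, f x ^ 2) ^ (m - 1) *
      (ENNReal.ofReal ((1 / m : ℝ) ^ ((Module.finrank ℝ E : ℝ) / 2)) *
        (ENNReal.ofReal (heatKernel a (0 : E)) * (∫⁻ y, f y) ^ 2)) := by
  set c : ℕ → ℝ≥0∞ := fun j => ∫⁻ x, (kop (gaussK a))^[j] f x ^ 2 with hc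
  have hK := isContractive_gaussK (E := E) ha
  have hmeas := measurable_kop_gaussK_iterate ha hf
  have hcm : c m ≤ _ := lintegral_kop_gaussK_iterate_sq_le ha hf hm
  change c 1 ^ m ≤ c 0 ^ (m - 1) * _
  refine le_trans ?_ (mul_le_mul_right hcm _)
  -- Log-convexity: as the heat kernel is symmetric, `‖Γ^(j+1) f‖²` is the pairing of `Γ^j f` with
  -- `Γ^(j+2) f`, and Cauchy-Schwarz applies.
  have hlog : ∀ j, c (j + 1) ^ 2 ≤ c j * c (j + 2) := by
    intro j
    have e : c (j + 1) = ∫⁻ x, (kop (gaussK a))^[j] f x * (kop (gaussK a))^[j + 2] f x := by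
      rw [Function.iterate_succ_apply' _ (j + 1),
        hK.lintegral_mul_kop (hmeas (j + 1)) (hmeas j)]
      refine lintegral_congr fun x => ?_
      have : kop (fun y x => gaussK a x y) ((kop (gaussK a))^[j] f) x =
          (kop (gaussK a))^[j + 1] f x := by
        rw [Function.iterate_succ_apply']
        simp only [kop]
        simp_rw [gaussK_comm a _ x]
      rw [this, sq]
    rw [e]
    exact sq_lintegral_mul_le (hmeas j).aemeasurable (hmeas (j + 2)).aemeasurable
  have hmono : ∀ j, c (j + 1) ≤ c j := fun j => by
    simp only [hc, Function.iterate_succ_apply']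
    exact hK.lintegral_kop_sq_le (hmeas j)
  -- If `f` is not square integrable, the right side is infinite except for `m = 1`, where the claim
  -- is trivial, or if `c m = 0`, where `0 · ∞` must be avoided.
  by_cases h0 : c 0 = ⊤
  · obtain ⟨m, rfl⟩ := Nat.exists_eq_add_of_le' hm
    rcases Nat.eq_zero_or_pos m with rfl | hm0
    · simp
    by_cases hz : c (m + 1) = 0
    · -- then `c 1 = 0` as well, by log-convexity
      have hz' : ∀ i, i ≤ m → c (m + 1 - i) = 0 := by
        intro i
        induction i with
        | zero => intro _; exact hz
        | succ i ih =>
          intro hi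
          have h1 := hlog (m + 1 - (i + 1) - 1)
          rw [show m + 1 - (i + 1) - 1 + 1 = m + 1 - (i + 1) by omega,
            show m + 1 - (i + 1) - 1 + 2 = m + 1 - i by omega, ih (by omega), mul_zero] at h1
          exact pow_eq_zero_iff (two_ne_zero) |>.1 (le_antisymm h1 zero_le)
      have := hz' m le_rfl
      rw [show m + 1 - m = 1 by omega] at this
      rw [this]
      simp
    · rw [h0, Nat.add_sub_cancel, ENNReal.top_pow hm0.ne', ENNReal.top_mul hz]
      exact le_top
  have hfin : ∀ j, c j ≠ ⊤ := fun j => by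
    induction j with
    | zero => exact h0
    | succ j ih => exact ne_top_of_le_ne_top ih (hmono j)
  -- The ratios `c (j+1) / c j` are nondecreasing, hence at least `c 1 / c 0`. Multiplying them
  -- gives `c 1 ^ m ≤ c 0 ^ (m-1) * c m`.
  have hr : ∀ j, c 1 * c j ≤ c 0 * c (j + 1) := by
    intro j
    induction j with
    | zero => rw [mul_comm]
    | succ j ih =>
      by_cases hz : c (j + 1) = 0
      · rw [hz, mul_zero]; exact zero_le
      · rw [← ENNReal.mul_le_mul_iff_left hz (hfin _)]
        calc c 1 * c (j + 1) * c (j + 1) = c 1 * c (j + 1) ^ 2 := by ring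
          _ ≤ c 1 * (c j * c (j + 2)) := mul_le_mul_right (hlog j) _
          _ = (c 1 * c j) * c (j + 2) := by ring
          _ ≤ (c 0 * c (j + 1)) * c (j + 2) := mul_le_mul_left ih _
          _ = c 0 * c (j + 1 + 1) * c (j + 1) := by ring
  induction m, hm using Nat.le_induction with
  | base => simp
  | succ m hm ih =>
    have ih' := ih (lintegral_kop_gaussK_iterate_sq_le ha hf hm)
    calc c 1 ^ (m + 1) = c 1 ^ m * c 1 := pow_succ _ _
      _ ≤ c 0 ^ (m - 1) * c m * c 1 := mul_le_mul_left ih' _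
      _ = c 0 ^ (m - 1) * (c 1 * c m) := by ring
      _ ≤ c 0 ^ (m - 1) * (c 0 * c (m + 1)) := mul_le_mul_right (hr m) _
      _ = c 0 ^ (m + 1 - 1) * c (m + 1) := by
        rw [← mul_assoc, ← pow_succ, Nat.sub_add_cancel hm, Nat.add_sub_cancel]

/-- The iteration `f ↦ Γ K_j f`, where `Γ` is the heat semigroup at time `a`. -/
noncomputable def fwd (a : ℝ) (K : ℕ → E → E → ℝ≥0∞) (f : E → ℝ≥0∞) : ℕ → E → ℝ≥0∞
  | 0 => f
  | j + 1 => kop (gaussK a) (kop (K j) (fwd a K f j))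

/-- The dual iteration `f ↦ K_jᵀ Γ f`. -/
noncomputable def bwd (a : ℝ) (K : ℕ → E → E → ℝ≥0∞) (f : E → ℝ≥0∞) : ℕ → E → ℝ≥0∞
  | 0 => f
  | j + 1 => kop (fun y x => K j x y) (kop (gaussK a) (bwd a K f j))

/-- The kernels `K j` increase neither the `L¹` nor the `L²` norm, so the one-step Nash inequality
survives between the heat steps. Nothing else about them enters: they may vary with `j` and need not
be symmetric. -/
lemma lintegral_fwd_sq_le {a : ℝ} (ha : 0 < a) {K : ℕ → E → E → ℝ≥0∞}
    (hK : ∀ j, IsContractive (K j)) {f : E → ℝ≥0∞} (hf : Measurable f) {N : ℕ} (hN : 1 ≤ N) :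
    Measurable (fwd a K f N) ∧ ∫⁻ x, fwd a K f N x ^ 2 ≤
      ENNReal.ofReal ((4 / N : ℝ) ^ ((Module.finrank ℝ E : ℝ) / 2)) *
        (ENNReal.ofReal (heatKernel a (0 : E)) * (∫⁻ y, f y) ^ 2) := by
  have hG := isContractive_gaussK (E := E) ha
  have hm : ∀ j, Measurable (fwd a K f j) := fun j => by
    induction j with
    | zero => exact hf
    | succ j ih => exact hG.measurable_kop ((hK j).measurable_kop ih)
  have h1 : ∀ j, ∫⁻ x, fwd a K f j x ≤ ∫⁻ x, f x := fun j => by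
    induction j with
    | zero => exact le_rfl
    | succ j ih =>
      exact (hG.lintegral_kop_le ((hK j).measurable_kop (hm j))).trans
        (((hK j).lintegral_kop_le (hm j)).trans ih)
  refine ⟨hm N, le_of_nash_recursion (y := fun N => ∫⁻ x, fwd a K f N x ^ 2)
    (b := ENNReal.ofReal (heatKernel a (0 : E)) * (∫⁻ y, f y) ^ 2)
    (r := (Module.finrank ℝ E : ℝ) / 2) (by positivity) (fun j m hm1 => ?_) N hN⟩
  refine (nash_gaussK ha ((hK j).measurable_kop (hm j)) hm1).trans ?_
  exact mul_le_mul' (pow_le_pow_left₀ zero_le ((hK j).lintegral_kop_sq_le (hm j)) _)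
    (mul_le_mul_right (mul_le_mul_right (pow_le_pow_left₀ zero_le
      (((hK j).lintegral_kop_le (hm j)).trans (h1 j)) 2) _) _)

lemma lintegral_bwd_sq_le {a : ℝ} (ha : 0 < a) {K : ℕ → E → E → ℝ≥0∞}
    (hK : ∀ j, IsContractive (K j)) {f : E → ℝ≥0∞} (hf : Measurable f) {N : ℕ} (hN : 1 ≤ N) :
    Measurable (bwd a K f N) ∧ ∫⁻ x, bwd a K f N x ^ 2 ≤
      ENNReal.ofReal ((4 / N : ℝ) ^ ((Module.finrank ℝ E : ℝ) / 2)) *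
        (ENNReal.ofReal (heatKernel a (0 : E)) * (∫⁻ y, f y) ^ 2) := by
  have hG := isContractive_gaussK (E := E) ha
  have hm : ∀ j, Measurable (bwd a K f j) := fun j => by
    induction j with
    | zero => exact hf
    | succ j ih => exact (hK j).flip.measurable_kop (hG.measurable_kop ih)
  have h1 : ∀ j, ∫⁻ x, bwd a K f j x ≤ ∫⁻ x, f x := fun j => by
    induction j with
    | zero => exact le_rfl
    | succ j ih =>
      exact ((hK j).flip.lintegral_kop_le (hG.measurable_kop (hm j))).trans
        ((hG.lintegral_kop_le (hm j)).trans ih)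
  refine ⟨hm N, le_of_nash_recursion (y := fun N => ∫⁻ x, bwd a K f N x ^ 2)
    (b := ENNReal.ofReal (heatKernel a (0 : E)) * (∫⁻ y, f y) ^ 2)
    (r := (Module.finrank ℝ E : ℝ) / 2) (by positivity) (fun j m hm1 => ?_) N hN⟩
  refine (pow_le_pow_left₀ zero_le
    ((hK j).flip.lintegral_kop_sq_le (hG.measurable_kop (hm j))) m).trans
    ((nash_gaussK ha (hm j) hm1).trans ?_)
  exact mul_le_mul_right (mul_le_mul_right (mul_le_mul_right
    (pow_le_pow_left₀ zero_le (h1 j) 2) _) _) _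

/-- Discrete Nash estimate, tested against integrable functions at both ends. -/
theorem lintegral_mul_fwd_le {a : ℝ} (ha : 0 < a) {K : ℕ → E → E → ℝ≥0∞}
    (hK : ∀ j, IsContractive (K j)) {f ρ : E → ℝ≥0∞} (hf : Measurable f) (hρ : Measurable ρ)
    {m : ℕ} (hm : 1 ≤ m) :
    ∫⁻ x, ρ x * fwd a K f (2 * m) x ≤
      ENNReal.ofReal ((4 / m : ℝ) ^ ((Module.finrank ℝ E : ℝ) / 2) * heatKernel a (0 : E)) *
        ((∫⁻ x, ρ x) * ∫⁻ x, f x) := by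
  have hG := isContractive_gaussK (E := E) ha
  -- The dual iteration meets the kernels in reverse order.
  set K' : ℕ → E → E → ℝ≥0∞ := fun j => K (2 * m - 1 - j) with hK'
  have hK'c : ∀ j, IsContractive (K' j) := fun j => hK _
  have hfm : ∀ j, Measurable (fwd a K f j) := fun j => by
    rcases Nat.eq_zero_or_pos j with rfl | hj
    · exact hf
    · exact (lintegral_fwd_sq_le ha hK hf hj).1
  have hbm : ∀ j, Measurable (bwd a K' ρ j) := fun j => by
    rcases Nat.eq_zero_or_pos j with rfl | hj
    · exact hρ
    · exact (lintegral_bwd_sq_le ha hK'c hρ hj).1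
  have hdual : ∀ j, j ≤ 2 * m → ∫⁻ x, ρ x * fwd a K f (2 * m) x =
      ∫⁻ x, bwd a K' ρ j x * fwd a K f (2 * m - j) x := by
    intro j
    induction j with
    | zero => intro _; rfl
    | succ j ih =>
      intro hj
      rw [ih (by omega), show 2 * m - j = (2 * m - 1 - j) + 1 by omega]
      have e : fwd a K f (2 * m - 1 - j + 1) =
        kop (gaussK a) (kop (K (2 * m - 1 - j)) (fwd a K f (2 * m - 1 - j))) := rfl
      rw [e, hG.lintegral_mul_kop ((hK _).measurable_kop (hfm _)) (hbm j),
        show (fun y x : E => gaussK a x y) = gaussK a from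
          funext fun y => funext fun x => gaussK_comm a x y,
        (hK _).lintegral_mul_kop (hfm _) (hG.measurable_kop (hbm j)),
        show 2 * m - (j + 1) = 2 * m - 1 - j by omega]
      rfl
  -- Half of the steps is moved to `ρ`. Both halves are then bounded from `L¹` to `L²`, and
  -- Cauchy-Schwarz combines them.
  rw [hdual m (by omega), show 2 * m - m = m by omega]
  refine (ENNReal.pow_le_pow_left_iff two_ne_zero).1
    ((sq_lintegral_mul_le (hbm m).aemeasurable (hfm m).aemeasurable).trans
    ((mul_le_mul' (lintegral_bwd_sq_le ha hK'c hρ hm).2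
      (lintegral_fwd_sq_le ha hK hf hm).2).trans_eq ?_))
  rw [ENNReal.ofReal_mul (by positivity)]
  ring

end Nash

end AdvectionDiffusion

namespace AdvectionDiffusion

/-! ### One step of the positive scheme: positivity and divergence-free cancellation -/

section StepKernel

variable {E : Type*} [NormedAddCommGroup E] [InnerProductSpace ℝ E] [FiniteDimensional ℝ E]
  [MeasurableSpace E] [BorelSpace E]
  {ν M : ℝ} {m v : ℝ → ℝ} {U : E → ℝ → E} {V : E → ℝ → ℝ}

/-- The potential integrated over a time interval. -/
noncomputable def potInt (V : E → ℝ → ℝ) (a b : ℝ) (y : E) : ℝ := ∫ τ in Ioo a b, V y τ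

/-- The drift integrated over a time interval. -/
noncomputable def driftInt (U : E → ℝ → E) (a b : ℝ) (y : E) : E := ∫ τ in Ioo a b, U y τ

/-- The explicit part of a time step of the positive approximation scheme. -/
noncomputable def stepKernel (ν : ℝ) (U : E → ℝ → E) (V : E → ℝ → ℝ) (a b : ℝ) (w y : E) : ℝ :=
  heatKernel (ν * (b - a) / 2) (w - y) * (1 + potInt V a b y) +
    heatKernel (ν * (b - a) / 4) (w - y) *
      (inner ℝ (w - y) (driftInt U a b y) / (2 * (ν * (b - a) / 4)))

/-- One time step of the positive approximation scheme. -/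
noncomputable def schemeStep (ν : ℝ) (U : E → ℝ → E) (V : E → ℝ → ℝ) (a b : ℝ) (f : E → ℝ) (x : E) :
    ℝ :=
  ∫ w, heatKernel (ν * (b - a) / 2) (x - w) * ∫ y, stepKernel ν U V a b w y * f y

/-- The drift is divergence free on the time interval `(a, b)`. -/
def DivFreeOn (U : E → ℝ → E) (a b : ℝ) : Prop :=
  ∀ τ ∈ Ioo a b, ∀ φ : E → ℝ, ContDiff ℝ ∞ φ → HasCompactSupport φ →
    ∫ x, inner ℝ (U x τ) (gradient φ x) = 0

lemma Coeff.integrableOn_m (h : Coeff ν M m v U V) (a b : ℝ) : IntegrableOn m (Ioo a b) :=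
  Measure.integrableOn_of_bounded (M := M) (by simp) h.measm.aestronglyMeasurable
    (Eventually.of_forall fun τ => by rw [Real.norm_of_nonneg (h.m_nonneg τ)]; exact h.m_le τ)

lemma Coeff.integrableOn_U (h : Coeff ν M m v U V) (a b : ℝ) (y : E) :
    IntegrableOn (U y) (Ioo a b) :=
  (h.integrableOn_m a b).mono' (h.measU.comp measurable_prodMk_left).aestronglyMeasurable
    (Eventually.of_forall fun τ => h.U_le y τ)

lemma Coeff.abs_potInt_le (h : Coeff ν M m v U V) (a b : ℝ) (y : E) :
    |potInt V a b y| ≤ ∫ τ in Ioo a b, v τ := by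
  rw [potInt, ← Real.norm_eq_abs]
  exact norm_integral_le_of_norm_le h.v_int.integrableOn (Eventually.of_forall fun τ => h.V_le y τ)

lemma Coeff.norm_driftInt_le (h : Coeff ν M m v U V) (a b : ℝ) (y : E) :
    ‖driftInt U a b y‖ ≤ ∫ τ in Ioo a b, m τ :=
  norm_integral_le_of_norm_le (h.integrableOn_m a b) (Eventually.of_forall fun τ => h.U_le y τ)

lemma Coeff.integral_m_le (h : Coeff ν M m v U V) {a b : ℝ} (hab : a ≤ b) :
    ∫ τ in Ioo a b, m τ ≤ M * (b - a) := by
  calc ∫ τ in Ioo a b, m τ ≤ ∫ τ in Ioo a b, M :=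
        setIntegral_mono (h.integrableOn_m a b) (integrableOn_const (by simp)) h.m_le
    _ = M * (b - a) := by simp [hab, mul_comm]

lemma Coeff.measurable_potInt (h : Coeff ν M m v U V) (a b : ℝ) : Measurable (potInt V a b) :=
  (h.measV.stronglyMeasurable.integral_prod_right' (ν := volume.restrict (Ioo a b))).measurable

lemma Coeff.measurable_driftInt (h : Coeff ν M m v U V) (a b : ℝ) : Measurable (driftInt U a b) :=
  (h.measU.stronglyMeasurable.integral_prod_right' (ν := volume.restrict (Ioo a b))).measurable

lemma Coeff.measurable_stepKernel (h : Coeff ν M m v U V) (a b : ℝ) :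
    Measurable (fun p : E × E => stepKernel ν U V a b p.1 p.2) := by
  have h1 : Measurable fun p : E × E => potInt V a b p.2 :=
    (h.measurable_potInt a b).comp measurable_snd
  have h2 : Measurable fun p : E × E => driftInt U a b p.2 :=
    (h.measurable_driftInt a b).comp measurable_snd
  exact ((Measurable.heatKernel (by fun_prop) (by fun_prop)).mul (measurable_const.add h1)).add
    ((Measurable.heatKernel (by fun_prop) (by fun_prop)).mul
      (((measurable_fst.sub measurable_snd).inner h2).div_const _))

/-- Smallness of a time step, which makes the scheme positive. -/
def IsSmallStep (E : Type*) [NormedAddCommGroup E] [InnerProductSpace ℝ E] (ν M : ℝ) (v : ℝ → ℝ)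
    (a b : ℝ) : Prop :=
  gaussFactor E * (M / Real.sqrt ν * (2 * Real.sqrt (b - a)) + ∫ τ in Ioo a b, v τ) ≤ 1 / 2

/-- The drift term is a gradient of a Gaussian at a quarter of the heat time of the step. Doubling
the variance dominates it by the same Gaussian that multiplies the leading term 1. For a small step,
drift and potential together are at most half of that Gaussian. -/
lemma Coeff.stepKernel_bounds (h : Coeff ν M m v U V) {a b : ℝ} (hab : a < b)
    (hs : IsSmallStep E ν M v a b) (w y : E) :
    0 ≤ stepKernel ν U V a b w y ∧
      stepKernel ν U V a b w y ≤ 2 * heatKernel (ν * (b - a) / 2) (w - y) := by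
  have hν := h.ν_pos
  have hσ : 0 < b - a := sub_pos.2 hab
  have hgf := one_le_gaussFactor (E := E)
  have ha : 0 < ν * (b - a) / 4 := by positivity
  have hG : 0 < heatKernel (ν * (b - a) / 2) (w - y) := heatKernel_pos (by positivity) _
  have h1 := abs_le.1 (h.abs_potInt_le a b y)
  have hv0 : 0 ≤ ∫ τ in Ioo a b, v τ := integral_nonneg fun τ => h.v_nonneg τ
  have h2 := abs_drift_kernel_le (V₀ := 0) (v₀ := 0) ha
    ((h.norm_driftInt_le a b y).trans (h.integral_m_le hab.le)) (by simp) (w - y)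
  have e1 : 2 * (ν * (b - a) / 4) = ν * (b - a) / 2 := by ring
  have e2 : M * (b - a) / Real.sqrt (ν * (b - a) / 4) =
      M / Real.sqrt ν * (2 * Real.sqrt (b - a)) := by
    rw [Real.sqrt_div (by positivity), Real.sqrt_mul hν.le,
      show (4 : ℝ) = 2 ^ 2 by norm_num, Real.sqrt_sq (by norm_num)]
    have := Real.sqrt_pos.2 hν
    have := Real.sqrt_pos.2 hσ
    field_simp
    rw [Real.sq_sqrt hσ.le]
  simp only [zero_add, add_zero] at h2
  rw [e1, e2] at h2
  rw [IsSmallStep, mul_add] at hs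
  have hvg : ∫ τ in Ioo a b, v τ ≤ gaussFactor E * ∫ τ in Ioo a b, v τ :=
    le_mul_of_one_le_left hv0 hgf
  obtain ⟨h3, h4⟩ := abs_le.1 h2
  have h5 : gaussFactor E * (M / Real.sqrt ν * (2 * Real.sqrt (b - a))) *
      heatKernel (ν * (b - a) / 2) (w - y) + (∫ τ in Ioo a b, v τ) *
      heatKernel (ν * (b - a) / 2) (w - y) ≤ 1 / 2 * heatKernel (ν * (b - a) / 2) (w - y) := by
    rw [← add_mul]
    exact mul_le_mul_of_nonneg_right (by linarith) hG.le
  have h6 := mul_le_mul_of_nonneg_left h1.1 hG.le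
  have h7 := mul_le_mul_of_nonneg_left h1.2 hG.le
  unfold stepKernel
  rw [e1]
  constructor <;> nlinarith

/-- The integrand is `U · ∇_y` of the Gaussian `heatKernel c (x - y)`. A Gaussian is not an
admissible test function, so it is cut off in space; the bounded drift and the Gaussian decay allow
the passage to the limit. -/
lemma Coeff.integral_gauss_U_eq_zero (h : Coeff ν M m v U V) {a b τ : ℝ} (hd : DivFreeOn U a b)
    (hτ : τ ∈ Ioo a b) {c : ℝ} (hc : 0 < c) (x : E) :
    ∫ y, heatKernel c (x - y) * (inner ℝ (x - y) (U y τ) / (2 * c)) = 0 := by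
  have hgf := gaussFactor_pos (E := E)
  have hM := h.M_nonneg
  obtain ⟨χ, C, hC, hχ, hχs, hχ1, hχg, -, hχe⟩ := exists_cutoffs E
  have hG : ContDiff ℝ ∞ fun y : E => heatKernel c (x - y) := by
    simp_rw [heatKernel_sub_comm c x]
    exact contDiff_heatKernel_sub hc x
  have hgrad : ∀ k y, gradient (fun y => χ k y * heatKernel c (x - y)) y =
      χ k y • ((1 / (2 * c) * heatKernel c (x - y)) • (x - y)) +
        heatKernel c (x - y) • gradient (χ k) y := fun k y => by
    rw [gradient_mul ((hχ k).differentiable (by simp) y) (hG.differentiable (by simp) y),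
      gradient_eq_of_hasFDerivAt (hasFDerivAt_heatKernel_sub c x y)]
  have h0 : ∀ k, ∫ y, inner ℝ (U y τ) (gradient (fun y => χ k y * heatKernel c (x - y)) y) = 0 :=
    fun k => hd τ hτ _ ((hχ k).mul hG) (hχs k).mul_right
  have hUm : Measurable fun y => U y τ := h.measU.comp measurable_prodMk_right
  have hlim : Tendsto (fun k => ∫ y, inner ℝ (U y τ)
      (gradient (fun y => χ k y * heatKernel c (x - y)) y)) atTop
      (𝓝 (∫ y, heatKernel c (x - y) * (inner ℝ (x - y) (U y τ) / (2 * c)))) := by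
    refine tendsto_integral_of_dominated_convergence (fun y =>
      M * (gaussFactor E * (1 / Real.sqrt c) + gaussFactor E * C) * heatKernel (2 * c) (x - y))
      (fun k => ?_) ((integrable_heatKernel_sub (by positivity) x).const_mul _)
      (fun k => Eventually.of_forall fun y => ?_) (Eventually.of_forall fun y => ?_)
    · have : Continuous (gradient fun y => χ k y * heatKernel c (x - y)) :=
        (InnerProductSpace.toDual ℝ E).symm.continuous.comp
          (((hχ k).mul hG).continuous_fderiv (by simp))
      exact (hUm.inner this.measurable).aestronglyMeasurable
    · have hp := heatKernel_pos hc (x - y)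
      refine (norm_inner_le_norm _ _).trans ?_
      rw [mul_assoc]
      refine mul_le_mul (h.U_le' y τ) ?_ (norm_nonneg _) hM
      rw [hgrad, add_mul]
      refine (norm_add_le _ _).trans (add_le_add ?_ ?_)
      · rw [norm_smul, norm_smul, Real.norm_of_nonneg (r := 1 / (2 * c) * _) (by positivity)]
        refine (mul_le_of_le_one_left (by positivity) (hχ1 k y)).trans ?_
        calc _ = ‖x - y‖ / (2 * c) * heatKernel c (x - y) := by ring
          _ ≤ _ := norm_mul_heatKernel_le hc _
      · rw [norm_smul, Real.norm_of_nonneg hp.le]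
        calc _ ≤ gaussFactor E * heatKernel (2 * c) (x - y) * C :=
              mul_le_mul (heatKernel_le_two_mul hc _) (hχg k y) (norm_nonneg _)
                (by have := heatKernel_pos (show 0 < 2 * c by positivity) (x - y); positivity)
          _ = _ := by ring
    · refine tendsto_const_nhds.congr' ?_
      filter_upwards [hχe y] with k hk
      rw [hgrad, hk.1, hk.2.1, smul_zero, add_zero, one_smul, real_inner_smul_right,
        real_inner_comm]
      ring
  simp_rw [h0] at hlim
  exact tendsto_nhds_unique hlim tendsto_const_nhds

lemma Coeff.integrable_gauss_driftInt (h : Coeff ν M m v U V) (a b : ℝ) {c : ℝ} (hc : 0 < c)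
    (x : E) :
    Integrable fun y => heatKernel c (x - y) * (inner ℝ (x - y) (driftInt U a b y) / (2 * c)) := by
  refine Integrable.mono' (g := fun y => gaussFactor E * ((∫ τ in Ioo a b, m τ) / Real.sqrt c) *
    heatKernel (2 * c) (x - y)) ((integrable_heatKernel_sub (by positivity) x).const_mul _) ?_ ?_
  · have := h.measurable_driftInt a b
    exact ((Measurable.heatKernel (by fun_prop) (by fun_prop)).mul
      (Measurable.div_const (Measurable.inner (by fun_prop) this) _)).aestronglyMeasurable
  · refine Eventually.of_forall fun y => ?_
    have := abs_drift_kernel_le (V₀ := 0) (v₀ := 0) hc (h.norm_driftInt_le a b y) (by simp) (x - y)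
    simpa only [zero_add, add_zero, Real.norm_eq_abs] using this

lemma Coeff.integral_inner_U (h : Coeff ν M m v U V) (a b : ℝ) (y ξ : E) :
    inner ℝ ξ (driftInt U a b y) = ∫ τ in Ioo a b, inner ℝ ξ (U y τ) :=
  (integral_inner (h.integrableOn_U a b y) ξ).symm

lemma Coeff.integrableOn_gauss_U (h : Coeff ν M m v U V) {a b R : ℝ} {c : ℝ} (hc : 0 < c) (x : E)
    {f : E → ℝ} (hf : Measurable f) (hfR : ∀ y, |f y| ≤ R) :
    IntegrableOn (fun p : E × ℝ => heatKernel c (x - p.1) *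
      (inner ℝ (x - p.1) (U p.1 p.2) / (2 * c)) * f p.1) (univ ×ˢ Ioo a b) := by
  have hgf := gaussFactor_pos (E := E)
  have hM := h.M_nonneg
  have hR : 0 ≤ R := (abs_nonneg _).trans (hfR 0)
  have hU := h.measU
  refine (strip_bound (g := fun _ => gaussFactor E * (M / Real.sqrt c) * R) (R := 1)
    (k := fun z _ => heatKernel (2 * c) (x - z)) ?_ (integrableOn_const (by simp))
    (fun _ _ => by positivity) ?_ ?_).1
  · exact (((Measurable.heatKernel (by fun_prop) (by fun_prop)).mul
      (Measurable.div_const (Measurable.inner (by fun_prop) hU) _)).mul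
      (hf.comp measurable_fst)).aestronglyMeasurable
  · exact fun τ _ => ⟨integrable_heatKernel_sub (by positivity) x,
      (integral_heatKernel_sub (by positivity) x).le⟩
  · intro z τ _
    have h1 := abs_drift_kernel_le (V₀ := 0) (v₀ := 0) hc (h.U_le' z τ) (by simp) (x - z)
    simp only [zero_add, add_zero] at h1
    rw [abs_mul]
    calc _ ≤ gaussFactor E * (M / Real.sqrt c) * heatKernel (2 * c) (x - z) * R :=
          mul_le_mul h1 (hfR z) (abs_nonneg _) ((abs_nonneg _).trans h1)
      _ = _ := by ring

lemma Coeff.integrableOn_gauss_V (h : Coeff ν M m v U V) {a b R : ℝ} {c : ℝ} (hc : 0 < c) (x : E)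
    {f : E → ℝ} (hf : Measurable f) (hfR : ∀ y, |f y| ≤ R) :
    IntegrableOn (fun p : E × ℝ => heatKernel c (x - p.1) * V p.1 p.2 * f p.1)
      (univ ×ˢ Ioo a b) := by
  have hR : 0 ≤ R := (abs_nonneg _).trans (hfR 0)
  have hV := h.measV
  refine (strip_bound (g := fun τ => v τ * R) (R := 1)
    (k := fun z _ => heatKernel c (x - z)) ?_ (h.v_int.integrableOn.mul_const R)
    (fun τ _ => mul_nonneg (h.v_nonneg τ) hR) ?_ ?_).1
  · exact (((Measurable.heatKernel (by fun_prop) (by fun_prop)).mul hV).mul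
      (hf.comp measurable_fst)).aestronglyMeasurable
  · exact fun τ _ => ⟨integrable_heatKernel_sub hc x, (integral_heatKernel_sub hc x).le⟩
  · intro z τ _
    have hp := heatKernel_pos hc (x - z)
    rw [abs_mul, abs_mul, abs_of_pos hp]
    calc _ ≤ heatKernel c (x - z) * v τ * R := by
          have := h.V_le z τ
          have := h.v_nonneg τ
          have := hfR z
          gcongr
      _ = _ := by ring

/-- Fubini puts the time-integrated drift back into a space-time integral, so that a step can be
compared with Duhamel's formula. -/
lemma Coeff.integral_gauss_driftInt (h : Coeff ν M m v U V) {a b R : ℝ} {c : ℝ} (hc : 0 < c) (x : E)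
    {f : E → ℝ} (hf : Measurable f) (hfR : ∀ y, |f y| ≤ R) :
    ∫ y, heatKernel c (x - y) * (inner ℝ (x - y) (driftInt U a b y) / (2 * c)) * f y =
      ∫ p : E × ℝ in univ ×ˢ Ioo a b, heatKernel c (x - p.1) *
        (inner ℝ (x - p.1) (U p.1 p.2) / (2 * c)) * f p.1 := by
  have hi := h.integrableOn_gauss_U (a := a) (b := b) hc x hf hfR
  rw [IntegrableOn, restrict_strip] at hi
  rw [restrict_strip, integral_prod _ hi]
  refine integral_congr_ae (Eventually.of_forall fun y => ?_)
  simp only [h.integral_inner_U a b y]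
  rw [integral_mul_const, integral_const_mul, integral_div]

lemma Coeff.integral_gauss_potInt (h : Coeff ν M m v U V) {a b R : ℝ} {c : ℝ} (hc : 0 < c) (x : E)
    {f : E → ℝ} (hf : Measurable f) (hfR : ∀ y, |f y| ≤ R) :
    ∫ y, heatKernel c (x - y) * potInt V a b y * f y =
      ∫ p : E × ℝ in univ ×ˢ Ioo a b, heatKernel c (x - p.1) * V p.1 p.2 * f p.1 := by
  have hi := h.integrableOn_gauss_V (a := a) (b := b) hc x hf hfR
  rw [IntegrableOn, restrict_strip] at hi
  rw [restrict_strip, integral_prod _ hi]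
  refine integral_congr_ae (Eventually.of_forall fun y => ?_)
  simp only [potInt]
  rw [integral_mul_const, integral_const_mul]

lemma Coeff.integral_gauss_driftInt_eq_zero (h : Coeff ν M m v U V) {a b : ℝ}
    (hd : DivFreeOn U a b) {c : ℝ} (hc : 0 < c) (x : E) :
    ∫ y, heatKernel c (x - y) * (inner ℝ (x - y) (driftInt U a b y) / (2 * c)) = 0 := by
  have h1 := h.integral_gauss_driftInt (a := a) (b := b) hc x (measurable_const (a := (1 : ℝ)))
    (R := 1) (fun _ => by simp)
  have hi := h.integrableOn_gauss_U (a := a) (b := b) hc x (measurable_const (a := (1 : ℝ)))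
    (R := 1) (fun _ => by simp)
  simp only [mul_one] at h1 hi
  rw [IntegrableOn, restrict_strip] at hi
  rw [h1, restrict_strip, integral_prod_symm _ hi]
  exact setIntegral_eq_zero_of_forall_eq_zero fun τ hτ => h.integral_gauss_U_eq_zero hd hτ hc x

end StepKernel

end AdvectionDiffusion

namespace AdvectionDiffusion

/-! ### Weighted row and column sums; discrete Duhamel formula for one step -/

section StepKernel

variable {E : Type*} [NormedAddCommGroup E] [InnerProductSpace ℝ E] [FiniteDimensional ℝ E]
  [MeasurableSpace E] [BorelSpace E]
  {ν M : ℝ} {m v : ℝ → ℝ} {U : E → ℝ → E} {V : E → ℝ → ℝ}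

/-- The growth factor of the explicit part of a time step, for the weight `exp ⟨α, ·⟩`. -/
noncomputable def stepFactor (ν : ℝ) (m v : ℝ → ℝ) (α : E) (a b : ℝ) : ℝ :=
  Real.exp (ν * (b - a) / 2 * ‖α‖ ^ 2 + ((∫ τ in Ioo a b, v τ) + ‖α‖ * ∫ τ in Ioo a b, m τ))

/-- The common end of both sum estimates, by `1 + r ≤ exp r`. The smaller Gaussian constant of the
drift term is replaced by that of the leading term. -/
lemma Coeff.stepFactor_aux (h : Coeff ν M m v U V) {a b : ℝ} (hab : a ≤ b) (α : E) {I W D : ℝ}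
    (hW : W ≤ ∫ τ in Ioo a b, v τ) (hD : D ≤ ‖α‖ * ∫ τ in Ioo a b, m τ)
    (hI : I = Real.exp (ν * (b - a) / 2 * ‖α‖ ^ 2) * (1 + W) +
      Real.exp (ν * (b - a) / 4 * ‖α‖ ^ 2) * D) : I ≤ stepFactor ν m v α a b := by
  have hν := h.ν_pos
  have hm : 0 ≤ ∫ τ in Ioo a b, m τ := integral_nonneg fun τ => h.m_nonneg τ
  have hσ : 0 ≤ b - a := sub_nonneg.2 hab
  have e1 : Real.exp (ν * (b - a) / 4 * ‖α‖ ^ 2) ≤ Real.exp (ν * (b - a) / 2 * ‖α‖ ^ 2) := by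
    gcongr
    norm_num
  rw [hI, stepFactor, Real.exp_add]
  calc _ ≤ Real.exp (ν * (b - a) / 2 * ‖α‖ ^ 2) * (1 + ∫ τ in Ioo a b, v τ) +
        Real.exp (ν * (b - a) / 2 * ‖α‖ ^ 2) * (‖α‖ * ∫ τ in Ioo a b, m τ) :=
        add_le_add (by gcongr) ((mul_le_mul_of_nonneg_left hD (Real.exp_pos _).le).trans
          (mul_le_mul_of_nonneg_right e1 (by positivity)))
    _ = Real.exp (ν * (b - a) / 2 * ‖α‖ ^ 2) *
        (((∫ τ in Ioo a b, v τ) + ‖α‖ * ∫ τ in Ioo a b, m τ) + 1) := by ring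
    _ ≤ _ := by gcongr; exact Real.add_one_le_exp _

lemma heatKernel_sub_mul_exp_inner {a : ℝ} (ha : 0 < a) (α w y : E) :
    heatKernel a (w - y) * Real.exp (inner ℝ α (w - y)) =
      Real.exp (a * ‖α‖ ^ 2) * heatKernel a ((w - (2 * a) • α) - y) := by
  rw [heatKernel_mul_exp_inner ha]
  congr 2
  abel

lemma stepKernel_mul_exp {a b : ℝ} (ha : 0 < ν * (b - a)) (α w y : E) :
    stepKernel ν U V a b w y * Real.exp (inner ℝ α (w - y)) =
      Real.exp (ν * (b - a) / 2 * ‖α‖ ^ 2) *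
        (heatKernel (ν * (b - a) / 2) ((w - (2 * (ν * (b - a) / 2)) • α) - y) *
          (1 + potInt V a b y)) +
      Real.exp (ν * (b - a) / 4 * ‖α‖ ^ 2) *
        (heatKernel (ν * (b - a) / 4) ((w - (2 * (ν * (b - a) / 4)) • α) - y) *
          (inner ℝ (w - y) (driftInt U a b y) / (2 * (ν * (b - a) / 4)))) := by
  rw [stepKernel, add_mul, mul_right_comm, heatKernel_sub_mul_exp_inner (by positivity),
    mul_right_comm (heatKernel (ν * (b - a) / 4) _), heatKernel_sub_mul_exp_inner (by positivity)]
  ring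

/-- Here `y`, and with it the integrated drift, is fixed. The tilt shifts the Gaussian by a multiple
of `α`, and the mean of `w - y` leaves exactly the inner product of `α` with the drift. The
divergence plays no role. -/
lemma Coeff.integral_stepKernel_left (h : Coeff ν M m v U V) {a b : ℝ} (hab : a < b) (α y : E) :
    Integrable (fun w => stepKernel ν U V a b w y * Real.exp (inner ℝ α (w - y))) ∧
    ∫ w, stepKernel ν U V a b w y * Real.exp (inner ℝ α (w - y)) ≤ stepFactor ν m v α a b := by
  have hν := h.ν_pos
  have hσ : 0 < ν * (b - a) := mul_pos hν (sub_pos.2 hab)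
  have h2 : 0 < ν * (b - a) / 2 := by positivity
  have h4 : 0 < ν * (b - a) / 4 := by positivity
  simp_rw [stepKernel_mul_exp hσ]
  set A := ν * (b - a) / 2
  set B := ν * (b - a) / 4
  set D := driftInt U a b y
  have e : ∀ c : ℝ, ∀ w : E, heatKernel c ((w - (2 * c) • α) - y) =
      heatKernel c (w - (y + (2 * c) • α)) := fun c w => by
    congr 1; abel
  simp_rw [e]
  have i1 : Integrable fun w => heatKernel A (w - (y + (2 * A) • α)) * (1 + potInt V a b y) := by
    simp_rw [heatKernel_sub_comm A _ (y + (2 * A) • α)]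
    exact (integrable_heatKernel_sub h2 _).mul_const _
  have i2 : Integrable fun w => heatKernel B (w - (y + (2 * B) • α)) *
      (inner ℝ (w - y) D / (2 * B)) := by
    simp_rw [← mul_div_assoc]
    exact (integrable_heatKernel_sub_mul_inner h4 _ y D).div_const _
  refine ⟨(i1.const_mul _).add (i2.const_mul _), h.stepFactor_aux hab.le α
    (W := potInt V a b y) (D := inner ℝ α D) ((le_abs_self _).trans (h.abs_potInt_le a b y))
    ((real_inner_le_norm _ _).trans
      (mul_le_mul_of_nonneg_left (h.norm_driftInt_le a b y) (norm_nonneg _))) ?_⟩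
  rw [integral_add (i1.const_mul _) (i2.const_mul _), integral_const_mul, integral_const_mul]
  congr 2
  · simp_rw [heatKernel_sub_comm A _ (y + (2 * A) • α)]
    rw [integral_mul_const, integral_heatKernel_sub h2, one_mul]
  · simp_rw [← mul_div_assoc]
    rw [integral_div, integral_heatKernel_sub_mul_inner h4, add_sub_cancel_left,
      real_inner_smul_left]
    field_simp

/-- Here the drift varies with the integration variable. Splitting `w - y` at the shifted centre
leaves an unweighted term, which vanishes as the drift is divergence free, and a Gaussian average of
`⟨α, drift⟩`. -/
lemma Coeff.integral_stepKernel_right (h : Coeff ν M m v U V) {a b : ℝ} (hab : a < b)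
    (hd : DivFreeOn U a b) (α w : E) :
    Integrable (fun y => stepKernel ν U V a b w y * Real.exp (inner ℝ α (w - y))) ∧
    ∫ y, stepKernel ν U V a b w y * Real.exp (inner ℝ α (w - y)) ≤ stepFactor ν m v α a b := by
  have hν := h.ν_pos
  have hσ : 0 < ν * (b - a) := mul_pos hν (sub_pos.2 hab)
  have h2 : 0 < ν * (b - a) / 2 := by positivity
  have h4 : 0 < ν * (b - a) / 4 := by positivity
  simp_rw [stepKernel_mul_exp hσ]
  set A := ν * (b - a) / 2
  set B := ν * (b - a) / 4
  set x := w - (2 * A) • α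
  set x' := w - (2 * B) • α with hx'
  have hpm := h.measurable_potInt a b
  have hdm := h.measurable_driftInt a b
  have hpb : ∀ y, potInt V a b y ≤ ∫ τ in Ioo a b, v τ := fun y =>
    (le_abs_self _).trans (h.abs_potInt_le a b y)
  have hdb : ∀ y, |inner ℝ α (driftInt U a b y)| ≤ ‖α‖ * ∫ τ in Ioo a b, m τ := fun y =>
    (abs_real_inner_le_norm _ _).trans
      (mul_le_mul_of_nonneg_left (h.norm_driftInt_le a b y) (norm_nonneg _))
  have i1 : Integrable fun y => heatKernel A (x - y) * (1 + potInt V a b y) := by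
    refine (integrable_heatKernel_sub h2 x).mul_bdd (c := 1 + ∫ τ in Ioo a b, v τ)
      (measurable_const.add hpm).aestronglyMeasurable (Eventually.of_forall fun y => ?_)
    exact (norm_add_le _ _).trans (add_le_add (by simp) (h.abs_potInt_le a b y))
  have i5 : Integrable fun y => heatKernel A (x - y) * potInt V a b y :=
    (integrable_heatKernel_sub h2 x).mul_bdd hpm.aestronglyMeasurable
      (Eventually.of_forall fun y => h.abs_potInt_le a b y)
  have i3 : Integrable fun y => heatKernel B (x' - y) * inner ℝ α (driftInt U a b y) :=
    (integrable_heatKernel_sub h4 x').mul_bdd (measurable_const.inner hdm).aestronglyMeasurable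
      (Eventually.of_forall fun y => hdb y)
  have i4 := h.integrable_gauss_driftInt a b h4 x'
  have e : ∀ y, heatKernel B (x' - y) * (inner ℝ (w - y) (driftInt U a b y) / (2 * B)) =
      heatKernel B (x' - y) * (inner ℝ (x' - y) (driftInt U a b y) / (2 * B)) +
        heatKernel B (x' - y) * inner ℝ α (driftInt U a b y) := fun y => by
    have : w - y = (x' - y) + (2 * B) • α := by rw [hx']; abel
    rw [this, inner_add_left, real_inner_smul_left]
    field_simp
  simp_rw [e]
  have i2 := i4.add i3
  have i2' : Integrable fun y =>
      heatKernel B (x' - y) * (inner ℝ (x' - y) (driftInt U a b y) / (2 * B)) +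
        heatKernel B (x' - y) * inner ℝ α (driftInt U a b y) := i2
  refine ⟨(i1.const_mul _).add (i2'.const_mul _), h.stepFactor_aux hab.le α
    (W := ∫ y, heatKernel A (x - y) * potInt V a b y)
    (D := ∫ y, heatKernel B (x' - y) * inner ℝ α (driftInt U a b y)) ?_ ?_ ?_⟩
  · calc _ ≤ ∫ y, heatKernel A (x - y) * ∫ τ in Ioo a b, v τ := by
          refine integral_mono i5 ((integrable_heatKernel_sub h2 x).mul_const _) fun y => ?_
          exact mul_le_mul_of_nonneg_left (hpb y) (heatKernel_pos h2 _).le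
      _ = _ := by rw [integral_mul_const, integral_heatKernel_sub h2, one_mul]
  · calc _ ≤ ∫ y, heatKernel B (x' - y) * (‖α‖ * ∫ τ in Ioo a b, m τ) := by
          refine integral_mono i3 ((integrable_heatKernel_sub h4 x').mul_const _) fun y => ?_
          exact mul_le_mul_of_nonneg_left ((le_abs_self _).trans (hdb y)) (heatKernel_pos h4 _).le
      _ = _ := by rw [integral_mul_const, integral_heatKernel_sub h4, one_mul]
  · rw [integral_add (i1.const_mul _) (i2'.const_mul _), integral_const_mul, integral_const_mul,
      integral_add i4 i3, h.integral_gauss_driftInt_eq_zero hd h4, zero_add]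
    congr 2
    simp_rw [mul_add, mul_one]
    rw [integral_add (integrable_heatKernel_sub h2 x) i5, integral_heatKernel_sub h2]

/-- The average of `f` with respect to the heat kernel at time `c ≥ 0`. -/
noncomputable def heatAvg (c : ℝ) (f : E → ℝ) (x : E) : ℝ :=
  ∫ ζ, heatKernel 1 ζ * f (x - Real.sqrt c • ζ)

lemma heatAvg_zero (f : E → ℝ) (x : E) : heatAvg 0 f x = f x := by
  simp [heatAvg, integral_mul_const, integral_heatKernel one_pos]

lemma heatAvg_eq {c : ℝ} (hc : 0 < c) (f : E → ℝ) (x : E) :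
    heatAvg c f x = ∫ z, heatKernel c (x - z) * f z :=
  (integral_heatKernel_sub_scale hc x f).symm

lemma integrable_heatKernel_sub_mul {c R : ℝ} (hc : 0 < c) {f : E → ℝ} (hf : Measurable f)
    (hR : ∀ y, |f y| ≤ R) (x : E) : Integrable fun z => heatKernel c (x - z) * f z :=
  (integrable_heatKernel_sub hc x).mul_bdd hf.aestronglyMeasurable
    (Eventually.of_forall fun y => hR y)

/-- The kernel appearing in the discrete form of Duhamel's formula. -/
noncomputable def schemeKernel (U : E → ℝ → E) (V : E → ℝ → ℝ) (A B : ℝ) (x z : E) (τ : ℝ) : ℝ :=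
  heatKernel A (x - z) * V z τ + heatKernel B (x - z) * (inner ℝ (x - z) (U z τ) / (2 * B))

lemma Coeff.integrable_stepKernel_mul (h : Coeff ν M m v U V) {a b R : ℝ} (hab : a < b)
    (hs : IsSmallStep E ν M v a b) {f : E → ℝ} (hf : Measurable f) (hR : ∀ y, |f y| ≤ R) (w : E) :
    Integrable (fun y => stepKernel ν U V a b w y * f y) := by
  have hσ : 0 < ν * (b - a) / 2 := by have := mul_pos h.ν_pos (sub_pos.2 hab); positivity
  refine Integrable.mul_bdd (c := R) ?_ hf.aestronglyMeasurable (Eventually.of_forall fun y => hR y)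
  refine ((integrable_heatKernel_sub hσ w).const_mul 2).mono'
    ((h.measurable_stepKernel a b).comp measurable_prodMk_left).aestronglyMeasurable
    (Eventually.of_forall fun y => ?_)
  have := h.stepKernel_bounds hab hs w y
  rw [Real.norm_of_nonneg this.1]
  exact this.2

lemma Coeff.stepKernel_integral_bound (h : Coeff ν M m v U V) {a b R : ℝ} (hab : a < b)
    (hs : IsSmallStep E ν M v a b) {f : E → ℝ} (hf : Measurable f) (hR : ∀ y, |f y| ≤ R) :
    Measurable (fun w => ∫ y, stepKernel ν U V a b w y * f y) ∧
      ∀ w, |∫ y, stepKernel ν U V a b w y * f y| ≤ 2 * R := by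
  have hσ : 0 < ν * (b - a) / 2 := by have := mul_pos h.ν_pos (sub_pos.2 hab); positivity
  have hR0 : 0 ≤ R := (abs_nonneg _).trans (hR 0)
  refine ⟨?_, fun w => ?_⟩
  · have hm : Measurable fun p : E × E => stepKernel ν U V a b p.1 p.2 * f p.2 :=
      (h.measurable_stepKernel a b).mul (hf.comp measurable_snd)
    exact (hm.stronglyMeasurable.integral_prod_right' (ν := volume)).measurable
  · calc |∫ y, stepKernel ν U V a b w y * f y| ≤ ∫ y, 2 * R * heatKernel (ν * (b - a) / 2) (w - y) := by
          rw [← Real.norm_eq_abs]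
          refine norm_integral_le_of_norm_le ((integrable_heatKernel_sub hσ w).const_mul _)
            (Eventually.of_forall fun y => ?_)
          have h1 := h.stepKernel_bounds hab hs w y
          rw [norm_mul, Real.norm_of_nonneg h1.1]
          calc _ ≤ 2 * heatKernel (ν * (b - a) / 2) (w - y) * R :=
                mul_le_mul h1.2 (hR y) (abs_nonneg _) (h1.1.trans h1.2)
            _ = _ := by ring
      _ = 2 * R := by rw [integral_const_mul, integral_heatKernel_sub hσ, mul_one]

lemma integral_heatKernel_mul_kernel {c A C R : ℝ} (hc : 0 < c) (hA : 0 < A) {K : E → E → ℝ}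
    (hK : Measurable fun p : E × E => K p.1 p.2) (hKb : ∀ z w, |K z w| ≤ C * heatKernel A (z - w))
    {g : E → ℝ} (hg : Measurable g) (hR : ∀ y, |g y| ≤ R) (x : E) :
    ∫ z, heatKernel c (x - z) * ∫ w, K z w * g w =
      ∫ w, (∫ z, heatKernel c (x - z) * K z w) * g w := by
  have hR0 : 0 ≤ R := (abs_nonneg _).trans (hR 0)
  have hm : Measurable fun p : E × E => heatKernel c (x - p.1) * (K p.1 p.2 * g p.2) :=
    (Measurable.heatKernel (by fun_prop) (by fun_prop)).mul (hK.mul (hg.comp measurable_snd))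
  have hmaj : Integrable (fun p : E × E => heatKernel c (x - p.1) *
      (C * R * heatKernel A (p.1 - p.2))) ((volume : Measure E).prod volume) := by
    have hm' : Measurable fun p : E × E => heatKernel c (x - p.1) *
        (C * R * heatKernel A (p.1 - p.2)) :=
      (Measurable.heatKernel (by fun_prop) (by fun_prop)).mul
        ((Measurable.heatKernel (by fun_prop) (by fun_prop)).const_mul _)
    rw [integrable_prod_iff hm'.aestronglyMeasurable]
    refine ⟨Eventually.of_forall fun z =>
      (((integrable_heatKernel_sub hA z).const_mul (C * R)).const_mul (heatKernel c (x - z))), ?_⟩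
    have e : ∀ z : E, ∫ w, ‖heatKernel c (x - z) * (C * R * heatKernel A (z - w))‖ =
        heatKernel c (x - z) * |C * R| := fun z => by
      simp_rw [norm_mul, Real.norm_of_nonneg (heatKernel_pos hc _).le,
        Real.norm_of_nonneg (heatKernel_pos hA _).le]
      rw [integral_const_mul, integral_const_mul, integral_heatKernel_sub hA, mul_one,
        Real.norm_eq_abs, Real.norm_eq_abs, abs_mul]
    simp_rw [e]
    exact (integrable_heatKernel_sub hc x).mul_const _
  have hi : Integrable (fun p : E × E => heatKernel c (x - p.1) * (K p.1 p.2 * g p.2))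
      ((volume : Measure E).prod volume) := by
    refine hmaj.mono' hm.aestronglyMeasurable (Eventually.of_forall fun p => ?_)
    rw [norm_mul, norm_mul, Real.norm_of_nonneg (heatKernel_pos hc _).le]
    refine mul_le_mul_of_nonneg_left ?_ (heatKernel_pos hc _).le
    calc _ ≤ C * heatKernel A (p.1 - p.2) * R :=
          mul_le_mul (hKb _ _) (hR _) (abs_nonneg _) ((abs_nonneg _).trans (hKb _ _))
      _ = _ := by ring
  simp_rw [← integral_const_mul, ← integral_mul_const]
  rw [integral_integral_swap hi]
  refine integral_congr_ae (Eventually.of_forall fun w => ?_)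
  simp only [mul_assoc]

/-- The discrete form of Duhamel's formula, for one step. -/
lemma Coeff.heatAvg_schemeStep (h : Coeff ν M m v U V) {a b R c : ℝ} (hab : a < b) (hc : 0 ≤ c)
    (hs : IsSmallStep E ν M v a b) {f : E → ℝ} (hf : Measurable f) (hR : ∀ y, |f y| ≤ R) (x : E) :
    heatAvg c (schemeStep ν U V a b f) x = heatAvg (c + ν * (b - a)) f x +
      ∫ p : E × ℝ in univ ×ˢ Ioo a b,
        schemeKernel U V (c + ν * (b - a)) (c + 3 / 4 * (ν * (b - a))) x p.1 p.2 * f p.1 := by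
  have hσ : 0 < ν * (b - a) := mul_pos h.ν_pos (sub_pos.2 hab)
  have h2 : 0 < ν * (b - a) / 2 := by positivity
  have h4 : 0 < ν * (b - a) / 4 := by positivity
  set A := ν * (b - a) / 2 with hA
  set B := ν * (b - a) / 4 with hB
  set g : E → ℝ := fun w => ∫ y, stepKernel ν U V a b w y * f y with hg
  obtain ⟨hgm, hgb⟩ := h.stepKernel_integral_bound hab hs hf hR
  have hstep : ∀ x, schemeStep ν U V a b f x = ∫ w, heatKernel A (x - w) * g w := fun x => rfl
  -- The outer heat half-step merges with the averaging. The case `c = 0` is separate, because the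
  -- kernel formula for the average needs positive time.
  have e1 : heatAvg c (schemeStep ν U V a b f) x = ∫ w, heatKernel (c + A) (x - w) * g w := by
    rcases hc.eq_or_lt with rfl | hc0
    · rw [heatAvg_zero, hstep, zero_add]
    · rw [heatAvg_eq hc0]
      simp_rw [hstep]
      rw [integral_heatKernel_mul_kernel (K := fun z w => heatKernel A (z - w)) hc0 h2
        (Measurable.heatKernel (by fun_prop) (by fun_prop)) (C := 1) (fun z w => by rw [abs_of_pos (heatKernel_pos h2 _), one_mul]) hgm hgb]
      simp_rw [integral_heatKernel_conv h2 hc0, add_comm A c]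
      rfl
  have hcA : 0 < c + A := by positivity
  have hA' : A + (c + A) = c + ν * (b - a) := by rw [hA]; ring
  have hB' : B + (c + A) = c + 3 / 4 * (ν * (b - a)) := by rw [hA, hB]; ring
  -- The heat times add up to a full step in the leading and potential terms, and to `1/2 + 1/4 =
  -- 3/4` of a step in the drift term.
  have e2 : ∀ y, ∫ z, heatKernel (c + A) (x - z) * stepKernel ν U V a b z y =
      heatKernel (c + ν * (b - a)) (x - y) * (1 + potInt V a b y) +
        heatKernel (c + 3 / 4 * (ν * (b - a))) (x - y) * (inner ℝ (x - y) (driftInt U a b y) /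
          (2 * (c + 3 / 4 * (ν * (b - a))))) := by
    intro y
    have e : ∀ z, heatKernel (c + A) (x - z) * stepKernel ν U V a b z y =
        heatKernel (c + A) (x - z) * heatKernel A (z - y) * (1 + potInt V a b y) +
          heatKernel (c + A) (x - z) * (heatKernel B (z - y) *
            (inner ℝ (z - y) (driftInt U a b y) / (2 * B))) := fun z => by
      simp only [stepKernel, hA, hB]; ring
    simp_rw [e]
    rw [integral_add ((integrable_heatKernel_conv h2 hcA x y).mul_const _)
      (integrable_heatKernel_conv_grad h4 hcA x y _), integral_mul_const,
      integral_heatKernel_conv h2 hcA, integral_heatKernel_conv_grad h4 hcA, hA', hB']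
  have hA0 : 0 < c + ν * (b - a) := by positivity
  have hB0 : 0 < c + 3 / 4 * (ν * (b - a)) := by positivity
  rw [e1, integral_heatKernel_mul_kernel hcA h2 (h.measurable_stepKernel a b) (C := 2)
    (fun z w => by
      have := h.stepKernel_bounds hab hs z w
      rw [abs_of_nonneg this.1]; exact this.2) hf hR, heatAvg_eq hA0]
  simp_rw [e2]
  set A' := c + ν * (b - a)
  set B' := c + 3 / 4 * (ν * (b - a))
  have i1 := integrable_heatKernel_sub_mul hA0 hf hR x
  have i2 : Integrable fun y => heatKernel A' (x - y) * potInt V a b y * f y :=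
    ((integrable_heatKernel_sub hA0 x).mul_bdd (h.measurable_potInt a b).aestronglyMeasurable
      (Eventually.of_forall fun y => h.abs_potInt_le a b y)).mul_bdd hf.aestronglyMeasurable
      (Eventually.of_forall fun y => hR y)
  have i3 : Integrable fun y => heatKernel B' (x - y) *
      (inner ℝ (x - y) (driftInt U a b y) / (2 * B')) * f y :=
    (h.integrable_gauss_driftInt a b hB0 x).mul_bdd hf.aestronglyMeasurable
      (Eventually.of_forall fun y => hR y)
  have e3 : ∀ y, (heatKernel A' (x - y) * (1 + potInt V a b y) +
      heatKernel B' (x - y) * (inner ℝ (x - y) (driftInt U a b y) / (2 * B'))) * f y =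
      heatKernel A' (x - y) * f y + (heatKernel A' (x - y) * potInt V a b y * f y +
        heatKernel B' (x - y) * (inner ℝ (x - y) (driftInt U a b y) / (2 * B')) * f y) :=
    fun y => by ring
  simp_rw [e3]
  have i23 : Integrable fun y => heatKernel A' (x - y) * potInt V a b y * f y +
      heatKernel B' (x - y) * (inner ℝ (x - y) (driftInt U a b y) / (2 * B')) * f y := i2.add i3
  rw [integral_add i1 i23, integral_add i2 i3, h.integral_gauss_potInt hA0 x hf hR,
    h.integral_gauss_driftInt hB0 x hf hR, ← integral_add (h.integrableOn_gauss_V hA0 x hf hR)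
    (h.integrableOn_gauss_U hB0 x hf hR)]
  congr 2
  ext p
  simp only [schemeKernel]
  ring

end StepKernel

end AdvectionDiffusion

namespace AdvectionDiffusion

/-! ### The iterated scheme and its Duhamel formula -/

section SchemeSeq

variable {E : Type*} [NormedAddCommGroup E] [InnerProductSpace ℝ E] [FiniteDimensional ℝ E]
  [MeasurableSpace E] [BorelSpace E]
  {ν M : ℝ} {m v : ℝ → ℝ} {U : E → ℝ → E} {V : E → ℝ → ℝ}

lemma integral_Ioo_add {g : ℝ → ℝ} {a b c : ℝ} (hab : a ≤ b) (hbc : b ≤ c)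
    (hg : IntegrableOn g (Ioo a c)) :
    (∫ τ in Ioo a b, g τ) + ∫ τ in Ioo b c, g τ = ∫ τ in Ioo a c, g τ := by
  simp_rw [← integral_Ioc_eq_integral_Ioo]
  rw [← intervalIntegral.integral_of_le hab, ← intervalIntegral.integral_of_le hbc,
    ← intervalIntegral.integral_of_le (hab.trans hbc)]
  have hg' : IntegrableOn g (Ioc a c) := (integrableOn_Ioc_iff_integrableOn_Ioo).2 hg
  refine intervalIntegral.integral_add_adjacent_intervals ?_ ?_
  · exact (intervalIntegrable_iff_integrableOn_Ioc_of_le hab).2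
      (hg'.mono_set (Ioc_subset_Ioc_right hbc))
  · exact (intervalIntegrable_iff_integrableOn_Ioc_of_le hbc).2
      (hg'.mono_set (Ioc_subset_Ioc_left hab))

/-- The factors multiply over adjacent intervals, so their product over all steps depends only on
the total interval, not on the mesh. -/
lemma Coeff.stepFactor_mul (h : Coeff ν M m v U V) (α : E) {a b c : ℝ} (hab : a ≤ b) (hbc : b ≤ c) :
    stepFactor ν m v α a b * stepFactor ν m v α b c = stepFactor ν m v α a c := by
  rw [stepFactor, stepFactor, stepFactor, ← Real.exp_add,
    ← integral_Ioo_add hab hbc h.v_int.integrableOn, ← integral_Ioo_add hab hbc (h.integrableOn_m a c)]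
  congr 1
  ring

lemma stepFactor_pos (α : E) (a b : ℝ) : 0 < stepFactor ν m v α a b := Real.exp_pos _

lemma Coeff.stepFactor_zero_le (h : Coeff ν M m v U V) (a b : ℝ) :
    stepFactor ν m v (0 : E) a b ≤ Real.exp (∫ τ, v τ) := by
  rw [stepFactor]
  simp only [norm_zero, zero_mul, add_zero, ne_eq, OfNat.ofNat_ne_zero, not_false_eq_true, zero_pow,
    mul_zero, zero_add]
  exact Real.exp_le_exp.2 (setIntegral_le_integral h.v_int (Eventually.of_forall h.v_nonneg))

/-- The nodes of the approximation scheme. -/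
noncomputable def node (s σ : ℝ) (k : ℕ) : ℝ := s + k * σ

/-- The approximation scheme started from `φ` at time `s`, with time step `σ`. -/
noncomputable def schemeSeq (ν : ℝ) (U : E → ℝ → E) (V : E → ℝ → ℝ) (s σ : ℝ) (φ : E → ℝ) :
    ℕ → E → ℝ
  | 0 => φ
  | k + 1 => schemeStep ν U V (node s σ k) (node s σ (k + 1)) (schemeSeq ν U V s σ φ k)

lemma node_succ_sub (s σ : ℝ) (k : ℕ) : node s σ (k + 1) - node s σ k = σ := by
  simp only [node]; push_cast; ring

lemma node_lt_succ {s σ : ℝ} (hσ : 0 < σ) (k : ℕ) : node s σ k < node s σ (k + 1) := by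
  linarith [node_succ_sub s σ k]

lemma node_zero (s σ : ℝ) : node s σ 0 = s := by simp [node]

lemma le_node {s σ : ℝ} (hσ : 0 < σ) (k : ℕ) : s ≤ node s σ k :=
  le_add_of_nonneg_right (by positivity)

/-- The index of the time interval of the scheme that contains `τ`. -/
noncomputable def nodeIdx (s σ τ : ℝ) : ℕ := ⌊(τ - s) / σ⌋₊

lemma nodeIdx_eq {s σ τ : ℝ} (hσ : 0 < σ) {k : ℕ} (h1 : node s σ k ≤ τ)
    (h2 : τ < node s σ (k + 1)) : nodeIdx s σ τ = k := by
  have h0 := le_node (s := s) hσ k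
  rw [nodeIdx, Nat.floor_eq_iff (div_nonneg (by linarith) hσ.le), le_div_iff₀ hσ, div_lt_iff₀ hσ]
  simp only [node, Nat.cast_add, Nat.cast_one] at h1 h2
  constructor <;> linarith

lemma node_nodeIdx_le {s σ τ : ℝ} (hσ : 0 < σ) (hτ : s ≤ τ) : node s σ (nodeIdx s σ τ) ≤ τ := by
  have := Nat.floor_le (div_nonneg (sub_nonneg.2 hτ) hσ.le)
  rw [le_div_iff₀ hσ] at this
  rw [node, nodeIdx]
  linarith

lemma lt_node_nodeIdx_add {s σ τ : ℝ} (hσ : 0 < σ) : τ < node s σ (nodeIdx s σ τ) + σ := by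
  have := Nat.lt_floor_add_one ((τ - s) / σ)
  rw [div_lt_iff₀ hσ] at this
  rw [node, nodeIdx]
  linarith

lemma measurable_nodeIdx (s σ : ℝ) : Measurable (nodeIdx s σ) :=
  Nat.measurable_floor.comp (by fun_prop)

lemma Coeff.schemeStep_spec (h : Coeff ν M m v U V) {a b R : ℝ} (hab : a < b)
    (hs : IsSmallStep E ν M v a b) (hd : DivFreeOn U a b) {f : E → ℝ} (hf : Measurable f)
    (hf0 : ∀ y, 0 ≤ f y) (hR : ∀ y, f y ≤ R) :
    Measurable (schemeStep ν U V a b f) ∧ ∀ x, 0 ≤ schemeStep ν U V a b f x ∧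
      schemeStep ν U V a b f x ≤ R * stepFactor ν m v (0 : E) a b := by
  have hσ : 0 < ν * (b - a) / 2 := by have := mul_pos h.ν_pos (sub_pos.2 hab); positivity
  have hfR : ∀ y, |f y| ≤ R := fun y => by rw [abs_of_nonneg (hf0 y)]; exact hR y
  have hR0 : 0 ≤ R := (hf0 0).trans (hR 0)
  obtain ⟨hgm, hgb⟩ := h.stepKernel_integral_bound hab hs hf hfR
  have hF : 0 < stepFactor ν m v (0 : E) a b := stepFactor_pos _ _ _
  have hg0 : ∀ w, 0 ≤ ∫ y, stepKernel ν U V a b w y * f y := fun w =>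
    integral_nonneg fun y => mul_nonneg (h.stepKernel_bounds hab hs w y).1 (hf0 y)
  have hgle : ∀ w, ∫ y, stepKernel ν U V a b w y * f y ≤ R * stepFactor ν m v (0 : E) a b := by
    intro w
    obtain ⟨hi, hle⟩ := h.integral_stepKernel_right hab hd 0 w
    simp only [inner_zero_left, Real.exp_zero, mul_one] at hi hle
    calc _ ≤ ∫ y, stepKernel ν U V a b w y * R :=
          integral_mono (h.integrable_stepKernel_mul hab hs hf hfR w) (hi.mul_const R) fun y =>
            mul_le_mul_of_nonneg_left (hR y) (h.stepKernel_bounds hab hs w y).1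
      _ ≤ _ := by
          rw [integral_mul_const, mul_comm]
          exact mul_le_mul_of_nonneg_left hle hR0
  refine ⟨?_, fun x => ⟨integral_nonneg fun w => mul_nonneg (heatKernel_pos hσ _).le (hg0 w), ?_⟩⟩
  · have : Measurable fun p : E × E => heatKernel (ν * (b - a) / 2) (p.1 - p.2) *
        ∫ y, stepKernel ν U V a b p.2 y * f y :=
      (Measurable.heatKernel (by fun_prop) (by fun_prop)).mul (hgm.comp measurable_snd)
    exact (this.stronglyMeasurable.integral_prod_right' (ν := volume)).measurable
  · calc _ ≤ ∫ w, heatKernel (ν * (b - a) / 2) (x - w) * (R * stepFactor ν m v (0 : E) a b) :=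
          integral_mono (integrable_heatKernel_sub_mul hσ hgm (fun w => by
            rw [abs_of_nonneg (hg0 w)]; exact hgle w) x)
            ((integrable_heatKernel_sub hσ x).mul_const _) fun w =>
            mul_le_mul_of_nonneg_left (hgle w) (heatKernel_pos hσ _).le
      _ = _ := by rw [integral_mul_const, integral_heatKernel_sub hσ, one_mul]

/-- All the steps of the scheme are small. -/
def IsSmallMesh (E : Type*) [NormedAddCommGroup E] [InnerProductSpace ℝ E] (ν M : ℝ) (v : ℝ → ℝ)
    (σ : ℝ) : Prop :=
  0 < σ ∧ ∀ a b, b - a = σ → IsSmallStep E ν M v a b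

/-- The smallness condition is, in closed form, that the time density with `c = gaussFactor E` has
integral at most `1/2` over the step. -/
lemma Coeff.exists_isSmallMesh (h : Coeff ν M m v U V) :
    ∃ δ : ℝ, 0 < δ ∧ ∀ σ, 0 < σ → σ ≤ δ → IsSmallMesh E ν M v σ := by
  obtain ⟨δ, hδ, hδ'⟩ := exists_integral_rate_le (gaussFactor_pos (E := E)).le h.ν_pos h.M_nonneg
    h.v_int h.v_nonneg (show (0 : ℝ) < 1 / 2 by norm_num)
  refine ⟨δ, hδ, fun σ hσ hσδ => ⟨hσ, fun a b hab => ?_⟩⟩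
  have h1 := hδ' a b (by linarith)
  have hab' : a ≤ b := by linarith
  rw [integral_rate h.ν_pos h.v_int hab', intervalIntegral.integral_of_le hab',
    integral_Ioc_eq_integral_Ioo] at h1
  exact h1

/-- The sharper bound by the product of the step factors is what propagates. It is weakened at the
end to a bound independent of the mesh and of `k`. -/
lemma Coeff.schemeSeq_spec (h : Coeff ν M m v U V) (hd : ∀ a b, DivFreeOn U a b) {s σ R : ℝ}
    (hσ : IsSmallMesh E ν M v σ) {φ : E → ℝ} (hφ : Measurable φ) (hφ0 : ∀ y, 0 ≤ φ y)
    (hR : ∀ y, φ y ≤ R) (k : ℕ) :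
    Measurable (schemeSeq ν U V s σ φ k) ∧ ∀ x, 0 ≤ schemeSeq ν U V s σ φ k x ∧
      schemeSeq ν U V s σ φ k x ≤ R * Real.exp (∫ τ, v τ) := by
  have hR0 : 0 ≤ R := (hφ0 0).trans (hR 0)
  suffices H : Measurable (schemeSeq ν U V s σ φ k) ∧ ∀ x, 0 ≤ schemeSeq ν U V s σ φ k x ∧
      schemeSeq ν U V s σ φ k x ≤ R * stepFactor ν m v (0 : E) s (node s σ k) from
    ⟨H.1, fun x => ⟨(H.2 x).1, (H.2 x).2.trans
      (mul_le_mul_of_nonneg_left (h.stepFactor_zero_le _ _) hR0)⟩⟩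
  induction k with
  | zero => exact ⟨hφ, fun x => ⟨hφ0 x, (hR x).trans (by simp [node_zero, stepFactor])⟩⟩
  | succ k ih =>
    have h1 := h.schemeStep_spec (node_lt_succ hσ.1 k) (hσ.2 _ _ (node_succ_sub s σ k))
      (hd _ _) ih.1 (fun y => (ih.2 y).1) (fun y => (ih.2 y).2)
    refine ⟨h1.1, fun x => ⟨(h1.2 x).1, (h1.2 x).2.trans_eq ?_⟩⟩
    rw [mul_assoc, h.stepFactor_mul 0 (le_node hσ.1 k) (node_lt_succ hσ.1 k).le]

lemma integrableOn_strip_add {f : E × ℝ → ℝ} {a b c : ℝ} (hab : a ≤ b) (hbc : b < c)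
    (h1 : IntegrableOn f (univ ×ˢ Ioo a b)) (h2 : IntegrableOn f (univ ×ˢ Ioo b c)) :
    IntegrableOn f (univ ×ˢ Ioo a c) ∧ ∫ p in univ ×ˢ Ioo a c, f p =
      (∫ p in univ ×ˢ Ioo a b, f p) + ∫ p in univ ×ˢ Ioo b c, f p := by
  have e : ((univ : Set E) ×ˢ Ioo a c : Set (E × ℝ)) =ᵐ[volume]
      ((univ : Set E) ×ˢ Ioo a b ∪ (univ : Set E) ×ˢ Ioo b c : Set (E × ℝ)) := by
    refine eventuallyEq_set.2 ?_
    filter_upwards [ae_snd_ne (E := E) b] with p hp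
    simp only [mem_prod, mem_univ, true_and, mem_Ioo, mem_union]
    constructor
    · rintro ⟨h3, h4⟩
      rcases lt_or_gt_of_ne hp with h5 | h5
      · exact Or.inl ⟨h3, h5⟩
      · exact Or.inr ⟨h5, h4⟩
    · rintro (⟨h3, h4⟩ | ⟨h3, h4⟩)
      · exact ⟨h3, h4.trans hbc⟩
      · exact ⟨hab.trans_lt h3, h4⟩
  rw [integrableOn_congr_set_ae e, setIntegral_congr_set e]
  refine ⟨h1.union h2, setIntegral_union ?_ (measurableSet_strip b c) h1 h2⟩
  rw [Set.disjoint_left]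
  rintro p ⟨-, h3⟩ ⟨-, h4⟩
  exact lt_asymm h3.2 h4.1

lemma Coeff.integrableOn_schemeKernel_mul (h : Coeff ν M m v U V) {a b R A B : ℝ} (hA : 0 < A)
    (hB : 0 < B) (x : E) {f : E → ℝ} (hf : Measurable f) (hR : ∀ y, |f y| ≤ R) :
    IntegrableOn (fun p : E × ℝ => schemeKernel U V A B x p.1 p.2 * f p.1) (univ ×ˢ Ioo a b) := by
  have := (h.integrableOn_gauss_V (a := a) (b := b) hA x hf hR).add
    (h.integrableOn_gauss_U (a := a) (b := b) hB x hf hR)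
  refine this.congr (Eventually.of_forall fun p => ?_)
  simp only [Pi.add_apply, schemeKernel]
  ring

/-- The integral kernel of the scheme at the point `(x, t)` (for a node `t`). -/
noncomputable def meshKernel (ν : ℝ) (U : E → ℝ → E) (V : E → ℝ → ℝ) (s σ : ℝ) (x : E) (t : ℝ)
    (z : E) (τ : ℝ) : ℝ :=
  schemeKernel U V (ν * (t - node s σ (nodeIdx s σ τ)))
    (ν * (t - node s σ (nodeIdx s σ τ) - σ / 4)) x z τ

/-- The one-step formula telescopes along the nodes: each step adds the strip between two nodes, on
which the kernel depends on `τ` only through the preceding node and the coefficients. -/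
lemma Coeff.heatAvg_schemeSeq (h : Coeff ν M m v U V) (hd : ∀ a b, DivFreeOn U a b) {s σ R : ℝ}
    (hσ : IsSmallMesh E ν M v σ) {φ : E → ℝ} (hφ : Measurable φ) (hφ0 : ∀ y, 0 ≤ φ y)
    (hR : ∀ y, φ y ≤ R) (k : ℕ) (x : E) {t : ℝ} (ht : node s σ k ≤ t) :
    IntegrableOn (fun p : E × ℝ => meshKernel ν U V s σ x t p.1 p.2 *
        schemeSeq ν U V s σ φ (nodeIdx s σ p.2) p.1) (univ ×ˢ Ioo s (node s σ k)) ∧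
    heatAvg (ν * (t - node s σ k)) (schemeSeq ν U V s σ φ k) x = heatAvg (ν * (t - s)) φ x +
      ∫ p : E × ℝ in univ ×ˢ Ioo s (node s σ k), meshKernel ν U V s σ x t p.1 p.2 *
        schemeSeq ν U V s σ φ (nodeIdx s σ p.2) p.1 := by
  have hν := h.ν_pos
  have hσ0 := hσ.1
  induction k with
  | zero => simp [node_zero, schemeSeq]
  | succ k ih =>
    have hlt := node_lt_succ (s := s) hσ.1 k
    have hsub := node_succ_sub s σ k
    obtain ⟨ih1, ih2⟩ := ih (hlt.le.trans ht)
    obtain ⟨hm, hb⟩ := h.schemeSeq_spec hd (s := s) hσ hφ hφ0 hR k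
    have hb' : ∀ y, |schemeSeq ν U V s σ φ k y| ≤ R * Real.exp (∫ τ, v τ) := fun y => by
      rw [abs_of_nonneg (hb y).1]; exact (hb y).2
    have hc : 0 ≤ ν * (t - node s σ (k + 1)) := mul_nonneg hν.le (by linarith)
    have h1 := h.heatAvg_schemeStep hlt hc (hσ.2 _ _ hsub) hm hb' x
    have e1 : ν * (t - node s σ (k + 1)) + ν * (node s σ (k + 1) - node s σ k) =
        ν * (t - node s σ k) := by ring
    have e2 : ν * (t - node s σ (k + 1)) + 3 / 4 * (ν * (node s σ (k + 1) - node s σ k)) =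
        ν * (t - node s σ k - σ / 4) := by
      rw [show node s σ (k + 1) = node s σ k + σ by linarith]; ring
    rw [e1, e2, ih2] at h1
    have hA : 0 < ν * (t - node s σ k) := mul_pos hν (by linarith)
    have hB : 0 < ν * (t - node s σ k - σ / 4) := mul_pos hν (by linarith)
    have hcongr : EqOn (fun p : E × ℝ => schemeKernel U V (ν * (t - node s σ k))
        (ν * (t - node s σ k - σ / 4)) x p.1 p.2 * schemeSeq ν U V s σ φ k p.1)
        (fun p : E × ℝ => meshKernel ν U V s σ x t p.1 p.2 *
          schemeSeq ν U V s σ φ (nodeIdx s σ p.2) p.1)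
        (univ ×ˢ Ioo (node s σ k) (node s σ (k + 1))) := by
      rintro ⟨z, τ⟩ ⟨-, h3, h4⟩
      simp only [meshKernel, nodeIdx_eq hσ0 (le_of_lt h3) h4]
    have i2 := (h.integrableOn_schemeKernel_mul (a := node s σ k) (b := node s σ (k + 1)) hA hB x
      hm hb').congr_fun hcongr (measurableSet_strip _ _)
    obtain ⟨h5, h6⟩ := integrableOn_strip_add (le_node hσ0 k) hlt ih1 i2
    refine ⟨h5, ?_⟩
    rw [h6, ← setIntegral_congr_fun (measurableSet_strip _ _) hcongr, schemeSeq, h1, add_assoc]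

end SchemeSeq

end AdvectionDiffusion

namespace AdvectionDiffusion

/-! ### Convergence of the scheme's kernel to the Duhamel kernel -/

section SchemeConv

variable {E : Type*} [NormedAddCommGroup E] [InnerProductSpace ℝ E] [FiniteDimensional ℝ E]
  [MeasurableSpace E] [BorelSpace E]
  {ν M : ℝ} {m v : ℝ → ℝ} {U : E → ℝ → E} {V : E → ℝ → ℝ}

lemma node_mono {s σ : ℝ} (hσ : 0 < σ) : Monotone (node s σ) := fun i j h => by
  have : (i : ℝ) ≤ j := by exact_mod_cast h
  simp only [node]
  gcongr

lemma node_nodeIdx_add_le {s σ τ : ℝ} (hσ : 0 < σ) {k : ℕ} (hτ : s ≤ τ) (hτk : τ < node s σ k) :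
    node s σ (nodeIdx s σ τ) + σ ≤ node s σ k := by
  have h1 : nodeIdx s σ τ < k := by
    by_contra! h2
    exact absurd ((node_mono hσ h2).trans (node_nodeIdx_le hσ hτ)) (not_le.2 hτk)
  have h2 := node_mono (s := s) hσ (Nat.succ_le_of_lt h1)
  have h3 := node_succ_sub s σ (nodeIdx s σ τ)
  simp only [Nat.succ_eq_add_one] at h2
  linarith

/-- The sum of Gaussian kernels that dominates the kernel of the scheme. -/
noncomputable def meshMajorant (ν s σ : ℝ) (x : E) (t : ℝ) (z : E) (τ : ℝ) : ℝ :=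
  heatKernel (ν * (t - node s σ (nodeIdx s σ τ))) (x - z) +
    heatKernel (2 * (ν * (t - node s σ (nodeIdx s σ τ) - σ / 4))) (x - z)

/-- The endpoint is a node, so it lies at least one full step after the node preceding `τ`, and the
shift `σ/4` is harmless. The factor `1/4` is not optimal; it is a square and costs just a factor 2
in `√`. -/
lemma mesh_pos {s σ τ : ℝ} (hν : 0 < ν) (hσ : 0 < σ) {k : ℕ} (hτ : s ≤ τ) (hτk : τ < node s σ k) :
    0 < ν * (node s σ k - node s σ (nodeIdx s σ τ)) ∧
    ν * (node s σ k - τ) / 4 ≤ ν * (node s σ k - node s σ (nodeIdx s σ τ) - σ / 4) := by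
  have h1 := node_nodeIdx_add_le hσ hτ hτk
  have h2 := node_nodeIdx_le hσ hτ
  refine ⟨mul_pos hν (by linarith), ?_⟩
  rw [mul_div_assoc]
  exact mul_le_mul_of_nonneg_left (by linarith) hν.le

lemma meshMajorant_spec {s σ τ : ℝ} (hν : 0 < ν) (hσ : 0 < σ) {k : ℕ} (hτ : s ≤ τ)
    (hτk : τ < node s σ k) (x : E) :
    Integrable (fun z => meshMajorant ν s σ x (node s σ k) z τ) ∧
      ∫ z, meshMajorant ν s σ x (node s σ k) z τ = 2 := by
  obtain ⟨h1, h2⟩ := mesh_pos hν hσ hτ hτk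
  have h3 : 0 < ν * (node s σ k - τ) / 4 := by have := mul_pos hν (sub_pos.2 hτk); positivity
  have h4 : 0 < 2 * (ν * (node s σ k - node s σ (nodeIdx s σ τ) - σ / 4)) := by linarith
  refine ⟨(integrable_heatKernel_sub h1 x).add (integrable_heatKernel_sub h4 x), ?_⟩
  simp only [meshMajorant]
  rw [integral_add (integrable_heatKernel_sub h1 x) (integrable_heatKernel_sub h4 x),
    integral_heatKernel_sub h1, integral_heatKernel_sub h4]
  norm_num

lemma Coeff.abs_meshKernel_le (h : Coeff ν M m v U V) {s σ τ : ℝ} (hσ : 0 < σ) {k : ℕ}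
    (hτ : s ≤ τ) (hτk : τ < node s σ k) (x z : E) :
    |meshKernel ν U V s σ x (node s σ k) z τ| ≤
      rate (2 * gaussFactor E) ν M v (node s σ k) τ * meshMajorant ν s σ x (node s σ k) z τ := by
  have hν := h.ν_pos
  have hM := h.M_nonneg
  have hv := h.v_nonneg τ
  have hg := one_le_gaussFactor (E := E)
  obtain ⟨h1, h2⟩ := mesh_pos hν hσ hτ hτk
  set t := node s σ k
  have h0 : 0 < ν * (t - τ) := mul_pos hν (sub_pos.2 hτk)
  simp only [meshKernel, schemeKernel, meshMajorant]
  set A := ν * (t - node s σ (nodeIdx s σ τ))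
  set B := ν * (t - node s σ (nodeIdx s σ τ) - σ / 4)
  have hB : 0 < B := by linarith
  have hA := heatKernel_pos h1 (x - z)
  have hB' := heatKernel_pos (show 0 < 2 * B by positivity) (x - z)
  have hd := abs_drift_kernel_le (V₀ := 0) (v₀ := 0) hB (h.U_le' z τ) (by simp) (x - z)
  simp only [zero_add, add_zero] at hd
  have hs : M / Real.sqrt B ≤ 2 * (M / Real.sqrt (ν * (t - τ))) := by
    have : Real.sqrt (ν * (t - τ) / 4) ≤ Real.sqrt B := Real.sqrt_le_sqrt h2
    rw [Real.sqrt_div h0.le, show (4 : ℝ) = 2 ^ 2 by norm_num, Real.sqrt_sq (by norm_num)] at this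
    have h5 := Real.sqrt_pos.2 h0
    calc M / Real.sqrt B ≤ M / (Real.sqrt (ν * (t - τ)) / 2) := by gcongr
      _ = _ := by field_simp
  have hq : 0 ≤ M / Real.sqrt (ν * (t - τ)) := by positivity
  rw [rate, mul_add]
  refine (abs_add_le _ _).trans (add_le_add ?_ (hd.trans ?_))
  · rw [abs_mul, abs_of_pos hA, mul_comm]
    refine mul_le_mul_of_nonneg_right ?_ hA.le
    have := h.V_le z τ
    nlinarith
  · refine mul_le_mul_of_nonneg_right ?_ hB'.le
    nlinarith

lemma Coeff.measurable_meshKernel (h : Coeff ν M m v U V) (s σ : ℝ) (x : E) (t : ℝ) :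
    Measurable (fun p : E × ℝ => meshKernel ν U V s σ x t p.1 p.2) := by
  have h1 : Measurable fun p : E × ℝ => node s σ (nodeIdx s σ p.2) :=
    (measurable_of_countable (node s σ)).comp ((measurable_nodeIdx s σ).comp measurable_snd)
  have hU := h.measU
  have hV := h.measV
  have h2 : Measurable fun p : E × ℝ => x - p.1 := by fun_prop
  exact ((Measurable.heatKernel (by fun_prop) h2).mul hV).add
    ((Measurable.heatKernel (by fun_prop) h2).mul ((h2.inner hU).div (by fun_prop)))

lemma measurable_meshMajorant (s σ : ℝ) (x : E) (t : ℝ) :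
    Measurable (fun p : E × ℝ => meshMajorant ν s σ x t p.1 p.2) := by
  have h1 : Measurable fun p : E × ℝ => node s σ (nodeIdx s σ p.2) :=
    (measurable_of_countable (node s σ)).comp ((measurable_nodeIdx s σ).comp measurable_snd)
  have h2 : Measurable fun p : E × ℝ => x - p.1 := by fun_prop
  exact (Measurable.heatKernel (by fun_prop) h2).add (Measurable.heatKernel (by fun_prop) h2)

lemma meshMajorant_nonneg {s σ τ : ℝ} (hν : 0 < ν) (hσ : 0 < σ) {k : ℕ} (hτ : s ≤ τ)
    (hτk : τ < node s σ k) (x z : E) : 0 ≤ meshMajorant ν s σ x (node s σ k) z τ := by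
  obtain ⟨h1, h2⟩ := mesh_pos hν hσ hτ hτk
  have h3 : 0 < ν * (node s σ k - τ) := mul_pos hν (sub_pos.2 hτk)
  exact add_nonneg (heatKernel_pos h1 _).le (heatKernel_pos (by linarith) _).le

lemma tendsto_node_nodeIdx {s τ : ℝ} {σ : ℕ → ℝ} (hσ : ∀ j, 0 < σ j)
    (hσ0 : Tendsto σ atTop (𝓝 0)) (hτ : s ≤ τ) :
    Tendsto (fun j => node s (σ j) (nodeIdx s (σ j) τ)) atTop (𝓝 τ) := by
  refine tendsto_of_tendsto_of_tendsto_of_le_of_le (g := fun j => τ - σ j) (h := fun _ => τ)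
    ?_ tendsto_const_nhds (fun j => ?_) (fun j => node_nodeIdx_le (hσ j) hτ)
  · simpa using (tendsto_const_nhds (x := τ)).sub hσ0
  · have := lt_node_nodeIdx_add (s := s) (τ := τ) (hσ j)
    simp only
    linarith

lemma Tendsto.heatKernel {ι : Type*} {l : Filter ι} {a : ι → ℝ} {a₀ : ℝ} (ha : Tendsto a l (𝓝 a₀))
    (h0 : 0 < a₀) (x : E) : Tendsto (fun j => heatKernel (a j) x) l (𝓝 (heatKernel a₀ x)) := by
  have h1 : ContinuousAt (fun p : ℝ × E => AdvectionDiffusion.heatKernel p.1 p.2) (a₀, x) :=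
    continuousOn_heatKernel.continuousAt ((isOpen_lt continuous_const continuous_fst).mem_nhds h0)
  exact h1.tendsto.comp (ha.prodMk_nhds tendsto_const_nhds)

lemma Coeff.integrable_rate_meshMajorant (h : Coeff ν M m v U V) {s σ : ℝ} (hσ : 0 < σ) (k : ℕ)
    (x : E) :
    IntegrableOn (fun p : E × ℝ => rate (2 * gaussFactor E) ν M v (node s σ k) p.2 *
      meshMajorant ν s σ x (node s σ k) p.1 p.2) (univ ×ˢ Ioo s (node s σ k)) := by
  have hr : IntegrableOn (rate (2 * gaussFactor E) ν M v (node s σ k)) (Ioo s (node s σ k)) :=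
    integrableOn_rate h.ν_pos h.v_int _ _
  have hg := gaussFactor_pos (E := E)
  refine (strip_bound (R := 2) (k := fun z τ => meshMajorant ν s σ x (node s σ k) z τ) ?_ hr
    (fun τ _ => AdvectionDiffusion.rate_nonneg (by positivity) h.M_nonneg h.v_nonneg _ _) (fun τ hτ => ?_)
    (fun z τ hτ => ?_)).1
  · refine AEStronglyMeasurable.mul ?_ (measurable_meshMajorant s σ x _).aestronglyMeasurable
    rw [restrict_strip]
    exact hr.aestronglyMeasurable.comp_snd
  · have := meshMajorant_spec h.ν_pos hσ hτ.1.le hτ.2 x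
    exact ⟨this.1, this.2.le⟩
  · rw [abs_of_nonneg]
    exact mul_nonneg (AdvectionDiffusion.rate_nonneg (by positivity) h.M_nonneg h.v_nonneg _ _)
      (meshMajorant_nonneg h.ν_pos hσ hτ.1.le hτ.2 x z)

/-- The singularity of the majorants sits at the last node and moves towards `t`. Their space
integrals equal 2, so their total integrals are explicit and converge, and varying dominated
convergence applies. The functions `F j` need only be bounded, since they multiply a kernel
difference tending to zero. -/
lemma Coeff.tendsto_integral_meshKernel (h : Coeff ν M m v U V) {s t R : ℝ} (hst : s < t)
    {σ : ℕ → ℝ} (hσ : ∀ j, 0 < σ j) (hσ0 : Tendsto σ atTop (𝓝 0)) {F : ℕ → E × ℝ → ℝ}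
    (hF : ∀ j, Measurable (F j)) (hR : ∀ j p, |F j p| ≤ R) (x : E) :
    Tendsto (fun j => ∫ p in univ ×ˢ Ioo s t,
      ({q : E × ℝ | q.2 < node s (σ j) (nodeIdx s (σ j) t)}.indicator
        (fun q => meshKernel ν U V s (σ j) x (node s (σ j) (nodeIdx s (σ j) t)) q.1 q.2) p -
        duhamelKernel ν U V x t p.1 p.2) * F j p) atTop (𝓝 0) := by
  have hν := h.ν_pos
  have hg := gaussFactor_pos (E := E)
  have hR0 : 0 ≤ R := (abs_nonneg _).trans (hR 0 (0, 0))
  set θ : ℕ → ℝ := fun j => node s (σ j) (nodeIdx s (σ j) t) with hθ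
  have hθt : ∀ j, θ j ≤ t := fun j => node_nodeIdx_le (hσ j) hst.le
  have hsθ : ∀ j, s ≤ θ j := fun j => le_node (hσ j) _
  have hθlim : Tendsto θ atTop (𝓝 t) := tendsto_node_nodeIdx hσ hσ0 hst.le
  have hms : ∀ a : ℝ, MeasurableSet {q : E × ℝ | q.2 < a} := fun a =>
    measurableSet_lt measurable_snd measurable_const
  set g : ℕ → E × ℝ → ℝ := fun j => {q : E × ℝ | q.2 < θ j}.indicator fun q =>
    rate (2 * gaussFactor E) ν M v (θ j) q.2 * meshMajorant ν s (σ j) x (θ j) q.1 q.2 with hgd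
  set g' : E × ℝ → ℝ := fun q => rate (2 * gaussFactor E) ν M v t q.2 *
    (heatKernel (ν * (t - q.2)) (x - q.1) + heatKernel (2 * (ν * (t - q.2))) (x - q.1)) with hgd'
  have hk : ∀ τ ∈ Ioo s t, Integrable (fun z : E => heatKernel (ν * (t - τ)) (x - z) +
      heatKernel (2 * (ν * (t - τ))) (x - z)) ∧ ∫ z : E, heatKernel (ν * (t - τ)) (x - z) +
      heatKernel (2 * (ν * (t - τ))) (x - z) = 2 := fun τ hτ => by
    have h1 : 0 < ν * (t - τ) := mul_pos hν (sub_pos.2 hτ.2)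
    have h2 : 0 < 2 * (ν * (t - τ)) := by positivity
    refine ⟨(integrable_heatKernel_sub h1 x).add (integrable_heatKernel_sub h2 x), ?_⟩
    rw [integral_add (integrable_heatKernel_sub h1 x) (integrable_heatKernel_sub h2 x),
      integral_heatKernel_sub h1, integral_heatKernel_sub h2]
    norm_num
  have hr : IntegrableOn (rate (2 * gaussFactor E) ν M v t) (Ioo s t) :=
    integrableOn_rate h.ν_pos h.v_int _ _
  have hr0 : ∀ a τ, 0 ≤ rate (2 * gaussFactor E) ν M v a τ := fun a τ =>
    AdvectionDiffusion.rate_nonneg (by positivity) h.M_nonneg h.v_nonneg _ _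
  have hgi' : IntegrableOn g' (univ ×ˢ Ioo s t) := by
    refine (strip_bound (R := 2) (k := fun z τ => heatKernel (ν * (t - τ)) (x - z) +
      heatKernel (2 * (ν * (t - τ))) (x - z)) ?_ hr (fun τ _ => hr0 t τ)
      (fun τ hτ => ⟨(hk τ hτ).1, (hk τ hτ).2.le⟩) (fun z τ hτ => ?_)).1
    · refine AEStronglyMeasurable.mul ?_ (((Measurable.heatKernel (by fun_prop) (by fun_prop)).add
        (Measurable.heatKernel (by fun_prop) (by fun_prop))).aestronglyMeasurable)
      rw [restrict_strip]
      exact hr.aestronglyMeasurable.comp_snd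
    · have h1 : 0 < ν * (t - τ) := mul_pos hν (sub_pos.2 hτ.2)
      rw [abs_of_nonneg]
      exact mul_nonneg (hr0 t τ) (add_nonneg (heatKernel_pos h1 _).le
        (heatKernel_pos (by positivity) _).le)
  have hgi : ∀ j, IntegrableOn (g j) (univ ×ˢ Ioo s t) := fun j =>
    integrable_indicator_lt (hθt j) (h.integrable_rate_meshMajorant (hσ j) _ x)
  have hgint : ∀ j, ∫ p in univ ×ˢ Ioo s t, g j p =
      (∫ τ in Ioo s (θ j), rate (2 * gaussFactor E) ν M v (θ j) τ) * 2 := fun j => by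
    rw [hgd, setIntegral_indicator_lt (hθt j)]
    exact integral_strip_mul (g := rate (2 * gaussFactor E) ν M v (θ j))
      (k := fun z τ => meshMajorant ν s (σ j) x (θ j) z τ)
      (h.integrable_rate_meshMajorant (hσ j) _ x)
      (fun τ hτ => (meshMajorant_spec hν (hσ j) hτ.1.le hτ.2 x).2)
  have hgint' : ∫ p in univ ×ˢ Ioo s t, g' p =
      (∫ τ in Ioo s t, rate (2 * gaussFactor E) ν M v t τ) * 2 :=
    integral_strip_mul (g := rate (2 * gaussFactor E) ν M v t)
      (k := fun z τ => heatKernel (ν * (t - τ)) (x - z) + heatKernel (2 * (ν * (t - τ))) (x - z))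
      hgi' (fun τ hτ => (hk τ hτ).2)
  have hcont : Continuous fun b => ∫ τ in s..b, v τ :=
    intervalIntegral.continuous_primitive (fun a b => h.v_int.intervalIntegrable) s
  have hglim : Tendsto (fun j => ∫ p in univ ×ˢ Ioo s t, g j p) atTop
      (𝓝 (∫ p in univ ×ˢ Ioo s t, g' p)) := by
    simp_rw [hgint]
    rw [hgint', integral_rate hν h.v_int hst.le]
    simp_rw [integral_rate hν h.v_int (hsθ _)]
    have : Continuous fun b => 2 * gaussFactor E * (M / Real.sqrt ν * (2 * Real.sqrt (b - s)) +
        ∫ τ in s..b, v τ) * 2 := by fun_prop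
    exact (this.tendsto t).comp hθlim
  have hlim : ∀ᵐ p ∂((volume : Measure (E × ℝ)).restrict (univ ×ˢ Ioo s t)),
      ((∀ᶠ j in atTop, p.2 < θ j) ∧
        Tendsto (fun j => ν * (θ j - node s (σ j) (nodeIdx s (σ j) p.2))) atTop
          (𝓝 (ν * (t - p.2)))) ∧
        Tendsto (fun j => ν * (θ j - node s (σ j) (nodeIdx s (σ j) p.2) - σ j / 4)) atTop
          (𝓝 (ν * (t - p.2))) := by
    refine ae_strip fun z τ hτ => ?_
    have h1 := tendsto_node_nodeIdx hσ hσ0 hτ.1.le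
    refine ⟨⟨hθlim.eventually (lt_mem_nhds hτ.2), (hθlim.sub h1).const_mul ν⟩, ?_⟩
    have h2 : Tendsto (fun j => σ j / 4) atTop (𝓝 0) := by simpa using hσ0.div_const 4
    simpa only [sub_zero] using ((hθlim.sub h1).sub h2).const_mul ν
  have hpos : ∀ᵐ p ∂((volume : Measure (E × ℝ)).restrict (univ ×ˢ Ioo s t)), p.2 ∈ Ioo s t :=
    ae_strip fun z τ hτ => hτ
  have h0 : ∫ p in (univ : Set E) ×ˢ Ioo s t, (fun _ : E × ℝ => (0 : ℝ)) p = 0 := by simp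
  rw [← h0]
  refine tendsto_integral_of_varying_dominated (g := fun j p => (g j p + g' p) * R)
    (g' := fun p => (g' p + g' p) * R) (fun j => ?_) (fun j => ((hgi j).add hgi').mul_const R)
    ((hgi'.add hgi').mul_const R) (fun j => ?_) ?_ ?_ ?_
  · refine (AEStronglyMeasurable.sub ?_ ?_).mul (hF j).aestronglyMeasurable
    · exact ((h.measurable_meshKernel s (σ j) x _).indicator (hms _)).aestronglyMeasurable
    · exact (h.measurable_duhamelKernel measurable_const measurable_fst measurable_const
        measurable_snd).aestronglyMeasurable
  · filter_upwards [hpos] with p hp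
    rw [abs_mul]
    have hgj : |{q : E × ℝ | q.2 < θ j}.indicator
        (fun q => meshKernel ν U V s (σ j) x (θ j) q.1 q.2) p| ≤ g j p := by
      by_cases hpj : p.2 < θ j
      · simp only [hgd]; rw [indicator_of_mem (by exact hpj), indicator_of_mem (by exact hpj)]
        exact h.abs_meshKernel_le (hσ j) hp.1.le hpj x p.1
      · simp only [hgd]; rw [indicator_of_notMem (by exact hpj), indicator_of_notMem (by exact hpj), abs_zero]
    have hdk : |duhamelKernel ν U V x t p.1 p.2| ≤ g' p := by
      have h1 : 0 < ν * (t - p.2) := mul_pos hν (sub_pos.2 hp.2)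
      have h3 := heatKernel_pos h1 (x - p.1)
      have h4 := heatKernel_pos (show 0 < 2 * (ν * (t - p.2)) by positivity) (x - p.1)
      refine (h.abs_duhamelKernel_le x p.1 hp.2).trans (mul_le_mul ?_ (by linarith) h4.le (hr0 _ _))
      have := h.rate_nonneg t p.2
      have e : rate (2 * gaussFactor E) ν M v t p.2 = 2 * rate (gaussFactor E) ν M v t p.2 := by
        simp only [rate]; ring
      linarith
    exact mul_le_mul ((abs_sub _ _).trans (add_le_add hgj hdk)) (hR j p) (abs_nonneg _)
      ((abs_nonneg _).trans ((abs_sub _ _).trans (add_le_add hgj hdk)))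
  · filter_upwards [hpos, hlim] with p hp ⟨⟨h1, h2⟩, h3⟩
    have h4 : 0 < ν * (t - p.2) := mul_pos hν (sub_pos.2 hp.2)
    have h5 : Tendsto (fun j => meshKernel ν U V s (σ j) x (θ j) p.1 p.2) atTop
        (𝓝 (duhamelKernel ν U V x t p.1 p.2)) := by
      have : Tendsto (fun j => meshKernel ν U V s (σ j) x (θ j) p.1 p.2) atTop
          (𝓝 (heatKernel (ν * (t - p.2)) (x - p.1) * V p.1 p.2 +
            heatKernel (ν * (t - p.2)) (x - p.1) *
              (inner ℝ (x - p.1) (U p.1 p.2) / (2 * (ν * (t - p.2)))))) :=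
        ((Tendsto.heatKernel h2 h4 _).mul_const _).add ((Tendsto.heatKernel h3 h4 _).mul
          (tendsto_const_nhds.div (h3.const_mul 2) (by positivity)))
      rwa [← mul_add] at this
    have h6 : Tendsto (fun j => {q : E × ℝ | q.2 < θ j}.indicator
        (fun q => meshKernel ν U V s (σ j) x (θ j) q.1 q.2) p -
        duhamelKernel ν U V x t p.1 p.2) atTop (𝓝 0) := by
      rw [← sub_self (duhamelKernel ν U V x t p.1 p.2)]
      refine (h5.sub_const _).congr' ?_
      filter_upwards [h1] with j hj
      rw [indicator_of_mem (by exact hj)]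
    exact h6.zero_mul_isBoundedUnder_le (isBoundedUnder_of ⟨R, fun j => hR j p⟩)
  · filter_upwards [hpos, hlim] with p hp ⟨⟨h1, h2⟩, h3⟩
    have h4 : 0 < ν * (t - p.2) := mul_pos hν (sub_pos.2 hp.2)
    refine (Tendsto.add_const _ ?_).mul_const R
    have h7 : Tendsto (fun j => rate (2 * gaussFactor E) ν M v (θ j) p.2) atTop
        (𝓝 (rate (2 * gaussFactor E) ν M v t p.2)) := by
      have h8 : Tendsto (fun j => Real.sqrt (ν * (θ j - p.2))) atTop
          (𝓝 (Real.sqrt (ν * (t - p.2)))) :=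
        (Real.continuous_sqrt.tendsto _).comp ((hθlim.sub_const _).const_mul ν)
      exact ((tendsto_const_nhds.div h8 (Real.sqrt_pos.2 h4).ne').add_const _).const_mul _
    have h9 : Tendsto (fun j => meshMajorant ν s (σ j) x (θ j) p.1 p.2) atTop
        (𝓝 (heatKernel (ν * (t - p.2)) (x - p.1) + heatKernel (2 * (ν * (t - p.2))) (x - p.1))) :=
      (Tendsto.heatKernel h2 h4 _).add (Tendsto.heatKernel (h3.const_mul 2) (by positivity) _)
    refine (h7.mul h9).congr' ?_
    filter_upwards [h1] with j hj
    simp only [hgd]; rw [indicator_of_mem (by exact hj)]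
  · simp_rw [integral_mul_const]
    refine Tendsto.mul_const R ?_
    have e : ∀ j, ∫ p in univ ×ˢ Ioo s t, (g j p + g' p) =
        (∫ p in univ ×ˢ Ioo s t, g j p) + ∫ p in univ ×ˢ Ioo s t, g' p := fun j =>
      integral_add (hgi j) hgi'
    rw [integral_add hgi' hgi']
    simp_rw [e]
    exact hglim.add_const _

end SchemeConv

end AdvectionDiffusion

namespace AdvectionDiffusion

/-! ### Convergence of the scheme -/

section SchemeLimit

variable {E : Type*} [NormedAddCommGroup E] [InnerProductSpace ℝ E] [FiniteDimensional ℝ E]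
  [MeasurableSpace E] [BorelSpace E]
  {ν M : ℝ} {m v : ℝ → ℝ} {U : E → ℝ → E} {V : E → ℝ → ℝ}

/-- The rescaled form of the average is continuous down to `c = 0`, where the kernel itself
degenerates. -/
lemma continuous_heatAvg {φ : E → ℝ} (hφ : Continuous φ) {R : ℝ} (hR : ∀ y, |φ y| ≤ R) (x : E) :
    Continuous fun c : ℝ => heatAvg c φ x := by
  refine continuous_of_dominated (bound := fun ζ => heatKernel 1 ζ * R) (fun c => ?_)
    (fun c => Eventually.of_forall fun ζ => ?_) ((integrable_heatKernel one_pos).mul_const R)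
    (Eventually.of_forall fun ζ => by fun_prop)
  · exact ((continuous_heatKernel 1).mul (by fun_prop)).aestronglyMeasurable
  · rw [norm_mul, Real.norm_of_nonneg (heatKernel_pos one_pos ζ).le]
    exact mul_le_mul_of_nonneg_left (hR _) (heatKernel_pos one_pos ζ).le

lemma Coeff.integrable_duhamelKernel_mul (h : Coeff ν M m v U V) {s t C : ℝ} (x : E)
    {F : E → ℝ → ℝ}
    (hF : AEStronglyMeasurable (fun p : E × ℝ => F p.1 p.2) (volume.restrict (univ ×ˢ Ioo s t)))
    (hFC : ∀ z, ∀ τ ∈ Ioo s t, |F z τ| ≤ C) :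
    IntegrableOn (fun p : E × ℝ => duhamelKernel ν U V x t p.1 p.2 * F p.1 p.2)
      (univ ×ˢ Ioo s t) := by
  refine (h.duhamel_bound (R := 1) (g := fun _ => max C 0) (ρ := fun _ _ => 1) hF
    ((integrableOn_rate h.ν_pos h.v_int s t).mul_const _) (fun _ _ => le_max_right _ _)
    (fun τ hτ => ?_) (fun z τ hτ => ?_)).1
  · have : 0 < 2 * (ν * (t - τ)) := by have := mul_pos h.ν_pos (sub_pos.2 hτ.2); positivity
    simp only [mul_one]
    exact ⟨integrable_heatKernel_sub this x, (integral_heatKernel_sub this x).le⟩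
  · rw [mul_one]
    exact (hFC z τ hτ).trans (le_max_left _ _)

lemma Coeff.integral_abs_duhamelKernel_mul_exp_le (h : Coeff ν M m v U V) {s t lam C q : ℝ}
    (hC : 0 ≤ C) (x : E)
    (hq : ∫ τ in Ioo s t, rate (gaussFactor E) ν M v t τ * Real.exp (-(lam * (t - τ))) ≤ q) :
    ∫ p : E × ℝ in univ ×ˢ Ioo s t, |duhamelKernel ν U V x t p.1 p.2| *
      (C * Real.exp (lam * (p.2 - s))) ≤ q * (C * Real.exp (lam * (t - s))) := by
  have e : ∀ τ, rate (gaussFactor E) ν M v t τ * (C * Real.exp (lam * (τ - s))) =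
      rate (gaussFactor E) ν M v t τ * Real.exp (-(lam * (t - τ))) *
        (C * Real.exp (lam * (t - s))) := fun τ => by
    have : Real.exp (lam * (τ - s)) = Real.exp (-(lam * (t - τ))) * Real.exp (lam * (t - s)) := by
      rw [← Real.exp_add]; ring_nf
    rw [this]; ring
  have h1 := (h.duhamel_bound (s := s) (t := t) (x := x) (R := 1)
    (F := fun _ τ => C * Real.exp (lam * (τ - s)))
    (g := fun τ => C * Real.exp (lam * (τ - s))) (ρ := fun _ _ => 1)
    (by fun_prop) ?_ (fun _ _ => by positivity) (fun τ hτ => ?_) (fun z τ hτ => ?_)).2.1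
  · have e2 : ∀ p : E × ℝ, |duhamelKernel ν U V x t p.1 p.2 * (C * Real.exp (lam * (p.2 - s)))| =
        |duhamelKernel ν U V x t p.1 p.2| * (C * Real.exp (lam * (p.2 - s))) := fun p => by
      rw [abs_mul, abs_of_nonneg (by positivity : 0 ≤ C * Real.exp (lam * (p.2 - s)))]
    simp_rw [e2] at h1
    refine h1.trans ?_
    simp_rw [e]
    rw [integral_mul_const, mul_one]
    exact mul_le_mul_of_nonneg_right hq (by positivity)
  · simp_rw [e]
    exact (integrableOn_rate_mul_exp h.ν_pos h.v_int lam s t).mul_const _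
  · have : 0 < 2 * (ν * (t - τ)) := by have := mul_pos h.ν_pos (sub_pos.2 hτ.2); positivity
    simp only [mul_one]
    exact ⟨integrable_heatKernel_sub this x, (integral_heatKernel_sub this x).le⟩
  · rw [mul_one, abs_of_nonneg (by positivity)]

/-- An asymptotic Gronwall inequality: approximate solutions of the mild equation converge. -/
lemma Coeff.tendsto_of_approx_mild (h : Coeff ν M m v U V) {s b C : ℝ} {F : ℕ → E → ℝ → ℝ}
    {u : E → ℝ → ℝ} (hF : ∀ j, Measurable fun p : E × ℝ => F j p.1 p.2)
    (hu : ∀ t, AEStronglyMeasurable (fun p : E × ℝ => u p.1 p.2)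
      (volume.restrict (univ ×ˢ Ioo s t)))
    (hC : ∀ j x, ∀ t ∈ Ioc s b, |F j x t - u x t| ≤ C)
    (hlim : ∀ x, ∀ t ∈ Ioc s b, Tendsto (fun j => F j x t - u x t -
      duhamel ν U V (fun z τ => F j z τ - u z τ) s x t) atTop (𝓝 0)) (x : E) {t : ℝ}
    (ht : t ∈ Ioc s b) : Tendsto (fun j => F j x t) atTop (𝓝 (u x t)) := by
  have hC0 : 0 ≤ C := (abs_nonneg _).trans (hC 0 x t ht)
  obtain ⟨lam, hlam, hq⟩ := exists_integral_rate_mul_exp_le (gaussFactor_pos (E := E)).le h.ν_pos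
    h.M_nonneg h.v_int h.v_nonneg (show (0 : ℝ) < 1 / 2 by norm_num)
  -- The statement says that the upper limit of `|F j - u|` is at most `C 2^(-i) exp(lam(t - s))`,
  -- phrased as convergence of the positive part of the excess. No rate in `j` is available, so the
  -- induction runs over pointwise limits.
  have key : ∀ i : ℕ, ∀ x, ∀ t ∈ Ioc s b, Tendsto (fun j => max (|F j x t - u x t| -
      C * (1 / 2) ^ i * Real.exp (lam * (t - s))) 0) atTop (𝓝 0) := by
    intro i
    induction i with
    | zero =>
      intro x t ht
      refine tendsto_const_nhds.congr fun j => (max_eq_right ?_).symm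
      have h1 : 1 ≤ Real.exp (lam * (t - s)) :=
        Real.one_le_exp (mul_nonneg hlam.le (sub_nonneg.2 ht.1.le))
      have := hC j x t ht
      simp only [pow_zero, mul_one]
      nlinarith
    | succ i ih =>
      intro x t ht
      set κ : ℝ → ℝ := fun τ => C * (1 / 2) ^ i * Real.exp (lam * (τ - s)) with hκ
      have hκ0 : ∀ τ, 0 ≤ κ τ := fun τ => by positivity
      set W : ℕ → E → ℝ → ℝ := fun j z τ => max (|F j z τ - u z τ| - κ τ) 0 with hW
      have hsub : ∀ τ ∈ Ioo s t, τ ∈ Ioc s b := fun τ hτ => ⟨hτ.1, hτ.2.le.trans ht.2⟩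
      have hFu : ∀ j, AEStronglyMeasurable (fun p : E × ℝ => F j p.1 p.2 - u p.1 p.2)
          (volume.restrict (univ ×ˢ Ioo s t)) := fun j =>
        (hF j).aestronglyMeasurable.sub (hu t)
      have hWC : ∀ j z, ∀ τ ∈ Ioo s t, |W j z τ| ≤ C := fun j z τ hτ => by
        rw [abs_of_nonneg (le_max_right _ _)]
        exact max_le (by linarith [hC j z τ (hsub τ hτ), hκ0 τ]) hC0
      have hWm : ∀ j, AEStronglyMeasurable (fun p : E × ℝ => W j p.1 p.2)
          (volume.restrict (univ ×ˢ Ioo s t)) := fun j => by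
        have h1 : Continuous fun p : E × ℝ => κ p.2 := by fun_prop
        exact ((hFu j).norm.sub h1.aestronglyMeasurable).sup aestronglyMeasurable_const
      have hW0 : ∀ j z τ, 0 ≤ W j z τ := fun j z τ => le_max_right _ _
      have iW := fun j => h.integrable_duhamelKernel_mul x (hWm j) (hWC j)
      have i1 := h.integrable_duhamelKernel_mul (s := s) (t := t) (F := fun _ _ => 1) (C := 1) x
        aestronglyMeasurable_const (by simp)
      simp only [mul_one] at i1
      have iκ : IntegrableOn (fun p : E × ℝ => duhamelKernel ν U V x t p.1 p.2 * κ p.2)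
          (univ ×ˢ Ioo s t) := by
        refine h.integrable_duhamelKernel_mul (F := fun _ τ => κ τ) (C := κ t) x
          (by simp only [hκ]; fun_prop) fun z τ hτ => ?_
        rw [abs_of_nonneg (hκ0 τ), hκ]
        have := hτ.2.le
        simp only
        gcongr
      have iκ' : IntegrableOn (fun p : E × ℝ => |duhamelKernel ν U V x t p.1 p.2| * κ p.2)
          (univ ×ˢ Ioo s t) := by
        refine iκ.abs.congr (Eventually.of_forall fun p => ?_)
        simp only [abs_mul, abs_of_nonneg (hκ0 p.2)]
      have iW' : ∀ j, IntegrableOn (fun p : E × ℝ =>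
          |duhamelKernel ν U V x t p.1 p.2| * W j p.1 p.2) (univ ×ˢ Ioo s t) := fun j => by
        refine (iW j).abs.congr (Eventually.of_forall fun p => ?_)
        simp only [abs_mul, abs_of_nonneg (hW0 j p.1 p.2)]
      -- The excess over the current bound tends to zero at each point and is bounded by `C`, so its
      -- Duhamel integral tends to zero. The remaining bound `κ` is halved by the choice of `lam`.
      have hWlim : Tendsto (fun j => ∫ p in univ ×ˢ Ioo s t,
          |duhamelKernel ν U V x t p.1 p.2| * W j p.1 p.2) atTop (𝓝 0) := by
        have h0 : ∫ p in (univ : Set E) ×ˢ Ioo s t, (fun _ : E × ℝ => (0 : ℝ)) p = 0 := by simp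
        rw [← h0]
        refine tendsto_integral_of_dominated_convergence
          (fun p => |duhamelKernel ν U V x t p.1 p.2| * C) (fun j => (iW' j).aestronglyMeasurable)
          (i1.abs.mul_const C) (fun j => ae_strip fun z τ hτ => ?_) (ae_strip fun z τ hτ => ?_)
        · rw [norm_mul, Real.norm_eq_abs, abs_abs]
          exact mul_le_mul_of_nonneg_left (hWC j z τ hτ) (abs_nonneg _)
        · have := (ih z τ (hsub τ hτ)).const_mul |duhamelKernel ν U V x t z τ|
          rwa [mul_zero] at this
      have hδ := (hlim x t ht).abs
      rw [abs_zero] at hδ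
      have hsum := hδ.add hWlim
      rw [add_zero] at hsum
      refine squeeze_zero (fun j => le_max_right _ _) (fun j => ?_) hsum
      have hI : ∫ p : E × ℝ in univ ×ˢ Ioo s t, |duhamelKernel ν U V x t p.1 p.2| * κ p.2 ≤
          C * (1 / 2) ^ (i + 1) * Real.exp (lam * (t - s)) :=
        (h.integral_abs_duhamelKernel_mul_exp_le (C := C * (1 / 2) ^ i) (by positivity) x
          (hq s t)).trans_eq (by rw [pow_succ]; ring)
      have hD : |duhamel ν U V (fun z τ => F j z τ - u z τ) s x t| ≤
          (∫ p : E × ℝ in univ ×ˢ Ioo s t, |duhamelKernel ν U V x t p.1 p.2| * κ p.2) +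
          ∫ p in univ ×ˢ Ioo s t, |duhamelKernel ν U V x t p.1 p.2| * W j p.1 p.2 := by
        rw [← integral_add iκ' (iW' j), duhamel, ← Real.norm_eq_abs]
        refine norm_integral_le_of_norm_le (iκ'.add (iW' j)) (Eventually.of_forall fun p => ?_)
        rw [norm_mul, ← mul_add, Real.norm_eq_abs, Real.norm_eq_abs]
        refine mul_le_mul_of_nonneg_left ?_ (abs_nonneg _)
        linarith [le_max_left (|F j p.1 p.2 - u p.1 p.2| - κ p.2) 0]
      have hWI : 0 ≤ ∫ p in univ ×ˢ Ioo s t,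
          |duhamelKernel ν U V x t p.1 p.2| * W j p.1 p.2 :=
        integral_nonneg fun p => mul_nonneg (abs_nonneg _) (le_max_right _ _)
      have htri := abs_sub_abs_le_abs_sub (F j x t - u x t)
        (duhamel ν U V (fun z τ => F j z τ - u z τ) s x t)
      refine max_le ?_ (add_nonneg (abs_nonneg _) hWI)
      linarith
  rw [Metric.tendsto_atTop']
  intro ε hε
  have hp : Tendsto (fun i : ℕ => C * (1 / 2) ^ i * Real.exp (lam * (t - s))) atTop (𝓝 0) := by
    have := ((tendsto_pow_atTop_nhds_zero_of_lt_one (r := (1 / 2 : ℝ)) (by norm_num)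
      (by norm_num)).const_mul C).mul_const (Real.exp (lam * (t - s)))
    simpa using this
  obtain ⟨i, hi⟩ := (hp.eventually (gt_mem_nhds (half_pos hε))).exists
  obtain ⟨N, hN⟩ := eventually_atTop.1 ((key i x t ht).eventually (gt_mem_nhds (half_pos hε)))
  refine ⟨N, fun j hj => ?_⟩
  have h1 := (le_max_left _ _).trans_lt (hN j hj.le)
  rw [Real.dist_eq]
  linarith

/-- The piecewise constant interpolation of the scheme satisfies the integral equation up to two
errors: the heat average runs to the last node instead of `t`, and the mesh kernel replaces the
Duhamel kernel. Both tend to zero, so the asymptotic Gronwall inequality applies. -/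
theorem Coeff.tendsto_schemeSeq (h : Coeff ν M m v U V) (hd : ∀ a b, DivFreeOn U a b) {s t R : ℝ}
    (hst : s < t) {σ : ℕ → ℝ} (hσ : ∀ j, IsSmallMesh E ν M v (σ j)) (hσ0 : Tendsto σ atTop (𝓝 0))
    {φ : E → ℝ} (hφ : Continuous φ) (hφ0 : ∀ y, 0 ≤ φ y) (hR : ∀ y, φ y ≤ R) (x : E) :
    Tendsto (fun j => schemeSeq ν U V s (σ j) φ (nodeIdx s (σ j) t) x) atTop
      (𝓝 (evolve ν U V φ s x t)) := by
  have hν := h.ν_pos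
  have hR0 : 0 ≤ R := (hφ0 0).trans (hR 0)
  have hφR : ∀ y, |φ y| ≤ R := fun y => by rw [abs_of_nonneg (hφ0 y)]; exact hR y
  obtain ⟨A, lam, hA, hlam, hev⟩ := h.evolve_spec
  obtain ⟨-, hub, hum, hmild⟩ := hev φ R 0 s hφ.aestronglyMeasurable hR0 (by simpa using hφR)
  set R' := R * Real.exp (∫ τ, v τ) with hR'
  set F : ℕ → E → ℝ → ℝ := fun j z τ => schemeSeq ν U V s (σ j) φ (nodeIdx s (σ j) τ) z with hF
  have hspec := fun j k => h.schemeSeq_spec hd (s := s) (hσ j) hφ.measurable hφ0 hR k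
  have hFR : ∀ j z τ, |F j z τ| ≤ R' := fun j z τ => by
    rw [abs_of_nonneg ((hspec j _).2 z).1]; exact ((hspec j _).2 z).2
  have hFm : ∀ j, Measurable fun p : E × ℝ => F j p.1 p.2 := fun j => by
    have h1 : Measurable fun q : ℕ × E => schemeSeq ν U V s (σ j) φ q.1 q.2 :=
      measurable_from_prod_countable_right fun k => (hspec j k).1
    exact h1.comp (((measurable_nodeIdx s (σ j)).comp measurable_snd).prodMk measurable_fst)
  have hub' : ∀ z τ, s < τ → τ ≤ t → |evolve ν U V φ s z τ| ≤ A * R * Real.exp (lam * (t - s)) := by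
    intro z τ h1 h2
    have := hub z τ h1
    simp only [ne_eq, OfNat.ofNat_ne_zero, not_false_eq_true, zero_pow, mul_zero, Real.exp_zero,
      mul_one, zero_mul] at this
    refine this.trans ?_
    gcongr
  refine h.tendsto_of_approx_mild (b := t) (C := R' + A * R * Real.exp (lam * (t - s)))
    (F := F) (u := evolve ν U V φ s) hFm hum
    (fun j z τ hτ => (abs_sub _ _).trans (add_le_add (hFR j z τ) (hub' z τ hτ.1 hτ.2))) ?_ x
    ⟨hst, le_rfl⟩
  intro x τ hτ
  have hm0 := h.tendsto_integral_meshKernel hτ.1 (fun j => (hσ j).1) hσ0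
    (F := fun j p => F j p.1 p.2) hFm (fun j p => hFR j p.1 p.2) x
  have hθ := tendsto_node_nodeIdx (fun j => (hσ j).1) hσ0 hτ.1.le
  have ha : Tendsto (fun j => heatAvg (ν * (node s (σ j) (nodeIdx s (σ j) τ) - s)) φ x -
      heatAvg (ν * (τ - s)) φ x) atTop (𝓝 0) := by
    rw [← sub_self (heatAvg (ν * (τ - s)) φ x)]
    exact (((continuous_heatAvg hφ hφR x).tendsto _).comp ((hθ.sub_const s).const_mul ν)).sub_const _
  have hsum := ha.add hm0
  rw [add_zero] at hsum
  refine hsum.congr fun j => ?_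
  have hle := node_nodeIdx_le (hσ j).1 hτ.1.le
  obtain ⟨i1, e1⟩ := h.heatAvg_schemeSeq hd (s := s) (hσ j) hφ.measurable hφ0 hR
    (nodeIdx s (σ j) τ) x le_rfl
  rw [sub_self, mul_zero, heatAvg_zero] at e1
  have i1' := integrable_indicator_lt hle i1
  rw [← setIntegral_indicator_lt hle] at e1
  have i2 := h.integrable_duhamelKernel_mul (s := s) (t := τ) x (F := F j)
    (hFm j).aestronglyMeasurable (fun z τ _ => hFR j z τ)
  have i3 := h.integrable_duhamelKernel_mul (s := s) (t := τ) x (F := evolve ν U V φ s)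
    (hum τ) (fun z τ' hτ' => hub' z τ' hτ'.1 (hτ'.2.le.trans hτ.2))
  have e2 : duhamel ν U V (fun z τ => F j z τ - evolve ν U V φ s z τ) s x τ =
      duhamel ν U V (F j) s x τ - duhamel ν U V (evolve ν U V φ s) s x τ := by
    simp only [duhamel, mul_sub]
    exact integral_sub i2 i3
  have e3 : ∀ p : E × ℝ, ({q : E × ℝ | q.2 < node s (σ j) (nodeIdx s (σ j) τ)}.indicator
        (fun q => meshKernel ν U V s (σ j) x (node s (σ j) (nodeIdx s (σ j) τ)) q.1 q.2) p -
        duhamelKernel ν U V x τ p.1 p.2) * F j p.1 p.2 =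
      {q : E × ℝ | q.2 < node s (σ j) (nodeIdx s (σ j) τ)}.indicator
        (fun q => meshKernel ν U V s (σ j) x (node s (σ j) (nodeIdx s (σ j) τ)) q.1 q.2 *
          schemeSeq ν U V s (σ j) φ (nodeIdx s (σ j) q.2) q.1) p -
        duhamelKernel ν U V x τ p.1 p.2 * F j p.1 p.2 := fun p => by
    by_cases hp : p.2 < node s (σ j) (nodeIdx s (σ j) τ)
    · rw [indicator_of_mem (by exact hp), indicator_of_mem (by exact hp), sub_mul]
    · rw [indicator_of_notMem (by exact hp), indicator_of_notMem (by exact hp)]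
      ring
  simp_rw [e3]
  rw [integral_sub i1' i2, e2, hmild x τ hτ.1,
    ← heatAvg_eq (mul_pos hν (sub_pos.2 hτ.1)) φ x]
  simp only [hF, duhamel] at e1 ⊢
  rw [e1]
  ring

end SchemeLimit

end AdvectionDiffusion

namespace AdvectionDiffusion

/-! ### Davies' weights and the uniform estimate -/

section WeightedScheme

variable {E : Type*} [NormedAddCommGroup E] [InnerProductSpace ℝ E] [FiniteDimensional ℝ E]
  [MeasurableSpace E] [BorelSpace E]
  {ν M : ℝ} {m v : ℝ → ℝ} {U : E → ℝ → E} {V : E → ℝ → ℝ}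

/-- The explicit part of a time step, conjugated with the weight `exp ⟨α, ·⟩`, translated and
normalised. -/
noncomputable def weightedKernel (ν : ℝ) (m v : ℝ → ℝ) (U : E → ℝ → E) (V : E → ℝ → ℝ) (α β : E)
    (a b : ℝ) (w y : E) : ℝ≥0∞ :=
  ENNReal.ofReal ((stepFactor ν m v α a b)⁻¹ *
    (stepKernel ν U V a b (w - β) y * Real.exp (inner ℝ α (w - β - y))))

/-- The normalisation is by the common bound of the weighted row and column sums; the translation by
`β` changes neither. The row sums are where `div U = 0` enters. -/
lemma Coeff.isContractive_weightedKernel (h : Coeff ν M m v U V) {a b : ℝ} (hab : a < b)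
    (hs : IsSmallStep E ν M v a b) (hd : DivFreeOn U a b) (α β : E) :
    IsContractive (weightedKernel ν m v U V α β a b) := by
  have hS : 0 < stepFactor ν m v α a b := stepFactor_pos _ _ _
  have h0 : ∀ w y, 0 ≤ (stepFactor ν m v α a b)⁻¹ *
      (stepKernel ν U V a b w y * Real.exp (inner ℝ α (w - y))) := fun w y => by
    have := (h.stepKernel_bounds hab hs w y).1
    positivity
  refine ⟨?_, fun w => ?_, fun y => ?_⟩
  · have h1 := (h.measurable_stepKernel a b).comp
      ((measurable_fst.sub_const β).prodMk measurable_snd : Measurable fun p : E × E => (p.1 - β, p.2))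
    exact (measurable_const.mul (h1.mul (by fun_prop))).ennreal_ofReal
  · obtain ⟨hi, hle⟩ := h.integral_stepKernel_right hab hd α (w - β)
    simp only [weightedKernel]
    rw [← ofReal_integral_eq_lintegral_ofReal (hi.const_mul _)
      (Eventually.of_forall fun y => h0 _ _), integral_const_mul, ENNReal.ofReal_le_one]
    exact (inv_mul_le_one₀ hS).2 hle
  · obtain ⟨hi, hle⟩ := h.integral_stepKernel_left hab α y
    simp only [weightedKernel]
    rw [lintegral_sub_right_eq_self (fun w => ENNReal.ofReal ((stepFactor ν m v α a b)⁻¹ *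
      (stepKernel ν U V a b w y * Real.exp (inner ℝ α (w - y))))) β,
      ← ofReal_integral_eq_lintegral_ofReal (hi.const_mul _)
      (Eventually.of_forall fun w => h0 _ _), integral_const_mul, ENNReal.ofReal_le_one]
    exact (inv_mul_le_one₀ hS).2 hle

lemma Coeff.ofReal_schemeStep (h : Coeff ν M m v U V) {a b R : ℝ} (hab : a < b)
    (hs : IsSmallStep E ν M v a b) {f : E → ℝ} (hf : Measurable f) (hf0 : ∀ y, 0 ≤ f y)
    (hR : ∀ y, f y ≤ R) (x : E) :
    ENNReal.ofReal (schemeStep ν U V a b f x) = ∫⁻ w, ∫⁻ y,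
      ENNReal.ofReal (heatKernel (ν * (b - a) / 2) (x - w) * (stepKernel ν U V a b w y * f y)) := by
  have hσ : 0 < ν * (b - a) / 2 := by have := mul_pos h.ν_pos (sub_pos.2 hab); positivity
  have hfR : ∀ y, |f y| ≤ R := fun y => by rw [abs_of_nonneg (hf0 y)]; exact hR y
  obtain ⟨hgm, hgb⟩ := h.stepKernel_integral_bound hab hs hf hfR
  have hp : ∀ w y, 0 ≤ stepKernel ν U V a b w y * f y := fun w y =>
    mul_nonneg (h.stepKernel_bounds hab hs w y).1 (hf0 y)
  have hG : ∀ w, 0 ≤ heatKernel (ν * (b - a) / 2) (x - w) := fun w => (heatKernel_pos hσ _).le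
  rw [schemeStep, ofReal_integral_eq_lintegral_ofReal (integrable_heatKernel_sub_mul hσ hgm hgb x)
    (Eventually.of_forall fun w => mul_nonneg (hG w) (integral_nonneg (hp w)))]
  refine lintegral_congr fun w => ?_
  rw [← integral_const_mul, ofReal_integral_eq_lintegral_ofReal
    ((h.integrable_stepKernel_mul hab hs hf hfR w).const_mul _)
    (Eventually.of_forall fun y => mul_nonneg (hG w) (hp w y))]

/-- The weight is split along `x`, the intermediate point and `y`. Its part on the heat half-step
turns the Gaussian into a translate by `β`, and a change of variables moves this translation into
the other kernel. An unweighted symmetric heat kernel remains, as Nash's inequality requires. -/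
lemma Coeff.exp_mul_schemeStep (h : Coeff ν M m v U V) {a b R : ℝ} (hab : a < b)
    (hs : IsSmallStep E ν M v a b) (α : E) {f : E → ℝ} (hf : Measurable f) (hf0 : ∀ y, 0 ≤ f y)
    (hR : ∀ y, f y ≤ R) (x : E) :
    ENNReal.ofReal (Real.exp (inner ℝ α x) * schemeStep ν U V a b f x) =
      ENNReal.ofReal (Real.exp (ν * (b - a) / 2 * ‖α‖ ^ 2) * stepFactor ν m v α a b) *
        kop (gaussK (ν * (b - a) / 2))
          (kop (weightedKernel ν m v U V α ((2 * (ν * (b - a) / 2)) • α) a b)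
            fun y => ENNReal.ofReal (Real.exp (inner ℝ α y) * f y)) x := by
  have hσ : 0 < ν * (b - a) / 2 := by have := mul_pos h.ν_pos (sub_pos.2 hab); positivity
  have hS : 0 < stepFactor ν m v α a b := stepFactor_pos _ _ _
  set β := (2 * (ν * (b - a) / 2)) • α with hβ
  rw [ENNReal.ofReal_mul (Real.exp_pos _).le, h.ofReal_schemeStep hab hs hf hf0 hR,
    ← lintegral_const_mul' _ _ ENNReal.ofReal_ne_top,
    ← lintegral_sub_right_eq_self _ β]
  simp only [kop]
  rw [← lintegral_const_mul' _ _ ENNReal.ofReal_ne_top]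
  refine lintegral_congr fun w => ?_
  rw [gaussK, ← lintegral_const_mul' _ _ ENNReal.ofReal_ne_top,
    ← lintegral_const_mul' _ _ ENNReal.ofReal_ne_top,
    ← lintegral_const_mul' _ _ ENNReal.ofReal_ne_top]
  refine lintegral_congr fun y => ?_
  have hk := (h.stepKernel_bounds hab hs (w - β) y).1
  have hG := heatKernel_pos hσ (x - w)
  rw [weightedKernel, ← ENNReal.ofReal_mul (by positivity), ← ENNReal.ofReal_mul (by positivity),
    ← ENNReal.ofReal_mul (by positivity), ← ENNReal.ofReal_mul (by positivity)]
  congr 1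
  have e1 := heatKernel_sub_mul_exp_inner hσ α x (w - β)
  rw [← hβ, sub_sub_sub_cancel_right] at e1
  have e2 : Real.exp (inner ℝ α x) =
      Real.exp (inner ℝ α (x - (w - β))) * Real.exp (inner ℝ α (w - β - y)) *
        Real.exp (inner ℝ α y) := by
    rw [← Real.exp_add, ← Real.exp_add, ← inner_add_right, ← inner_add_right]
    congr 2
    abel
  rw [e2]
  calc _ = heatKernel (ν * (b - a) / 2) (x - (w - β)) * Real.exp (inner ℝ α (x - (w - β))) *
        (Real.exp (inner ℝ α (w - β - y)) * Real.exp (inner ℝ α y) *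
          stepKernel ν U V a b (w - β) y * f y) := by ring
    _ = _ := by rw [e1]; field_simp

lemma kop_const_mul {c : ℝ≥0∞} (hc : c ≠ ⊤) (K : E → E → ℝ≥0∞) (f : E → ℝ≥0∞) :
    kop K (fun y => c * f y) = fun x => c * kop K f x := by
  funext x
  simp only [kop]
  rw [← lintegral_const_mul' _ _ hc]
  exact lintegral_congr fun y => by ring

lemma Coeff.exp_mul_schemeSeq (h : Coeff ν M m v U V) (hd : ∀ a b, DivFreeOn U a b) {s σ R : ℝ}
    (hσ : IsSmallMesh E ν M v σ) {φ : E → ℝ} (hφ : Measurable φ) (hφ0 : ∀ y, 0 ≤ φ y)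
    (hR : ∀ y, φ y ≤ R) (α : E) (k : ℕ) (x : E) :
    ENNReal.ofReal (Real.exp (inner ℝ α x) * schemeSeq ν U V s σ φ k x) =
      ENNReal.ofReal (Real.exp (k * (ν * σ / 2) * ‖α‖ ^ 2) * stepFactor ν m v α s (node s σ k)) *
        fwd (ν * σ / 2) (fun j => weightedKernel ν m v U V α ((2 * (ν * σ / 2)) • α) (node s σ j)
          (node s σ (j + 1))) (fun y => ENNReal.ofReal (Real.exp (inner ℝ α y) * φ y)) k x := by
  induction k generalizing x with
  | zero => simp [schemeSeq, fwd, node_zero, stepFactor]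
  | succ k ih =>
    obtain ⟨hm, hb⟩ := h.schemeSeq_spec hd (s := s) hσ hφ hφ0 hR k
    have hlt := node_lt_succ (s := s) hσ.1 k
    rw [schemeSeq, h.exp_mul_schemeStep hlt (hσ.2 _ _ (node_succ_sub s σ k)) α hm
      (fun y => (hb y).1) (fun y => (hb y).2)]
    simp_rw [ih]
    rw [kop_const_mul ENNReal.ofReal_ne_top, kop_const_mul ENNReal.ofReal_ne_top, ← mul_assoc, fwd, node_succ_sub,
      ← ENNReal.ofReal_mul (by have := stepFactor_pos (ν := ν) (m := m) (v := v) α (node s σ k)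
                                (node s σ (k + 1)); positivity)]
    congr 2
    rw [← h.stepFactor_mul α (le_node hσ.1 k) hlt.le]
    push_cast
    rw [add_mul, add_mul, Real.exp_add, one_mul]
    ring

/-- The number of steps drops out: `(4/N)^(d/2)` from the Nash estimate meets the value at zero of a
Gaussian at heat time `ν(t - s)/(4N)`. The heat half-steps and the step factors contribute equally
to `exp(ν(t - s)|α|²)`. -/
theorem Coeff.lintegral_mul_schemeSeq_le (h : Coeff ν M m v U V) (hd : ∀ a b, DivFreeOn U a b)
    {s t R : ℝ} {N : ℕ} (hN : 1 ≤ N) (hσ : IsSmallMesh E ν M v ((t - s) / (2 * N)))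
    {φ ρ : E → ℝ} (hφ : Measurable φ) (hφ0 : ∀ y, 0 ≤ φ y) (hR : ∀ y, φ y ≤ R)
    (hρ : Measurable ρ) (hρ0 : ∀ x, 0 ≤ ρ x) (α : E) :
    ∫⁻ x, ENNReal.ofReal (ρ x * schemeSeq ν U V s ((t - s) / (2 * N)) φ (2 * N) x) ≤
      ENNReal.ofReal ((4 / (Real.pi * (ν * (t - s)))) ^ ((Module.finrank ℝ E : ℝ) / 2) *
        Real.exp (ν * (t - s) * ‖α‖ ^ 2 + ((∫ τ in Ioo s t, v τ) + ‖α‖ * ∫ τ in Ioo s t, m τ))) *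
      ((∫⁻ x, ENNReal.ofReal (ρ x * Real.exp (-inner ℝ α x))) *
        ∫⁻ y, ENNReal.ofReal (Real.exp (inner ℝ α y) * φ y)) := by
  have hν := h.ν_pos
  have hN0 : (0 : ℝ) < N := by exact_mod_cast hN
  set σ := (t - s) / (2 * N) with hσd
  have hσ0 := hσ.1
  have hts : t - s = 2 * N * σ := by rw [hσd]; field_simp
  have hnode : node s σ (2 * N) = t := by
    simp only [node]; push_cast; linarith
  have ha : 0 < ν * σ / 2 := by positivity
  have e1 : ∀ x, ENNReal.ofReal (ρ x * schemeSeq ν U V s σ φ (2 * N) x) =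
      ENNReal.ofReal (Real.exp ((2 * N : ℕ) * (ν * σ / 2) * ‖α‖ ^ 2) * stepFactor ν m v α s t) *
      (ENNReal.ofReal (ρ x * Real.exp (-inner ℝ α x)) *
        fwd (ν * σ / 2) (fun j => weightedKernel ν m v U V α ((2 * (ν * σ / 2)) • α) (node s σ j)
          (node s σ (j + 1))) (fun y => ENNReal.ofReal (Real.exp (inner ℝ α y) * φ y)) (2 * N) x) :=
    fun x => by
    rw [mul_left_comm, ← hnode, ← h.exp_mul_schemeSeq hd hσ hφ hφ0 hR α (2 * N) x,
      ← ENNReal.ofReal_mul (mul_nonneg (hρ0 x) (Real.exp_pos _).le)]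
    congr 1
    rw [Real.exp_neg]
    field_simp
  simp_rw [e1]
  rw [lintegral_const_mul' _ _ ENNReal.ofReal_ne_top]
  have h1 := lintegral_mul_fwd_le ha (K := fun j => weightedKernel ν m v U V α
    ((2 * (ν * σ / 2)) • α) (node s σ j) (node s σ (j + 1)))
    (fun j => h.isContractive_weightedKernel (node_lt_succ hσ0 j) (hσ.2 _ _ (node_succ_sub s σ j))
      (hd _ _) α _)
    (f := fun y => ENNReal.ofReal (Real.exp (inner ℝ α y) * φ y))
    (ρ := fun x => ENNReal.ofReal (ρ x * Real.exp (-inner ℝ α x)))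
    (Measurable.ennreal_ofReal (Measurable.mul (by fun_prop) hφ))
    (Measurable.ennreal_ofReal (Measurable.mul hρ (by fun_prop))) hN
  refine (mul_le_mul_right h1 _).trans_eq ?_
  have hS := stepFactor_pos (ν := ν) (m := m) (v := v) α s t
  rw [← mul_assoc, ← ENNReal.ofReal_mul (by positivity)]
  congr 2
  have e2 : (4 / N : ℝ) ^ ((Module.finrank ℝ E : ℝ) / 2) * heatKernel (ν * σ / 2) (0 : E) =
      (4 / (Real.pi * (ν * (t - s)))) ^ ((Module.finrank ℝ E : ℝ) / 2) := by
    rw [heatKernel_zero, Real.rpow_neg (by positivity), ← Real.inv_rpow (by positivity),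
      ← Real.mul_rpow (by positivity) (by positivity), hts]
    congr 1
    field_simp
    norm_num
  rw [e2, mul_comm, stepFactor, ← Real.exp_add]
  congr 2
  rw [hts]
  push_cast
  ring

/-- Fatou's lemma along meshes for which `t` is the node of index `2 N`, so that the scheme is
evaluated exactly at time `t`. -/
theorem Coeff.lintegral_mul_evolve_le (h : Coeff ν M m v U V) (hd : ∀ a b, DivFreeOn U a b)
    {s t R : ℝ} (hst : s < t) {φ ρ : E → ℝ} (hφ : Continuous φ) (hφ0 : ∀ y, 0 ≤ φ y)
    (hR : ∀ y, φ y ≤ R) (hρ : Measurable ρ) (hρ0 : ∀ x, 0 ≤ ρ x) (α : E) :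
    (∀ x, 0 ≤ evolve ν U V φ s x t) ∧
    ∫⁻ x, ENNReal.ofReal (ρ x * evolve ν U V φ s x t) ≤
      ENNReal.ofReal ((4 / (Real.pi * (ν * (t - s)))) ^ ((Module.finrank ℝ E : ℝ) / 2) *
        Real.exp (ν * (t - s) * ‖α‖ ^ 2 + ((∫ τ in Ioo s t, v τ) + ‖α‖ * ∫ τ in Ioo s t, m τ))) *
      ((∫⁻ x, ENNReal.ofReal (ρ x * Real.exp (-inner ℝ α x))) *
        ∫⁻ y, ENNReal.ofReal (Real.exp (inner ℝ α y) * φ y)) := by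
  have hts : 0 < t - s := sub_pos.2 hst
  obtain ⟨δ, hδ, hmesh⟩ := h.exists_isSmallMesh
  obtain ⟨j₀, hj₀⟩ := exists_nat_ge ((t - s) / δ)
  -- The offset `j₀` makes every mesh in the sequence, not only the late ones, small enough for
  -- positivity.
  set N : ℕ → ℕ := fun j => j + j₀ + 1
  set σ : ℕ → ℝ := fun j => (t - s) / (2 * N j) with hσd
  have hNpos : ∀ j, (0 : ℝ) < N j := fun j => by exact_mod_cast Nat.succ_pos _
  have hσpos : ∀ j, 0 < σ j := fun j => by have := hNpos j; positivity
  have hNlim : Tendsto (fun j => (N j : ℝ)) atTop atTop :=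
    tendsto_natCast_atTop_atTop.comp (tendsto_add_atTop_nat (j₀ + 1))
  have hσ0 : Tendsto σ atTop (𝓝 0) :=
    tendsto_const_nhds.div_atTop (hNlim.const_mul_atTop (by norm_num))
  have hσ : ∀ j, IsSmallMesh E ν M v (σ j) := fun j => by
    refine hmesh _ (hσpos j) ?_
    rw [hσd, div_le_iff₀ (by have := hNpos j; positivity)]
    rw [div_le_iff₀ hδ] at hj₀
    have h1 : (j₀ : ℝ) ≤ 2 * N j := by
      have : j₀ ≤ 2 * N j := by simp only [N]; omega
      exact_mod_cast this
    calc t - s ≤ j₀ * δ := hj₀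
      _ ≤ _ := by rw [mul_comm]; gcongr
  have hidx : ∀ j, nodeIdx s (σ j) t = 2 * N j := fun j => by
    have hN := hNpos j
    have : (t - s) / σ j = ((2 * N j : ℕ) : ℝ) := by
      rw [hσd]; push_cast; field_simp
    rw [nodeIdx, this, Nat.floor_natCast]
  have hlim : ∀ x, Tendsto (fun j => schemeSeq ν U V s (σ j) φ (2 * N j) x) atTop
      (𝓝 (evolve ν U V φ s x t)) := fun x => by
    simpa only [hidx] using h.tendsto_schemeSeq hd hst hσ hσ0 hφ hφ0 hR x
  have hspec := fun j => h.schemeSeq_spec hd (s := s) (hσ j) hφ.measurable hφ0 hR (2 * N j)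
  refine ⟨fun x => ge_of_tendsto' (hlim x) fun j => ((hspec j).2 x).1, ?_⟩
  calc _ = ∫⁻ x, liminf (fun j => ENNReal.ofReal (ρ x * schemeSeq ν U V s (σ j) φ (2 * N j) x))
        atTop := lintegral_congr fun x =>
          ((ENNReal.tendsto_ofReal ((hlim x).const_mul (ρ x))).liminf_eq).symm
    _ ≤ liminf (fun j => ∫⁻ x, ENNReal.ofReal
        (ρ x * schemeSeq ν U V s (σ j) φ (2 * N j) x)) atTop :=
          lintegral_liminf_le fun j => (hρ.mul (hspec j).1).ennreal_ofReal
    _ ≤ liminf (fun _ : ℕ => _) atTop := liminf_le_liminf (Eventually.of_forall fun j =>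
          h.lintegral_mul_schemeSeq_le hd (Nat.succ_pos _) (hσ j) hφ.measurable hφ0 hR hρ hρ0 α)
    _ = _ := liminf_const _

end WeightedScheme

end AdvectionDiffusion

namespace AdvectionDiffusion

/-! ### The Gaussian upper bound, pointwise -/

section PointwiseBounds

variable {E : Type*} [NormedAddCommGroup E] [InnerProductSpace ℝ E] [FiniteDimensional ℝ E]
  [MeasurableSpace E] [BorelSpace E]
  {ν M : ℝ} {m v : ℝ → ℝ} {U : E → ℝ → E} {V : E → ℝ → ℝ}

lemma Coeff.continuousOn_fundSol (h : Coeff ν M m v U V) :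
    ContinuousOn (fun p : (E × ℝ) × (E × ℝ) => fundSol ν U V p.1.1 p.1.2 p.2.1 p.2.2)
      (orderedPairs E) := by
  obtain ⟨A, lam, -, -, hc, -⟩ := h.fundSol_spec
  exact hc

lemma Coeff.continuous_fundSol_right (h : Coeff ν M m v U V) {s t : ℝ} (hst : s < t) (x : E) :
    Continuous fun y => fundSol ν U V x t y s :=
  h.continuousOn_fundSol.comp_continuous (f := fun y => ((x, t), (y, s))) (by fun_prop)
    fun _ => hst

lemma Coeff.continuous_fundSol_left (h : Coeff ν M m v U V) {s t : ℝ} (hst : s < t) (y : E) :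
    Continuous fun x => fundSol ν U V x t y s :=
  h.continuousOn_fundSol.comp_continuous (f := fun x => ((x, t), (y, s))) (by fun_prop)
    fun _ => hst

lemma Coeff.exists_abs_fundSol_le (h : Coeff ν M m v U V) {s t : ℝ} (hst : s < t) :
    ∃ C : ℝ, ∀ x y : E, |fundSol ν U V x t y s| ≤ C := by
  obtain ⟨A, lam, hA, -, -, hb, -⟩ := h.fundSol_spec
  have : 0 < 2 * (ν * (t - s)) := by have := mul_pos h.ν_pos (sub_pos.2 hst); positivity
  exact ⟨_, fun x y => (hb x t y s hst).trans
    (mul_le_mul_of_nonneg_left (heatKernel_le_zero this _) (by positivity))⟩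

/-- The evolution of a concentrating Gaussian is the heat average of `z ↦ fundSol ν U V x t z s` at
`y`; this function is bounded and continuous. -/
lemma Coeff.tendsto_evolve_heatKernel (h : Coeff ν M m v U V) {s t : ℝ} (hst : s < t) (x y : E)
    {ε : ℕ → ℝ} (hε : ∀ j, 0 < ε j) (hε0 : Tendsto ε atTop (𝓝 0)) :
    Tendsto (fun j => evolve ν U V (fun z => heatKernel (ε j) (y - z)) s x t) atTop
      (𝓝 (fundSol ν U V x t y s)) := by
  obtain ⟨C, hC⟩ := h.exists_abs_fundSol_le (E := E) hst
  have h1 := ((continuous_heatAvg (h.continuous_fundSol_right hst x) (hC x) y).tendsto 0).comp hε0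
  rw [heatAvg_zero] at h1
  refine h1.congr fun j => ?_
  rw [Function.comp_apply, heatAvg_eq (hε j), evolve]
  simp_rw [mul_comm]

lemma lintegral_exp_mul_heatKernel {ε : ℝ} (hε : 0 < ε) (α y : E) :
    ∫⁻ z, ENNReal.ofReal (Real.exp (inner ℝ α z) * heatKernel ε (y - z)) =
      ENNReal.ofReal (Real.exp (inner ℝ α y + ε * ‖α‖ ^ 2)) := by
  have e : ∀ z, Real.exp (inner ℝ α z) * heatKernel ε (y - z) =
      Real.exp (inner ℝ α y + ε * ‖α‖ ^ 2) * heatKernel ε ((y + (2 * ε) • α) - z) := fun z => by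
    have h1 := heatKernel_sub_mul_exp_inner hε α z y
    have h2 : Real.exp (inner ℝ α z) = Real.exp (inner ℝ α y) * Real.exp (inner ℝ α (z - y)) := by
      rw [← Real.exp_add, ← inner_add_right, add_sub_cancel]
    rw [h2, heatKernel_sub_comm ε y z, mul_assoc, mul_comm (Real.exp (inner ℝ α (z - y))), h1,
      Real.exp_add, mul_assoc, heatKernel_sub_comm ε (z - _) y]
    congr 3
    abel_nf
  simp_rw [e]
  rw [← ofReal_integral_eq_lintegral_ofReal ((integrable_heatKernel_sub hε _).const_mul _)
    (Eventually.of_forall fun z => mul_nonneg (Real.exp_pos _).le (heatKernel_pos hε _).le),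
    integral_const_mul, integral_heatKernel_sub hε, mul_one]

lemma le_of_ae_le_of_continuous {f g : E → ℝ} (hf : Continuous f) (hg : Continuous g)
    (h : f ≤ᵐ[volume] g) (x : E) : f x ≤ g x := by
  have h1 : (fun x => max (f x) (g x)) =ᵐ[volume] g := by
    filter_upwards [h] with x hx using max_eq_right hx
  have h2 := (Continuous.ae_eq_iff_eq volume (hf.max hg) hg).1 h1
  exact max_eq_right_iff.1 (congrFun h2 x)

/-- The Gaussian estimate for the fundamental solution, in the form given by Davies' method. -/
theorem Coeff.fundSol_le (h : Coeff ν M m v U V) (hd : ∀ a b, DivFreeOn U a b) {s t : ℝ}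
    (hst : s < t) (x y α : E) :
    0 ≤ fundSol ν U V x t y s ∧ fundSol ν U V x t y s ≤
      (4 / (Real.pi * (ν * (t - s)))) ^ ((Module.finrank ℝ E : ℝ) / 2) *
        Real.exp (ν * (t - s) * ‖α‖ ^ 2 + ((∫ τ in Ioo s t, v τ) + ‖α‖ * ∫ τ in Ioo s t, m τ) -
          inner ℝ α (x - y)) := by
  have hνt : 0 < ν * (t - s) := mul_pos h.ν_pos (sub_pos.2 hst)
  set ε : ℕ → ℝ := fun j => 1 / ((j : ℝ) + 1)
  have hε : ∀ j, 0 < ε j := fun j => by positivity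
  have hε0 : Tendsto ε atTop (𝓝 0) := tendsto_one_div_add_atTop_nhds_zero_nat
  have hev := fun (j : ℕ) (ρ : E → ℝ) (hρ : Measurable ρ) (hρ0 : ∀ x, 0 ≤ ρ x) =>
    h.lintegral_mul_evolve_le hd hst (φ := fun z => heatKernel (ε j) (y - z)) (ρ := ρ)
      ((continuous_heatKernel _).comp (by fun_prop)) (fun z => (heatKernel_pos (hε j) _).le)
      (fun z => heatKernel_le_zero (hε j) _) hρ hρ0 α
  have hlim := fun x => h.tendsto_evolve_heatKernel hst x y hε hε0
  -- Non-negativity does not involve the test function, so `ρ = 0` will do.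
  refine ⟨ge_of_tendsto' (hlim x) fun j =>
    (hev j (fun _ => 0) measurable_const fun _ => le_rfl).1 x, ?_⟩
  set D := (4 / (Real.pi * (ν * (t - s)))) ^ ((Module.finrank ℝ E : ℝ) / 2) *
    Real.exp (ν * (t - s) * ‖α‖ ^ 2 + ((∫ τ in Ioo s t, v τ) + ‖α‖ * ∫ τ in Ioo s t, m τ)) with hD
  have hD0 : 0 < D := by positivity
  -- Initial data concentrating at `y`, tested with the indicator of `S`, and Fatou's lemma. Since
  -- `S` is arbitrary this gives the inequality almost everywhere, and continuity in `x` gives it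
  -- everywhere.
  have key : ∀ S : Set E, MeasurableSet S →
      ∫⁻ x in S, ENNReal.ofReal (fundSol ν U V x t y s) ≤
        ∫⁻ x in S, ENNReal.ofReal (D * Real.exp (-inner ℝ α (x - y))) := by
    intro S hS
    set ρ : E → ℝ := S.indicator fun _ => 1 with hρd
    have hρ : Measurable ρ := measurable_const.indicator hS
    have hρ0 : ∀ x, 0 ≤ ρ x := fun x => indicator_nonneg (fun _ _ => zero_le_one) x
    have e1 : ∀ f : E → ℝ, ∫⁻ x in S, ENNReal.ofReal (f x) = ∫⁻ x, ENNReal.ofReal (ρ x * f x) :=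
      fun f => by
      rw [← lintegral_indicator hS]
      refine lintegral_congr fun x => ?_
      by_cases hx : x ∈ S <;> simp [hρd, hx]
    rw [e1, e1]
    have hm : ∀ j, Measurable fun x => evolve ν U V (fun z => heatKernel (ε j) (y - z)) s x t :=
      fun j => by
      have h1 : Measurable fun p : E × E => fundSol ν U V p.1 t p.2 s *
          heatKernel (ε j) (y - p.2) := by
        refine Continuous.measurable (Continuous.mul ?_ ?_)
        · exact h.continuousOn_fundSol.comp_continuous
            (f := fun p : E × E => ((p.1, t), (p.2, s))) (by fun_prop) fun _ => hst
        · exact (continuous_heatKernel _).comp (by fun_prop)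
      exact (h1.stronglyMeasurable.integral_prod_right' (ν := volume)).measurable
    have hlimD : Tendsto (fun j => ENNReal.ofReal D *
        ((∫⁻ x, ENNReal.ofReal (ρ x * Real.exp (-inner ℝ α x))) *
          ENNReal.ofReal (Real.exp (inner ℝ α y + ε j * ‖α‖ ^ 2)))) atTop
        (𝓝 (ENNReal.ofReal D * ((∫⁻ x, ENNReal.ofReal (ρ x * Real.exp (-inner ℝ α x))) *
          ENNReal.ofReal (Real.exp (inner ℝ α y))))) := by
      have h1 : Tendsto (fun j => Real.exp (inner ℝ α y + ε j * ‖α‖ ^ 2)) atTop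
          (𝓝 (Real.exp (inner ℝ α y))) := by
        have : Continuous fun r : ℝ => Real.exp (inner ℝ α y + r * ‖α‖ ^ 2) := by fun_prop
        have h2 := (this.tendsto 0).comp hε0
        rwa [zero_mul, add_zero] at h2
      refine ENNReal.Tendsto.const_mul (ENNReal.Tendsto.const_mul (ENNReal.tendsto_ofReal h1)
        (Or.inl ?_)) (Or.inr ENNReal.ofReal_ne_top)
      simpa using Real.exp_pos _
    calc _ = ∫⁻ x, liminf (fun j => ENNReal.ofReal
          (ρ x * evolve ν U V (fun z => heatKernel (ε j) (y - z)) s x t)) atTop :=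
          lintegral_congr fun x =>
            ((ENNReal.tendsto_ofReal ((hlim x).const_mul (ρ x))).liminf_eq).symm
      _ ≤ liminf (fun j => ∫⁻ x, ENNReal.ofReal
          (ρ x * evolve ν U V (fun z => heatKernel (ε j) (y - z)) s x t)) atTop :=
          lintegral_liminf_le fun j => (hρ.mul (hm j)).ennreal_ofReal
      _ ≤ liminf (fun j => ENNReal.ofReal D *
          ((∫⁻ x, ENNReal.ofReal (ρ x * Real.exp (-inner ℝ α x))) *
          ENNReal.ofReal (Real.exp (inner ℝ α y + ε j * ‖α‖ ^ 2)))) atTop :=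
          liminf_le_liminf (Eventually.of_forall fun j => by
            rw [← lintegral_exp_mul_heatKernel (hε j)]
            exact (hev j ρ hρ hρ0).2)
      _ = ENNReal.ofReal D * ((∫⁻ x, ENNReal.ofReal (ρ x * Real.exp (-inner ℝ α x))) *
          ENNReal.ofReal (Real.exp (inner ℝ α y))) := hlimD.liminf_eq
      _ = _ := by
          rw [← lintegral_mul_const' _ _ ENNReal.ofReal_ne_top,
            ← lintegral_const_mul' _ _ ENNReal.ofReal_ne_top]
          refine lintegral_congr fun x => ?_
          have := hρ0 x
          rw [← ENNReal.ofReal_mul (by positivity), ← ENNReal.ofReal_mul (by positivity),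
            inner_sub_right, neg_sub, sub_eq_add_neg, Real.exp_add]
          congr 1
          ring
  have hcl := h.continuous_fundSol_left hst y
  have hcr : Continuous fun x => D * Real.exp (-inner ℝ α (x - y)) := by fun_prop
  have hae : (fun x => ENNReal.ofReal (fundSol ν U V x t y s)) ≤ᵐ[volume]
      fun x => ENNReal.ofReal (D * Real.exp (-inner ℝ α (x - y))) :=
    ae_le_of_forall_setLIntegral_le_of_sigmaFinite hcl.measurable.ennreal_ofReal
      fun S hS _ => key S hS
  have hfin := le_of_ae_le_of_continuous hcl hcr (by
    filter_upwards [hae] with x hx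
    exact (ENNReal.ofReal_le_ofReal_iff (by positivity)).1 hx) x
  rw [sub_eq_add_neg (_ + _) (inner ℝ α (x - y)), Real.exp_add, ← mul_assoc]
  exact hfin

end PointwiseBounds

end AdvectionDiffusion

namespace AdvectionDiffusion

/-! ### Representation of weak solutions and strict positivity -/

section Positivity

variable {E : Type*} [NormedAddCommGroup E] [InnerProductSpace ℝ E] [FiniteDimensional ℝ E]
  [MeasurableSpace E] [BorelSpace E]
  {ν M : ℝ} {m v : ℝ → ℝ} {U : E → ℝ → E} {V : E → ℝ → ℝ}

lemma aestronglyMeasurable_strip_of_continuousOn {f : E → ℝ → ℝ} {J : Set ℝ}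
    (hf : ContinuousOn (fun p : E × ℝ => f p.1 p.2) (univ ×ˢ J)) {s t : ℝ} (hsub : Ioo s t ⊆ J) :
    AEStronglyMeasurable (fun p : E × ℝ => f p.1 p.2) (volume.restrict (univ ×ˢ Ioo s t)) :=
  (hf.mono (prod_mono_right hsub)).aestronglyMeasurable (measurableSet_strip s t)

/-- Regular weak solutions are represented by the fundamental solution. -/
theorem Coeff.eq_evolve_of_weak (h : Coeff ν M m v U V) {J : Set ℝ} (hJ : IsOpen J) {f : E → ℝ → ℝ}
    (hf : ContinuousOn (fun p : E × ℝ => f p.1 p.2) (univ ×ˢ J))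
    (hgrow : ∀ a b : ℝ, Icc a b ⊆ J →
      ∃ A B : ℝ, ∀ t ∈ Icc a b, ∀ x, |f x t| ≤ A * Real.exp (B * ‖x‖))
    (hweak : ∀ φ : E × ℝ → ℝ, ContDiff ℝ ∞ φ → HasCompactSupport φ → tsupport φ ⊆ univ ×ˢ J →
      ∫ p : E × ℝ, f p.1 p.2 * adjOp ν U V φ p = 0)
    {s t : ℝ} (hst : s < t) (hsub : Icc s t ⊆ J) (x : E) :
    Integrable (fun y => fundSol ν U V x t y s * f y s) ∧
      f x t = evolve ν U V (fun y => f y s) s x t := by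
  obtain ⟨A, B, hAB⟩ := hgrow s t hsub
  have hs : s ∈ Icc s t := left_mem_Icc.2 hst.le
  have hA : 0 ≤ A := by
    have := (abs_nonneg _).trans (hAB s hs 0)
    simpa using this
  have hc : Continuous fun y => f y s :=
    hf.comp_continuous (f := fun y : E => (y, s)) (by fun_prop) fun y => ⟨mem_univ _, hsub hs⟩
  obtain ⟨_, _, _, _, hev⟩ := h.evolve_spec
  refine ⟨(hev _ A B s hc.aestronglyMeasurable hA (hAB s hs)).1 x t hst,
    h.eq_evolve_of_mild (A := A) hA hc.aestronglyMeasurable (hAB s hs) (fun τ hτ => ?_)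
      (fun τ hτ => hAB τ ⟨hτ.1.le, hτ.2⟩) (fun τ hτ y => ?_) t ⟨hst, le_rfl⟩ x⟩
  · exact aestronglyMeasurable_strip_of_continuousOn hf
      fun r hr => hsub ⟨hr.1.le, hr.2.le.trans hτ.2⟩
  · exact h.mild_of_weak hJ hf hgrow hweak hτ.1
      (Subset.trans (Icc_subset_Icc_right hτ.2) hsub) y

lemma Coeff.continuousOn_fundSol_forward (h : Coeff ν M m v U V) (y : E) (s : ℝ) :
    ContinuousOn (fun p : E × ℝ => fundSol ν U V p.1 p.2 y s) (univ ×ˢ Ioi s) :=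
  h.continuousOn_fundSol.comp (f := fun p : E × ℝ => (p, (y, s))) (by fun_prop)
    fun _ hp => hp.2

lemma Coeff.exists_fundSol_growth (h : Coeff ν M m v U V) (y : E) {s a : ℝ} (b : ℝ)
    (ha : s < a) :
    ∃ A B : ℝ, ∀ t ∈ Icc a b, ∀ x, |fundSol ν U V x t y s| ≤ A * Real.exp (B * ‖x‖) := by
  obtain ⟨A, lam, hA, hlam, -, hb, -⟩ := h.fundSol_spec
  have hν := h.ν_pos
  refine ⟨A * Real.exp (lam * (b - s)) * heatKernel (2 * (ν * (a - s))) (0 : E), 0,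
    fun t ht x => ?_⟩
  have h1 : 0 < 2 * (ν * (a - s)) := by have := mul_pos hν (sub_pos.2 ha); positivity
  have h2 : 2 * (ν * (a - s)) ≤ 2 * (ν * (t - s)) := by have := ht.1; gcongr
  have h3 : heatKernel (2 * (ν * (t - s))) (x - y) ≤ heatKernel (2 * (ν * (a - s))) (0 : E) := by
    refine (heatKernel_le_zero (h1.trans_le h2) _).trans ?_
    rw [heatKernel_zero, heatKernel_zero]
    refine Real.rpow_le_rpow_of_nonpos (by positivity) (by gcongr) ?_
    rw [neg_nonpos]
    positivity
  have h4 := heatKernel_pos h1 (0 : E)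
  have h5 := heatKernel_pos (h1.trans_le h2) (x - y)
  rw [zero_mul, Real.exp_zero, mul_one]
  refine (hb x t y s (ha.trans_le ht.1)).trans ?_
  have := ht.2
  gcongr

/-- The Chapman-Kolmogorov relation. -/
lemma Coeff.fundSol_eq_evolve (h : Coeff ν M m v U V) (y : E) {s r t : ℝ} (hsr : s < r)
    (hrt : r < t) (x : E) :
    Integrable (fun z => fundSol ν U V x t z r * fundSol ν U V z r y s) ∧
      fundSol ν U V x t y s = ∫ z, fundSol ν U V x t z r * fundSol ν U V z r y s :=
  h.eq_evolve_of_weak (f := fun x t => fundSol ν U V x t y s) isOpen_Ioi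
    (h.continuousOn_fundSol_forward y s)
    (fun a b hab => by
      rcases le_or_gt a b with hle | hlt
      · exact h.exists_fundSol_growth y b (hab (left_mem_Icc.2 hle))
      · exact ⟨0, 0, fun t ht => absurd (ht.1.trans ht.2) (not_le.2 hlt)⟩)
    (fun φ hφ hc hsupp => h.weak_fundSol y s hφ hc hsupp) hrt
    (fun _ hτ => hsr.trans_le hτ.1) x

/-- In the parabolic region `|x - y|² ≤ 8ν(t - s)` the spare factor between the Gaussian and its
double is at least `exp(-1)`, whereas the Duhamel term is a small multiple of the doubled Gaussian
for short times. -/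
lemma Coeff.exists_fundSol_pos_near (h : Coeff ν M m v U V) : ∃ δ : ℝ, 0 < δ ∧ ∀ (x y : E) (s t : ℝ),
    s < t → t - s ≤ δ → ‖x - y‖ ^ 2 ≤ 8 * (ν * (t - s)) → 0 < fundSol ν U V x t y s := by
  obtain ⟨A, lam, hA, hlam, hc, hb, hmild⟩ := h.fundSol_spec
  have hν := h.ν_pos
  have hg := gaussFactor_pos (E := E)
  -- Chosen so that the Duhamel term is at most half of the lower bound for the heat kernel; `A + 1`
  -- guards against `A = 0`.
  set ε := gaussFactor E * Real.exp (-1) / (2 * (A + 1) * Real.exp lam) with hε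
  have hε0 : 0 < ε := by positivity
  obtain ⟨δ, hδ, hδ'⟩ := exists_integral_rate_le (gaussFactor_pos (E := E)).le hν h.M_nonneg
    h.v_int h.v_nonneg hε0
  refine ⟨min δ 1, by positivity, fun x y s t hst hts hxy => ?_⟩
  have h0 : 0 < ν * (t - s) := mul_pos hν (sub_pos.2 hst)
  have hq : ∫ τ in Ioo s t, rate (gaussFactor E) ν M v t τ * Real.exp (-(lam * (t - τ))) ≤ ε := by
    refine le_trans ?_ (hδ' s t (hts.trans (min_le_left _ _)))
    refine setIntegral_mono_on (integrableOn_rate_mul_exp hν h.v_int lam s t)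
      (integrableOn_rate hν h.v_int s t) measurableSet_Ioo fun τ hτ => ?_
    refine mul_le_of_le_one_right (h.rate_nonneg t τ) (Real.exp_le_one_iff.2 ?_)
    have := mul_nonneg hlam.le (sub_nonneg.2 hτ.2.le)
    linarith
  have h1 := (h.duhamel_gauss_bound (F := fun z τ => fundSol ν U V z τ y s) (x := x) hA hq hst
    (aestronglyMeasurable_strip hc y s t) (fun z τ hτ => hb z τ y s hτ.1)).2.2
  have h2 := heatKernel_pos (show 0 < 2 * (ν * (t - s)) by positivity) (x - y)
  have h3 : gaussFactor E * Real.exp (-1) * heatKernel (2 * (ν * (t - s))) (x - y) ≤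
      heatKernel (ν * (t - s)) (x - y) := by
    rw [heatKernel_eq_two_mul h0]
    gcongr
    rw [div_le_one (by positivity)]
    exact hxy
  have h4 : ε * A * Real.exp (lam * (t - s)) < gaussFactor E * Real.exp (-1) := by
    have h5 : Real.exp (lam * (t - s)) ≤ Real.exp lam :=
      Real.exp_le_exp.2 (mul_le_of_le_one_right hlam.le (hts.trans (min_le_right _ _)))
    calc ε * A * Real.exp (lam * (t - s)) ≤ ε * (A + 1) * Real.exp lam := by gcongr; linarith
      _ = gaussFactor E * Real.exp (-1) / 2 := by rw [hε]; field_simp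
      _ < _ := half_lt_self (by positivity)
  rw [hmild x t y s hst]
  have h6 := (abs_le.1 h1).1
  have h7 := mul_lt_mul_of_pos_right h4 h2
  linarith

theorem Coeff.fundSol_pos (h : Coeff ν M m v U V) (hd : ∀ a b, DivFreeOn U a b) {s t : ℝ}
    (hst : s < t) (x y : E) : 0 < fundSol ν U V x t y s := by
  have hν := h.ν_pos
  have hts := sub_pos.2 hst
  obtain ⟨δ, hδ, hpos⟩ := h.exists_fundSol_pos_near
  have chain : ∀ η : ℝ, 0 < η → η ≤ δ → ∀ n : ℕ, ∀ (x y : E) (s : ℝ),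
      ‖x - y‖ ≤ (n + 1) * Real.sqrt (8 * (ν * η)) →
      0 < fundSol ν U V x (s + (n + 1) * η) y s := by
    intro η hη hηδ n
    have hr : 0 < 8 * (ν * η) := by positivity
    induction n with
    | zero =>
      intro x y s hxy
      simp only [Nat.cast_zero, zero_add, one_mul] at hxy ⊢
      refine hpos x y s _ (by linarith) (by linarith) ?_
      rw [add_sub_cancel_left, ← Real.sq_sqrt hr.le]
      gcongr
    | succ n ih =>
      intro x y s hxy
      push_cast at hxy ⊢
      have hn : (0 : ℝ) < n + 1 := by positivity
      have h1 : s < s + (n + 1) * η := by have := mul_pos hn hη; linarith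
      have h2 : s + (n + 1) * η < s + (n + 1 + 1) * η := by nlinarith
      obtain ⟨hi, he⟩ := h.fundSol_eq_evolve y h1 h2 x
      rw [he]
      -- Only one intermediate point on the segment from `y` to `x` is needed: the
      -- Chapman-Kolmogorov integrand is continuous, non-negative and positive at `z`.
      set z : E := y + (((n : ℝ) + 1) / (n + 1 + 1)) • (x - y) with hz
      have hz1 : ‖z - y‖ ≤ (n + 1) * Real.sqrt (8 * (ν * η)) := by
        rw [hz, add_sub_cancel_left, norm_smul, Real.norm_of_nonneg (by positivity),
          div_mul_eq_mul_div, mul_div_assoc]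
        refine mul_le_mul_of_nonneg_left ?_ hn.le
        rw [div_le_iff₀ (by positivity), mul_comm]
        exact hxy
      have hz2 : ‖x - z‖ ≤ Real.sqrt (8 * (ν * η)) := by
        have e : x - z = (1 / ((n : ℝ) + 1 + 1)) • (x - y) := by
          have : (1 / ((n : ℝ) + 1 + 1)) = 1 - ((n : ℝ) + 1) / (n + 1 + 1) := by field_simp; ring
          rw [hz, this, sub_smul, one_smul]
          abel
        rw [e, norm_smul, Real.norm_of_nonneg (by positivity), one_div_mul_eq_div,
          div_le_iff₀ (by positivity), mul_comm]
        exact hxy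
      have hp1 := ih z y s hz1
      have hp2 : 0 < fundSol ν U V x (s + (n + 1 + 1) * η) z (s + (n + 1) * η) := by
        have e : s + (n + 1 + 1) * η - (s + (n + 1) * η) = η := by ring
        refine hpos x z _ _ h2 (by rw [e]; exact hηδ) ?_
        rw [e, ← Real.sq_sqrt hr.le]
        gcongr
      exact integral_pos_of_integrable_nonneg_nonzero (x := z)
        ((h.continuous_fundSol_right h2 x).mul (h.continuous_fundSol_left h1 y)) hi
        (fun w => mul_nonneg (h.fundSol_le hd h2 x w 0).1 (h.fundSol_le hd h1 w y 0).1)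
        (mul_pos hp2 hp1).ne'
  -- `n₁` makes the time steps shorter than `δ`. `n₂` serves the spatial condition: `n + 1` steps
  -- reach squared distance `(n + 1) · 8ν(t - s)`, which grows without bound.
  obtain ⟨n₁, hn₁⟩ := exists_nat_ge ((t - s) / δ)
  obtain ⟨n₂, hn₂⟩ := exists_nat_ge (‖x - y‖ ^ 2 / (8 * (ν * (t - s))))
  set n := n₁ + n₂
  have hn : (0 : ℝ) < n + 1 := by positivity
  have hn1 : (n₁ : ℝ) ≤ n + 1 := by
    have : n₁ ≤ n + 1 := by omega
    exact_mod_cast this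
  have hn2 : (n₂ : ℝ) ≤ n + 1 := by
    have : n₂ ≤ n + 1 := by omega
    exact_mod_cast this
  have hη : 0 < (t - s) / (n + 1) := by positivity
  have e : s + (n + 1) * ((t - s) / (n + 1)) = t := by field_simp; ring
  rw [← e]
  refine chain _ hη ?_ n x y s ?_
  · rw [div_le_iff₀ hδ] at hn₁
    rw [div_le_iff₀ hn]
    calc t - s ≤ n₁ * δ := hn₁
      _ ≤ _ := by rw [mul_comm]; gcongr
  · refine abs_le_of_sq_le_sq' ?_ (by positivity) |>.2
    rw [mul_pow, Real.sq_sqrt (by positivity)]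
    have h8 : 0 < 8 * (ν * (t - s)) := by positivity
    rw [div_le_iff₀ h8] at hn₂
    calc ‖x - y‖ ^ 2 ≤ n₂ * (8 * (ν * (t - s))) := hn₂
      _ ≤ (n + 1) * (8 * (ν * (t - s))) := by gcongr
      _ = _ := by field_simp

end Positivity

end AdvectionDiffusion

namespace AdvectionDiffusion

/-! ### Truncation of the given coefficients -/

section Reduction

variable {E : Type*} [NormedAddCommGroup E] [InnerProductSpace ℝ E] [FiniteDimensional ℝ E]
  [MeasurableSpace E] [BorelSpace E]
  {ν : ℝ} {T : EReal} {K₁ K₂ : ℝ≥0} {U : E → ℝ → E} {V : E → ℝ → ℝ}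

lemma isOpen_timeInterval (a : ℝ) (T : EReal) : IsOpen (timeInterval a T) :=
  isOpen_Ioi.inter (isOpen_Iio.preimage continuous_coe_real_ereal)

lemma timeInterval_mono {a b : ℝ} (h : a ≤ b) (T : EReal) : timeInterval b T ⊆ timeInterval a T :=
  fun _ ht => ⟨h.trans_lt ht.1, ht.2⟩

lemma lt_of_Icc_subset_timeInterval {a b s : ℝ} {T : EReal} (hab : a ≤ b)
    (h : Icc a b ⊆ timeInterval s T) : s < a :=
  (h (left_mem_Icc.2 hab)).1

/-- The hypotheses on the drift and on the potential. -/
structure Admissible (ν : ℝ) (T : EReal) (K₁ K₂ : ℝ≥0) (U : E → ℝ → E) (V : E → ℝ → ℝ) : Prop where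
  ν_pos : 0 < ν
  contU : ContinuousOn (fun p : E × ℝ => U p.1 p.2) (univ ×ˢ timeInterval 0 T)
  contV : ContinuousOn (fun p : E × ℝ => V p.1 p.2) (univ ×ˢ timeInterval 0 T)
  divFree : ∀ t ∈ timeInterval 0 T, ∀ φ : E → ℝ, ContDiff ℝ ∞ φ → HasCompactSupport φ →
    ∫ x, inner ℝ (U x t) (gradient φ x) = 0
  U_le : ∀ t ∈ timeInterval 0 T, ∀ x, ‖U x t‖ ≤ K₁ * Real.sqrt (ν / t)
  V_le : ∫⁻ t in timeInterval 0 T, eLpNorm (fun x => V x t) ⊤ volume ≤ K₂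

/-- The supremum over space of the potential, set to zero outside of the time interval. -/
noncomputable def potSup (T : EReal) (V : E → ℝ → ℝ) (τ : ℝ) : ℝ≥0∞ :=
  ⨆ k, ‖(timeInterval 0 T).indicator (V (TopologicalSpace.denseSeq E k)) τ‖ₑ

/-- The drift, set to zero outside of a time interval. -/
noncomputable def truncU (a : ℝ) (T : EReal) (U : E → ℝ → E) (x : E) (τ : ℝ) : E :=
  (timeInterval a T).indicator (U x) τ

/-- The potential, set to zero outside of the time interval and where it is unbounded. -/
noncomputable def truncV (T : EReal) (V : E → ℝ → ℝ) (x : E) (τ : ℝ) : ℝ :=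
  {τ | potSup T V τ < ⊤}.indicator ((timeInterval 0 T).indicator (V x)) τ

/-- The fundamental solution for admissible coefficients. -/
noncomputable def fundamental (ν : ℝ) (T : EReal) (U : E → ℝ → E) (V : E → ℝ → ℝ) (x : E) (t : ℝ)
    (y : E) (s : ℝ) : ℝ :=
  fundSol ν (truncU s T U) (truncV T V) x t y s

/-- For a continuous function the set where the essential supremum is exceeded is open and null,
hence empty. -/
lemma enorm_le_eLpNorm_top {F : Type*} [NormedAddCommGroup F] {g : E → F} (hg : Continuous g)
    (x : E) : ‖g x‖ₑ ≤ eLpNorm g ⊤ volume := by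
  have h1 : volume {x | eLpNorm g ⊤ volume < ‖g x‖ₑ} = 0 := by
    rw [eLpNorm_exponent_top]
    simpa [ae_iff, not_le] using ae_le_eLpNormEssSup (f := g) (μ := volume)
  have h2 : IsOpen {x | eLpNorm g ⊤ volume < ‖g x‖ₑ} := isOpen_lt continuous_const hg.enorm
  have h3 := h2.measure_eq_zero_iff volume |>.1 h1
  by_contra! h4
  exact (h3 ▸ h4 : x ∈ (∅ : Set E))

lemma measurable_indicator_timeInterval {F : Type*} [NormedAddCommGroup F] [MeasurableSpace F]
    [BorelSpace F] {f : E → ℝ → F} {a : ℝ}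
    (hf : ContinuousOn (fun p : E × ℝ => f p.1 p.2) (univ ×ˢ timeInterval a T)) :
    Measurable fun p : E × ℝ => (timeInterval a T).indicator (f p.1) p.2 := by
  classical
  have h1 := ContinuousOn.measurable_piecewise (g := fun _ => (0 : F)) hf continuousOn_const
    (MeasurableSet.univ.prod (isOpen_timeInterval a T).measurableSet)
  convert h1 using 2 with p
  by_cases hp : p.2 ∈ timeInterval a T <;> simp [piecewise, hp]

lemma Admissible.measurable_potSup (h : Admissible ν T K₁ K₂ U V) : Measurable (potSup T V) :=
  Measurable.iSup fun _ =>
    ((measurable_indicator_timeInterval h.contV).comp measurable_prodMk_left).enorm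

lemma slice_continuous {F : Type*} [TopologicalSpace F] {f : E → ℝ → F} {J : Set ℝ}
    (hf : ContinuousOn (fun p : E × ℝ => f p.1 p.2) (univ ×ˢ J)) {t : ℝ} (ht : t ∈ J) :
    Continuous fun x => f x t :=
  hf.comp_continuous (f := fun x : E => (x, t)) (by fun_prop) fun _ => ⟨mem_univ _, ht⟩

lemma Admissible.enorm_le_potSup (h : Admissible ν T K₁ K₂ U V) (x : E) (τ : ℝ) :
    ‖(timeInterval 0 T).indicator (V x) τ‖ₑ ≤ potSup T V τ := by
  by_cases hτ : τ ∈ timeInterval 0 T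
  · have hc : Continuous fun x => ‖(timeInterval 0 T).indicator (V x) τ‖ₑ := by
      simp only [indicator_of_mem hτ]
      exact (slice_continuous h.contV hτ).enorm
    exact (TopologicalSpace.denseRange_denseSeq E).induction_on x
      (isClosed_le hc continuous_const)
      (le_iSup (fun k => ‖(timeInterval 0 T).indicator
        (V (TopologicalSpace.denseSeq E k)) τ‖ₑ))
  · simp [indicator_of_notMem hτ]

lemma Admissible.lintegral_potSup_le (h : Admissible ν T K₁ K₂ U V) :
    ∫⁻ τ, potSup T V τ ≤ K₂ := by
  have e : potSup T V = (timeInterval 0 T).indicator (potSup T V) := by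
    funext τ
    by_cases hτ : τ ∈ timeInterval 0 T
    · rw [indicator_of_mem hτ]
    · rw [indicator_of_notMem hτ]
      simp [potSup, indicator_of_notMem hτ]
  have hJ := (isOpen_timeInterval 0 T).measurableSet
  rw [e, lintegral_indicator hJ]
  refine le_trans (setLIntegral_mono' hJ fun τ hτ => iSup_le fun k => ?_) h.V_le
  rw [indicator_of_mem hτ]
  exact enorm_le_eLpNorm_top (slice_continuous h.contV hτ) _

lemma Admissible.ae_potSup_lt_top (h : Admissible ν T K₁ K₂ U V) : ∀ᵐ τ, potSup T V τ < ⊤ :=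
  ae_lt_top h.measurable_potSup (h.lintegral_potSup_le.trans_lt ENNReal.coe_lt_top).ne

lemma Admissible.integral_potSup_le (h : Admissible ν T K₁ K₂ U V) :
    ∫ τ, (potSup T V τ).toReal ≤ K₂ := by
  rw [integral_toReal h.measurable_potSup.aemeasurable h.ae_potSup_lt_top]
  exact ENNReal.toReal_le_coe_of_le_coe h.lintegral_potSup_le

/-- Admissible coefficients satisfy the assumptions of the general theory after truncation. -/
lemma Admissible.coeff (h : Admissible ν T K₁ K₂ U V) {a : ℝ} (ha : 0 < a) :
    Coeff ν (K₁ * Real.sqrt (ν / a))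
      ((timeInterval a T).indicator fun τ => K₁ * Real.sqrt (ν / τ))
      (fun τ => (potSup T V τ).toReal) (truncU a T U) (truncV T V) := by
  have hν := h.ν_pos
  have hsub := timeInterval_mono ha.le T
  refine ⟨hν, measurable_indicator_timeInterval (h.contU.mono (prod_mono_right hsub)), ?_, ?_,
    fun x τ => ?_, fun τ => ?_, fun x τ => ?_, integrable_toReal_of_lintegral_ne_top
      h.measurable_potSup.aemeasurable
      (h.lintegral_potSup_le.trans_lt ENNReal.coe_lt_top).ne⟩
  · have h1 : MeasurableSet {p : E × ℝ | potSup T V p.2 < ⊤} :=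
      measurableSet_lt (h.measurable_potSup.comp measurable_snd) measurable_const
    exact (measurable_indicator_timeInterval h.contV).indicator h1
  · exact Measurable.indicator (by fun_prop) (isOpen_timeInterval a T).measurableSet
  · by_cases hτ : τ ∈ timeInterval a T
    · rw [truncU, indicator_of_mem hτ, indicator_of_mem hτ]
      exact h.U_le τ (hsub hτ) x
    · rw [truncU, indicator_of_notMem hτ, indicator_of_notMem hτ, norm_zero]
  · by_cases hτ : τ ∈ timeInterval a T
    · rw [indicator_of_mem hτ]
      have := hτ.1.le
      gcongr
    · rw [indicator_of_notMem hτ]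
      positivity
  · by_cases hτ : potSup T V τ < ⊤
    · rw [truncV, indicator_of_mem (by exact hτ)]
      have h1 := h.enorm_le_potSup x τ
      rw [← Real.norm_eq_abs, ← toReal_enorm]
      exact ENNReal.toReal_mono hτ.ne h1
    · rw [truncV, indicator_of_notMem (by exact hτ), abs_zero]
      exact ENNReal.toReal_nonneg

/-- Where the drift has been cut off, the zero field is trivially divergence free; hence no
condition on the interval. -/
lemma Admissible.divFreeOn (h : Admissible ν T K₁ K₂ U V) {a : ℝ} (ha : 0 < a) (b c : ℝ) :
    DivFreeOn (truncU a T U) b c := by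
  intro τ _ φ hφ hc
  by_cases hτ : τ ∈ timeInterval a T
  · simp only [truncU, indicator_of_mem hτ]
    exact h.divFree τ (timeInterval_mono ha.le T hτ) φ hφ hc
  · simp [truncU, indicator_of_notMem hτ]

/-- Causality: the series at `(x, t; y, s)` uses only the coefficients at times between `s` and `t`.
-/
lemma picard_congr {U' : E → ℝ → E} {s t : ℝ} (hU : ∀ z, ∀ τ ∈ Ioo s t, U z τ = U' z τ)
    (y : E) (k : ℕ) : ∀ x t', t' ≤ t → picard ν U V k x t' y s = picard ν U' V k x t' y s := by
  induction k with
  | zero => intros; rfl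
  | succ k ih =>
    intro x t' ht'
    refine setIntegral_congr_fun (measurableSet_strip s t') ?_
    rintro ⟨z, τ⟩ ⟨-, h1, h2⟩
    simp only [duhamelKernel]
    rw [ih z τ (h2.le.trans ht'), hU z τ ⟨h1, h2.trans_le ht'⟩]

/-- The cutoff time in the definition moves with `s`, whereas continuity in `s` and the
representation formula need one fixed set of bounded coefficients. Any cutoff time `a ≤ s` gives the
same function. -/
lemma fundamental_eq {a s : ℝ} (has : a ≤ s) (x : E) (t : ℝ) (y : E) :
    fundamental ν T U V x t y s = fundSol ν (truncU a T U) (truncV T V) x t y s := by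
  refine tsum_congr fun k => picard_congr (t := t) (fun z τ hτ => ?_) y k x t le_rfl
  by_cases hT : (τ : EReal) < T
  · rw [truncU, truncU, indicator_of_mem (by exact ⟨hτ.1, hT⟩),
      indicator_of_mem (by exact ⟨has.trans_lt hτ.1, hT⟩)]
  · rw [truncU, truncU, indicator_of_notMem (fun hh => hT hh.2),
      indicator_of_notMem (fun hh => hT hh.2)]

/-- On the support of the test function the truncations change something only at times when the
potential is unbounded in space. These form a null set. -/
lemma Admissible.integral_mul_adjOp_trunc (h : Admissible ν T K₁ K₂ U V) {a : ℝ} (ha : 0 ≤ a)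
    {φ : E × ℝ → ℝ} (hsupp : tsupport φ ⊆ univ ×ˢ timeInterval a T) (f : E → ℝ → ℝ) :
    ∫ p : E × ℝ, f p.1 p.2 * adjOp ν (truncU a T U) (truncV T V) φ p =
      ∫ p : E × ℝ, f p.1 p.2 * adjOp ν U V φ p := by
  have hae : ∀ᵐ p : E × ℝ, potSup T V p.2 < ⊤ := by
    rw [Measure.volume_eq_prod]
    exact Measure.quasiMeasurePreserving_snd.ae h.ae_potSup_lt_top
  refine integral_congr_ae ?_
  filter_upwards [hae] with p hp
  by_cases hpφ : p ∈ tsupport φ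
  · have h1 := (hsupp hpφ).2
    simp only [adjOp, truncU, truncV, indicator_of_mem h1,
      indicator_of_mem (timeInterval_mono ha T h1), indicator_of_mem (show p.2 ∈ {τ |
        potSup T V τ < ⊤} from hp)]
  · have h1 := notMem_tsupport_iff_eventuallyEq.1 hpφ
    rw [adjOp_eq_zero h1, adjOp_eq_zero h1]

lemma setIntegral_m_le (hν : 0 < ν) {s t : ℝ} (hs : 0 < s) (hst : s < t) :
    ∫ τ in Ioo s t, (timeInterval s T).indicator (fun τ => K₁ * Real.sqrt (ν / τ)) τ ≤
      K₁ * (2 * Real.sqrt (ν * (t - s))) := by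
  have hsi := Real.sqrt_nonneg ν
  have h0 : (0 : ℝ) ∉ uIcc s t := by
    rw [uIcc_of_le hst.le]
    exact fun hh => absurd hh.1 (not_le.2 hs)
  have e : ∫ τ in Ioo s t, K₁ * Real.sqrt ν * τ ^ (-(1 / 2) : ℝ) =
      K₁ * Real.sqrt ν * (2 * (Real.sqrt t - Real.sqrt s)) := by
    rw [integral_const_mul, ← integral_Ioc_eq_integral_Ioo,
      ← intervalIntegral.integral_of_le hst.le, integral_rpow (Or.inr ⟨by norm_num, h0⟩),
      Real.sqrt_eq_rpow t, Real.sqrt_eq_rpow s, show (-(1 / 2) + 1 : ℝ) = 1 / 2 by norm_num]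
    ring
  have hi : IntegrableOn (fun τ => K₁ * Real.sqrt ν * τ ^ (-(1 / 2) : ℝ)) (Ioo s t) := by
    have h1 := (intervalIntegral.intervalIntegrable_rpow (μ := volume) (a := s) (b := t)
      (r := -(1 / 2)) (Or.inr h0)).const_mul (K₁ * Real.sqrt ν)
    exact ((intervalIntegrable_iff_integrableOn_Ioc_of_le hst.le).1 h1).mono_set Ioo_subset_Ioc_self
  calc _ ≤ ∫ τ in Ioo s t, K₁ * Real.sqrt ν * τ ^ (-(1 / 2) : ℝ) := by
        refine integral_mono_of_nonneg (Eventually.of_forall fun τ =>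
          indicator_nonneg (fun _ _ => by positivity) τ) hi ?_
        refine (ae_restrict_iff' measurableSet_Ioo).2 (Eventually.of_forall fun τ hτ => ?_)
        have hτ0 := hs.trans hτ.1
        refine (indicator_le_self' (fun _ _ => by positivity) τ).trans_eq ?_
        simp only
        rw [Real.sqrt_div hν.le, Real.rpow_neg hτ0.le, ← Real.sqrt_eq_rpow, mul_assoc,
          div_eq_mul_inv]
    _ = _ := e
    _ ≤ _ := by
        -- Subadditivity of the square root turns `√t - √s` into `√(t - s)`, which makes the final
        -- bound depend on `t - s` only.
        have h2 : Real.sqrt t ≤ Real.sqrt (t - s) + Real.sqrt s := by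
          have h3 := Real.sq_sqrt (sub_nonneg.2 hst.le)
          have h4 := Real.sq_sqrt hs.le
          have h5 := Real.sqrt_nonneg (t - s)
          have h6 := Real.sqrt_nonneg s
          rw [Real.sqrt_le_left (by positivity)]
          nlinarith [mul_nonneg h5 h6]
        rw [Real.sqrt_mul hν.le, mul_assoc]
        have : Real.sqrt ν * (2 * (Real.sqrt t - Real.sqrt s)) ≤
            Real.sqrt ν * (2 * Real.sqrt (t - s)) := by
          gcongr; linarith
        calc _ ≤ K₁ * (Real.sqrt ν * (2 * Real.sqrt (t - s))) := by gcongr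
          _ = _ := by ring

lemma Admissible.fundamental_pos (h : Admissible ν T K₁ K₂ U V) {s t : ℝ} (hs : 0 < s)
    (hst : s < t) (x y : E) : 0 < fundamental ν T U V x t y s :=
  (h.coeff hs).fundSol_pos (h.divFreeOn hs) hst x y

/-- The vector `α = (x - y)/(2ν(t - s))` minimises `ν(t - s)|α|² - ⟨α, x - y⟩`, with minimum `-|x -
y|²/(4ν(t - s))`. For it `|α|` times the integral of the drift bound is at most `K₁|x - y|/√(ν(t -
s))`. -/
lemma Admissible.fundamental_le (h : Admissible ν T K₁ K₂ U V) {s t : ℝ} (hs : 0 < s)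
    (hst : s < t) (x y : E) : fundamental ν T U V x t y s ≤
      (4 / Real.pi) ^ ((Module.finrank ℝ E : ℝ) / 2) /
        (ν * (t - s)) ^ ((Module.finrank ℝ E : ℝ) / 2) *
        Real.exp (-(‖x - y‖ ^ 2 / (4 * ν * (t - s))) +
          K₁ * (‖x - y‖ / Real.sqrt (ν * (t - s))) + K₂) := by
  have h0 : 0 < ν * (t - s) := mul_pos h.ν_pos (sub_pos.2 hst)
  have h1 := ((h.coeff hs).fundSol_le (h.divFreeOn hs) hst x y
    ((1 / (2 * (ν * (t - s)))) • (x - y))).2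
  refine h1.trans ?_
  rw [← div_div, Real.div_rpow (by positivity) h0.le]
  refine mul_le_mul_of_nonneg_left (Real.exp_le_exp.2 ?_) (by positivity)
  rw [norm_smul, Real.norm_of_nonneg (by positivity), real_inner_smul_left,
    real_inner_self_eq_norm_sq]
  have hv : ∫ τ in Ioo s t, (potSup T V τ).toReal ≤ K₂ :=
    (setIntegral_le_integral (h.coeff hs).v_int
      (Eventually.of_forall (h.coeff hs).v_nonneg)).trans h.integral_potSup_le
  have hm := setIntegral_m_le (T := T) (K₁ := K₁) h.ν_pos hs hst
  have hn := norm_nonneg (x - y)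
  set w := ‖x - y‖
  have e1 : ν * (t - s) * (1 / (2 * (ν * (t - s))) * w) ^ 2 - 1 / (2 * (ν * (t - s))) * w ^ 2 =
      -(w ^ 2 / (4 * ν * (t - s))) := by
    rw [mul_assoc 4 ν]
    field_simp
    ring
  have e2 : 1 / (2 * (ν * (t - s))) * w * (K₁ * (2 * Real.sqrt (ν * (t - s)))) =
      K₁ * (w / Real.sqrt (ν * (t - s))) := by
    have h3 := Real.sqrt_pos.2 h0
    field_simp
    rw [Real.sq_sqrt h0.le, mul_div_cancel_right₀ _ h0.ne']
  have h4 : 1 / (2 * (ν * (t - s))) * w * ∫ τ in Ioo s t,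
      (timeInterval s T).indicator (fun τ => K₁ * Real.sqrt (ν / τ)) τ ≤
      K₁ * (w / Real.sqrt (ν * (t - s))) := by
    rw [← e2]
    exact mul_le_mul_of_nonneg_left hm (by positivity)
  linarith

end Reduction

end AdvectionDiffusion

namespace AdvectionDiffusion

/-! ### Existence, representation and uniqueness -/

section Main

variable {n : ℕ} {ν : ℝ} {T : EReal} {K₁ K₂ : ℝ≥0}
  {U : EuclideanSpace ℝ (Fin n) → ℝ → EuclideanSpace ℝ (Fin n)}
  {V : EuclideanSpace ℝ (Fin n) → ℝ → ℝ}

theorem Admissible.isFundamentalSolution (h : Admissible ν T K₁ K₂ U V) :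
    IsFundamentalSolution ν T U V (fundamental ν T U V) := by
  refine ⟨fun p hp => ?_, fun s hs y => ⟨?_, fun a b hab => ?_, fun φ hφ hc hsupp => ?_⟩,
    fun s hs φ hφ hc b hb => ?_, fun s hs φ hφ hc x₀ => ?_⟩
  · obtain ⟨h1, h2, -⟩ := hp
    -- A cutoff at half the starting time is valid for all nearby starting times, which gives joint
    -- continuity including the variable `s`.
    have h3 := ((h.coeff (half_pos h1)).continuousOn_fundSol).continuousAt
      (isOpen_orderedPairs.mem_nhds h2)
    refine (h3.congr ?_).continuousWithinAt
    have h4 : ∀ᶠ q : (EuclideanSpace ℝ (Fin n) × ℝ) × (EuclideanSpace ℝ (Fin n) × ℝ) in 𝓝 p,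
        p.2.2 / 2 < q.2.2 :=
      (isOpen_lt continuous_const (continuous_snd.comp continuous_snd)).mem_nhds
        (half_lt_self h1)
    filter_upwards [h4] with q hq
    exact (fundamental_eq hq.le _ _ _).symm
  · exact ((h.coeff hs.1).continuousOn_fundSol_forward y s).mono
      (prod_mono_right fun t ht => ht.1)
  · rcases le_or_gt a b with hle | hlt
    · exact (h.coeff hs.1).exists_fundSol_growth y b (lt_of_Icc_subset_timeInterval hle hab)
    · exact ⟨0, 0, fun t ht => absurd (ht.1.trans ht.2) (not_le.2 hlt)⟩
  · exact (h.integral_mul_adjOp_trunc hs.1.le hsupp fun x t => fundamental ν T U V x t y s).symm.trans ((h.coeff hs.1).weak_fundSol y s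
      hφ hc (hsupp.trans (prod_mono_right fun t ht => ht.1)))
  · obtain ⟨A, lam, hA, hlam, hev⟩ := (h.coeff hs.1).evolve_spec
    obtain ⟨C, hC⟩ := hc.exists_bound_of_continuous hφ
    have hC0 : 0 ≤ C := (norm_nonneg _).trans (hC 0)
    refine ⟨A * C * Real.exp (lam * (b - s)), fun t ht x => ?_⟩
    have h1 := (hev φ C 0 s hφ.aestronglyMeasurable hC0 (by simpa using hC)).2.1 x t ht.1
    simp only [ne_eq, OfNat.ofNat_ne_zero, not_false_eq_true, zero_pow, mul_zero, Real.exp_zero,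
      mul_one, zero_mul] at h1
    refine h1.trans ?_
    have := ht.2
    gcongr
  · obtain ⟨C, hC⟩ := hc.exists_bound_of_continuous hφ
    exact (h.coeff hs.1).tendsto_evolve s x₀ hφ hC

/-- Regular solutions are represented by the fundamental solution. -/
theorem Admissible.eq_integral_fundamental (h : Admissible ν T K₁ K₂ U V) {a s t : ℝ} (ha : 0 ≤ a)
    {f : EuclideanSpace ℝ (Fin n) → ℝ → ℝ} (hf : IsRegularSolution ν U V (timeInterval a T) f)
    (has : a < s) (hst : s < t) (htT : (t : EReal) < T) (x : EuclideanSpace ℝ (Fin n)) :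
    Integrable (fun y => fundamental ν T U V x t y s * f y s) ∧
      f x t = ∫ y, fundamental ν T U V x t y s * f y s := by
  -- The drift may blow up at `a = 0`, so it is cut off at some `b` strictly between `a` and `s`;
  -- this also leaves an open time interval around `s`.
  obtain ⟨b, hab, hbs⟩ := exists_between has
  have hb : 0 < b := ha.trans_lt hab
  have hsub := timeInterval_mono hab.le T
  simp only [fundamental_eq hbs.le]
  refine (h.coeff hb).eq_evolve_of_weak (isOpen_timeInterval b T)
    (hf.continuousOn.mono (prod_mono_right hsub)) (fun c d hcd => hf.growth c d (hcd.trans hsub))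
    (fun φ hφ hc hsupp => ?_) hst
    (fun τ hτ => ⟨hbs.trans_le hτ.1, (EReal.coe_le_coe_iff.2 hτ.2).trans_lt htT⟩) x
  rw [h.integral_mul_adjOp_trunc hb.le hsupp]
  exact hf.weak_eq φ hφ hc (hsupp.trans (prod_mono_right hsub))

/-- Gaussians at times within a factor two are compared with a single one, which gives an integrable
majorant when the starting time varies. -/
lemma heatKernel_le_of_le {E : Type*} [NormedAddCommGroup E] [InnerProductSpace ℝ E]
    [FiniteDimensional ℝ E] [MeasurableSpace E] [BorelSpace E] {a b : ℝ} (ha : 0 < a) (hab : a ≤ b) (hba : b ≤ 2 * a) (w : E) :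
    heatKernel a w ≤ gaussFactor E * heatKernel b w := by
  have hb : 0 < b := ha.trans_le hab
  rw [heatKernel, heatKernel, ← mul_assoc]
  refine mul_le_mul ?_ (Real.exp_le_exp.2 (by gcongr)) (Real.exp_pos _).le
    (by have := gaussFactor_pos (E := E); positivity)
  rw [gaussFactor, Real.rpow_neg (by positivity), Real.rpow_neg (by positivity),
    ← div_eq_mul_inv, le_div_iff₀ (by positivity), inv_mul_le_iff₀ (by positivity),
    ← Real.mul_rpow (by positivity) (by positivity)]
  refine Real.rpow_le_rpow (by positivity) ?_ (by positivity)
  nlinarith [Real.pi_pos]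

/-- Superpositions of a family of regular solutions that depends continuously on a parameter. -/
lemma Admissible.isRegularSolution_integral (h : Admissible ν T K₁ K₂ U V)
    {Ψ : EuclideanSpace ℝ (Fin n) → ℝ → EuclideanSpace ℝ (Fin n) → ℝ → ℝ}
    (hΨ : IsFundamentalSolution ν T U V Ψ) {s : ℝ} (hs : s ∈ timeInterval 0 T)
    {φ : EuclideanSpace ℝ (Fin n) → ℝ} (hφ : Continuous φ) (hc : HasCompactSupport φ) :
    IsRegularSolution ν U V (timeInterval s T) fun x t => ∫ y, Ψ x t y s * φ y := by
  have hΨc : ContinuousOn (fun q : (EuclideanSpace ℝ (Fin n) × ℝ) × EuclideanSpace ℝ (Fin n) =>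
      Ψ q.1.1 q.1.2 q.2 s * φ q.2) ((univ ×ˢ timeInterval s T) ×ˢ univ) := by
    refine ContinuousOn.mul ?_ (hφ.comp continuous_snd).continuousOn
    exact hΨ.continuousOn.comp (f := fun q : (EuclideanSpace ℝ (Fin n) × ℝ) ×
      EuclideanSpace ℝ (Fin n) => (q.1, (q.2, s))) (by fun_prop)
      fun q hq => ⟨hs.1, hq.1.2.1, hq.1.2.2⟩
  refine ⟨continuousOn_integral_of_compact_support (k := tsupport φ) hc hΨc
    (fun p y _ hy => by simp [image_eq_zero_of_notMem_tsupport hy]), fun a b hab => ?_,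
    fun θ hθ hθc hsupp => ?_⟩
  · rcases le_or_gt a b with hle | hlt
    · obtain ⟨M, hM⟩ := hΨ.bounded s hs φ hφ hc b (hab (right_mem_Icc.2 hle))
      refine ⟨M, 0, fun t ht x => ?_⟩
      rw [zero_mul, Real.exp_zero, mul_one]
      exact hM t ⟨(lt_of_Icc_subset_timeInterval hle hab).trans_le ht.1, ht.2⟩ x
    · exact ⟨0, 0, fun t ht => absurd (ht.1.trans ht.2) (not_le.2 hlt)⟩
  · change ∫ p : EuclideanSpace ℝ (Fin n) × ℝ, (∫ y, Ψ p.1 p.2 y s * φ y) * adjOp ν U V θ p = 0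
    have hJ : ∀ p ∈ tsupport θ, p ∈ (univ : Set (EuclideanSpace ℝ (Fin n))) ×ˢ timeInterval 0 T :=
      fun p hp => ⟨mem_univ _, timeInterval_mono hs.1.le T (hsupp hp).2⟩
    -- With continuous coefficients the integrand is continuous on the compact product of the two
    -- supports, which justifies Fubini although nothing is known about the size of `Ψ`.
    have hadj : ContinuousOn (adjOp ν U V θ) (tsupport θ) := by
      have h1 : ContinuousOn (fun p => heatOp ν θ p + dirDeriv (U p.1 p.2, 0) θ p +
          V p.1 p.2 * θ p) (tsupport θ) := by
        refine ((contDiff_heatOp hθ ν).continuous.continuousOn.add ?_).add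
          ((h.contV.mono hJ).mul hθ.continuous.continuousOn)
        exact (hθ.continuous_fderiv (by simp)).continuousOn.clm_apply
          ((h.contU.mono hJ).prodMk continuousOn_const)
      exact h1.congr fun p _ => adjOp_eq_heatOp hθ ν U V p
    have hi : Integrable (fun q : (EuclideanSpace ℝ (Fin n) × ℝ) × EuclideanSpace ℝ (Fin n) =>
        Ψ q.1.1 q.1.2 q.2 s * φ q.2 * adjOp ν U V θ q.1)
        ((volume : Measure (EuclideanSpace ℝ (Fin n) × ℝ)).prod volume) := by
      rw [← integrableOn_iff_integrable_of_support_subset (s := tsupport θ ×ˢ tsupport φ)]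
      · refine ContinuousOn.integrableOn_compact (hθc.prod hc) (ContinuousOn.mul ?_ ?_)
        · exact hΨc.mono fun q hq => ⟨hsupp hq.1, mem_univ _⟩
        · exact hadj.comp continuousOn_fst fun q hq => hq.1
      · intro q hq
        by_contra hn
        refine hq ?_
        simp only [mem_prod, not_and_or] at hn
        beta_reduce
        rcases hn with hn | hn
        · rw [adjOp_eq_zero (notMem_tsupport_iff_eventuallyEq.1 hn), mul_zero]
        · rw [image_eq_zero_of_notMem_tsupport hn, mul_zero, zero_mul]
    simp_rw [← integral_mul_const]
    rw [integral_integral_swap hi]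
    refine (integral_congr_ae (Eventually.of_forall fun y => ?_)).trans (integral_zero _ _)
    have h2 := (hΨ.solution s hs y).weak_eq θ hθ hθc hsupp
    change ∫ p : EuclideanSpace ℝ (Fin n) × ℝ, Ψ p.1 p.2 y s * adjOp ν U V θ p = 0 at h2
    rw [← mul_zero (φ y), ← h2, ← integral_const_mul]
    exact integral_congr_ae (Eventually.of_forall fun p => by simp only; ring)

/-- The function on the left is a regular solution on `(s, T)`, hence represented from every
starting time `r > s` by the constructed kernel. As `r → s` its values at time `r` tend to `φ`
pointwise and stay bounded, by the two parts of the initial condition. -/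
lemma Admissible.integral_eq_of_isFundamentalSolution (h : Admissible ν T K₁ K₂ U V)
    {Ψ : EuclideanSpace ℝ (Fin n) → ℝ → EuclideanSpace ℝ (Fin n) → ℝ → ℝ}
    (hΨ : IsFundamentalSolution ν T U V Ψ) {s t : ℝ} (hs : 0 < s) (hst : s < t)
    (htT : (t : EReal) < T) {φ : EuclideanSpace ℝ (Fin n) → ℝ} (hφ : Continuous φ)
    (hc : HasCompactSupport φ) (x : EuclideanSpace ℝ (Fin n)) :
    ∫ y, Ψ x t y s * φ y = ∫ y, fundamental ν T U V x t y s * φ y := by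
  have hν := h.ν_pos
  have hsT : s ∈ timeInterval 0 T := ⟨hs, (EReal.coe_lt_coe_iff.2 hst).trans htT⟩
  have hg := gaussFactor_pos (E := EuclideanSpace ℝ (Fin n))
  set u : EuclideanSpace ℝ (Fin n) → ℝ → ℝ := fun x t => ∫ y, Ψ x t y s * φ y with hu
  have hreg : IsRegularSolution ν U V (timeInterval s T) u := h.isRegularSolution_integral hΨ hsT hφ hc
  obtain ⟨C, hC⟩ := hΨ.bounded s hsT φ hφ hc t ⟨hst, htT⟩
  have hC0 : 0 ≤ C := (abs_nonneg _).trans (hC t ⟨hst, le_rfl⟩ x)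
  have hr0 : 0 < (t - s) / 2 := by linarith
  -- The starting times stay in the first half of the interval, so that `t - r j` is comparable with
  -- `t - s` and a single Gaussian dominates all kernels.
  set r : ℕ → ℝ := fun j => s + (t - s) / 2 * (1 / ((j : ℝ) + 1)) with hr
  have hrlim : Tendsto r atTop (𝓝 s) := by
    have := (tendsto_one_div_add_atTop_nhds_zero_nat (𝕜 := ℝ)).const_mul ((t - s) / 2)
    simpa [hr] using this.const_add s
  have hsr : ∀ j, s < r j := fun j => lt_add_of_pos_right _ (by positivity)
  have hrt : ∀ j, r j ≤ s + (t - s) / 2 := fun j => by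
    have : 1 / ((j : ℝ) + 1) ≤ 1 := by
      rw [div_le_one (by positivity)]
      linarith [Nat.cast_nonneg (α := ℝ) j]
    have := mul_le_mul_of_nonneg_left this hr0.le
    simp only [hr]
    linarith
  have hrt' : ∀ j, r j < t := fun j => by linarith [hrt j]
  obtain ⟨A, lam, hA, hlam, hcont, hb, -⟩ := (h.coeff hs).fundSol_spec
  have hrep : ∀ j, u x t = ∫ z, fundSol ν (truncU s T U) (truncV T V) x t z (r j) * u z (r j) :=
    fun j => by
    have := (h.eq_integral_fundamental hs.le hreg (hsr j) (hrt' j) htT x).2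
    simpa only [fundamental_eq (hsr j).le] using this
  have hts : 0 < 2 * (ν * (t - s)) := by have := mul_pos hν (sub_pos.2 hst); positivity
  have hlim : Tendsto (fun j => ∫ z, fundSol ν (truncU s T U) (truncV T V) x t z (r j) * u z (r j))
      atTop (𝓝 (∫ y, fundSol ν (truncU s T U) (truncV T V) x t y s * φ y)) := by
    refine tendsto_integral_of_dominated_convergence (fun z => A * Real.exp (lam * (t - s)) *
      (gaussFactor (EuclideanSpace ℝ (Fin n)) * heatKernel (2 * (ν * (t - s))) (x - z)) * C)
      (fun j => ?_) ((((integrable_heatKernel_sub hts x).const_mul _).const_mul _).mul_const _)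
      (fun j => Eventually.of_forall fun z => ?_) (Eventually.of_forall fun z => ?_)
    · exact (((h.coeff hs).continuous_fundSol_right (hrt' j) x).mul (slice_continuous hreg.continuousOn
        ⟨hsr j, (EReal.coe_lt_coe_iff.2 (hrt' j)).trans htT⟩)).aestronglyMeasurable
    · rw [norm_mul]
      have h2 : 0 < 2 * (ν * (t - r j)) := by
        have := mul_pos hν (sub_pos.2 (hrt' j)); positivity
      refine mul_le_mul ((hb x t z (r j) (hrt' j)).trans ?_) (hC (r j) ⟨hsr j, (hrt' j).le⟩ z)
        (norm_nonneg _) (by have := heatKernel_pos hts (x - z); positivity)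
      refine mul_le_mul ?_ (heatKernel_le_of_le h2 ?_ ?_ _) (heatKernel_pos h2 _).le (by positivity)
      · have := (hsr j).le
        gcongr
      · have := (hsr j).le
        gcongr
      · have h3 : t - s ≤ 2 * (t - r j) := by linarith [hrt j]
        have := mul_le_mul_of_nonneg_left h3 hν.le
        linarith
    · refine Tendsto.mul ?_ ?_
      · have h3 : ContinuousAt (fun p : (EuclideanSpace ℝ (Fin n) × ℝ) ×
            (EuclideanSpace ℝ (Fin n) × ℝ) =>
            fundSol ν (truncU s T U) (truncV T V) p.1.1 p.1.2 p.2.1 p.2.2) ((x, t), (z, s)) :=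
          hcont.continuousAt (isOpen_orderedPairs.mem_nhds hst)
        exact h3.tendsto.comp
          (tendsto_const_nhds.prodMk_nhds (tendsto_const_nhds.prodMk_nhds hrlim))
      · refine (hΨ.initial s hsT φ hφ hc z).comp (f := fun j => (z, r j))
          (tendsto_nhdsWithin_iff.2 ⟨tendsto_const_nhds.prodMk_nhds hrlim,
            Eventually.of_forall fun j => ⟨mem_univ _, hsr j⟩⟩)
  simp_rw [← hrep] at hlim
  exact tendsto_nhds_unique tendsto_const_nhds hlim

/-- Both kernels are continuous in `y` and have the same integrals against test functions. -/
theorem Admissible.eq_fundamental (h : Admissible ν T K₁ K₂ U V)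
    {Ψ : EuclideanSpace ℝ (Fin n) → ℝ → EuclideanSpace ℝ (Fin n) → ℝ → ℝ}
    (hΨ : IsFundamentalSolution ν T U V Ψ) {s t : ℝ} (hs : 0 < s) (hst : s < t)
    (htT : (t : EReal) < T) (x y : EuclideanSpace ℝ (Fin n)) :
    Ψ x t y s = fundamental ν T U V x t y s := by
  have h1 : Continuous fun y => Ψ x t y s :=
    hΨ.continuousOn.comp_continuous (f := fun y => ((x, t), (y, s))) (by fun_prop)
      fun _ => ⟨hs, hst, htT⟩
  have h2 : Continuous fun y => fundamental ν T U V x t y s :=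
    (h.coeff hs).continuous_fundSol_right hst x
  have h3 := ae_eq_of_integral_contDiff_smul_eq (μ := volume) h1.locallyIntegrable
    h2.locallyIntegrable fun g hg hgc => by
      simp_rw [smul_eq_mul, mul_comm (g _)]
      exact h.integral_eq_of_isFundamentalSolution hΨ hs hst htT hg.continuous hgc x
  exact congrFun ((Continuous.ae_eq_iff_eq volume h1 h2).1 h3) y

lemma norm_le_of_iSup_eq (hν : 0 < ν)
    (hU : ContinuousOn (fun p : EuclideanSpace ℝ (Fin n) × ℝ => U p.1 p.2)
      (univ ×ˢ timeInterval 0 T))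
    (hK : (⨆ t ∈ timeInterval 0 T,
      ENNReal.ofReal ((t / ν) ^ (1 / 2 : ℝ)) * eLpNorm (fun x => U x t) ∞ volume) = (K₁ : ℝ≥0∞))
    {t : ℝ} (ht : t ∈ timeInterval 0 T) (x : EuclideanSpace ℝ (Fin n)) :
    ‖U x t‖ ≤ K₁ * Real.sqrt (ν / t) := by
  have ht0 : 0 < t := ht.1
  have h1 : ENNReal.ofReal ((t / ν) ^ (1 / 2 : ℝ)) * ‖U x t‖ₑ ≤ K₁ :=
    (mul_le_mul_right (enorm_le_eLpNorm_top (slice_continuous hU ht) x) _).trans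
      ((le_iSup₂ (f := fun t (_ : t ∈ timeInterval 0 T) =>
        ENNReal.ofReal ((t / ν) ^ (1 / 2 : ℝ)) * eLpNorm (fun x => U x t) ∞ volume) t ht).trans_eq hK)
  rw [← ofReal_norm, ← ENNReal.ofReal_mul (by positivity), ← ENNReal.ofReal_coe_nnreal,
    ENNReal.ofReal_le_ofReal_iff K₁.coe_nonneg, ← Real.sqrt_eq_rpow] at h1
  have h2 : 0 < Real.sqrt (t / ν) := Real.sqrt_pos.2 (by positivity)
  rw [← inv_div, Real.sqrt_inv, ← div_eq_mul_inv, le_div_iff₀ h2, mul_comm]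
  exact h1

end Main

end AdvectionDiffusion

theorem mainTheorem6 (n : ℕ) (hn : 1 ≤ n) :
    ∃ C : ℝ, 0 < C ∧
      ∀ (ν : ℝ) (T : EReal) (K₁ K₂ : ℝ≥0)
        (U : EuclideanSpace ℝ (Fin n) → ℝ → EuclideanSpace ℝ (Fin n))
        (V : EuclideanSpace ℝ (Fin n) → ℝ → ℝ),
        0 < ν → 0 < T →
        ContinuousOn (fun p : EuclideanSpace ℝ (Fin n) × ℝ => U p.1 p.2)
          (univ ×ˢ AdvectionDiffusion.timeInterval 0 T) →
        ContinuousOn (fun p : EuclideanSpace ℝ (Fin n) × ℝ => V p.1 p.2)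
          (univ ×ˢ AdvectionDiffusion.timeInterval 0 T) →
        (∀ t ∈ AdvectionDiffusion.timeInterval 0 T,
          AdvectionDiffusion.DivFree (fun x => U x t)) →
        (⨆ t ∈ AdvectionDiffusion.timeInterval 0 T,
          ENNReal.ofReal ((t / ν) ^ (1 / 2 : ℝ)) * eLpNorm (fun x => U x t) ∞ volume)
            = (K₁ : ℝ≥0∞) →
        (∫⁻ t in AdvectionDiffusion.timeInterval 0 T, eLpNorm (fun x => V x t) ∞ volume)
            = (K₂ : ℝ≥0∞) →
        ∃ Φ : EuclideanSpace ℝ (Fin n) → ℝ → EuclideanSpace ℝ (Fin n) → ℝ → ℝ,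
          AdvectionDiffusion.IsFundamentalSolution ν T U V Φ ∧
          (∀ Ψ : EuclideanSpace ℝ (Fin n) → ℝ → EuclideanSpace ℝ (Fin n) → ℝ → ℝ,
            AdvectionDiffusion.IsFundamentalSolution ν T U V Ψ →
            ∀ (x y : EuclideanSpace ℝ (Fin n)) (s t : ℝ), 0 < s → s < t → (t : EReal) < T →
              Ψ x t y s = Φ x t y s) ∧
          (∀ f : EuclideanSpace ℝ (Fin n) → ℝ → ℝ,
            AdvectionDiffusion.IsRegularSolution ν U V
              (AdvectionDiffusion.timeInterval 0 T) f →
            ∀ (x : EuclideanSpace ℝ (Fin n)) (s t : ℝ), 0 < s → s < t → (t : EReal) < T →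
              Integrable (fun y => Φ x t y s * f y s) ∧
              f x t = ∫ y, Φ x t y s * f y s) ∧
          (∀ (x y : EuclideanSpace ℝ (Fin n)) (s t : ℝ), 0 < s → s < t → (t : EReal) < T →
            0 < Φ x t y s ∧
            Φ x t y s ≤ C / (ν * (t - s)) ^ ((n : ℝ) / 2) *
              Real.exp (-(‖x - y‖ ^ 2 / (4 * ν * (t - s)))
                + K₁ * (‖x - y‖ / Real.sqrt (ν * (t - s))) + K₂)) := by
  -- The constant is the one produced by the discrete Nash estimate; `ν`, `T` and the coefficients
  -- do not enter it.
  refine ⟨(4 / Real.pi) ^ ((n : ℝ) / 2), by positivity, ?_⟩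
  intro ν T K₁ K₂ U V hν _ hU hV hdiv hK₁ hK₂
  have h : AdvectionDiffusion.Admissible ν T K₁ K₂ U V :=
    ⟨hν, hU, hV, hdiv, fun t ht x => AdvectionDiffusion.norm_le_of_iSup_eq hν hU hK₁ ht x, hK₂.le⟩
  refine ⟨AdvectionDiffusion.fundamental ν T U V, h.isFundamentalSolution,
    fun Ψ hΨ x y s t hs hst htT => h.eq_fundamental hΨ hs hst htT x y,
    fun f hf x s t hs hst htT => h.eq_integral_fundamental le_rfl hf hs hst htT x,
    fun x y s t hs hst _ => ⟨h.fundamental_pos hs hst x y, ?_⟩⟩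
  have h1 := h.fundamental_le hs hst x y
  rwa [finrank_euclideanSpace_fin] at h1
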